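/- **Theorem 1.1.** Let $n\ge 3$ and let $P$ be a closed polygonal curve with $n$ line segments embedded in $\mathbb{R}^3$ (that is, the closed curve running once through the $n$ segments passes through no point twice). Then there exists an embedded, oriented, triangulated PL surface $\Sigma\subset\mathbb{R}^3$ (a finite simplicial complex of dimension at most two in $\mathbb{R}^3$ in which the link of every vertex is a polygonal arc or a closed polygon, together with a coherent orientation of its triangles) whose boundary (the subcomplex formed by the edges that lie in exactly one triangle, together with their vertices) is a PL subdivision of $P$, and which has at most $7n^2$ triangles. -/

import Mathlib

namespace Polygon

variable {E : Type*} [AddCommGroup E] [Module ℝ E] {n : ℕ}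

/-- A closed polygon is embedded if the closed curve that runs once through its edges, each
parametrized affinely by `[0, 1)`, passes through no point twice. (In particular all edges are
nondegenerate, non-adjacent edges are disjoint, and adjacent edges meet only in their common
vertex.) -/
def IsEmbedded (P : Polygon E n) : Prop :=
  ∀ (i j : Fin n) (s t : ℝ), s ∈ Set.Ico (0 : ℝ) 1 → t ∈ Set.Ico (0 : ℝ) 1 →
    P.edgePath ℝ i s = P.edgePath ℝ j t → i = j ∧ s = t

end Polygon

namespace Geometry.SimplicialComplex

variable {E : Type*} [AddCommGroup E] [Module ℝ E]

/-- The triangles (2-simplices) of a simplicial complex. -/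
def triangles (K : SimplicialComplex ℝ E) : Set (Finset E) :=
  {t ∈ K.faces | t.card = 3}

/-- The link of `v` in a complex of dimension at most two, as a graph: its vertices are the
vertices `a ≠ v` joined to `v` by an edge of `K`, and `a`, `b` are adjacent when `v`, `a`, `b`
span a triangle of `K`. (Faces are closed under passing to nonempty subsets, so some face contains
the given points if and only if they span a face.) -/
def linkGraph (K : SimplicialComplex ℝ E) (v : E) :
    SimpleGraph {a : E // a ≠ v ∧ ∃ t ∈ K.faces, v ∈ t ∧ a ∈ t} where
  Adj a b := a ≠ b ∧ ∃ t ∈ K.faces, v ∈ t ∧ a.1 ∈ t ∧ b.1 ∈ t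
  symm := ⟨fun _ _ h => ⟨h.1.symm, h.2.imp fun _ ht => ⟨ht.1, ht.2.1, ht.2.2.2, ht.2.2.1⟩⟩⟩
  loopless := ⟨fun _ h => h.1 rfl⟩

/-- `K` is a (compact) triangulated PL surface, possibly with boundary: a finite complex of
dimension at most two in which the link of every vertex is an arc (a path with at least one edge)
or a closed polygon (a cycle of length at least three). This makes `K` pure of dimension two.
The surface is embedded, since the simplices of `K` lie in `E` and meet only in common faces. -/
structure IsSurface (K : SimplicialComplex ℝ E) : Prop where
  finite : K.faces.Finite
  card_le_three : ∀ t ∈ K.faces, t.card ≤ 3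
  link : ∀ v ∈ K.vertices,
    (∃ m : ℕ, 2 ≤ m ∧ Nonempty (K.linkGraph v ≃g SimpleGraph.pathGraph m)) ∨
    (∃ m : ℕ, 3 ≤ m ∧ Nonempty (K.linkGraph v ≃g SimpleGraph.cycleGraph m))

/-- `a`, `b`, `c` are the three vertices of a triangle of `K`. -/
def SpansTriangle (K : SimplicialComplex ℝ E) (a b c : E) : Prop :=
  a ≠ b ∧ b ≠ c ∧ a ≠ c ∧ ∃ t ∈ K.triangles, a ∈ t ∧ b ∈ t ∧ c ∈ t

/-- An orientation of a triangulated surface: for each triangle one of its two cyclic orders is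
declared positive (`pos a b c`: the order `a → b → c → a` is the positive one), in such a way that
two different triangles with a common edge induce opposite directions on that edge. -/
structure SurfaceOrientation (K : SimplicialComplex ℝ E) where
  pos : E → E → E → Prop
  spans : ∀ {a b c}, pos a b c → K.SpansTriangle a b c
  cyclic : ∀ {a b c}, pos a b c → pos b c a
  exactly_one : ∀ {a b c}, K.SpansTriangle a b c → (pos a b c ↔ ¬ pos b a c)
  coherent : ∀ {a b c d}, pos a b c → pos a b d → c = d

/-- The boundary edges of a triangulated surface: those contained in exactly one triangle. -/
def boundaryEdges (K : SimplicialComplex ℝ E) : Set (Finset E) :=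
  {e ∈ K.faces | e.card = 2 ∧ ∃! t, t ∈ K.triangles ∧ e ⊆ t}

/-- The boundary of a triangulated surface: the subcomplex of the boundary edges and their
vertices. -/
def boundaryComplex (K : SimplicialComplex ℝ E) : SimplicialComplex ℝ E where
  faces := {s | s ∈ K.faces ∧ ∃ e ∈ K.boundaryEdges, s ⊆ e}
  isRelLowerSet_faces := fun s hs =>
    ⟨K.nonempty_of_mem_faces hs.1, fun _ hts htn => by
      obtain ⟨e, he, hse⟩ := hs.2
      exact ⟨K.down_closed hs.1 hts htn, e, he, subset_trans hts hse⟩⟩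
  indep := fun hs => K.indep hs.1
  inter_subset_convexHull := fun hs ht => K.inter_subset_convexHull hs.1 ht.1

/-- The complex `L` is a subdivision of the closed polygon `P`: both have the same underlying set,
and every simplex of `L` lies in an edge of `P`. (For embedded `P` this forces the vertices of `P`
to be vertices of `L`.) -/
def IsSubdivisionOfPolygon (L : SimplicialComplex ℝ E) {n : ℕ} (P : Polygon E n) : Prop :=
  L.space = P.boundary ℝ ∧
    ∀ s ∈ L.faces, ∃ i : Fin n, convexHull ℝ (s : Set E) ⊆ P.edgeSet ℝ i

end Geometry.SimplicialComplex

open Filter Topology Geometry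

set_option linter.unusedSectionVars false

/-! The surface comes from Seifert's algorithm, arranged so that all triangles can be counted. In a
generic direction the polygon projects to a closed plane polygon with finitely many transverse
double points (`exists_isGenericPolygon`). At each crossing take nodes t on the upper strand, b
below it, p shortly after t and q shortly before b. The crossing is smoothed by letting the incoming
upper strand continue from b on the lower strand, and by letting the incoming lower strand turn at q
along a chord to p. The result is a family of disjoint simple closed plane polygons
(`Node.isPlanar_diagram`). Vertical walls hang down along its edges, the triangles t p q and t q b
at each crossing attach the walls to the polygon, and floors fill the smoothed curve at the lower
ends of the walls.

The floors must not be hit by the walls. Give each edge of the smoothed curve as level the larger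
absolute value of the winding numbers on its two sides. Consecutive edges have the same winding
number on their left (`IsPlanarCurve.left_wind_eq`), so the level is constant on components. Where
the whole curve has winding number w, the components of level k have winding number [k ≤ w] - [w ≤
-k] (`IsPlanarCurve.wind_level`). Hence their winding number is 0, 1 or -1, and it vanishes on edges
of smaller level (`IsPlanarCurve.exists_level`). The floor of level k covers the region where it is
1 or -1, oriented by the sign, in a horizontal plane below the polygon whose height grows with k.
Walls of smaller level pass beside this floor, and walls of larger level end above it.

A floor needs no new vertices. Extend the edges of a level to a maximal noncrossing system of
segments between its vertices. A segment with some vertex on its left bounds an empty triangle on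
that side (`IsMaximalNoncrossing.exists_emptyTriangle`), and the winding number is constant inside.
Turning around a vertex from triangle to triangle ends at an edge of the curve, which gives
connected links.

To count floor triangles, choose a generic linear function on the plane. Every triangle has a vertex
with the middle value, and it is determined by this vertex and by the direction along the level line
in which it lies. This allows two triangles per vertex, but only one if the function is monotone
along the curve there, because the winding number jumps by one (`IsLevelCurve.not_apex_both`). At
every crossing the function is monotone at q or at p. For c crossings the smoothed curve has L = n +
3c vertices. There are at most 2L - c floor triangles, 2L + c wall triangles and 2c triangles at
crossings, altogether 4L + 2c = 4n + 14c. Adjacent edges do not cross, so 2c + 3n ≤ n², and the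
total is at most 7n² - 17n.

The combinatorial side is reduced to `IsOrientedSurface`: an oriented edge belongs to at most one
oriented triangle, triangles meet in common faces, and links are connected. -/

/-! ### Vertex links: paths and cycles -/

theorem SimpleGraph.exists_iso_pathGraph_or_cycleGraph {X : Type*} [Finite X] (G : SimpleGraph X)
    (r : X → X → Prop) (hG : ∀ a b, G.Adj a b ↔ r a b ∨ r b a)
    (right_unique : ∀ {a b c}, r a b → r a c → b = c)
    (left_unique : ∀ {a b c}, r a c → r b c → a = b)
    (asymm : ∀ {a b}, r a b → ¬ r b a) (connected : ∀ a b, Relation.EqvGen r a b)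
    (nonempty : ∃ a b, r a b) :
    (∃ m : ℕ, 2 ≤ m ∧ Nonempty (G ≃g SimpleGraph.pathGraph m)) ∨
    (∃ m : ℕ, 3 ≤ m ∧ Nonempty (G ≃g SimpleGraph.cycleGraph m)) := by
  classical
  cases nonempty_fintype X
  have irrefl : ∀ {a}, ¬ r a a := fun h => asymm h h
  -- `Q m` means that there is an injective `r`-chain of `m` points. A longest chain is closed under
  -- successors and predecessors, so by connectedness it exhausts `X`. The graph is a cycle or a
  -- path according to whether the last point precedes the first.
  let Q : ℕ → Prop := fun m => ∃ f : ℕ → X, Set.InjOn f (Set.Iio m) ∧ ∀ i, i + 1 < m → r (f i) (f (i + 1))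
  have hQ2 : Q 2 := by
    obtain ⟨a, b, hab⟩ := nonempty
    have hne : a ≠ b := fun h => irrefl (h ▸ hab)
    refine ⟨fun i => if i = 0 then a else b, ?_, ?_⟩
    · intro i hi j hj h
      simp only [Set.mem_Iio] at hi hj
      interval_cases i <;> interval_cases j <;> simp_all
    · intro i hi
      obtain rfl : i = 0 := by omega
      simpa using hab
  have hQb : ∀ m, Q m → m ≤ Fintype.card X := by
    rintro m ⟨f, hf, -⟩
    have := Finset.card_le_univ ((Finset.range m).image f)
    rwa [Finset.card_image_of_injOn (by simpa using hf), Finset.card_range] at this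
  obtain ⟨m, hm2, hm, hmax⟩ : ∃ m, 2 ≤ m ∧ Q m ∧ ¬ Q (m + 1) := by
    refine ⟨Nat.findGreatest Q (Fintype.card X), Nat.le_findGreatest (hQb 2 hQ2) hQ2,
      Nat.findGreatest_spec (hQb 2 hQ2) hQ2, fun h => ?_⟩
    have := Nat.le_findGreatest (hQb _ h) h
    omega
  obtain ⟨f, hinj, hr⟩ := hm
  have inj : ∀ {i j}, i < m → j < m → f i = f j → i = j := fun hi hj h => hinj hi hj h
  have hlast : ∀ {y}, r (f (m - 1)) y → y = f 0 := by
    intro y hy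
    by_cases hex : ∃ j < m, f j = y
    · obtain ⟨j, hj, rfl⟩ := hex
      rcases Nat.eq_zero_or_pos j with rfl | hj0
      · rfl
      · have h1 := hr (j - 1) (by omega)
        rw [Nat.sub_add_cancel hj0] at h1
        have := inj (by omega) (by omega) (left_unique hy h1)
        omega
    · push Not at hex
      -- A successor of the last point outside the chain could be appended.
      refine (hmax ⟨Function.update f m y, ?_, ?_⟩).elim
      · intro i hi j hj h
        simp only [Set.mem_Iio] at hi hj
        rcases eq_or_ne i m with him | him <;> rcases eq_or_ne j m with hjm | hjm
        · omega
        · rw [him, Function.update_self, Function.update_of_ne hjm] at h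
          exact (hex j (by omega) h.symm).elim
        · rw [hjm, Function.update_self, Function.update_of_ne him] at h
          exact (hex i (by omega) h).elim
        · rw [Function.update_of_ne hjm, Function.update_of_ne him] at h
          exact inj (by omega) (by omega) h
      · intro i hi
        rcases eq_or_ne (i + 1) m with him | him
        · obtain rfl : i = m - 1 := by omega
          rw [him, Function.update_self, Function.update_of_ne (by omega)]
          exact hy
        · rw [Function.update_of_ne him, Function.update_of_ne (by omega)]
          exact hr i (by omega)
  have hfirst : ∀ {y}, r y (f 0) → ∃ j < m, f j = y := by
    intro y hy
    by_contra! hex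
    refine hmax ⟨fun i => if i = 0 then y else f (i - 1), ?_, ?_⟩
    · intro i hi j hj h
      simp only [Set.mem_Iio] at hi hj
      rcases eq_or_ne i 0 with rfl | hi0 <;> rcases eq_or_ne j 0 with rfl | hj0
      · rfl
      · simp only [if_true, if_neg hj0] at h
        exact (hex _ (by omega) h.symm).elim
      · simp only [if_true, if_neg hi0] at h
        exact (hex _ (by omega) h).elim
      · simp only [if_neg hi0, if_neg hj0] at h
        have := inj (by omega) (by omega) h
        omega
    · intro i hi
      rcases eq_or_ne i 0 with rfl | hi0
      · simpa using hy
      · simp only [if_neg hi0, Nat.add_eq_zero_iff, one_ne_zero, and_false, if_false, Nat.add_sub_cancel]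
        have := hr (i - 1) (by omega)
        rwa [Nat.sub_add_cancel (by omega)] at this
  have hsurj : ∀ y, ∃ j < m, f j = y := by
    have step : ∀ a b, r a b → ((∃ j < m, f j = a) ↔ ∃ j < m, f j = b) := by
      intro a b hab
      constructor
      · rintro ⟨j, hj, rfl⟩
        by_cases hj' : j + 1 < m
        · exact ⟨j + 1, hj', right_unique (hr j hj') hab⟩
        · obtain rfl : j = m - 1 := by omega
          exact ⟨0, by omega, (hlast hab).symm⟩
      · rintro ⟨j, hj, rfl⟩
        rcases Nat.eq_zero_or_pos j with rfl | hj0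
        · exact hfirst hab
        · have h1 := hr (j - 1) (by omega)
          rw [Nat.sub_add_cancel hj0] at h1
          exact ⟨j - 1, by omega, left_unique h1 hab⟩
    intro y
    have := connected (f 0) y
    have key : ∀ a b, Relation.EqvGen r a b → ((∃ j < m, f j = a) ↔ ∃ j < m, f j = b) := by
      intro a b h
      induction h with
      | rel a b h => exact step a b h
      | refl a => exact Iff.rfl
      | symm a b _ ih => exact ih.symm
      | trans a b c _ _ ih1 ih2 => exact ih1.trans ih2
    exact (key _ _ this).1 ⟨0, by omega, rfl⟩
  let e : Fin m ≃ X := Equiv.ofBijective (fun i => f i)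
    ⟨fun i j h => Fin.ext (inj i.2 j.2 h), fun y => by
      obtain ⟨j, hj, h⟩ := hsurj y
      exact ⟨⟨j, hj⟩, h⟩⟩
  have hadj : ∀ i j : Fin m, r (f i) (f j) ↔
      (i.1 + 1 = j.1 ∨ (i.1 + 1 = m ∧ j.1 = 0 ∧ r (f (m - 1)) (f 0))) := by
    intro i j
    constructor
    · intro h
      by_cases hi : i.1 + 1 < m
      · exact Or.inl (inj hi j.2 (right_unique (hr _ hi) h))
      · have him : i.1 = m - 1 := by omega
        rw [him] at h
        have h0 := hlast h
        have := inj j.2 (by omega) h0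
        refine Or.inr ⟨by omega, this, ?_⟩
        rwa [h0] at h
    · rintro (h | ⟨h1, h2, h3⟩)
      · have := hr i (by omega)
        rwa [h] at this
      · rw [h2, show i.1 = m - 1 by omega]
        exact h3
  by_cases hc : r (f (m - 1)) (f 0)
  · right
    have hm3 : 3 ≤ m := by
      by_contra hlt
      obtain rfl : m = 2 := by omega
      exact asymm hc (hr 0 (by omega))
    refine ⟨m, hm3, ⟨(RelIso.mk e ?_).symm⟩⟩
    intro i j
    change G.Adj (f i) (f j) ↔ _
    rw [hG, hadj, hadj, SimpleGraph.cycleGraph_adj']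
    have sub : ∀ u v : Fin m, (u - v).1 = if v.1 ≤ u.1 then u.1 - v.1 else m + u.1 - v.1 := by
      intro u v
      rw [Fin.sub_def]
      have := u.2
      have := v.2
      split_ifs with h
      · rw [show m - v.1 + u.1 = (u.1 - v.1) + m by omega]
        simp [Nat.mod_eq_of_lt (show u.1 - v.1 < m by omega)]
      · simp only
        rw [Nat.mod_eq_of_lt (by omega)]
        omega
    rw [sub, sub]
    have := i.2
    have := j.2
    simp only [hc, and_true]
    split_ifs <;> omega
  · left
    refine ⟨m, hm2, ⟨(RelIso.mk e ?_).symm⟩⟩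
    intro i j
    change G.Adj (f i) (f j) ↔ _
    rw [hG, hadj, hadj, SimpleGraph.pathGraph_adj]
    simp [hc]

/-! ### Simplicial surfaces from oriented triangles -/

/-- The two simplices spanned by the images of `s` and `t` meet in their common face. -/
def MeetProperly {W E : Type*} [AddCommGroup E] [Module ℝ E] (pos : W → E) (s t : Set W) : Prop :=
  convexHull ℝ (pos '' s) ∩ convexHull ℝ (pos '' t) ⊆ convexHull ℝ (pos '' (s ∩ t))

/-- Oriented triangles with vertices `pos w` that fit together to an oriented surface. -/
structure IsOrientedSurface {W E : Type*} [AddCommGroup E] [Module ℝ E] (pos : W → E)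
    (Tri : W → W → W → Prop) : Prop where
  inj : Function.Injective pos
  cyc : ∀ {a b c}, Tri a b c → Tri b c a
  indep : ∀ {a b c}, Tri a b c → AffineIndependent ℝ ![pos a, pos b, pos c]
  coherent : ∀ {a b c d}, Tri a b c → Tri a b d → c = d
  noflip : ∀ {a b c}, Tri a b c → ¬ Tri b a c
  proper : ∀ {a b c a' b' c'}, Tri a b c → Tri a' b' c' → MeetProperly pos {a, b, c} {a', b', c'}
  link : ∀ {v a b a' b'}, Tri v a b → Tri v a' b' → Relation.EqvGen (Tri v) a a'

namespace IsOrientedSurface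

theorem mem_pos {W E : Type*} [DecidableEq E] {pos : W → E} {a b c : W} {x : E} (hx : x ∈ ({pos a, pos b, pos c} : Finset E)) :
    ∃ w, x = pos w ∧ (w = a ∨ w = b ∨ w = c) := by
  simp only [Finset.mem_insert, Finset.mem_singleton] at hx
  rcases hx with rfl | rfl | rfl
  exacts [⟨a, rfl, by simp⟩, ⟨b, rfl, by simp⟩, ⟨c, rfl, by simp⟩]

variable {W E : Type*} [AddCommGroup E] [Module ℝ E] {pos : W → E} {Tri : W → W → W → Prop}

theorem ne (h : IsOrientedSurface pos Tri) {a b c : W} (ht : Tri a b c) :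
    a ≠ b ∧ b ≠ c ∧ a ≠ c := by
  have hi := (h.indep ht).injective
  refine ⟨fun e => ?_, fun e => ?_, fun e => ?_⟩
  · have := @hi 0 1 (by simp [e]); simp at this
  · have := @hi 1 2 (by simp [e]); simp at this
  · have := @hi 0 2 (by simp [e]); simp at this

theorem indep_set (h : IsOrientedSurface pos Tri) {a b c : W} (ht : Tri a b c) :
    AffineIndependent ℝ ((↑) : ({pos a, pos b, pos c} : Set E) → E) := by
  have := (h.indep ht).range
  have e : Set.range ![pos a, pos b, pos c] = {pos a, pos b, pos c} := by
    ext x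
    simp
    tauto
  rwa [e] at this

theorem rotate_to (h : IsOrientedSurface pos Tri) {a b c w x : W} (ht : Tri a b c)
    (hw : w = a ∨ w = b ∨ w = c) (hx : x = a ∨ x = b ∨ x = c) (hwx : w ≠ x) :
    ∃ y, (Tri w x y ∨ Tri x w y) ∧ ({w, x, y} : Set W) = {a, b, c} := by
  have h1 := h.cyc ht
  have h2 := h.cyc h1
  rcases hw with rfl | rfl | rfl <;> rcases hx with rfl | rfl | rfl
  · exact (hwx rfl).elim
  · exact ⟨c, Or.inl ht, rfl⟩
  · exact ⟨b, Or.inr h2, by ext; simp; tauto⟩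
  · exact ⟨c, Or.inr ht, by ext; simp; tauto⟩
  · exact (hwx rfl).elim
  · exact ⟨a, Or.inl h1, by ext; simp; tauto⟩
  · exact ⟨b, Or.inl h2, by ext; simp; tauto⟩
  · exact ⟨a, Or.inr h1, by ext; simp; tauto⟩
  · exact (hwx rfl).elim

variable [DecidableEq E]

/-- The simplicial complex formed by the faces of the triangles. -/
def complex (h : IsOrientedSurface pos Tri) : SimplicialComplex ℝ E where
  faces := {s | s.Nonempty ∧ ∃ a b c, Tri a b c ∧ s ⊆ {pos a, pos b, pos c}}
  isRelLowerSet_faces := fun _ hs => ⟨hs.1, fun _ hts htn => ⟨htn, by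
    obtain ⟨a, b, c, ht, hs⟩ := hs.2
    exact ⟨a, b, c, ht, subset_trans hts hs⟩⟩⟩
  indep := by
    rintro s ⟨-, a, b, c, ht, hs⟩
    refine (h.indep_set ht).mono ?_
    intro x hx
    simpa using hs hx
  inter_subset_convexHull := by
    rintro s t ⟨-, a, b, c, h1, hs⟩ ⟨-, a', b', c', h2, ht⟩ x ⟨hxs, hxt⟩
    have i1 : AffineIndependent ℝ ((↑) : ({pos a, pos b, pos c} : Finset E) → E) := by
      have := h.indep_set h1
      refine this.mono (fun x hx => ?_)
      simpa using hx
    have i2 : AffineIndependent ℝ ((↑) : ({pos a', pos b', pos c'} : Finset E) → E) := by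
      have := h.indep_set h2
      refine this.mono (fun x hx => ?_)
      simpa using hx
    have img : ∀ a b c : W, pos '' {a, b, c} = (({pos a, pos b, pos c} : Finset E) : Set E) := by
      intro a b c
      simp [Set.image_insert_eq]
    have hx1 : x ∈ convexHull ℝ (({pos a, pos b, pos c} : Finset E) : Set E) :=
      convexHull_mono (by exact_mod_cast hs) hxs
    have hx2 : x ∈ convexHull ℝ (({pos a', pos b', pos c'} : Finset E) : Set E) :=
      convexHull_mono (by exact_mod_cast ht) hxt
    -- The two full triangles meet in the hull of their common vertices. Intersecting this hull with
    -- `s` in the first triangle and with `t` in the second, each time by affine independence,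
    -- leaves only common vertices of `s` and `t`.
    have hx : x ∈ convexHull ℝ ((({pos a, pos b, pos c} ∩ {pos a', pos b', pos c'} : Finset E)) : Set E) := by
      have := h.proper h1 h2
      unfold MeetProperly at this
      rw [Set.image_inter h.inj, img, img] at this
      rw [Finset.coe_inter]
      exact this ⟨hx1, hx2⟩
    have k1 := (i1.convexHull_inter hs Finset.inter_subset_left).symm.subset ⟨hxs, hx⟩
    have k2 := (i2.convexHull_inter ht Finset.inter_subset_right).symm.subset ⟨hxt, hx⟩
    rw [← Finset.coe_inter] at k1 k2
    have k3 := (i1.convexHull_inter (t₁ := s ∩ ({pos a, pos b, pos c} ∩ {pos a', pos b', pos c'}))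
      (t₂ := t ∩ ({pos a, pos b, pos c} ∩ {pos a', pos b', pos c'}))
      (fun y hy => by simp only [Finset.mem_inter] at hy; exact hy.2.1)
      (fun y hy => by simp only [Finset.mem_inter] at hy; exact hy.2.1)).symm.subset ⟨k1, k2⟩
    refine convexHull_mono ?_ k3
    intro y hy
    simp only [Finset.coe_inter, Set.mem_inter_iff] at hy ⊢
    exact ⟨hy.1.1, hy.2.1⟩

theorem card_image (h : IsOrientedSurface pos Tri) {a b c : W} (ht : Tri a b c) :
    ({pos a, pos b, pos c} : Finset E).card = 3 := by
  obtain ⟨h1, h2, h3⟩ := h.ne ht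
  rw [Finset.card_eq_three]
  exact ⟨_, _, _, h.inj.ne h1, h.inj.ne h3, h.inj.ne h2, rfl⟩

theorem triangles_complex (h : IsOrientedSurface pos Tri) :
    h.complex.triangles = {s | ∃ a b c, Tri a b c ∧ s = {pos a, pos b, pos c}} := by
  ext s
  constructor
  · rintro ⟨⟨-, a, b, c, ht, hs⟩, h3⟩
    exact ⟨a, b, c, ht, Finset.eq_of_subset_of_card_le hs (by rw [h.card_image ht, h3])⟩
  · rintro ⟨a, b, c, ht, rfl⟩
    exact ⟨⟨⟨pos a, by simp⟩, a, b, c, ht, subset_rfl⟩, h.card_image ht⟩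

theorem face_of (h : IsOrientedSurface pos Tri) {a b c : W} (ht : Tri a b c) :
    ({pos a, pos b, pos c} : Finset E) ∈ h.complex.faces :=
  ⟨⟨pos a, by simp⟩, a, b, c, ht, subset_rfl⟩

theorem exists_of_mem_face (h : IsOrientedSurface pos Tri) {s : Finset E} (hs : s ∈ h.complex.faces)
    {w x : W} (hw : pos w ∈ s) (hx : pos x ∈ s) (hne : w ≠ x) :
    ∃ y, (Tri w x y ∨ Tri x w y) ∧ s ⊆ {pos w, pos x, pos y} := by
  obtain ⟨-, a, b, c, ht, hs⟩ := hs
  obtain ⟨w', e, hw'⟩ := mem_pos (hs hw)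
  obtain ⟨x', e', hx'⟩ := mem_pos (hs hx)
  rw [← h.inj e] at hw'
  rw [← h.inj e'] at hx'
  obtain ⟨y, hy, hy'⟩ := h.rotate_to ht hw' hx' hne
  refine ⟨y, hy, fun p hp => ?_⟩
  obtain ⟨p', rfl, hp'⟩ := mem_pos (hs hp)
  have : p' ∈ ({w, x, y} : Set W) := by rw [hy']; simpa using hp'
  simp only [Set.mem_insert_iff, Set.mem_singleton_iff] at this
  rcases this with rfl | rfl | rfl <;> simp

theorem spansTriangle_iff (h : IsOrientedSurface pos Tri) {a b c : E} :
    h.complex.SpansTriangle a b c ↔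
      ∃ x y z, (Tri x y z ∨ Tri y x z) ∧ a = pos x ∧ b = pos y ∧ c = pos z := by
  constructor
  · rintro ⟨hab, hbc, hac, t, ht, ha, hb, hc⟩
    rw [h.triangles_complex] at ht
    obtain ⟨x, y, z, hT, rfl⟩ := ht
    obtain ⟨x', rfl, -⟩ := mem_pos ha
    obtain ⟨y', rfl, -⟩ := mem_pos hb
    obtain ⟨z', hz, hsub⟩ := h.exists_of_mem_face (h.face_of hT) ha hb (fun e => hab (by rw [e]))
    have := hsub hc
    simp only [Finset.mem_insert, Finset.mem_singleton] at this
    rcases this with e | e | e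
    · exact (hac e.symm).elim
    · exact (hbc e.symm).elim
    · exact ⟨x', y', z', hz, rfl, rfl, e⟩
  · rintro ⟨x, y, z, hT, rfl, rfl, rfl⟩
    have key : ∀ {x y z}, Tri x y z → h.complex.SpansTriangle (pos x) (pos y) (pos z) := by
      intro x y z hT
      obtain ⟨h1, h2, h3⟩ := h.ne hT
      refine ⟨h.inj.ne h1, h.inj.ne h2, h.inj.ne h3, {pos x, pos y, pos z}, ?_, by simp, by simp, by simp⟩
      rw [h.triangles_complex]
      exact ⟨x, y, z, hT, rfl⟩
    rcases hT with hT | hT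
    · exact key hT
    · obtain ⟨h1, h2, h3, t, ht, ha, hb, hc⟩ := key hT
      exact ⟨h1.symm, h3, h2, t, ht, hb, ha, hc⟩

/-- The orientation of the complex by its oriented triangles. -/
def orientation (h : IsOrientedSurface pos Tri) : h.complex.SurfaceOrientation where
  pos a b c := ∃ x y z, Tri x y z ∧ a = pos x ∧ b = pos y ∧ c = pos z
  spans := by
    rintro a b c ⟨x, y, z, hT, ha⟩
    exact h.spansTriangle_iff.2 ⟨x, y, z, Or.inl hT, ha⟩
  cyclic := by
    rintro a b c ⟨x, y, z, hT, ha, hb, hc⟩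
    exact ⟨y, z, x, h.cyc hT, hb, hc, ha⟩
  exactly_one := by
    intro a b c hs
    obtain ⟨x, y, z, hT, rfl, rfl, rfl⟩ := h.spansTriangle_iff.1 hs
    constructor
    · rintro ⟨x', y', z', hT1, e1, e2, e3⟩ ⟨x'', y'', z'', hT2, e4, e5, e6⟩
      obtain rfl := h.inj e1
      obtain rfl := h.inj e2
      obtain rfl := h.inj e3
      obtain rfl := h.inj e4
      obtain rfl := h.inj e5
      obtain rfl := h.inj e6
      exact h.noflip hT1 hT2
    · intro hn
      rcases hT with hT | hT
      · exact ⟨x, y, z, hT, rfl, rfl, rfl⟩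
      · exact (hn ⟨y, x, z, hT, rfl, rfl, rfl⟩).elim
  coherent := by
    rintro a b c d ⟨x, y, z, hT, rfl, rfl, rfl⟩ ⟨x', y', z', hT', e1, e2, rfl⟩
    obtain rfl := h.inj e1
    obtain rfl := h.inj e2
    rw [h.coherent hT hT']

/-- Around a vertex `w` the relation `Tri w` is a partial injection between neighbours by
`coherent`, asymmetric by `noflip` and connected by `link`. Its symmetrization, the link graph, is
therefore a path or a cycle. -/
theorem isSurface_complex [Finite W] (h : IsOrientedSurface pos Tri) : h.complex.IsSurface where
  finite := by
    cases nonempty_fintype W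
    refine ((Finset.univ.image pos).powerset : Set (Finset E)).toFinite.subset ?_
    rintro s ⟨-, a, b, c, -, hs⟩
    simp only [Finset.coe_powerset, Set.mem_preimage, Set.mem_powerset_iff]
    intro x hx
    obtain ⟨w, rfl, -⟩ := mem_pos (hs hx)
    simp
  card_le_three := by
    rintro s ⟨-, a, b, c, -, hs⟩
    exact (Finset.card_le_card hs).trans Finset.card_le_three
  link := by
    intro v hv
    obtain ⟨-, a, b, c, ht, hs⟩ := hv
    obtain ⟨w, rfl, hw⟩ := mem_pos (hs (Finset.mem_singleton_self v))
    obtain ⟨x, y, hxy⟩ : ∃ x y, Tri w x y := by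
      rcases hw with rfl | rfl | rfl
      exacts [⟨_, _, ht⟩, ⟨_, _, h.cyc ht⟩, ⟨_, _, h.cyc (h.cyc ht)⟩]
    set X := {a : E // a ≠ pos w ∧ ∃ t ∈ h.complex.faces, pos w ∈ t ∧ a ∈ t}
    have memL : ∀ {x y}, Tri w x y → pos x ≠ pos w ∧ ∃ t ∈ h.complex.faces, pos w ∈ t ∧ pos x ∈ t :=
      fun {x y} hT => ⟨h.inj.ne (h.ne hT).1.symm, _, h.face_of hT, by simp, by simp⟩
    have memR : ∀ {x y}, Tri w x y → pos y ≠ pos w ∧ ∃ t ∈ h.complex.faces, pos w ∈ t ∧ pos y ∈ t :=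
      fun {x y} hT => ⟨h.inj.ne (h.ne hT).2.2.symm, _, h.face_of hT, by simp, by simp⟩
    have surj : ∀ p : X, ∃ x y, p.1 = pos x ∧ (Tri w x y ∨ Tri x w y) := by
      rintro ⟨p, hp, t, ht, hwt, hpt⟩
      obtain ⟨x, rfl⟩ : ∃ x, p = pos x := by
        obtain ⟨-, a, b, c, -, hs⟩ := ht
        obtain ⟨x, e, -⟩ := mem_pos (hs hpt)
        exact ⟨x, e⟩
      obtain ⟨y, hy, -⟩ := h.exists_of_mem_face ht hwt hpt (fun e => hp (by rw [e]))
      exact ⟨x, y, rfl, hy⟩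
    have : Finite X := by
      refine Finite.of_injective (fun p : X => (surj p).choose) ?_
      intro p q e
      have h1 := (surj p).choose_spec.choose_spec.1
      have h2 := (surj q).choose_spec.choose_spec.1
      have e : (surj p).choose = (surj q).choose := e
      exact Subtype.ext (by rw [h1, h2, e])
    let r : X → X → Prop := fun p q => ∃ x y, Tri w x y ∧ p.1 = pos x ∧ q.1 = pos y
    have lift : ∀ x y, Relation.EqvGen (Tri w) x y → x = y ∨ ∃ hx hy, Relation.EqvGen r ⟨pos x, hx⟩ ⟨pos y, hy⟩ := by
      intro x y hxy
      induction hxy with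
      | rel x y hT => exact Or.inr ⟨memL hT, memR hT, .rel _ _ ⟨x, y, hT, rfl, rfl⟩⟩
      | refl x => exact Or.inl rfl
      | symm x y _ ih =>
        rcases ih with rfl | ⟨hx, hy, ih⟩
        · exact Or.inl rfl
        · exact Or.inr ⟨hy, hx, ih.symm⟩
      | trans x y z _ _ ih1 ih2 =>
        rcases ih1 with rfl | ⟨hx, hy, ih1⟩
        · exact ih2
        · rcases ih2 with rfl | ⟨hy', hz, ih2⟩
          · exact Or.inr ⟨hx, hy, ih1⟩
          · exact Or.inr ⟨hx, hz, ih1.trans _ _ _ ih2⟩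
    have surj2 : ∀ p : X, ∃ x y, Tri w x y ∧ ∃ hx, Relation.EqvGen r p ⟨pos x, hx⟩ := by
      intro p
      obtain ⟨x, y, e, hT | hT⟩ := surj p
      · refine ⟨x, y, hT, memL hT, ?_⟩
        obtain rfl : p = ⟨pos x, memL hT⟩ := Subtype.ext e
        exact .refl _
      · have hT := h.cyc hT
        refine ⟨y, x, hT, memL hT, .symm _ _ (.rel _ _ ⟨y, x, hT, rfl, e⟩)⟩
    refine SimpleGraph.exists_iso_pathGraph_or_cycleGraph (h.complex.linkGraph (pos w)) r ?_ ?_ ?_ ?_ ?_ ?_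
    · intro p q
      constructor
      · rintro ⟨hne, t, ht, hw, hp, hq⟩
        obtain ⟨x, -, e, -⟩ := surj p
        obtain ⟨y, -, e', -⟩ := surj q
        rw [e] at hp
        rw [e'] at hq
        have hxy : x ≠ y := fun h => hne (Subtype.ext (by rw [e, e', h]))
        obtain ⟨z, hT, hsub⟩ := h.exists_of_mem_face ht hp hq hxy
        have := hsub hw
        simp only [Finset.mem_insert, Finset.mem_singleton] at this
        rcases this with e1 | e1 | e1
        · exact (p.2.1 (e.trans e1.symm)).elim
        · exact (q.2.1 (e'.trans e1.symm)).elim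
        · obtain rfl := h.inj e1
          rcases hT with hT | hT
          · exact Or.inl ⟨x, y, h.cyc (h.cyc hT), e, e'⟩
          · exact Or.inr ⟨y, x, h.cyc (h.cyc hT), e', e⟩
      · have key : ∀ p q : X, r p q → p ≠ q ∧ ∃ t ∈ h.complex.faces, pos w ∈ t ∧ p.1 ∈ t ∧ q.1 ∈ t := by
          rintro p q ⟨x, y, hT, e, e'⟩
          refine ⟨fun hpq => (h.ne hT).2.1 (h.inj (by rw [← e, ← e', hpq])), _, h.face_of hT, by simp, ?_, ?_⟩
          · simp [e]
          · simp [e']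
        rintro (h1 | h1)
        · exact key p q h1
        · obtain ⟨k1, t, k2, k3, k4, k5⟩ := key q p h1
          exact ⟨k1.symm, t, k2, k3, k5, k4⟩
    · rintro p q q' ⟨x, y, hT, e1, e2⟩ ⟨x', y', hT', e1', e2'⟩
      obtain rfl := h.inj (e1.symm.trans e1')
      exact Subtype.ext (by rw [e2, e2', h.coherent hT hT'])
    · rintro p p' q ⟨x, y, hT, e1, e2⟩ ⟨x', y', hT', e1', e2'⟩
      obtain rfl := h.inj (e2.symm.trans e2')
      refine Subtype.ext ?_
      rw [e1, e1', h.coherent (h.cyc (h.cyc hT)) (h.cyc (h.cyc hT'))]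
    · rintro p q ⟨x, y, hT, e1, e2⟩ ⟨x', y', hT', e1', e2'⟩
      obtain rfl := h.inj (e1.symm.trans e2')
      obtain rfl := h.inj (e2.symm.trans e1')
      exact h.noflip (h.cyc hT) (h.cyc hT')
    · intro p q
      obtain ⟨x, y, hT, hx, h1⟩ := surj2 p
      obtain ⟨x', y', hT', hx', h2⟩ := surj2 q
      refine h1.trans _ _ _ (.trans _ _ _ ?_ (.symm _ _ h2))
      rcases lift _ _ (h.link hT hT') with rfl | ⟨_, _, k⟩
      · exact .refl _
      · exact k
    · exact ⟨⟨pos x, memL hxy⟩, ⟨pos y, memR hxy⟩, x, y, hxy, rfl, rfl⟩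

/-- Each of the two directions of an edge borders at most one triangle, and triangles on opposite
directions are different. So an edge lies in exactly one triangle when one direction is occupied and
the other is not. -/
theorem mem_boundaryEdges_complex (h : IsOrientedSurface pos Tri) {e : Finset E} :
    e ∈ h.complex.boundaryEdges ↔
      ∃ a b c, Tri a b c ∧ (∀ d, ¬ Tri b a d) ∧ e = {pos a, pos b} := by
  have uniq : ∀ {a b c d}, Tri a b c → Tri b a d →
      ({pos a, pos b, pos c} : Finset E) ≠ {pos b, pos a, pos d} := by
    intro a b c d h1 h2 heq
    have hcd : pos d ∈ ({pos a, pos b, pos c} : Finset E) := heq ▸ by simp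
    simp only [Finset.mem_insert, Finset.mem_singleton] at hcd
    rcases hcd with e | e | e
    · exact (h.ne h2).2.1 (h.inj e.symm)
    · exact (h.ne h2).2.2 (h.inj e.symm)
    · obtain rfl := h.inj e
      exact h.noflip h1 h2
  have tri_mem : ∀ {a b c}, Tri a b c → ({pos a, pos b, pos c} : Finset E) ∈ h.complex.triangles := by
    intro a b c hT
    rw [h.triangles_complex]
    exact ⟨a, b, c, hT, rfl⟩
  constructor
  · rintro ⟨⟨-, a, b, c, hT, hs⟩, h2, t, ⟨ht, het⟩, hu⟩
    obtain ⟨p, q, hpq, rfl⟩ := Finset.card_eq_two.1 h2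
    obtain ⟨x, rfl, hx⟩ := mem_pos (hs (by simp : p ∈ _))
    obtain ⟨y, rfl, hy⟩ := mem_pos (hs (by simp : q ∈ _))
    have key : ∀ {x y z}, ({pos x, pos y} : Finset E) ⊆ t →
        (∀ u, u ∈ h.complex.triangles ∧ {pos x, pos y} ⊆ u → u = t) → Tri x y z → ∀ d, ¬ Tri y x d := by
      intro x y z _ hu h1 d h2
      apply uniq h1 h2
      rw [hu _ ⟨tri_mem h1, ?_⟩, hu _ ⟨tri_mem h2, ?_⟩]
      · intro u; simp; tauto
      · intro u; simp; tauto
    obtain ⟨z, hz | hz, -⟩ := h.rotate_to hT hx hy (fun e => hpq (by rw [e]))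
    · exact ⟨x, y, z, hz, key het hu hz, rfl⟩
    · refine ⟨y, x, z, hz, key ?_ ?_ hz, Finset.pair_comm _ _⟩
      · rwa [Finset.pair_comm]
      · rwa [Finset.pair_comm]
  · rintro ⟨a, b, c, hT, hn, rfl⟩
    have sub : ({pos a, pos b} : Finset E) ⊆ {pos a, pos b, pos c} := by intro u; simp; tauto
    refine ⟨⟨⟨pos a, by simp⟩, a, b, c, hT, sub⟩, Finset.card_pair (h.inj.ne (h.ne hT).1),
      {pos a, pos b, pos c}, ⟨tri_mem hT, sub⟩, ?_⟩
    rintro t ⟨ht, hsub⟩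
    obtain ⟨z, hz | hz, hsub'⟩ := h.exists_of_mem_face ht.1 (hsub (by simp : pos a ∈ _))
      (hsub (by simp : pos b ∈ _)) (h.ne hT).1
    · rw [h.coherent hT hz]
      refine Finset.eq_of_subset_of_card_le hsub' ?_
      rw [h.card_image hz, ht.2]
    · exact (hn _ hz).elim

end IsOrientedSurface

/-! ### Signed area and segments in the plane -/

/-- Twice the signed area of the triangle `a b c`. -/
def signedArea (a b c : ℂ) : ℝ :=
  (b.re - a.re) * (c.im - a.im) - (b.im - a.im) * (c.re - a.re)

/-- The point dividing the segment from `p` to `q` in the ratio `t`. -/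
def pointAt (p q : ℂ) (t : ℝ) : ℂ := p + t * (q - p)

@[simp] theorem pointAt_re (p q : ℂ) (t : ℝ) : (pointAt p q t).re = p.re + t * (q.re - p.re) := by
  simp [pointAt]

@[simp] theorem pointAt_im (p q : ℂ) (t : ℝ) : (pointAt p q t).im = p.im + t * (q.im - p.im) := by
  simp [pointAt]

theorem mem_openSegment_iff_pointAt {p q z : ℂ} :
    z ∈ openSegment ℝ p q ↔ ∃ t : ℝ, 0 < t ∧ t < 1 ∧ pointAt p q t = z := by
  rw [openSegment_eq_image']
  simp only [Set.mem_image, Set.mem_Ioo, and_assoc]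
  rfl

theorem mem_segment_iff_pointAt {p q z : ℂ} :
    z ∈ segment ℝ p q ↔ ∃ t : ℝ, 0 ≤ t ∧ t ≤ 1 ∧ pointAt p q t = z := by
  rw [segment_eq_image']
  simp only [Set.mem_image, Set.mem_Icc, and_assoc]
  rfl

theorem signedArea_pointAt (a b p q : ℂ) (t : ℝ) :
    signedArea a b (pointAt p q t) = (1 - t) * signedArea a b p + t * signedArea a b q := by
  simp only [signedArea, pointAt_re, pointAt_im]; ring

theorem signedArea_cyc (a b c : ℂ) : signedArea b c a = signedArea a b c := by
  simp only [signedArea]; ring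

theorem signedArea_swap (a b c : ℂ) : signedArea b a c = - signedArea a b c := by
  simp only [signedArea]; ring

@[simp] theorem signedArea_left (a b : ℂ) : signedArea a b a = 0 := by
  simp only [signedArea]; ring

@[simp] theorem signedArea_right (a b : ℂ) : signedArea a b b = 0 := by
  simp only [signedArea]; ring

@[simp] theorem signedArea_same (a b : ℂ) : signedArea a a b = 0 := by
  simp only [signedArea]; ring

/-- With `signedArea_re` and `signedArea_im` this says that the three areas are the barycentric
coordinates of `z`, scaled by the area of the triangle. -/
theorem signedArea_sum (a b c z : ℂ) :
    signedArea a b z + signedArea b c z + signedArea c a z = signedArea a b c := by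
  simp only [signedArea]; ring

theorem signedArea_re (a b c z : ℂ) : signedArea a b c * z.re =
    signedArea b c z * a.re + signedArea c a z * b.re + signedArea a b z * c.re := by
  simp only [signedArea]; ring

theorem signedArea_im (a b c z : ℂ) : signedArea a b c * z.im =
    signedArea b c z * a.im + signedArea c a z * b.im + signedArea a b z * c.im := by
  simp only [signedArea]; ring

theorem pointAt_zero (p q : ℂ) : pointAt p q 0 = p := by simp [pointAt]

theorem pointAt_one (p q : ℂ) : pointAt p q 1 = q := by simp [pointAt]

theorem eq_of_signedArea_eq_zero {a b c z : ℂ} (h : signedArea a b c ≠ 0)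
    (h1 : signedArea a b z = 0) (h2 : signedArea c a z = 0) : z = a := by
  have h3 : signedArea b c z = signedArea a b c := by linarith [signedArea_sum a b c z]
  have e1 := signedArea_re a b c z
  have e2 := signedArea_im a b c z
  rw [h1, h2, h3] at e1 e2
  apply Complex.ext
  · apply mul_left_cancel₀ h; linarith
  · apply mul_left_cancel₀ h; linarith

theorem mem_openSegment_of_signedArea {a b c z : ℂ} (h : 0 < signedArea a b c)
    (h1 : signedArea a b z = 0) (h2 : 0 < signedArea b c z) (h3 : 0 < signedArea c a z) :
    z ∈ openSegment ℝ a b := by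
  have hs := signedArea_sum a b c z
  rw [mem_openSegment_iff_pointAt]
  refine ⟨signedArea c a z / signedArea a b c, by positivity, ?_, ?_⟩
  · rw [div_lt_one h]; linarith
  · have e1 := signedArea_re a b c z
    have e2 := signedArea_im a b c z
    have h4 : signedArea b c z = signedArea a b c - signedArea c a z := by linarith
    rw [h1, h4] at e1 e2
    apply Complex.ext
    · rw [pointAt_re]; field_simp; linarith
    · rw [pointAt_im]; field_simp; linarith

theorem exists_pointAt_of_signedArea_eq_zero {a b z : ℂ} (h : a ≠ b) (h1 : signedArea a b z = 0) :
    ∃ t, pointAt a b t = z := by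
  have hd : (b.re - a.re) ^ 2 + (b.im - a.im) ^ 2 ≠ 0 := by
    intro h0
    apply h
    have e1 : b.re - a.re = 0 := by nlinarith [sq_nonneg (b.re - a.re), sq_nonneg (b.im - a.im)]
    have e2 : b.im - a.im = 0 := by nlinarith [sq_nonneg (b.re - a.re), sq_nonneg (b.im - a.im)]
    exact Complex.ext (by linarith) (by linarith)
  -- The parameter of the orthogonal projection of `z` to the line.
  refine ⟨((b.re - a.re) * (z.re - a.re) + (b.im - a.im) * (z.im - a.im)) /
    ((b.re - a.re) ^ 2 + (b.im - a.im) ^ 2), ?_⟩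
  unfold signedArea at h1
  apply Complex.ext
  · rw [pointAt_re]; field_simp; linear_combination (b.im - a.im) * h1
  · rw [pointAt_im]; field_simp; linear_combination -(b.re - a.re) * h1

theorem pointAt_mem_openSegment {a b : ℂ} {s t u : ℝ} (h1 : s < u) (h2 : u < t) :
    pointAt a b u ∈ openSegment ℝ (pointAt a b s) (pointAt a b t) := by
  rw [mem_openSegment_iff_pointAt]
  refine ⟨(u - s) / (t - s), div_pos (by linarith) (by linarith), ?_, ?_⟩
  · rw [div_lt_one (by linarith)]; linarith
  · have : t - s ≠ 0 := by linarith
    apply Complex.ext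
    · simp only [pointAt_re]; field_simp; ring
    · simp only [pointAt_im]; field_simp; ring

theorem pointAt_injective {a b : ℂ} (h : a ≠ b) : Function.Injective (pointAt a b) := by
  intro s t hst
  have : ((s : ℂ) - t) * (b - a) = 0 := by
    simp only [pointAt] at hst
    linear_combination hst
  rcases mul_eq_zero.1 this with h1 | h1
  · exact_mod_cast sub_eq_zero.1 h1
  · exact (h (sub_eq_zero.1 h1).symm).elim

/-- Overlapping collinear segments neither of which contains an endpoint of the other in its
interior are equal. -/
theorem eq_of_collinear_overlap {a b p q z : ℂ} (hab : a ≠ b) (hp : signedArea a b p = 0)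
    (hq : signedArea a b q = 0) (hz : z ∈ openSegment ℝ a b) (hz' : z ∈ openSegment ℝ p q)
    (hp' : p ∉ openSegment ℝ a b) (hq' : q ∉ openSegment ℝ a b)
    (ha' : a ∉ openSegment ℝ p q) (hb' : b ∉ openSegment ℝ p q) :
    (p = a ∧ q = b) ∨ (p = b ∧ q = a) := by
  obtain ⟨s, rfl⟩ := exists_pointAt_of_signedArea_eq_zero hab hp
  obtain ⟨t, rfl⟩ := exists_pointAt_of_signedArea_eq_zero hab hq
  obtain ⟨u, hu0, hu1, rfl⟩ := mem_openSegment_iff_pointAt.1 hz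
  obtain ⟨v, hv0, hv1, hv⟩ := mem_openSegment_iff_pointAt.1 hz'
  have huv : u = s + v * (t - s) := by
    apply pointAt_injective hab
    rw [← hv]
    apply Complex.ext
    · simp only [pointAt_re]; ring
    · simp only [pointAt_im]; ring
  have key : ∀ s t : ℝ, s < u → u < t → pointAt a b s ∉ openSegment ℝ a b →
      pointAt a b t ∉ openSegment ℝ a b → a ∉ openSegment ℝ (pointAt a b s) (pointAt a b t) →
      b ∉ openSegment ℝ (pointAt a b s) (pointAt a b t) → s = 0 ∧ t = 1 := by
    intro s t hs ht h1 h2 h3 h4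
    have hs0 : s ≤ 0 := by
      by_contra h
      exact h1 (mem_openSegment_iff_pointAt.2 ⟨s, by linarith, by linarith, rfl⟩)
    have ht0 : 1 ≤ t := by
      by_contra h
      exact h2 (mem_openSegment_iff_pointAt.2 ⟨t, by linarith, by linarith, rfl⟩)
    constructor
    · by_contra h
      have := pointAt_mem_openSegment (a := a) (b := b) (lt_of_le_of_ne hs0 h)
        (show (0 : ℝ) < t by linarith)
      rw [pointAt_zero] at this
      exact h3 this
    · by_contra h
      have := pointAt_mem_openSegment (a := a) (b := b) (show s < (1 : ℝ) by linarith)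
        (lt_of_le_of_ne ht0 (Ne.symm h))
      rw [pointAt_one] at this
      exact h4 this
  rcases lt_trichotomy s t with h | h | h
  · obtain ⟨rfl, rfl⟩ := key s t (by nlinarith) (by nlinarith) hp' hq' ha' hb'
    exact Or.inl ⟨pointAt_zero _ _, pointAt_one _ _⟩
  · exfalso
    subst h
    apply hp'
    rw [mem_openSegment_iff_pointAt]
    exact ⟨s, by linarith, by linarith, rfl⟩
  · rw [openSegment_symm] at ha' hb'
    obtain ⟨rfl, rfl⟩ := key t s (by nlinarith) (by nlinarith) hq' hp' ha' hb'
    exact Or.inr ⟨pointAt_one _ _, pointAt_zero _ _⟩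

/-! ### Maximal noncrossing systems of segments -/

/-- A maximal system `F` of segments between points of `V` such that the segments contain no point
of `V` in their interiors and have disjoint interiors. -/
structure IsMaximalNoncrossing (V : Finset ℂ) (F : ℂ → ℂ → Prop) : Prop where
  mem : ∀ {a b}, F a b → a ∈ V
  symm : ∀ {a b}, F a b → F b a
  ne : ∀ {a b}, F a b → a ≠ b
  free : ∀ {a b z}, F a b → z ∈ openSegment ℝ a b → z ∉ V
  disj : ∀ {a b c d z}, F a b → F c d → z ∈ openSegment ℝ a b → z ∈ openSegment ℝ c d →
    (c = a ∧ d = b) ∨ (c = b ∧ d = a)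
  maximal : ∀ {a b}, a ∈ V → b ∈ V → a ≠ b → (∀ z ∈ openSegment ℝ a b, z ∉ V) →
    (∀ {c d z}, F c d → z ∈ openSegment ℝ a b → z ∈ openSegment ℝ c d → False) → F a b

namespace IsMaximalNoncrossing

variable {V : Finset ℂ} {F : ℂ → ℂ → Prop}

/-- In the triangle `b c a` with two sides in `F`, a segment of `F` that starts inside cannot leave
through these sides. -/
theorem stays_in_cone (h : IsMaximalNoncrossing V F) {a b c p q r : ℂ} (hbc : F b c) (hab : F a b)
    (hD : 0 < signedArea b c a) (hpq : F p q) (hr : r ∈ openSegment ℝ p q)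
    (h1 : 0 < signedArea b c r) (h2 : 0 < signedArea a b r) (h3 : 0 ≤ signedArea c a r)
    (h4 : 0 ≤ signedArea c a p) (h5 : 0 < signedArea c a r ∨ 0 < signedArea c a p) :
    0 ≤ signedArea b c p ∧ 0 ≤ signedArea a b p := by
  by_contra hcon
  obtain ⟨u, hu0, hu1, hur⟩ := mem_openSegment_iff_pointAt.1 hr
  -- points of the open segment from `r` to `p`
  have sub : ∀ t : ℝ, 0 < t → t < 1 → pointAt r p t ∈ openSegment ℝ p q := by
    intro t ht0 ht1
    rw [mem_openSegment_iff_pointAt]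
    refine ⟨u * (1 - t), by nlinarith, by nlinarith, ?_⟩
    rw [← hur]
    apply Complex.ext
    · simp only [pointAt_re]; ring
    · simp only [pointAt_im]; ring
  have pos3 : ∀ t : ℝ, 0 < t → t < 1 → 0 < signedArea c a (pointAt r p t) := by
    intro t ht0 ht1
    rw [signedArea_pointAt]
    rcases h5 with h5 | h5
    · have : 0 < (1 - t) * signedArea c a r := mul_pos (by linarith) h5
      nlinarith
    · have : 0 < t * signedArea c a p := mul_pos ht0 h5
      have : 0 ≤ (1 - t) * signedArea c a r := mul_nonneg (by linarith) h3
      linarith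
  -- The segment cannot meet the line `b c` while it is not yet beyond the line `a b`: the meeting
  -- point would be the vertex `b` or an interior point of the side `b c`.
  have bad1 : ∀ t : ℝ, 0 < t → t < 1 → signedArea b c (pointAt r p t) = 0 →
      0 ≤ signedArea a b (pointAt r p t) → False := by
    intro t ht0 ht1 e1 e2
    rcases e2.eq_or_lt with e2 | e2
    · have := eq_of_signedArea_eq_zero hD.ne' e1 e2.symm
      exact h.free hpq (sub t ht0 ht1) (this ▸ h.mem hbc)
    · have hz := mem_openSegment_of_signedArea hD e1 (pos3 t ht0 ht1) e2
      rcases h.disj hpq hbc (sub t ht0 ht1) hz with ⟨rfl, rfl⟩ | ⟨rfl, rfl⟩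
      · rw [← hur, signedArea_pointAt] at h1; simp at h1
      · rw [← hur, signedArea_pointAt] at h1; simp at h1
  have hD' : 0 < signedArea a b c := by rwa [← signedArea_cyc]
  have bad2 : ∀ t : ℝ, 0 < t → t < 1 → signedArea a b (pointAt r p t) = 0 →
      0 ≤ signedArea b c (pointAt r p t) → False := by
    intro t ht0 ht1 e1 e2
    rcases e2.eq_or_lt with e2 | e2
    · exact bad1 t ht0 ht1 e2.symm e1.ge
    · have hz := mem_openSegment_of_signedArea hD' e1 e2 (pos3 t ht0 ht1)
      rcases h.disj hpq hab (sub t ht0 ht1) hz with ⟨rfl, rfl⟩ | ⟨rfl, rfl⟩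
      · rw [← hur, signedArea_pointAt] at h2; simp at h2
      · rw [← hur, signedArea_pointAt] at h2; simp at h2
  set x := signedArea b c r with hx
  set x' := signedArea b c p with hx'
  set y := signedArea a b r with hy
  set y' := signedArea a b p with hy'
  have cross : ∀ {x x' : ℝ}, 0 < x → x' < 0 → 0 < x / (x - x') ∧ x / (x - x') < 1 ∧
      (1 - x / (x - x')) * x + x / (x - x') * x' = 0 := by
    intro x x' hx hx'
    have : 0 < x - x' := by linarith
    refine ⟨by positivity, by rw [div_lt_one this]; linarith, by field_simp; ring⟩
  -- The line reached first decides. If the segment is already beyond `a b` when it reaches `b c`,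
  -- then it has crossed `a b` earlier, and `bad2` applies there.
  by_cases hb1 : x' < 0
  · obtain ⟨c1, c2, c3⟩ := cross h1 hb1
    by_cases hb2 : 0 ≤ (1 - x / (x - x')) * y + x / (x - x') * y'
    · exact bad1 _ c1 c2 (by rw [signedArea_pointAt]; exact c3) (by rw [signedArea_pointAt]; exact hb2)
    · have hy0 : y' < 0 := by
        by_contra hy0
        apply hb2
        have : 0 ≤ (1 - x / (x - x')) * y := mul_nonneg (by linarith) h2.le
        have : 0 ≤ x / (x - x') * y' := mul_nonneg c1.le (by linarith)
        linarith
      obtain ⟨d1, d2, d3⟩ := cross h2 hy0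
      refine bad2 _ d1 d2 (by rw [signedArea_pointAt]; exact d3) ?_
      rw [signedArea_pointAt, ← hx, ← hx']
      have lt : y / (y - y') < x / (x - x') := by
        by_contra hle
        nlinarith
      nlinarith
  · have hb2 : y' < 0 := by
      by_contra hb2
      exact hcon ⟨by linarith, by linarith⟩
    obtain ⟨d1, d2, d3⟩ := cross h2 hb2
    refine bad2 _ d1 d2 (by rw [signedArea_pointAt]; exact d3) ?_
    rw [signedArea_pointAt, ← hx, ← hx']
    have : 0 ≤ (1 - y / (y - y')) * x := mul_nonneg (by linarith) h1.le
    have : 0 ≤ y / (y - y') * x' := mul_nonneg d1.le (by linarith)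
    linarith

/-- Two segments of `F` at `b` that are consecutive and enclose an angle less than `π` span an
empty triangle whose third side is in `F`. -/
theorem triangle_of_consecutive (h : IsMaximalNoncrossing V F) {a b c : ℂ} (hbc : F b c) (hab : F a b)
    (hD : 0 < signedArea b c a)
    (hcons : ∀ d, F b d → 0 < signedArea b c d → 0 < signedArea a b d → False) :
    F c a ∧ ∀ z ∈ V, 0 ≤ signedArea b c z → 0 ≤ signedArea c a z → 0 ≤ signedArea a b z →
      z = a ∨ z = b ∨ z = c := by
  have hD1 : 0 < signedArea a b c := by rwa [← signedArea_cyc]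
  have hD2 : 0 < signedArea c a b := by rwa [← signedArea_cyc]
  have noapex : ∀ {q r}, F b q → r ∈ openSegment ℝ b q → 0 < signedArea b c r →
      0 < signedArea a b r → False := by
    intro q r hq hr h1 h2
    obtain ⟨u, hu0, hu1, rfl⟩ := mem_openSegment_iff_pointAt.1 hr
    rw [signedArea_pointAt] at h1 h2
    simp only [signedArea_left, signedArea_right, mul_zero, zero_add] at h1 h2
    exact hcons q hq (pos_of_mul_pos_right h1 hu0.le) (pos_of_mul_pos_right h2 hu0.le)
  have empty : ∀ z ∈ V, 0 ≤ signedArea b c z → 0 ≤ signedArea c a z → 0 ≤ signedArea a b z →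
      z = a ∨ z = b ∨ z = c := by
    by_contra! hcon
    classical
    -- Among the superfluous points of `V` in the triangle take `y` farthest from the side `c a`.
    -- The segment from `b` to `y` turns out to be unobstructed, so by maximality it belongs to `F`,
    -- although it runs between two consecutive segments.
    obtain ⟨y, hy, hmin⟩ := Finset.exists_max_image (V.filter fun z => 0 ≤ signedArea b c z ∧
      0 ≤ signedArea c a z ∧ 0 ≤ signedArea a b z ∧ z ≠ a ∧ z ≠ b ∧ z ≠ c) (signedArea c a) (by
        obtain ⟨z, hz⟩ := hcon
        exact ⟨z, by simpa using hz⟩)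
    simp only [Finset.mem_filter] at hy hmin
    obtain ⟨hyV, y1, y2, y3, ya, yb, yc⟩ := hy
    have hyD : signedArea c a y < signedArea b c a := by
      have hs := signedArea_sum b c a y
      rcases y1.eq_or_lt with e1 | e1
      · rcases y3.eq_or_lt with e3 | e3
        · exact (yb (eq_of_signedArea_eq_zero hD.ne' e1.symm e3.symm)).elim
        · linarith
      · linarith
    have y1' : 0 < signedArea b c y := by
      refine lt_of_le_of_ne y1 fun e => ?_
      rcases y2.eq_or_lt with e2 | e2
      · exact yc (eq_of_signedArea_eq_zero (a := c) (b := a) (c := b) hD2.ne' e2.symm e.symm)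
      rcases y3.eq_or_lt with e3 | e3
      · exact yb (eq_of_signedArea_eq_zero hD.ne' e.symm e3.symm)
      · exact h.free hbc (mem_openSegment_of_signedArea hD e.symm e2 e3) hyV
    have y3' : 0 < signedArea a b y := by
      refine lt_of_le_of_ne y3 fun e => ?_
      rcases y2.eq_or_lt with e2 | e2
      · exact ya (eq_of_signedArea_eq_zero (a := a) (b := b) (c := c) hD1.ne' e.symm e2.symm)
      · exact h.free hab (mem_openSegment_of_signedArea hD1 e.symm y1' e2) hyV
    have onby : ∀ z ∈ openSegment ℝ b y, 0 < signedArea b c z ∧ 0 < signedArea a b z ∧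
        signedArea c a y < signedArea c a z := by
      intro z hz
      obtain ⟨t, ht0, ht1, rfl⟩ := mem_openSegment_iff_pointAt.1 hz
      simp only [signedArea_pointAt]
      simp only [signedArea_left, signedArea_right, mul_zero, zero_add]
      have e : signedArea c a b = signedArea b c a := by rw [signedArea_cyc, signedArea_cyc, signedArea_cyc]
      refine ⟨by positivity, by positivity, ?_⟩
      rw [e]
      nlinarith
    have hby : F b y := by
      apply h.maximal (h.mem hbc) hyV yb.symm
      · intro z hz hzV
        obtain ⟨z1, z2, z3⟩ := onby z hz
        have := hmin z ⟨hzV, z1.le, by linarith, z2.le, ?_, ?_, ?_⟩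
        · linarith
        · rintro rfl; simp at z2
        · rintro rfl; simp at z2
        · rintro rfl; simp at z1
      -- One end `p` of an obstructing segment is at least as far from `c a` as the obstructed
      -- point, hence farther than `y`. By `stays_in_cone` it lies in the triangle, so it is `b`,
      -- which `noapex` excludes, or a better choice than `y`.
      · have main : ∀ {p q z}, F p q → z ∈ openSegment ℝ b y → z ∈ openSegment ℝ p q →
            signedArea c a z ≤ signedArea c a p → False := by
          intro p q z hpq hz hz' hle
          obtain ⟨z1, z2, z3⟩ := onby z hz
          obtain ⟨p1, p2⟩ := h.stays_in_cone hbc hab hD hpq hz' z1 z2 (by linarith) (by linarith)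
            (Or.inl (by linarith))
          by_cases hpb : p = b
          · subst hpb
            exact noapex hpq hz' z1 z2
          · have := hmin p ⟨h.mem hpq, p1, by linarith, p2, ?_, hpb, ?_⟩
            · linarith
            · rintro rfl; simp at hle; linarith
            · rintro rfl; simp at hle; linarith
        intro p q z hpq hz hz'
        by_cases hle : signedArea c a z ≤ signedArea c a p
        · exact main hpq hz hz' hle
        · refine main (h.symm hpq) hz (by rwa [openSegment_symm]) ?_
          obtain ⟨t, ht0, ht1, rfl⟩ := mem_openSegment_iff_pointAt.1 hz'
          rw [signedArea_pointAt] at hle ⊢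
          nlinarith
    exact hcons y hby y1' y3'
  refine ⟨?_, empty⟩
  by_contra hca
  apply hca
  have onca : ∀ z ∈ openSegment ℝ c a, 0 < signedArea b c z ∧ 0 < signedArea a b z ∧
      signedArea c a z = 0 := by
    intro z hz
    obtain ⟨t, ht0, ht1, rfl⟩ := mem_openSegment_iff_pointAt.1 hz
    simp only [signedArea_pointAt]
    simp only [signedArea_left, signedArea_right, mul_zero, zero_add, add_zero]
    exact ⟨mul_pos ht0 hD, mul_pos (by linarith) hD1, trivial⟩
  have free : ∀ z ∈ openSegment ℝ c a, z ∉ V := by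
    intro z hz hzV
    obtain ⟨z1, z2, z3⟩ := onca z hz
    rcases empty z hzV z1.le z3.ge z2.le with rfl | rfl | rfl
    · simp at z2
    · simp at z2
    · simp at z1
  apply h.maximal (h.mem (h.symm hbc)) (h.mem hab) (by rintro rfl; simp at hD) free
  -- A segment crossing `c a` has an end on the inner side. That end lies in the empty triangle,
  -- hence is `b`, and no segment of `F` leaves `b` between the two given ones.
  have main : ∀ {p q z}, F p q → z ∈ openSegment ℝ c a → z ∈ openSegment ℝ p q →
      0 < signedArea c a p → False := by
    intro p q z hpq hz hz' hp
    obtain ⟨z1, z2, z3⟩ := onca z hz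
    obtain ⟨p1, p2⟩ := h.stays_in_cone hbc hab hD hpq hz' z1 z2 z3.ge hp.le (Or.inr hp)
    rcases empty p (h.mem hpq) p1 hp.le p2 with rfl | rfl | rfl
    · simp at hp
    · exact noapex hpq hz' z1 z2
    · simp at hp
  intro p q z hpq hz hz'
  rcases lt_trichotomy 0 (signedArea c a p) with hp | hp | hp
  · exact main hpq hz hz' hp
  · have hq : signedArea c a q = 0 := by
      have hz3 := (onca z hz).2.2
      obtain ⟨t, ht0, ht1, rfl⟩ := mem_openSegment_iff_pointAt.1 hz'
      rw [signedArea_pointAt, ← hp] at hz3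
      simpa [ht0.ne'] using hz3
    have := eq_of_collinear_overlap (by rintro rfl; simp at hD) hp.symm hq hz hz'
      (fun hh => free _ hh (h.mem hpq)) (fun hh => free _ hh (h.mem (h.symm hpq)))
      (fun hh => h.free hpq hh (h.mem (h.symm hbc))) (fun hh => h.free hpq hh (h.mem hab))
    rcases this with ⟨rfl, rfl⟩ | ⟨rfl, rfl⟩
    · exact hca hpq
    · exact hca (h.symm hpq)
  · refine main (h.symm hpq) hz (by rwa [openSegment_symm]) ?_
    have hz3 := (onca z hz).2.2
    obtain ⟨t, ht0, ht1, rfl⟩ := mem_openSegment_iff_pointAt.1 hz'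
    rw [signedArea_pointAt] at hz3
    nlinarith

end IsMaximalNoncrossing

namespace IsMaximalNoncrossing

variable {V : Finset ℂ} {F : ℂ → ℂ → Prop}

-- Let `c` be the point left of `a b` that is seen first from `a` when turning away from `b`. If `a
-- c` is not in `F`, it is crossed by segments of `F`. Let `p q` cross it nearest to `a`, in the
-- point `r`, with `q` on the left. In the triangle `a r q`, let `y` be the point of `V` seen first
-- from `a` when turning away from `r`. A segment obstructing `a y` would have to cross `a r` or `p
-- q`, or end at a point seen earlier. So `a y` is in `F` by maximality, and `y` is left of `a b`.
set_option maxHeartbeats 1000000 in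
theorem exists_left_neighbor (h : IsMaximalNoncrossing V F) {a b : ℂ} (hab : F a b)
    (hex : ∃ y ∈ V, 0 < signedArea a b y) : ∃ d, F a d ∧ 0 < signedArea a b d := by
  classical
  by_contra! hno
  -- a point of minimal angle at `a`, nearest to `a`
  obtain ⟨c, hcV, hc, hcmin, hctie⟩ : ∃ c ∈ V, 0 < signedArea a b c ∧
      (∀ y ∈ V, 0 < signedArea a b y → 0 ≤ signedArea a c y) ∧
      (∀ z ∈ openSegment ℝ a c, z ∉ V) := by
    -- `dt y / signedArea a b y` is the cotangent of the angle from `a b` to `a y`, so its maximum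
    -- gives the smallest angle. Ties are resolved by the distance from the line `a b`, which keeps
    -- the open segment `a c` free of points of `V`.
    let dt : ℂ → ℝ := fun y => (b.re - a.re) * (y.re - a.re) + (b.im - a.im) * (y.im - a.im)
    obtain ⟨c₀, hc₀, hmax⟩ := Finset.exists_max_image (V.filter fun y => 0 < signedArea a b y)
      (fun y => dt y / signedArea a b y) (by
        obtain ⟨y, hy⟩ := hex
        exact ⟨y, by simpa using hy⟩)
    obtain ⟨c, hc, hmin⟩ := Finset.exists_min_image (V.filter fun y => 0 < signedArea a b y ∧
      dt y / signedArea a b y = dt c₀ / signedArea a b c₀) (signedArea a b)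
        ⟨c₀, by simpa using hc₀⟩
    simp only [Finset.mem_filter] at hc₀ hmax hc hmin
    refine ⟨c, hc.1, hc.2.1, ?_, ?_⟩
    · intro y hyV hy
      have h1 := hmax y ⟨hyV, hy⟩
      rw [← hc.2.2, div_le_div_iff₀ hy hc.2.1] at h1
      have h2 : ((b.re - a.re) ^ 2 + (b.im - a.im) ^ 2) * signedArea a c y =
          dt c * signedArea a b y - dt y * signedArea a b c := by
        simp only [dt, signedArea]; ring
      have h3 : 0 < (b.re - a.re) ^ 2 + (b.im - a.im) ^ 2 := by
        by_contra h0
        apply h.ne hab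
        have e1 : b.re - a.re = 0 := by nlinarith [sq_nonneg (b.re - a.re), sq_nonneg (b.im - a.im)]
        have e2 : b.im - a.im = 0 := by nlinarith [sq_nonneg (b.re - a.re), sq_nonneg (b.im - a.im)]
        exact Complex.ext (by linarith) (by linarith)
      by_contra hneg
      nlinarith
    · intro z hz hzV
      obtain ⟨t, ht0, ht1, rfl⟩ := mem_openSegment_iff_pointAt.1 hz
      have e1 : signedArea a b (pointAt a c t) = t * signedArea a b c := by
        rw [signedArea_pointAt]; simp
      have e2 : dt (pointAt a c t) = t * dt c := by
        simp only [dt, pointAt_re, pointAt_im]; ring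
      have hpos : 0 < signedArea a b (pointAt a c t) := by rw [e1]; exact mul_pos ht0 hc.2.1
      have := hmin _ ⟨hzV, hpos, by rw [e1, e2, mul_div_mul_left _ _ ht0.ne', hc.2.2]⟩
      rw [e1] at this
      nlinarith [hc.2.1]
  have hac : a ≠ c := by rintro rfl; simp at hc
  have hFac : ¬ F a c := fun hF => (hno c hF).not_gt hc
  -- Obstructing segments cross transversally, since overlapping collinear segments would coincide.
  have noncol : ∀ {y}, y ∈ V → a ≠ y → ¬ F a y → (∀ z ∈ openSegment ℝ a y, z ∉ V) →
      ∀ {p q z}, F p q → z ∈ openSegment ℝ a y → z ∈ openSegment ℝ p q →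
      signedArea a y p ≠ 0 ∧ signedArea a y p * signedArea a y q < 0 := by
    intro y hyV hay hF hfree p q z hpq hz hz'
    have hz0 : signedArea a y z = 0 := by
      obtain ⟨t, -, -, rfl⟩ := mem_openSegment_iff_pointAt.1 hz
      rw [signedArea_pointAt]; simp
    obtain ⟨t, ht0, ht1, rfl⟩ := mem_openSegment_iff_pointAt.1 hz'
    rw [signedArea_pointAt] at hz0
    have hne : signedArea a y p ≠ 0 := by
      intro hp
      have hq : signedArea a y q = 0 := by
        rw [hp] at hz0; simpa [ht0.ne'] using hz0
      have := eq_of_collinear_overlap hay hp hq hz hz'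
        (fun hh => hfree _ hh (h.mem hpq)) (fun hh => hfree _ hh (h.mem (h.symm hpq)))
        (fun hh => h.free hpq hh (h.mem hab)) (fun hh => h.free hpq hh hyV)
      rcases this with ⟨rfl, rfl⟩ | ⟨rfl, rfl⟩
      · exact hF hpq
      · exact hF (h.symm hpq)
    refine ⟨hne, ?_⟩
    have h1 : 0 < signedArea a y p ^ 2 := by positivity
    have h2 : t * (signedArea a y p * signedArea a y q) = -(1 - t) * signedArea a y p ^ 2 := by
      linear_combination signedArea a y p * hz0
    by_contra h3
    nlinarith
  -- the segment of `F` crossing `a c` nearest to `a`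
  let T : Set ℝ := {t | 0 < t ∧ t < 1 ∧ ∃ p q, F p q ∧ pointAt a c t ∈ openSegment ℝ p q}
  have hTfin : T.Finite := by
    -- The crossing parameter is determined by the ends `p` and `q`: it is the zero of the affine
    -- function `signedArea p q` along `a c`.
    refine ((V ×ˢ V).image fun pq : ℂ × ℂ => signedArea pq.1 pq.2 a /
      (signedArea pq.1 pq.2 a - signedArea pq.1 pq.2 c)).finite_toSet.subset ?_
    rintro t ⟨ht0, ht1, p, q, hpq, hz⟩
    simp only [Finset.coe_image, Set.mem_image, Finset.mem_coe, Finset.mem_product]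
    refine ⟨(p, q), ⟨h.mem hpq, h.mem (h.symm hpq)⟩, ?_⟩
    have hn := noncol hcV hac hFac hctie hpq (mem_openSegment_iff_pointAt.2 ⟨t, ht0, ht1, rfl⟩) hz
    have h0 : signedArea p q (pointAt a c t) = 0 := by
      obtain ⟨s, -, -, hs⟩ := mem_openSegment_iff_pointAt.1 hz
      rw [← hs, signedArea_pointAt]; simp
    rw [signedArea_pointAt] at h0
    have hd : signedArea p q a - signedArea p q c ≠ 0 := by
      have e : signedArea p q a - signedArea p q c = signedArea a c q - signedArea a c p := by
        simp only [signedArea]; ring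
      rw [e]
      intro e0
      have : signedArea a c p = signedArea a c q := by linarith
      rw [← this] at hn
      nlinarith [hn.2, mul_self_nonneg (signedArea a c p)]
    rw [div_eq_iff hd]
    linarith
  have hTne : T.Nonempty := by
    by_contra hT
    apply hFac
    apply h.maximal (h.mem hab) hcV hac hctie
    intro p q z hpq hz hz'
    obtain ⟨t, ht0, ht1, rfl⟩ := mem_openSegment_iff_pointAt.1 hz
    exact hT ⟨t, ht0, ht1, p, q, hpq, hz'⟩
  obtain ⟨t, ⟨ht0, ht1, p', q', hpq', hr'⟩, htmin⟩ := Set.exists_min_image T id hTfin hTne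
  simp only [id] at htmin
  set r := pointAt a c t with hrdef
  have hrac : r ∈ openSegment ℝ a c := mem_openSegment_iff_pointAt.2 ⟨t, ht0, ht1, rfl⟩
  have hrV : r ∉ V := hctie _ hrac
  obtain ⟨p, q, hpq, hr, hp, hq⟩ : ∃ p q, F p q ∧ r ∈ openSegment ℝ p q ∧ signedArea a c p < 0 ∧
      0 < signedArea a c q := by
    obtain ⟨n1, n2⟩ := noncol hcV hac hFac hctie hpq' hrac hr'
    rcases lt_or_gt_of_ne n1 with n1 | n1
    · exact ⟨p', q', hpq', hr', n1, by nlinarith⟩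
    · exact ⟨q', p', h.symm hpq', by rwa [openSegment_symm], by nlinarith, n1⟩
  have hr_left : 0 < signedArea a b r := by
    rw [hrdef, signedArea_pointAt]; simp; positivity
  -- No point of `V` left of `a b` is seen before `c`, so `p` is not left of `a b`. As `r` is left
  -- of it, `q` must be as well.
  have hp_left : signedArea a b p ≤ 0 := by
    by_contra hpos
    exact (hcmin p (h.mem hpq) (by linarith)).not_gt hp
  have hq_left : 0 < signedArea a b q := by
    obtain ⟨s, hs0, hs1, hs⟩ := mem_openSegment_iff_pointAt.1 hr
    rw [← hs, signedArea_pointAt] at hr_left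
    by_contra hneg
    nlinarith
  have hD : 0 < signedArea a r q := by
    have : signedArea a r q = t * signedArea a c q := by
      simp only [hrdef, signedArea, pointAt_re, pointAt_im]; ring
    rw [this]; positivity
  have hD' : 0 < signedArea r q a := by rwa [signedArea_cyc]
  have hD'' : 0 < signedArea q a r := by rwa [signedArea_cyc]
  -- a point of the triangle `a r q` of minimal angle with `a r`
  have pos_of : ∀ z, 0 ≤ signedArea a r z → 0 ≤ signedArea q a z → z ≠ a →
      0 < signedArea a r z + signedArea q a z := by
    intro z z1 z3 hza
    by_contra hneg
    exact hza (eq_of_signedArea_eq_zero hD.ne' (by linarith) (by linarith))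
  have side1 : ∀ z, signedArea a r z = 0 → 0 < signedArea q a z → 0 ≤ signedArea r q z →
      ∃ s, 0 < s ∧ s ≤ t ∧ z = pointAt a c s := by
    intro z z1 z3 z2
    rcases z2.eq_or_lt with z2 | z2
    · exact ⟨t, ht0, le_rfl, eq_of_signedArea_eq_zero hD'.ne' z2.symm z1⟩
    · have := mem_openSegment_of_signedArea hD z1 z2 z3
      obtain ⟨s, hs0, hs1, rfl⟩ := mem_openSegment_iff_pointAt.1 this
      refine ⟨t * s, by positivity, by nlinarith, ?_⟩
      apply Complex.ext
      · simp only [hrdef, pointAt_re]; ring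
      · simp only [hrdef, pointAt_im]; ring
  obtain ⟨y, hyV, y1, y2, y3, hya, hyfree, hymin⟩ : ∃ y ∈ V, 0 < signedArea a r y ∧
      0 ≤ signedArea r q y ∧ 0 ≤ signedArea q a y ∧ y ≠ a ∧ (∀ z ∈ openSegment ℝ a y, z ∉ V) ∧
      ∀ z ∈ V, 0 ≤ signedArea a r z → 0 ≤ signedArea r q z → 0 ≤ signedArea q a z → z ≠ a →
        signedArea a r y * signedArea q a z ≤ signedArea a r z * signedArea q a y := by
    let S := V.filter fun z => 0 ≤ signedArea a r z ∧ 0 ≤ signedArea r q z ∧ 0 ≤ signedArea q a z ∧ z ≠ a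
    -- Inside the triangle `a r q`, `g` increases from 0 on the ray `a r` to 1 on the ray `a q` and
    -- is constant on rays from `a`. The second minimum selects the point nearest to `a` on the
    -- first ray that contains points of `V`.
    let g : ℂ → ℝ := fun z => signedArea a r z / (signedArea a r z + signedArea q a z)
    have hqS : q ∈ S := by
      simp only [S, Finset.mem_filter]
      refine ⟨h.mem (h.symm hpq), hD.le, by simp, by simp, ?_⟩
      rintro rfl
      simp at hD
    obtain ⟨y₀, hy₀, hmin⟩ := Finset.exists_min_image S g ⟨q, hqS⟩
    obtain ⟨y, hy, hmin'⟩ := Finset.exists_min_image (S.filter fun z => g z = g y₀)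
      (fun z => signedArea a r z + signedArea q a z) ⟨y₀, by simpa using hy₀⟩
    simp only [S, Finset.mem_filter] at hy hmin hmin'
    obtain ⟨⟨hyV, y1, y2, y3, hya⟩, hgy⟩ := hy
    have hpos := pos_of y y1 y3 hya
    have y1' : 0 < signedArea a r y := by
      refine lt_of_le_of_ne y1 fun e => ?_
      obtain ⟨s, hs0, hs1, rfl⟩ := side1 y e.symm (by linarith) y2
      exact hctie _ (mem_openSegment_iff_pointAt.2 ⟨s, hs0, by linarith, rfl⟩) hyV
    refine ⟨y, hyV, y1', y2, y3, hya, ?_, ?_⟩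
    · intro z hz hzV
      obtain ⟨s, hs0, hs1, rfl⟩ := mem_openSegment_iff_pointAt.1 hz
      have e1 : signedArea a r (pointAt a y s) = s * signedArea a r y := by
        rw [signedArea_pointAt]; simp
      have e3 : signedArea q a (pointAt a y s) = s * signedArea q a y := by
        rw [signedArea_pointAt]; simp
      have := hmin' (pointAt a y s) ⟨⟨hzV, by rw [e1]; positivity, ?_, by rw [e3]; positivity, ?_⟩, ?_⟩
      · rw [e1, e3] at this
        nlinarith
      · rw [signedArea_pointAt]
        have : 0 ≤ (1 - s) * signedArea r q a := mul_nonneg (by linarith) hD'.le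
        have : 0 ≤ s * signedArea r q y := by positivity
        linarith
      · intro e
        rw [e] at e1
        simp only [signedArea_left] at e1
        have := mul_pos hs0 y1'
        linarith
      · rw [← hgy]
        simp only [g, e1, e3, ← mul_add]
        rw [mul_div_mul_left _ _ hs0.ne']
    · intro z hzV z1 z2 z3 hza
      have h1 := hmin z ⟨hzV, z1, z2, z3, hza⟩
      rw [← hgy] at h1
      simp only [g] at h1
      rw [div_le_div_iff₀ hpos (pos_of z z1 z3 hza)] at h1
      linarith
  have hyb : 0 < signedArea a b y := by
    have e : signedArea a r q * signedArea a b y =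
        signedArea q a y * signedArea a b r + signedArea a r y * signedArea a b q := by
      simp only [signedArea]; ring
    have h1 : 0 < signedArea a r y * signedArea a b q := by positivity
    have h2 : 0 ≤ signedArea q a y * signedArea a b r := by positivity
    by_contra hneg
    nlinarith
  have hFay : ¬ F a y := fun hF => (hno y hF).not_gt hyb
  apply hFay
  apply h.maximal (h.mem hab) hyV hya.symm hyfree
  have main : ∀ {u w z}, F u w → z ∈ openSegment ℝ a y → z ∈ openSegment ℝ u w →
      signedArea a y u < 0 → False := by
    intro u w z huw hz hz' hu
    have turn : ∀ x, signedArea a r q * signedArea a y x =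
        signedArea q a y * signedArea a r x - signedArea a r y * signedArea q a x := by
      intro x; simp only [signedArea]; ring
    obtain ⟨s, hs0, hs1, hs⟩ := mem_openSegment_iff_pointAt.1 hz
    have z1 : 0 < signedArea a r z := by
      rw [← hs, signedArea_pointAt]; simp; positivity
    have z3 : 0 ≤ signedArea q a z := by
      rw [← hs, signedArea_pointAt]; simp; positivity
    have z2 : 0 < signedArea r q z := by
      rw [← hs, signedArea_pointAt]
      have : 0 < (1 - s) * signedArea r q a := mul_pos (by linarith) hD'
      have : 0 ≤ s * signedArea r q y := by positivity
      linarith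
    have zy : signedArea a y z = 0 := by
      rw [← hs, signedArea_pointAt]; simp
    have huturn : signedArea q a y * signedArea a r u < signedArea a r y * signedArea q a u := by
      have := turn u
      nlinarith
    obtain ⟨v, hv0, hv1, hv⟩ := mem_openSegment_iff_pointAt.1 hz'
    have sub : ∀ t : ℝ, 0 < t → t < 1 → pointAt z u t ∈ openSegment ℝ u w := by
      intro t ht0 ht1
      rw [mem_openSegment_iff_pointAt]
      refine ⟨v * (1 - t), by nlinarith, by nlinarith, ?_⟩
      rw [← hv]
      apply Complex.ext
      · simp only [pointAt_re]; ring
      · simp only [pointAt_im]; ring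
    have notpq : ∀ {x}, x ∈ openSegment ℝ u w → x ∈ openSegment ℝ p q → False := by
      intro x hx hx'
      have hz0 : signedArea r q z = 0 := by
        have hrp : signedArea r q p = 0 := by
          obtain ⟨s, hs0, hs1, hs⟩ := mem_openSegment_iff_pointAt.1 hr
          rw [← hs]
          simp only [signedArea, pointAt_re, pointAt_im]; ring
        rcases h.disj hpq huw hx' hx with ⟨rfl, rfl⟩ | ⟨rfl, rfl⟩
        · rw [← hv, signedArea_pointAt, hrp]; simp
        · rw [← hv, signedArea_pointAt, hrp]; simp
      linarith
    -- the exit point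
    have exit : ∀ t : ℝ, 0 < t → t < 1 → 0 ≤ signedArea a r (pointAt z u t) →
        0 ≤ signedArea r q (pointAt z u t) →
        (signedArea a r (pointAt z u t) = 0 ∨ signedArea r q (pointAt z u t) = 0) → False := by
      intro s hs0 hs1 e1 e2 e12
      have hx := sub s hs0 hs1
      set x := pointAt z u s with hxdef
      have e3 : 0 < signedArea q a x := by
        have h1 : signedArea a y x < 0 := by
          rw [hxdef, signedArea_pointAt, zy]; nlinarith
        have := turn x
        have h2 : 0 ≤ signedArea q a y * signedArea a r x := by positivity
        by_contra hneg
        nlinarith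
      rcases e1.eq_or_lt with e1' | e1'
      · obtain ⟨s', hs0', hs1', hx'⟩ := side1 x e1'.symm e3 e2
        have := htmin s' ⟨hs0', by linarith, u, w, huw, hx' ▸ hx⟩
        have : s' = t := by linarith
        rw [this] at hx'
        exact notpq hx (hx' ▸ hr)
      · have e2' : signedArea r q x = 0 := e12.resolve_left e1'.ne'
        have hx' := mem_openSegment_of_signedArea hD' e2' e3 e1'
        obtain ⟨s', hs0', hs1', hs'⟩ := mem_openSegment_iff_pointAt.1 hx'
        obtain ⟨v', hv0', hv1', hv'⟩ := mem_openSegment_iff_pointAt.1 hr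
        refine notpq hx ?_
        rw [mem_openSegment_iff_pointAt]
        refine ⟨v' + s' * (1 - v'), by nlinarith, by nlinarith, ?_⟩
        rw [← hs', ← hv']
        apply Complex.ext
        · simp only [pointAt_re]; ring
        · simp only [pointAt_im]; ring
    set A := signedArea a r z with hA
    set A' := signedArea a r u with hA'
    set B := signedArea r q z with hB
    set B' := signedArea r q u with hB'
    have cross : ∀ {x x' : ℝ}, 0 < x → x' < 0 → 0 < x / (x - x') ∧ x / (x - x') < 1 ∧
        (1 - x / (x - x')) * x + x / (x - x') * x' = 0 := by
      intro x x' hx hx'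
      have : 0 < x - x' := by linarith
      refine ⟨by positivity, by rw [div_lt_one this]; linarith, by field_simp; ring⟩
    -- If `u` is beyond the line `a r` or `r q`, the line that is reached first provides an exit
    -- point. Otherwise `u` lies in the triangle and is seen before `y`.
    by_cases hb1 : A' < 0
    · obtain ⟨c1, c2, c3⟩ := cross z1 hb1
      by_cases hb2 : 0 ≤ (1 - A / (A - A')) * B + A / (A - A') * B'
      · exact exit _ c1 c2 (by rw [signedArea_pointAt]; exact c3.ge) (by rw [signedArea_pointAt]; exact hb2)
          (Or.inl (by rw [signedArea_pointAt]; exact c3))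
      · have hy0 : B' < 0 := by
          by_contra hy0
          apply hb2
          have : 0 ≤ (1 - A / (A - A')) * B := mul_nonneg (by linarith) z2.le
          have : 0 ≤ A / (A - A') * B' := mul_nonneg c1.le (by linarith)
          linarith
        obtain ⟨d1, d2, d3⟩ := cross z2 hy0
        refine exit _ d1 d2 ?_ (by rw [signedArea_pointAt]; exact d3.ge)
          (Or.inr (by rw [signedArea_pointAt]; exact d3))
        rw [signedArea_pointAt, ← hA, ← hA']
        have lt : B / (B - B') < A / (A - A') := by
          by_contra hle
          nlinarith
        nlinarith
    · by_cases hb2 : B' < 0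
      · obtain ⟨d1, d2, d3⟩ := cross z2 hb2
        refine exit _ d1 d2 ?_ (by rw [signedArea_pointAt]; exact d3.ge)
          (Or.inr (by rw [signedArea_pointAt]; exact d3))
        rw [signedArea_pointAt, ← hA, ← hA']
        have : 0 ≤ (1 - B / (B - B')) * A := mul_nonneg (by linarith) z1.le
        have : 0 ≤ B / (B - B') * A' := mul_nonneg d1.le (by linarith)
        linarith
      · have h3 : 0 < signedArea q a u := by
          have : 0 ≤ signedArea q a y * A' := mul_nonneg y3 (by linarith)
          by_contra hneg
          nlinarith
        have := hymin u (h.mem huw) (by linarith) (by linarith) h3.le (by rintro rfl; simp at hu)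
        linarith
  intro u w z huw hz hz'
  obtain ⟨n1, n2⟩ := noncol hyV hya.symm hFay hyfree huw hz hz'
  rcases lt_or_gt_of_ne n1 with n1 | n1
  · exact main huw hz hz' n1
  · exact main (h.symm huw) hz (by rwa [openSegment_symm]) (by nlinarith)

end IsMaximalNoncrossing

/-! ### Empty triangles of a maximal system -/

theorem exists_min_angle {S : Finset ℂ} {a b : ℂ} (hS : S.Nonempty)
    (hpos : ∀ y ∈ S, 0 < signedArea a b y) : ∃ c ∈ S, ∀ y ∈ S, 0 ≤ signedArea a c y := by
  -- The quotient by the area is the cotangent of the angle at `a`, so a maximal quotient means a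
  -- minimal angle.
  let dt : ℂ → ℝ := fun y => (b.re - a.re) * (y.re - a.re) + (b.im - a.im) * (y.im - a.im)
  obtain ⟨c, hc, hmax⟩ := Finset.exists_max_image S (fun y => dt y / signedArea a b y) hS
  refine ⟨c, hc, fun y hy => ?_⟩
  have hcp := hpos c hc
  have hyp := hpos y hy
  have h1 := hmax y hy
  rw [div_le_div_iff₀ hyp hcp] at h1
  have h2 : ((b.re - a.re) ^ 2 + (b.im - a.im) ^ 2) * signedArea a c y =
      dt c * signedArea a b y - dt y * signedArea a b c := by
    simp only [dt, signedArea]; ring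
  have h3 : 0 < (b.re - a.re) ^ 2 + (b.im - a.im) ^ 2 := by
    by_contra h0
    have e1 : b.re - a.re = 0 := by nlinarith [sq_nonneg (b.re - a.re), sq_nonneg (b.im - a.im)]
    have e2 : b.im - a.im = 0 := by nlinarith [sq_nonneg (b.re - a.re), sq_nonneg (b.im - a.im)]
    simp only [signedArea, e1, e2] at hcp
    linarith
  by_contra hneg
  nlinarith

theorem mem_segment_of_signedArea {a b c z : ℂ} (h : 0 < signedArea a b c)
    (h1 : signedArea a b z = 0) (h2 : 0 ≤ signedArea b c z) (h3 : 0 ≤ signedArea c a z) :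
    z = a ∨ z = b ∨ z ∈ openSegment ℝ a b := by
  rcases h2.eq_or_lt with h2 | h2
  · exact Or.inr (Or.inl (eq_of_signedArea_eq_zero (a := b) (b := c) (c := a)
      (by rw [signedArea_cyc]; exact h.ne') h2.symm h1))
  · rcases h3.eq_or_lt with h3 | h3
    · exact Or.inl (eq_of_signedArea_eq_zero h.ne' h1 h3.symm)
    · exact Or.inr (Or.inr (mem_openSegment_of_signedArea h h1 h2 h3))

theorem mem_convexHull_triangle_iff {a b c z : ℂ} (h : 0 < signedArea a b c) :
    z ∈ convexHull ℝ {a, b, c} ↔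
      0 ≤ signedArea a b z ∧ 0 ≤ signedArea b c z ∧ 0 ≤ signedArea c a z := by
  constructor
  · have hconv : ∀ p q : ℂ, Convex ℝ {z | 0 ≤ signedArea p q z} := by
      intro p q x hx y hy s t hs ht hst
      simp only [Set.mem_ofPred_eq] at *
      have : signedArea p q (s • x + t • y) = s * signedArea p q x + t * signedArea p q y := by
        simp only [signedArea, Complex.add_re, Complex.add_im, Complex.real_smul, Complex.mul_re,
          Complex.mul_im, Complex.ofReal_re, Complex.ofReal_im]
        obtain rfl : s = 1 - t := by linarith
        ring
      rw [this]; positivity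
    intro hz
    have hb : 0 < signedArea b c a := by rwa [signedArea_cyc]
    have hc : 0 < signedArea c a b := by rwa [signedArea_cyc]
    refine ⟨convexHull_min ?_ (hconv a b) hz, convexHull_min ?_ (hconv b c) hz,
      convexHull_min ?_ (hconv c a) hz⟩
    all_goals
      intro x hx
      simp only [Set.mem_insert_iff, Set.mem_singleton_iff] at hx
      rcases hx with rfl | rfl | rfl <;> simp [h.le, hb.le, hc.le]
  · rintro ⟨h1, h2, h3⟩
    rw [convexHull_insert (by simp), convexHull_pair, mem_convexJoin]
    by_cases h0 : signedArea b c z = signedArea a b c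
    · have hs := signedArea_sum a b c z
      have : z = a := eq_of_signedArea_eq_zero h.ne' (by linarith) (by linarith)
      subst this
      exact ⟨z, rfl, b, left_mem_segment _ _ _, left_mem_segment _ _ _⟩
    · have hs := signedArea_sum a b c z
      have hlt : 0 < signedArea a b c - signedArea b c z := by
        have : signedArea b c z ≤ signedArea a b c := by linarith
        have := lt_of_le_of_ne this h0
        linarith
      -- The point where the ray from `a` through `z` meets the opposite side.
      refine ⟨a, rfl, pointAt b c (signedArea a b z / (signedArea a b c - signedArea b c z)), ?_, ?_⟩
      · rw [mem_segment_iff_pointAt]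
        exact ⟨_, by positivity, by rw [div_le_one hlt]; linarith, rfl⟩
      · rw [mem_segment_iff_pointAt]
        refine ⟨(signedArea a b c - signedArea b c z) / signedArea a b c, by positivity, ?_, ?_⟩
        · rw [div_le_one h]; linarith
        · have e1 := signedArea_re a b c z
          have e2 := signedArea_im a b c z
          have e3 : signedArea c a z = signedArea a b c - signedArea b c z - signedArea a b z := by linarith
          rw [e3] at e1 e2
          have := hlt.ne'
          apply Complex.ext
          · simp only [pointAt_re]; field_simp; linarith
          · simp only [pointAt_im]; field_simp; linarith

/-- A segment that leaves a closed triangle meets its boundary. -/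
theorem exists_exit {a b c z p : ℂ} (h1 : 0 ≤ signedArea a b z) (h2 : 0 ≤ signedArea b c z)
    (h3 : 0 ≤ signedArea c a z)
    (hp : ¬ (0 ≤ signedArea a b p ∧ 0 ≤ signedArea b c p ∧ 0 ≤ signedArea c a p)) :
    ∃ t : ℝ, 0 ≤ t ∧ t < 1 ∧ 0 ≤ signedArea a b (pointAt z p t) ∧
      0 ≤ signedArea b c (pointAt z p t) ∧ 0 ≤ signedArea c a (pointAt z p t) ∧
      (signedArea a b (pointAt z p t) = 0 ∨ signedArea b c (pointAt z p t) = 0 ∨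
        signedArea c a (pointAt z p t) = 0) := by
  -- The minimum of the three areas is nonnegative exactly on the closed triangle, so it has a zero
  -- along a segment that leaves.
  let m : ℝ → ℝ := fun t => min (signedArea a b (pointAt z p t))
    (min (signedArea b c (pointAt z p t)) (signedArea c a (pointAt z p t)))
  have hm : Continuous m := by
    simp only [m, signedArea_pointAt]
    fun_prop
  have hm0 : 0 ≤ m 0 := by simp [m, pointAt_zero, h1, h2, h3]
  have hm1 : m 1 < 0 := by
    simp only [m, pointAt_one, min_lt_iff]
    by_contra! hcon
    exact hp ⟨hcon.1, hcon.2.1, hcon.2.2⟩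
  obtain ⟨t, ⟨ht0, ht1⟩, ht⟩ := intermediate_value_Icc' (zero_le_one' ℝ) hm.continuousOn ⟨hm1.le, hm0⟩
  have ht1' : t < 1 := lt_of_le_of_ne ht1 (by rintro rfl; linarith)
  have g1 : 0 ≤ signedArea a b (pointAt z p t) := ht ▸ min_le_left _ _
  have g2 : 0 ≤ signedArea b c (pointAt z p t) := ht ▸ (min_le_right _ _).trans (min_le_left _ _)
  have g3 : 0 ≤ signedArea c a (pointAt z p t) := ht ▸ (min_le_right _ _).trans (min_le_right _ _)
  refine ⟨t, ht0, ht1', g1, g2, g3, ?_⟩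
  by_contra! hcon
  have : 0 < m t := by
    simp only [m, lt_min_iff]
    exact ⟨lt_of_le_of_ne g1 (Ne.symm hcon.1), lt_of_le_of_ne g2 (Ne.symm hcon.2.1),
      lt_of_le_of_ne g3 (Ne.symm hcon.2.2)⟩
  linarith

/-- The triangle `a b c`, counterclockwise, has its sides in `F` and contains no further point of
`V`. -/
structure IsEmptyTriangle (V : Finset ℂ) (F : ℂ → ℂ → Prop) (a b c : ℂ) : Prop where
  ab : F a b
  bc : F b c
  ca : F c a
  pos : 0 < signedArea a b c
  empty : ∀ z ∈ V, 0 ≤ signedArea a b z → 0 ≤ signedArea b c z → 0 ≤ signedArea c a z →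
    z = a ∨ z = b ∨ z = c

theorem IsEmptyTriangle.rotate {V : Finset ℂ} {F : ℂ → ℂ → Prop} {a b c : ℂ}
    (h : IsEmptyTriangle V F a b c) : IsEmptyTriangle V F b c a where
  ab := h.bc
  bc := h.ca
  ca := h.ab
  pos := by rw [signedArea_cyc]; exact h.pos
  empty z hz h1 h2 h3 := by
    rcases h.empty z hz h3 h1 h2 with h | h | h <;> simp [h]

/-- The point `z` lies in the interior of the triangle `a b c`. -/
def InsideTriangle (a b c z : ℂ) : Prop :=
  0 < signedArea a b z ∧ 0 < signedArea b c z ∧ 0 < signedArea c a z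

theorem InsideTriangle.rotate {a b c z : ℂ} (h : InsideTriangle a b c z) : InsideTriangle b c a z :=
  ⟨h.2.1, h.2.2, h.1⟩

namespace IsMaximalNoncrossing

variable {V : Finset ℂ} {F : ℂ → ℂ → Prop}

/-- The first neighbour of `a` met when turning counterclockwise from `b` encloses with `b` an angle
free of further segments at `a`, so `triangle_of_consecutive` applies at the corner `a`. -/
theorem exists_emptyTriangle (h : IsMaximalNoncrossing V F) {a b : ℂ} (hab : F a b)
    (hex : ∃ y ∈ V, 0 < signedArea a b y) : ∃ c, IsEmptyTriangle V F a b c := by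
  classical
  obtain ⟨d₀, h1, h2⟩ := h.exists_left_neighbor hab hex
  obtain ⟨d, hd, hmin⟩ := exists_min_angle (S := V.filter fun y => F a y ∧ 0 < signedArea a b y)
    (a := a) (b := b) ⟨d₀, by simpa using ⟨h.mem (h.symm h1), h1, h2⟩⟩
    (by intro y hy; simp only [Finset.mem_filter] at hy; exact hy.2.2)
  simp only [Finset.mem_filter] at hd hmin
  obtain ⟨k1, k2⟩ := h.triangle_of_consecutive hab (h.symm hd.2.1) hd.2.2 (by
    intro e he e1 e2
    have := hmin e ⟨h.mem (h.symm he), he, e1⟩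
    rw [signedArea_swap] at e2
    linarith)
  exact ⟨d, hab, k1, h.symm hd.2.1, hd.2.2, fun z hz z1 z2 z3 => by
    rcases k2 z hz z1 z2 z3 with h | h | h <;> simp [h]⟩

theorem eq_or_mem_side (h : IsMaximalNoncrossing V F) {a b c z : ℂ} (ht : IsEmptyTriangle V F a b c)
    (h1 : 0 ≤ signedArea a b z) (h2 : 0 ≤ signedArea b c z) (h3 : 0 ≤ signedArea c a z)
    (h0 : signedArea a b z = 0 ∨ signedArea b c z = 0 ∨ signedArea c a z = 0) :
    z ∈ V ∨ z ∈ openSegment ℝ a b ∨ z ∈ openSegment ℝ b c ∨ z ∈ openSegment ℝ c a := by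
  have ha := h.mem ht.ab
  have hb := h.mem ht.bc
  have hc := h.mem ht.ca
  rcases h0 with h0 | h0 | h0
  · rcases mem_segment_of_signedArea ht.pos h0 h2 h3 with rfl | rfl | k
    exacts [Or.inl ha, Or.inl hb, Or.inr (Or.inl k)]
  · rcases mem_segment_of_signedArea ht.rotate.pos h0 h3 h1 with rfl | rfl | k
    exacts [Or.inl hb, Or.inl hc, Or.inr (Or.inr (Or.inl k))]
  · rcases mem_segment_of_signedArea ht.rotate.rotate.pos h0 h1 h2 with rfl | rfl | k
    exacts [Or.inl hc, Or.inl ha, Or.inr (Or.inr (Or.inr k))]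

theorem not_inside_of_mem (ht : IsEmptyTriangle V F a b c) {z : ℂ} (hz : z ∈ V) :
    ¬ InsideTriangle a b c z := by
  rintro ⟨h1, h2, h3⟩
  rcases ht.empty z hz h1.le h2.le h3.le with rfl | rfl | rfl
  · simp at h1
  · simp at h1
  · simp at h2

/-- An open segment of the system avoids the interiors of the empty triangles. -/
theorem not_inside (h : IsMaximalNoncrossing V F) {a b c p q z : ℂ} (ht : IsEmptyTriangle V F a b c)
    (hpq : F p q) (hz : z ∈ openSegment ℝ p q) : ¬ InsideTriangle a b c z := by
  intro hin
  have side0 : ∀ {a b z}, z ∈ openSegment ℝ a b → signedArea a b z = 0 := by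
    intro a b z hz
    obtain ⟨t, -, -, rfl⟩ := mem_openSegment_iff_pointAt.1 hz
    rw [signedArea_pointAt]; simp
  have noside : ∀ {a b c}, InsideTriangle a b c z → F a b → ∀ {p q x}, F p q → z ∈ openSegment ℝ p q →
      x ∈ openSegment ℝ p q → x ∈ openSegment ℝ a b → False := by
    intro a b c hin hab p q x hpq hz hx hx'
    have h1 := hin.1
    rcases h.disj hab hpq hx' hx with ⟨rfl, rfl⟩ | ⟨rfl, rfl⟩
    · rw [side0 hz] at h1; exact h1.false
    · rw [openSegment_symm] at hz
      rw [side0 hz] at h1; exact h1.false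
  -- Both ends must be corners, since otherwise the segment would leave the triangle through a point
  -- of `V` or through a side. A segment between two corners is a side and contains no interior
  -- point.
  have vertex : ∀ {p q}, F p q → z ∈ openSegment ℝ p q → p = a ∨ p = b ∨ p = c := by
    intro p q hpq hz
    by_contra hp
    have hp' : ¬ (0 ≤ signedArea a b p ∧ 0 ≤ signedArea b c p ∧ 0 ≤ signedArea c a p) := fun hh =>
      hp (ht.empty p (h.mem hpq) hh.1 hh.2.1 hh.2.2)
    obtain ⟨t, ht0, ht1, e1, e2, e3, e⟩ := exists_exit hin.1.le hin.2.1.le hin.2.2.le hp'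
    have hx : pointAt z p t ∈ openSegment ℝ p q := by
      obtain ⟨u, hu0, hu1, rfl⟩ := mem_openSegment_iff_pointAt.1 hz
      rw [mem_openSegment_iff_pointAt]
      refine ⟨u * (1 - t), by nlinarith, by nlinarith, ?_⟩
      apply Complex.ext
      · simp only [pointAt_re]; ring
      · simp only [pointAt_im]; ring
    rcases h.eq_or_mem_side ht e1 e2 e3 e with k | k | k | k
    · exact h.free hpq hx k
    · exact noside hin ht.ab hpq hz hx k
    · exact noside hin.rotate ht.bc hpq hz hx k
    · exact noside hin.rotate.rotate ht.ca hpq hz hx k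
  have hp := vertex hpq hz
  have hq := vertex (h.symm hpq) (by rwa [openSegment_symm])
  have hne := h.ne hpq
  obtain ⟨h1, h2, h3⟩ := hin
  rcases hp with rfl | rfl | rfl <;> rcases hq with rfl | rfl | rfl
  all_goals first
    | exact hne rfl
    | (rw [side0 hz] at h1; exact h1.false)
    | (rw [side0 hz] at h2; exact h2.false)
    | (rw [side0 hz] at h3; exact h3.false)
    | (rw [openSegment_symm] at hz
       first
       | (rw [side0 hz] at h1; exact h1.false)
       | (rw [side0 hz] at h2; exact h2.false)
       | (rw [side0 hz] at h3; exact h3.false))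

/-- Empty triangles with a common interior point agree. -/
theorem eq_of_inside (h : IsMaximalNoncrossing V F) {a b c a' b' c' z : ℂ}
    (ht : IsEmptyTriangle V F a b c) (ht' : IsEmptyTriangle V F a' b' c')
    (hz : InsideTriangle a b c z) (h1 : 0 ≤ signedArea a' b' z) (h2 : 0 ≤ signedArea b' c' z)
    (h3 : 0 ≤ signedArea c' a' z) : ({a, b, c} : Set ℂ) = {a', b', c'} := by
  -- On the way from `z` to `v` the segment stays inside the first triangle. If `v` were outside the
  -- second triangle, the segment would meet a vertex or a side of it, and neither reaches the
  -- interior of the first one.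
  have vertex : ∀ v ∈ V, 0 ≤ signedArea a b v → 0 ≤ signedArea b c v → 0 ≤ signedArea c a v →
      v = a' ∨ v = b' ∨ v = c' := by
    intro v hv v1 v2 v3
    by_contra hcon
    obtain ⟨t, ht0, ht1, e1, e2, e3, e⟩ := exists_exit h1 h2 h3
      (fun hh => hcon (ht'.empty v hv hh.1 hh.2.1 hh.2.2))
    have hin : InsideTriangle a b c (pointAt z v t) := by
      obtain ⟨z1, z2, z3⟩ := hz
      refine ⟨?_, ?_, ?_⟩ <;> rw [signedArea_pointAt]
      · nlinarith [mul_pos (sub_pos.2 ht1) z1, mul_nonneg ht0 v1]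
      · nlinarith [mul_pos (sub_pos.2 ht1) z2, mul_nonneg ht0 v2]
      · nlinarith [mul_pos (sub_pos.2 ht1) z3, mul_nonneg ht0 v3]
    rcases h.eq_or_mem_side ht' e1 e2 e3 e with k | k | k | k
    · exact not_inside_of_mem ht k hin
    · exact h.not_inside ht ht'.ab k hin
    · exact h.not_inside ht ht'.bc k hin
    · exact h.not_inside ht ht'.ca k hin
  have hpos := ht.pos
  have hpos1 := ht.rotate.pos
  have hpos2 := ht.rotate.rotate.pos
  have ha := vertex a (h.mem ht.ab) (by simp) hpos1.le (by simp)
  have hb := vertex b (h.mem ht.bc) (by simp) (by simp) hpos2.le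
  have hc := vertex c (h.mem ht.ca) hpos.le (by simp) (by simp)
  have n1 := h.ne ht.ab
  have n2 := h.ne ht.bc
  have n3 := h.ne ht.ca
  ext x
  simp only [Set.mem_insert_iff, Set.mem_singleton_iff]
  rcases ha with rfl | rfl | rfl <;> rcases hb with rfl | rfl | rfl <;>
    rcases hc with rfl | rfl | rfl <;> simp_all <;> tauto

theorem segment_subset_of_pair {a b : ℂ} {s : Set ℂ} {z : ℂ} (hz : z ∈ openSegment ℝ a b)
    (ha : a ∈ s) (hb : b ∈ s) : z ∈ convexHull ℝ s := by
  refine convexHull_mono (?_ : {a, b} ⊆ s) ?_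
  · rintro x (rfl | rfl) <;> assumption
  · rw [convexHull_pair]; exact openSegment_subset_segment _ _ _ hz

theorem side_cases (h : IsMaximalNoncrossing V F) {a b c z : ℂ} (ht : IsEmptyTriangle V F a b c)
    (hz : z ∈ convexHull ℝ {a, b, c}) (hin : ¬ InsideTriangle a b c z) :
    z ∈ V ∨ ∃ p q, F p q ∧ z ∈ openSegment ℝ p q ∧ p ∈ ({a, b, c} : Set ℂ) ∧ q ∈ ({a, b, c} : Set ℂ) := by
  rw [mem_convexHull_triangle_iff ht.pos] at hz
  obtain ⟨h1, h2, h3⟩ := hz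
  have h0 : signedArea a b z = 0 ∨ signedArea b c z = 0 ∨ signedArea c a z = 0 := by
    by_contra! hcon
    exact hin ⟨lt_of_le_of_ne h1 (Ne.symm hcon.1), lt_of_le_of_ne h2 (Ne.symm hcon.2.1),
      lt_of_le_of_ne h3 (Ne.symm hcon.2.2)⟩
  rcases h.eq_or_mem_side ht h1 h2 h3 h0 with k | k | k | k
  · exact Or.inl k
  · exact Or.inr ⟨a, b, ht.ab, k, by simp, by simp⟩
  · exact Or.inr ⟨b, c, ht.bc, k, by simp, by simp⟩
  · exact Or.inr ⟨c, a, ht.ca, k, by simp, by simp⟩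

theorem mem_vertices_of_mem {a b c z : ℂ} (ht : IsEmptyTriangle V F a b c)
    (hz : z ∈ convexHull ℝ {a, b, c}) (hzV : z ∈ V) : z ∈ ({a, b, c} : Set ℂ) := by
  rw [mem_convexHull_triangle_iff ht.pos] at hz
  simpa using ht.empty z hzV hz.1 hz.2.1 hz.2.2

/-- A common point interior to one of the triangles makes them equal by `eq_of_inside`. Every other
common point is in `V` or lies on a side of each triangle, and two segments of `F` sharing an
interior point coincide. -/
theorem triangle_inter_triangle (h : IsMaximalNoncrossing V F) {a b c a' b' c' : ℂ}
    (ht : IsEmptyTriangle V F a b c) (ht' : IsEmptyTriangle V F a' b' c') :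
    convexHull ℝ {a, b, c} ∩ convexHull ℝ {a', b', c'} ⊆
      convexHull ℝ (({a, b, c} : Set ℂ) ∩ {a', b', c'}) := by
  rintro z ⟨hz, hz'⟩
  by_cases hin : InsideTriangle a b c z
  · rw [mem_convexHull_triangle_iff ht'.pos] at hz'
    rw [← h.eq_of_inside ht ht' hin hz'.1 hz'.2.1 hz'.2.2, Set.inter_self]
    exact hz
  by_cases hin' : InsideTriangle a' b' c' z
  · rw [mem_convexHull_triangle_iff ht.pos] at hz
    rw [← h.eq_of_inside ht' ht hin' hz.1 hz.2.1 hz.2.2, Set.inter_self]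
    exact hz'
  have vert : z ∈ V → z ∈ convexHull ℝ (({a, b, c} : Set ℂ) ∩ {a', b', c'}) := fun hzV =>
    subset_convexHull _ _ ⟨mem_vertices_of_mem ht hz hzV, mem_vertices_of_mem ht' hz' hzV⟩
  rcases h.side_cases ht hz hin with k | ⟨p, q, hpq, k, hp, hq⟩
  · exact vert k
  rcases h.side_cases ht' hz' hin' with k' | ⟨p', q', hpq', k', hp', hq'⟩
  · exact vert k'
  rcases h.disj hpq hpq' k k' with ⟨rfl, rfl⟩ | ⟨rfl, rfl⟩
  · exact segment_subset_of_pair k ⟨hp, hp'⟩ ⟨hq, hq'⟩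
  · exact segment_subset_of_pair k ⟨hp, hq'⟩ ⟨hq, hp'⟩

theorem segment_inter_triangle (h : IsMaximalNoncrossing V F) {a b c p q : ℂ}
    (hpq : F p q) (ht : IsEmptyTriangle V F a b c) :
    convexHull ℝ {p, q} ∩ convexHull ℝ {a, b, c} ⊆ convexHull ℝ (({p, q} : Set ℂ) ∩ {a, b, c}) := by
  rintro z ⟨hz, hz'⟩
  have vert : z ∈ ({p, q} : Set ℂ) → z ∈ convexHull ℝ (({p, q} : Set ℂ) ∩ {a, b, c}) := fun hzpq =>
    subset_convexHull _ _ ⟨hzpq, mem_vertices_of_mem ht hz' (by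
      rcases hzpq with rfl | rfl
      exacts [h.mem hpq, h.mem (h.symm hpq)])⟩
  rw [convexHull_pair] at hz
  by_cases hzp : z = p
  · exact vert (by simp [hzp])
  by_cases hzq : z = q
  · exact vert (by simp [hzq])
  have hz := mem_openSegment_of_ne_left_right (Ne.symm hzp) (Ne.symm hzq) hz
  rcases h.side_cases ht hz' (h.not_inside ht hpq hz) with k | ⟨p', q', hpq', k', hp', hq'⟩
  · exact (h.free hpq hz k).elim
  rcases h.disj hpq hpq' hz k' with ⟨rfl, rfl⟩ | ⟨rfl, rfl⟩
  · exact segment_subset_of_pair hz ⟨by simp, hp'⟩ ⟨by simp, hq'⟩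
  · exact segment_subset_of_pair hz ⟨by simp, hq'⟩ ⟨by simp, hp'⟩

/-- Every noncrossing system of segments extends to a maximal one. -/
theorem exists_extension (V : Finset ℂ) (E : ℂ → ℂ → Prop) (mem : ∀ {a b}, E a b → a ∈ V)
    (symm : ∀ {a b}, E a b → E b a) (ne : ∀ {a b}, E a b → a ≠ b)
    (free : ∀ {a b z}, E a b → z ∈ openSegment ℝ a b → z ∉ V)
    (disj : ∀ {a b c d z}, E a b → E c d → z ∈ openSegment ℝ a b → z ∈ openSegment ℝ c d →
      (c = a ∧ d = b) ∨ (c = b ∧ d = a)) :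
    ∃ F, IsMaximalNoncrossing V F ∧ ∀ {a b}, E a b → F a b := by
  classical
  let P : Finset (ℂ × ℂ) → Prop := fun G => (∀ a b, (a, b) ∈ G → (b, a) ∈ G) ∧
    (∀ a b, (a, b) ∈ G → a ≠ b) ∧ (∀ a b z, (a, b) ∈ G → z ∈ openSegment ℝ a b → z ∉ V) ∧
    (∀ a b c d z, (a, b) ∈ G → (c, d) ∈ G → z ∈ openSegment ℝ a b → z ∈ openSegment ℝ c d →
      (c = a ∧ d = b) ∨ (c = b ∧ d = a)) ∧ (∀ a b, E a b → (a, b) ∈ G)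
  -- There are finitely many pairs of points of `V`, so an admissible system with the largest number
  -- of pairs exists; it cannot be enlarged.
  obtain ⟨G, hG, hmax⟩ := Finset.exists_max_image ((V ×ˢ V).powerset.filter P) Finset.card (by
    refine ⟨(V ×ˢ V).filter fun x => E x.1 x.2, ?_⟩
    simp only [Finset.mem_filter, Finset.mem_powerset, Finset.mem_product, P]
    refine ⟨Finset.filter_subset _ _, ?_, ?_, ?_, ?_, ?_⟩
    · exact fun a b h => ⟨h.1.symm, symm h.2⟩
    · exact fun a b h => ne h.2
    · exact fun a b z h => free h.2
    · exact fun a b c d z h h' => disj h.2 h'.2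
    · exact fun a b h => ⟨⟨mem h, mem (symm h)⟩, h⟩)
  simp only [Finset.mem_filter, Finset.mem_powerset] at hG hmax
  obtain ⟨hGV, g1, g2, g3, g4, g5⟩ := hG
  refine ⟨fun a b => (a, b) ∈ G, ⟨?_, ?_, ?_, ?_, ?_, ?_⟩, ?_⟩
  · intro a b h
    have := hGV h
    simp only [Finset.mem_product] at this
    exact this.1
  · exact fun h => g1 _ _ h
  · exact fun h => g2 _ _ h
  · exact fun h => g3 _ _ _ h
  · exact fun h h' => g4 _ _ _ _ _ h h'
  · intro a b ha hb hab hfree hcross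
    by_contra hnot
    have := hmax (insert (a, b) (insert (b, a) G)) ⟨?_, ?_, ?_, ?_, ?_, ?_⟩
    · have h2 : G.card < (insert (a, b) (insert (b, a) G)).card :=
        Finset.card_lt_card ((Finset.ssubset_iff_of_subset (by
          intro x hx; simp [hx])).2 ⟨(a, b), by simp, hnot⟩)
      omega
    · intro x hx
      simp only [Finset.mem_insert] at hx
      rcases hx with rfl | rfl | hx
      · simp [ha, hb]
      · simp [ha, hb]
      · exact hGV hx
    · intro x y h
      simp only [Finset.mem_insert, Prod.mk.injEq] at h ⊢
      rcases h with ⟨rfl, rfl⟩ | ⟨rfl, rfl⟩ | h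
      · simp
      · simp
      · exact Or.inr (Or.inr (g1 _ _ h))
    · intro x y h
      simp only [Finset.mem_insert, Prod.mk.injEq] at h
      rcases h with ⟨rfl, rfl⟩ | ⟨rfl, rfl⟩ | h
      · exact hab
      · exact hab.symm
      · exact g2 _ _ h
    · intro x y z h hz
      simp only [Finset.mem_insert, Prod.mk.injEq] at h
      rcases h with ⟨rfl, rfl⟩ | ⟨rfl, rfl⟩ | h
      · exact hfree z hz
      · rw [openSegment_symm] at hz; exact hfree z hz
      · exact g3 _ _ _ h hz
    · intro x y u w z h h' hz hz'
      simp only [Finset.mem_insert, Prod.mk.injEq] at h h'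
      rcases h with ⟨rfl, rfl⟩ | ⟨rfl, rfl⟩ | h <;> rcases h' with ⟨rfl, rfl⟩ | ⟨rfl, rfl⟩ | h'
      · simp
      · simp
      · exact (hcross h' hz hz').elim
      · simp
      · simp
      · rw [openSegment_symm] at hz
        exact (hcross h' hz hz').elim
      · exact (hcross h hz' hz).elim
      · rw [openSegment_symm] at hz'
        exact (hcross h hz' hz).elim
      · exact g4 _ _ _ _ _ h h' hz hz'
    · intro x y h
      simp only [Finset.mem_insert]
      exact Or.inr (Or.inr (g5 _ _ h))
  · exact fun h => g5 _ _ h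

end IsMaximalNoncrossing

/-! ### Winding numbers of closed polygons -/

/-- A function that is locally constant on a preconnected set is constant there. -/
theorem IsPreconnected.eq_of_eventually_eq {X Y : Type*} [TopologicalSpace X] {U : Set X}
    (hU : IsPreconnected U) {g : X → Y} (hg : ∀ p ∈ U, ∀ᶠ x in 𝓝[U] p, g x = g p) {p q : X}
    (hp : p ∈ U) (hq : q ∈ U) : g p = g q := by
  have := isPreconnected_iff_preconnectedSpace.1 hU
  have : IsLocallyConstant (fun x : U => g x) := by
    rw [IsLocallyConstant.iff_eventually_eq]
    rintro ⟨x, hx⟩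
    have := hg x hx
    rw [nhdsWithin_eq_map_subtype_coe hx, eventually_map] at this
    exact this
  exact this.apply_eq_of_preconnectedSpace ⟨p, hp⟩ ⟨q, hq⟩

/-- Integer values with a limit are eventually constant. -/
theorem eventually_eq_round_of_tendsto {X : Type*} {l : Filter X} {g : X → ℝ} {L : ℝ}
    (hg : Tendsto g l (𝓝 L)) (hi : ∀ᶠ x in l, ∃ n : ℤ, g x = n) : ∀ᶠ x in l, g x = round L := by
  have h1 : ∀ᶠ x in l, |g x - L| < 1 / 2 := by
    have := hg (Metric.ball_mem_nhds L (by norm_num : (0 : ℝ) < 1 / 2))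
    filter_upwards [this] with x hx
    simpa [Real.dist_eq] using hx
  filter_upwards [h1, hi] with x hx ⟨n, hn⟩
  rw [hn] at hx ⊢
  have : round L = n := by
    rw [round_eq, Int.floor_eq_iff]
    rw [abs_lt] at hx
    constructor <;> linarith
  rw [this]

section Wind

variable {ι : Type*} (f : ι → ℂ) (σ : Equiv.Perm ι)

/-- The points on the edges of `S`. -/
def curve (S : Finset ι) : Set ℂ := ⋃ v ∈ S, segment ℝ (f v) (f (σ v))

/-- The winding number around `p` of the closed polygons with vertices `S`. -/
noncomputable def wind (S : Finset ι) (p : ℂ) : ℝ :=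
  (∑ v ∈ S, ((f (σ v) - p) / (f v - p)).arg) / (2 * Real.pi)

theorem isClosed_curve (S : Finset ι) : IsClosed (curve f σ S) := by
  apply Set.Finite.isClosed_biUnion S.finite_toSet
  intro v _
  rw [← convexHull_pair]
  exact ((Set.toFinite _).isCompact_convexHull (𝕜 := ℝ)).isClosed

/-- Modulo `2π` each summand is a difference of the arguments at consecutive vertices. These
differences cancel because `σ` permutes `S`. -/
theorem exists_int_wind {S : Finset ι} (hS : ∀ v, v ∈ S ↔ σ v ∈ S) {p : ℂ} (hp : ∀ v ∈ S, f v ≠ p) :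
    ∃ n : ℤ, wind f σ S p = n := by
  have h0 : ((∑ v ∈ S, ((f (σ v) - p) / (f v - p)).arg : ℝ) : Real.Angle) = ((0 : ℝ) : Real.Angle) := by
    have : ∀ T : Finset ι, ((∑ v ∈ T, ((f (σ v) - p) / (f v - p)).arg : ℝ) : Real.Angle) =
        ∑ v ∈ T, (((f (σ v) - p) / (f v - p)).arg : Real.Angle) := fun T =>
      map_sum Real.Angle.coeHom _ _
    rw [this]
    have h1 : ∀ v ∈ S, (((f (σ v) - p) / (f v - p)).arg : Real.Angle) =
        ((f (σ v) - p).arg : Real.Angle) - ((f v - p).arg : Real.Angle) := fun v hv =>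
      Complex.arg_div_coe_angle (sub_ne_zero.2 (hp _ ((hS v).1 hv))) (sub_ne_zero.2 (hp _ hv))
    rw [Finset.sum_congr rfl h1, Finset.sum_sub_distrib,
      Finset.sum_equiv (s := S) (t := S) (g := fun v => ((f v - p).arg : Real.Angle)) σ hS
        (fun _ _ => rfl)]
    simp
  obtain ⟨n, hn⟩ := Real.Angle.angle_eq_iff_two_pi_dvd_sub.1 h0
  refine ⟨n, ?_⟩
  have := Real.pi_pos
  rw [wind, ← sub_zero (∑ v ∈ S, _), hn]
  field_simp

/-- The quotient is a nonpositive real only if `b - p` is zero or points opposite to `a - p`, which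
places `p` on the segment. -/
theorem mem_slitPlane_of_notMem_segment {a b p : ℂ} (ha : a ≠ p) (hp : p ∉ segment ℝ a b) :
    (b - p) / (a - p) ∈ Complex.slitPlane := by
  rw [Complex.mem_slitPlane_iff]
  by_contra! hcon
  obtain ⟨h1, h2⟩ := hcon
  set q := (b - p) / (a - p) with hq
  have hqr : q = (q.re : ℂ) := Complex.ext (by simp) (by simp [h2])
  have hb : b - p = (q.re : ℂ) * (a - p) := by
    rw [← hqr, hq, div_mul_cancel₀ _ (sub_ne_zero.2 ha)]
  have e1 := congrArg Complex.re hb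
  have e2 := congrArg Complex.im hb
  simp only [Complex.sub_re, Complex.sub_im, Complex.mul_re, Complex.mul_im, Complex.ofReal_re,
    Complex.ofReal_im] at e1 e2
  apply hp
  rw [mem_segment_iff_pointAt]
  have hpos : 0 < 1 - q.re := by linarith
  refine ⟨1 / (1 - q.re), by positivity, by rw [div_le_one hpos]; linarith, ?_⟩
  apply Complex.ext
  · rw [pointAt_re]; field_simp; linarith
  · rw [pointAt_im]; field_simp; linarith

theorem continuousAt_arg_div {a b p : ℂ} (hp : p ∉ segment ℝ a b) :
    ContinuousAt (fun x : ℂ => ((b - x) / (a - x)).arg) p := by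
  have ha : a ≠ p := by rintro rfl; exact hp (left_mem_segment _ _ _)
  refine ContinuousAt.comp (g := Complex.arg) (f := fun x : ℂ => (b - x) / (a - x))
    (Complex.continuousAt_arg (mem_slitPlane_of_notMem_segment ha hp)) ?_
  exact ((continuousAt_const.sub continuousAt_id).div (continuousAt_const.sub continuousAt_id)
    (sub_ne_zero.2 ha))

theorem ne_of_notMem_curve {S : Finset ι} {p : ℂ} (hp : p ∉ curve f σ S) : ∀ v ∈ S, f v ≠ p := by
  rintro v hv rfl
  exact hp (Set.mem_biUnion hv (left_mem_segment _ _ _))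

/-- Off the curve all arguments are continuous, and a continuous function with integer values is
locally constant. -/
theorem eventually_wind_eq {S : Finset ι} (hS : ∀ v, v ∈ S ↔ σ v ∈ S) {p : ℂ}
    (hp : p ∉ curve f σ S) : ∀ᶠ x in 𝓝 p, wind f σ S x = wind f σ S p := by
  have hcont : Tendsto (wind f σ S) (𝓝 p) (𝓝 (wind f σ S p)) := by
    refine Tendsto.div_const ?_ _
    refine tendsto_finsetSum _ fun v hv => ?_
    exact continuousAt_arg_div fun h => hp (Set.mem_biUnion hv h)
  have hev : ∀ᶠ x in 𝓝 p, x ∉ curve f σ S := (isClosed_curve f σ S).isOpen_compl.mem_nhds hp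
  have := eventually_eq_round_of_tendsto hcont
    (hev.mono fun x hx => exists_int_wind f σ hS (ne_of_notMem_curve f σ hx))
  have h0 := this.self_of_nhds
  exact this.mono fun x hx => hx.trans h0.symm

theorem wind_eq_of_isPreconnected {S : Finset ι} (hS : ∀ v, v ∈ S ↔ σ v ∈ S) {U : Set ℂ}
    (hU : IsPreconnected U) (hUS : ∀ x ∈ U, x ∉ curve f σ S) {p q : ℂ} (hp : p ∈ U) (hq : q ∈ U) :
    wind f σ S p = wind f σ S q :=
  hU.eq_of_eventually_eq (fun x hx => (eventually_wind_eq f σ hS (hUS x hx)).filter_mono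
    nhdsWithin_le_nhds) hp hq

/-- Seen from `p`, the polygon lies in an open half-plane. Multiplication by `k` turns it into the
right half-plane, where no branch cut of the argument interferes and the sum telescopes exactly. -/
theorem wind_eq_zero {S : Finset ι} (hS : ∀ v, v ∈ S ↔ σ v ∈ S) {a b p : ℂ}
    (h : ∀ v ∈ S, signedArea a b (f v) < signedArea a b p) : wind f σ S p = 0 := by
  set k : ℂ := Complex.I * (starRingEnd ℂ) (b - a) with hk
  have hre : ∀ v ∈ S, 0 < (k * (f v - p)).re := by
    intro v hv
    have := h v hv
    simp only [hk, signedArea, Complex.mul_re, Complex.mul_im, Complex.I_re, Complex.I_im,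
      Complex.sub_re, Complex.sub_im, Complex.conj_re, Complex.conj_im] at this ⊢
    nlinarith
  have harg : ∀ v ∈ S, ((f (σ v) - p) / (f v - p)).arg =
      (k * (f (σ v) - p)).arg - (k * (f v - p)).arg := by
    intro v hv
    have h1 := hre v hv
    have h2 := hre _ ((hS v).1 hv)
    have n1 : k * (f v - p) ≠ 0 := by intro e; rw [e] at h1; simp at h1
    have n2 : k * (f (σ v) - p) ≠ 0 := by intro e; rw [e] at h2; simp at h2
    have hk0 : k ≠ 0 := left_ne_zero_of_mul n1
    rw [← mul_div_mul_left _ _ hk0]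
    have e := Complex.arg_div_coe_angle n2 n1
    have a1 := abs_lt.1 (Complex.abs_arg_lt_pi_div_two_iff.2 (Or.inl h1))
    have a2 := abs_lt.1 (Complex.abs_arg_lt_pi_div_two_iff.2 (Or.inl h2))
    rw [← Real.Angle.coe_sub] at e
    have e2 := congrArg Real.Angle.toReal e
    rw [Real.Angle.toReal_coe_eq_self_iff.2 ⟨Complex.neg_pi_lt_arg _, Complex.arg_le_pi _⟩,
      Real.Angle.toReal_coe_eq_self_iff.2 ⟨by linarith, by linarith⟩] at e2
    exact e2
  rw [wind, Finset.sum_congr rfl harg, Finset.sum_sub_distrib,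
    Finset.sum_equiv (s := S) (t := S) (g := fun v => (k * (f v - p)).arg) σ hS (fun _ _ => rfl)]
  simp

theorem frequently_left {a b : ℂ} (hab : a ≠ b) (z : ℂ) (hz : signedArea a b z = 0) :
    ∃ᶠ x in 𝓝 z, 0 < signedArea a b x := by
  have hT : Tendsto (fun s : ℝ => z + s * (Complex.I * (b - a))) (𝓝[>] 0) (𝓝 z) := by
    have : Tendsto (fun s : ℝ => z + s * (Complex.I * (b - a))) (𝓝 0) (𝓝 (z + (0 : ℝ) * (Complex.I * (b - a)))) := by
      refine Continuous.tendsto ?_ _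
      fun_prop
    simp only [Complex.ofReal_zero, zero_mul, add_zero] at this
    exact this.mono_left nhdsWithin_le_nhds
  refine hT.frequently (Eventually.frequently ?_)
  filter_upwards [self_mem_nhdsWithin] with s hs
  have hs : 0 < s := hs
  have : signedArea a b (z + s * (Complex.I * (b - a))) =
      signedArea a b z + s * ((b.re - a.re) ^ 2 + (b.im - a.im) ^ 2) := by
    simp [signedArea]; ring
  rw [this, hz, zero_add]
  refine mul_pos hs ?_
  by_contra h0
  have e1 : b.re - a.re = 0 := by nlinarith [sq_nonneg (b.re - a.re), sq_nonneg (b.im - a.im)]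
  have e2 : b.im - a.im = 0 := by nlinarith [sq_nonneg (b.re - a.re), sq_nonneg (b.im - a.im)]
  exact hab (Complex.ext (by linarith) (by linarith))

/-- At a point between `a` and `b` the quotient is a negative real, and near it its imaginary part
has the sign of `signedArea a b x`. The two sides of the segment correspond to the two sides of the
branch cut. -/
theorem tendsto_arg_left {a b z : ℂ} (hz : z ∈ openSegment ℝ a b) (hab : a ≠ b) :
    Tendsto (fun x : ℂ => ((b - x) / (a - x)).arg) (𝓝[{x | 0 < signedArea a b x}] z) (𝓝 Real.pi) ∧
    Tendsto (fun x : ℂ => ((b - x) / (a - x)).arg) (𝓝[{x | signedArea a b x < 0}] z) (𝓝 (-Real.pi)) := by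
  obtain ⟨t, ht0, ht1, rfl⟩ := mem_openSegment_iff_pointAt.1 hz
  set z := pointAt a b t with hzdef
  have hba : b - a ≠ 0 := sub_ne_zero.2 hab.symm
  have haz : a - z ≠ 0 := by
    rw [hzdef, pointAt]
    intro h
    have : (t : ℂ) * (b - a) = 0 := by linear_combination -h
    rcases mul_eq_zero.1 this with h | h
    · exact ht0.ne' (by exact_mod_cast h)
    · exact hba h
  have hq : (b - z) / (a - z) = ((-((1 - t) / t) : ℝ) : ℂ) := by
    rw [div_eq_iff haz, hzdef, pointAt]
    have : (t : ℂ) ≠ 0 := by exact_mod_cast ht0.ne'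
    push_cast
    field_simp
    ring
  have hre : ((b - z) / (a - z)).re < 0 := by
    rw [hq, Complex.ofReal_re]
    have : 0 < (1 - t) / t := div_pos (by linarith) ht0
    linarith
  have him0 : ((b - z) / (a - z)).im = 0 := by rw [hq, Complex.ofReal_im]
  have hcont : Tendsto (fun x : ℂ => (b - x) / (a - x)) (𝓝 z) (𝓝 ((b - z) / (a - z))) :=
    ((continuousAt_const.sub continuousAt_id).div (continuousAt_const.sub continuousAt_id) haz)
  have him : ∀ x, ((b - x) / (a - x)).im = signedArea a b x / Complex.normSq (a - x) := by
    intro x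
    simp only [Complex.div_im, signedArea, Complex.sub_re, Complex.sub_im]
    ring
  have hpos : ∀ᶠ x in 𝓝 z, 0 < Complex.normSq (a - x) := by
    have : ∀ᶠ x in 𝓝 z, a - x ≠ 0 :=
      (continuousAt_const.sub continuousAt_id).eventually_ne haz
    exact this.mono fun x hx => Complex.normSq_pos.2 hx
  constructor
  · refine (Complex.tendsto_arg_nhdsWithin_im_nonneg_of_re_neg_of_im_zero hre him0).comp ?_
    refine tendsto_nhdsWithin_iff.2 ⟨hcont.mono_left nhdsWithin_le_nhds, ?_⟩
    filter_upwards [self_mem_nhdsWithin, hpos.filter_mono nhdsWithin_le_nhds] with x hx hx'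
    have hx : 0 < signedArea a b x := hx
    show 0 ≤ _
    rw [him]; positivity
  · refine (Complex.tendsto_arg_nhdsWithin_im_neg_of_re_neg_of_im_zero hre him0).comp ?_
    refine tendsto_nhdsWithin_iff.2 ⟨hcont.mono_left nhdsWithin_le_nhds, ?_⟩
    filter_upwards [self_mem_nhdsWithin, hpos.filter_mono nhdsWithin_le_nhds] with x hx hx'
    have hx : signedArea a b x < 0 := hx
    show _ < 0
    rw [him]; exact div_neg_of_neg_of_pos hx hx'

end Wind

/-! ### Winding numbers next to edges and vertices -/

/-- The segments from `f v` to `f (σ v)` form disjoint simple closed polygons in the plane. -/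
structure IsPlanarCurve {ι : Type*} (f : ι → ℂ) (σ : Equiv.Perm ι) : Prop where
  inj : Function.Injective f
  ne : ∀ v, σ v ≠ v
  disj : ∀ {v w z}, v ≠ w → z ∈ openSegment ℝ (f v) (f (σ v)) → z ∉ segment ℝ (f w) (f (σ w))

/-- The open sector at `u` with one side in direction `e`. -/
def sector (u e : ℂ) (ε κ r : ℝ) : Set ℂ :=
  (fun x : ℝ × ℝ => u + (x.1 + ε * x.2 * Complex.I) * e) '' {x | 0 < x.1 ∧ x.1 < r ∧ 0 < x.2 ∧ x.2 < κ * x.1}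

theorem isPreconnected_sector (u e : ℂ) (ε κ r : ℝ) : IsPreconnected (sector u e ε κ r) := by
  refine IsPreconnected.image (Convex.isPreconnected ?_) _ (Continuous.continuousOn (by fun_prop))
  rintro ⟨x, y⟩ ⟨h1, h2, h3, h4⟩ ⟨x', y'⟩ ⟨h1', h2', h3', h4'⟩ s t hs ht hst
  simp only at h1 h2 h3 h4 h1' h2' h3' h4'
  simp only [Prod.smul_mk, Prod.mk_add_mk, smul_eq_mul, Set.mem_ofPred_eq]
  obtain rfl : s = 1 - t := by linarith
  rcases ht.eq_or_lt with rfl | ht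
  · simp only [sub_zero, one_mul, zero_mul, add_zero]; exact ⟨h1, h2, h3, h4⟩
  · refine ⟨?_, ?_, ?_, ?_⟩
    · nlinarith [mul_pos ht h1', mul_nonneg hs h1.le]
    · nlinarith [mul_pos ht (sub_pos.2 h2'), mul_nonneg hs (sub_pos.2 h2).le]
    · nlinarith [mul_pos ht h3', mul_nonneg hs h3.le]
    · nlinarith [mul_pos ht (sub_pos.2 h4'), mul_nonneg hs (sub_pos.2 h4).le]

/-- A ray not in direction `e` makes a positive angle with it, and a sufficiently narrow sector
stays clear. A ray in direction `e` runs along the side of the open sector. -/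
theorem exists_sector_avoids_ray {e : ℂ} (he : e ≠ 0) (d : ℂ) {ε : ℝ} (hε : ε = 1 ∨ ε = -1) :
    ∃ κ₀ > 0, ∀ x y t : ℝ, 0 < x → 0 < y → y < κ₀ * x → 0 ≤ t →
      (t : ℂ) * d ≠ (x + ε * y * Complex.I) * e := by
  set β := d / e with hβ
  have hd : d = β * e := by rw [hβ, div_mul_cancel₀ _ he]
  have key : ∀ x y t : ℝ, (t : ℂ) * d = (x + ε * y * Complex.I) * e → t * β.re = x ∧ t * β.im = ε * y := by
    intro x y t h
    rw [hd, ← mul_assoc] at h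
    have := mul_right_cancel₀ he h
    have e1 := congrArg Complex.re this
    have e2 := congrArg Complex.im this
    simp at e1 e2
    exact ⟨e1, e2⟩
  have hy : ∀ y : ℝ, 0 < y → |ε * y| = y := by
    intro y hy
    rcases hε with rfl | rfl <;> simp [abs_of_pos hy]
  by_cases h0 : β.im = 0
  · refine ⟨1, one_pos, fun x y t hx hy' _ ht h => ?_⟩
    have := (key x y t h).2
    rw [h0, mul_zero] at this
    have h1 := hy y hy'
    rw [← this] at h1
    simp at h1
    linarith
  -- The absolute slope of `d` relative to `e` is `|β.im| / |β.re|`; adding 1 avoids a zero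
  -- denominator and only lowers the bound.
  · refine ⟨|β.im| / (|β.re| + 1), by positivity, fun x y t hx hy' hlt ht h => ?_⟩
    obtain ⟨e1, e2⟩ := key x y t h
    have h1 := hy y hy'
    rw [← e2, abs_mul, abs_of_nonneg ht] at h1
    have h2 : t * |β.re| = x := by
      rw [← abs_of_nonneg ht, ← abs_mul, e1, abs_of_pos hx]
    have h3 : 0 < |β.im| := abs_pos.2 h0
    have h4 : |β.im| / (|β.re| + 1) * x ≤ t * |β.im| := by
      rw [← h2, div_mul_eq_mul_div, div_le_iff₀ (by positivity)]
      nlinarith [mul_nonneg ht h3.le, abs_nonneg β.re]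
    linarith

namespace IsPlanarCurve

variable {ι : Type*} {f : ι → ℂ} {σ : Equiv.Perm ι}

theorem f_ne (h : IsPlanarCurve f σ) (v : ι) : f v ≠ f (σ v) := h.inj.ne (h.ne v).symm

theorem symm_ne (h : IsPlanarCurve f σ) (v : ι) : σ.symm v ≠ v := fun e => h.ne v (by
  conv_lhs => rw [← e]
  simp)

theorem ne_of_mem_openSegment (h : IsPlanarCurve f σ) {v : ι} {z : ℂ}
    (hz : z ∈ openSegment ℝ (f v) (f (σ v))) (w : ι) : f w ≠ z := by
  rintro rfl
  by_cases hvw : v = w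
  · subst hvw
    exact h.disj (h.symm_ne v).symm hz (by simp [right_mem_segment])
  · exact h.disj hvw hz (left_mem_segment _ _ _)

theorem vertex_notMem_segment (h : IsPlanarCurve f σ) {v w : ι} (h1 : w ≠ v) (h2 : w ≠ σ.symm v) :
    f v ∉ segment ℝ (f w) (f (σ w)) := by
  intro hm
  rcases eq_or_ne (f w) (f v) with e | e
  · exact h1 (h.inj e)
  rcases eq_or_ne (f (σ w)) (f v) with e' | e'
  · exact h2 (by rw [← h.inj e']; simp)
  exact h.disj h1 (mem_openSegment_of_ne_left_right e e' hm) (left_mem_segment _ _ _)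

theorem notMem_curve_of_notMem (h : IsPlanarCurve f σ) {S : Finset ι} {v : ι} (hv : v ∉ S) {z : ℂ}
    (hz : z ∈ openSegment ℝ (f v) (f (σ v))) : z ∉ curve f σ S := by
  intro hm
  obtain ⟨w, hw, hzw⟩ := Set.mem_iUnion₂.1 hm
  exact h.disj (by rintro rfl; exact hv hw) hz hzw

theorem eventually_ne_vertices {S : Finset ι} {z : ℂ} (hz : ∀ v ∈ S, f v ≠ z) :
    ∀ᶠ x in 𝓝 z, ∀ v ∈ S, f v ≠ x := by
  rw [Filter.eventually_all_finset]
  intro v hv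
  exact (eventually_ne_nhds (hz v hv).symm).mono fun x hx => hx.symm

variable {S : Finset ι}

/-- At an interior point of the edge at `v` only the summand of `v` is discontinuous. It tends to
`π` from the left and to `-π` from the right, so the integral winding number changes by one. -/
theorem exists_jump (h : IsPlanarCurve f σ) (hS : ∀ v, v ∈ S ↔ σ v ∈ S) {v : ι} (hv : v ∈ S) {z : ℂ}
    (hz : z ∈ openSegment ℝ (f v) (f (σ v))) : ∃ n : ℤ, ∀ᶠ x in 𝓝 z,
      (0 < signedArea (f v) (f (σ v)) x → wind f σ S x = n) ∧
      (signedArea (f v) (f (σ v)) x < 0 → wind f σ S x = n - 1) := by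
  classical
  have hpi := Real.pi_pos
  set rest : ℂ → ℝ := fun x => ∑ w ∈ S.erase v, ((f (σ w) - x) / (f w - x)).arg with hrest
  have hrc : Tendsto rest (𝓝 z) (𝓝 (rest z)) := by
    refine tendsto_finsetSum _ fun w hw => continuousAt_arg_div ?_
    exact h.disj (Finset.ne_of_mem_erase hw).symm hz
  have hsum : ∀ x, wind f σ S x = (((f (σ v) - x) / (f v - x)).arg + rest x) / (2 * Real.pi) := by
    intro x
    rw [wind, hrest, ← Finset.add_sum_erase S _ hv]
  have hint : ∀ᶠ x in 𝓝 z, ∃ n : ℤ, wind f σ S x = n :=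
    (eventually_ne_vertices fun w _ => h.ne_of_mem_openSegment hz w).mono fun x hx =>
      exists_int_wind f σ hS hx
  obtain ⟨t1, t2⟩ := tendsto_arg_left hz (h.f_ne v)
  have l1 : Tendsto (wind f σ S) (𝓝[{x | 0 < signedArea (f v) (f (σ v)) x}] z)
      (𝓝 ((Real.pi + rest z) / (2 * Real.pi))) := by
    simp_rw [funext hsum]
    exact (t1.add (hrc.mono_left nhdsWithin_le_nhds)).div_const _
  have l2 : Tendsto (wind f σ S) (𝓝[{x | signedArea (f v) (f (σ v)) x < 0}] z)
      (𝓝 ((-Real.pi + rest z) / (2 * Real.pi))) := by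
    simp_rw [funext hsum]
    exact (t2.add (hrc.mono_left nhdsWithin_le_nhds)).div_const _
  have e1 := eventually_eq_round_of_tendsto l1 (hint.filter_mono nhdsWithin_le_nhds)
  have e2 := eventually_eq_round_of_tendsto l2 (hint.filter_mono nhdsWithin_le_nhds)
  rw [eventually_nhdsWithin_iff] at e1 e2
  refine ⟨round ((Real.pi + rest z) / (2 * Real.pi)), ?_⟩
  filter_upwards [e1, e2] with x h1 h2
  refine ⟨h1, fun hx => ?_⟩
  rw [h2 hx]
  have : (-Real.pi + rest z) / (2 * Real.pi) = (Real.pi + rest z) / (2 * Real.pi) - 1 := by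
    field_simp; ring
  rw [this, round_sub_one]
  push_cast
  ring

/-- The left value found at a point is also the left value at nearby points of the edge, since
points to the left of the edge are close to both. So it is locally constant along the edge. -/
theorem exists_edge_wind (h : IsPlanarCurve f σ) (hS : ∀ v, v ∈ S ↔ σ v ∈ S) {v : ι} (hv : v ∈ S) :
    ∃ n : ℤ, ∀ z ∈ openSegment ℝ (f v) (f (σ v)), ∀ᶠ x in 𝓝 z,
      (0 < signedArea (f v) (f (σ v)) x → wind f σ S x = n) ∧
      (signedArea (f v) (f (σ v)) x < 0 → wind f σ S x = n - 1) := by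
  classical
  choose! n hn using fun z (hz : z ∈ openSegment ℝ (f v) (f (σ v))) => h.exists_jump hS hv hz
  have hconst : ∀ z ∈ openSegment ℝ (f v) (f (σ v)), ∀ z' ∈ openSegment ℝ (f v) (f (σ v)), n z = n z' := by
    intro z hz z' hz'
    refine IsPreconnected.eq_of_eventually_eq (convex_openSegment (𝕜 := ℝ) (f v) (f (σ v))).isPreconnected
      (fun p hp => ?_) hz hz'
    rw [eventually_nhdsWithin_iff]
    filter_upwards [eventually_eventually_nhds.2 (hn p hp)] with x hx hxs
    have hline : signedArea (f v) (f (σ v)) x = 0 := by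
      obtain ⟨t, -, -, rfl⟩ := mem_openSegment_iff_pointAt.1 hxs
      rw [signedArea_pointAt]; simp
    obtain ⟨y, hy, hy1, hy2⟩ := ((frequently_left (h.f_ne v) x hline).and_eventually
      (hx.and (hn x hxs))).exists
    have := hy1.1 hy
    rw [hy2.1 hy] at this
    exact_mod_cast this
  obtain ⟨z₀, hz₀⟩ : (openSegment ℝ (f v) (f (σ v))).Nonempty :=
    ⟨_, mem_openSegment_iff_pointAt.2 ⟨1 / 2, by norm_num, by norm_num, rfl⟩⟩
  refine ⟨n z₀, fun z hz => ?_⟩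
  rw [← hconst z hz z₀ hz₀]
  exact hn z hz

/-- The winding number along rays that start at a vertex. -/
theorem exists_wind_ray (h : IsPlanarCurve f σ) (hS : ∀ v, v ∈ S ↔ σ v ∈ S) {v : ι} (hv : v ∈ S) :
    ∃ R : ℝ, ∀ g : ℂ, g ≠ 0 → -g / (f (σ.symm v) - f v) ∈ Complex.slitPlane →
      (f (σ v) - f v) / -g ∈ Complex.slitPlane → ∀ᶠ s : ℝ in 𝓝[>] 0, wind f σ S (f v + s * g) =
        round ((R + (-g / (f (σ.symm v) - f v)).arg + ((f (σ v) - f v) / -g).arg) / (2 * Real.pi)) := by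
  classical
  set u := f v with hu
  set a := f (σ.symm v) with ha
  set b := f (σ v) with hb
  have hw : σ.symm v ∈ S := (hS _).2 (by simpa using hv)
  have hne := h.symm_ne v
  set rest : ℂ → ℝ := fun x => ∑ w ∈ (S.erase v).erase (σ.symm v), ((f (σ w) - x) / (f w - x)).arg
    with hrest
  have hrc : Tendsto rest (𝓝 u) (𝓝 (rest u)) := by
    refine tendsto_finsetSum _ fun w hw => continuousAt_arg_div ?_
    exact h.vertex_notMem_segment (Finset.ne_of_mem_erase (Finset.mem_of_mem_erase hw))
      (Finset.ne_of_mem_erase hw)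
  have hsum : ∀ x, wind f σ S x =
      (rest x + ((u - x) / (a - x)).arg + ((b - x) / (u - x)).arg) / (2 * Real.pi) := by
    intro x
    rw [wind, hrest, ← Finset.add_sum_erase S _ hv,
      ← Finset.add_sum_erase (S.erase v) _ (Finset.mem_erase.2 ⟨hne, hw⟩)]
    simp only [Equiv.apply_symm_apply]
    ring
  -- `R` collects the edges that do not touch `f v`. The contributions of the two edges at `f v`
  -- have limits that depend only on the direction of the ray, because positive real factors do not
  -- change an argument.
  refine ⟨rest u, fun g hg h1 h2 => ?_⟩
  have hau : a - u ≠ 0 := sub_ne_zero.2 (h.inj.ne hne)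
  have hp : Tendsto (fun s : ℝ => u + s * g) (𝓝[>] 0) (𝓝 u) := by
    have : Tendsto (fun s : ℝ => u + s * g) (𝓝 0) (𝓝 (u + (0 : ℝ) * g)) :=
      Continuous.tendsto (by fun_prop) _
    simp only [Complex.ofReal_zero, zero_mul, add_zero] at this
    exact this.mono_left nhdsWithin_le_nhds
  have l1 : Tendsto (fun s : ℝ => ((u - (u + s * g)) / (a - (u + s * g))).arg) (𝓝[>] 0)
      (𝓝 (-g / (a - u)).arg) := by
    have k1 : Tendsto (fun s : ℝ => (-g / (a - (u + s * g)))) (𝓝[>] 0) (𝓝 (-g / (a - u))) :=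
      tendsto_const_nhds.div (tendsto_const_nhds.sub hp) hau
    refine ((Complex.continuousAt_arg h1).tendsto.comp k1).congr' ?_
    filter_upwards [self_mem_nhdsWithin] with s hs
    have hs : 0 < s := hs
    rw [Function.comp, ← Complex.arg_real_mul _ hs]
    congr 1
    ring
  have l2 : Tendsto (fun s : ℝ => ((b - (u + s * g)) / (u - (u + s * g))).arg) (𝓝[>] 0)
      (𝓝 ((b - u) / -g).arg) := by
    have k1 : Tendsto (fun s : ℝ => ((b - (u + s * g)) / -g)) (𝓝[>] 0) (𝓝 ((b - u) / -g)) :=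
      (tendsto_const_nhds.sub hp).div tendsto_const_nhds (neg_ne_zero.2 hg)
    refine ((Complex.continuousAt_arg h2).tendsto.comp k1).congr' ?_
    filter_upwards [self_mem_nhdsWithin] with s hs
    have hs : 0 < s := hs
    have hs' : (s : ℂ) ≠ 0 := by exact_mod_cast hs.ne'
    rw [Function.comp, ← Complex.arg_real_mul _ (inv_pos.2 hs)]
    congr 1
    push_cast
    field_simp
    ring
  refine eventually_eq_round_of_tendsto (g := fun s : ℝ => wind f σ S (u + s * g)) ?_ ?_
  · simp_rw [hsum]
    exact (((hrc.comp hp).add l1).add l2).div_const _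
  · have h0 : ∀ᶠ x in 𝓝 u, ∀ w ∈ S.erase v, f w ≠ x := eventually_ne_vertices fun w hw =>
      h.inj.ne (Finset.ne_of_mem_erase hw)
    filter_upwards [hp.eventually h0, self_mem_nhdsWithin] with s hs hs'
    have hs' : 0 < s := hs'
    refine exists_int_wind f σ hS fun w hw => ?_
    by_cases hwv : w = v
    · subst hwv
      intro e
      have : (s : ℂ) * g = 0 := by linear_combination -e
      rcases mul_eq_zero.1 this with e | e
      · exact hs'.ne' (by exact_mod_cast e)
      · exact hg e
    · exact hs w (Finset.mem_erase.2 ⟨hwv, hw⟩)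

/-- A narrow sector misses the rays along the two edges at `f v`, and a small radius keeps it away
from all other edges. All openings up to `κ₀` are allowed so that two sectors can later share one
opening. -/
theorem exists_sector_disjoint (h : IsPlanarCurve f σ) (v : ι) {e : ℂ} (he : e ≠ 0) {ε : ℝ}
    (hε : ε = 1 ∨ ε = -1) : ∃ κ₀ > 0, ∀ κ > 0, κ ≤ κ₀ → ∃ r > 0, ∀ x ∈ sector (f v) e ε κ r,
      x ∉ curve f σ S := by
  classical
  obtain ⟨κ₁, hκ₁, H1⟩ := exists_sector_avoids_ray he (f (σ.symm v) - f v) hε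
  obtain ⟨κ₂, hκ₂, H2⟩ := exists_sector_avoids_ray he (f (σ v) - f v) hε
  refine ⟨min κ₁ κ₂, lt_min hκ₁ hκ₂, fun κ hκ hle => ?_⟩
  have hcl : f v ∉ curve f σ ((S.erase v).erase (σ.symm v)) := by
    intro hm
    obtain ⟨w, hw, hzw⟩ := Set.mem_iUnion₂.1 hm
    exact h.vertex_notMem_segment (Finset.ne_of_mem_erase (Finset.mem_of_mem_erase hw))
      (Finset.ne_of_mem_erase hw) hzw
  obtain ⟨ρ, hρ, hball⟩ := Metric.isOpen_iff.1 (isClosed_curve f σ _).isOpen_compl (f v) hcl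
  -- A point of the sector with coordinates `x` and `y < κ x` has distance at most `x (1 + κ) ‖e‖`
  -- from the vertex.
  refine ⟨ρ / ((1 + κ) * (‖e‖ + 1)), by positivity, ?_⟩
  rintro _ ⟨⟨x, y⟩, ⟨h1, h2, h3, h4⟩, rfl⟩ hm
  simp only at h1 h2 h3 h4
  have hray : ∀ (t : ℝ) (d : ℂ), f v + t * d = f v + (x + ε * y * Complex.I) * e →
      (t : ℂ) * d = (x + ε * y * Complex.I) * e := fun t d h => add_left_cancel h
  obtain ⟨w, hw, hzw⟩ := Set.mem_iUnion₂.1 hm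
  obtain ⟨t, ht0, ht1, ht⟩ := mem_segment_iff_pointAt.1 hzw
  by_cases hwv : w = v
  · subst hwv
    exact H2 x y t h1 h3 (h4.trans_le (by gcongr; exact hle.trans (min_le_right _ _))) ht0
      (hray _ _ (by simp only [pointAt] at ht; exact ht))
  by_cases hwv' : w = σ.symm v
  · subst hwv'
    refine H1 x y (1 - t) h1 h3 (h4.trans_le (by gcongr; exact hle.trans (min_le_left _ _)))
      (by linarith) (hray _ _ ?_)
    simp only [pointAt, Equiv.apply_symm_apply] at ht
    rw [← ht]
    push_cast
    ring
  · refine hball ?_ (Set.mem_biUnion (Finset.mem_coe.2 (Finset.mem_erase.2 ⟨hwv', Finset.mem_erase.2 ⟨hwv, hw⟩⟩)) hzw)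
    rw [mem_ball_iff_norm]
    simp only [add_sub_cancel_left]
    rw [norm_mul]
    rw [lt_div_iff₀ (by positivity)] at h2
    have hn : ‖(x : ℂ) + ε * y * Complex.I‖ ≤ x + y := by
      refine (norm_add_le _ _).trans ?_
      have : |ε| = 1 := by rcases hε with rfl | rfl <;> simp
      simp [abs_of_pos h1, abs_of_pos h3, this]
    have : 0 ≤ ‖e‖ := norm_nonneg e
    calc ‖(x : ℂ) + ε * y * Complex.I‖ * ‖e‖ ≤ (x + y) * ‖e‖ := by gcongr
      _ ≤ x * ((1 + κ) * ‖e‖) := by nlinarith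
      _ ≤ x * ((1 + κ) * (‖e‖ + 1)) := by gcongr; linarith
      _ < ρ := h2

/-- A value of the winding number attained next to an edge is attained in the sector. -/
theorem wind_in_sector (h : IsPlanarCurve f σ) (hS : ∀ v, v ∈ S ↔ σ v ∈ S) (v : ι) {e : ℂ} (he : e ≠ 0)
    {ε : ℝ} (hε : ε = 1 ∨ ε = -1) {n : ℝ}
    (hn : ∀ x : ℝ, 0 < x → x < 1 → ∀ᶠ y : ℝ in 𝓝[>] 0,
      wind f σ S (f v + (x + ε * y * Complex.I) * e) = n) :
    ∃ κ₀ > 0, ∀ κ > 0, κ ≤ κ₀ → ∀ᶠ s : ℝ in 𝓝[>] 0,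
      wind f σ S (f v + s * ((1 + ε * (κ / 2 : ℝ) * Complex.I) * e)) = n := by
  obtain ⟨κ₀, hκ₀, H⟩ := h.exists_sector_disjoint (S := S) v he hε
  refine ⟨κ₀, hκ₀, fun κ hκ hle => ?_⟩
  obtain ⟨r, hr, hdis⟩ := H κ hκ hle
  set x₀ := min r 1 / 2 with hx₀
  have hx₀pos : 0 < x₀ := by positivity
  have hx₀r : x₀ < r := by have := min_le_left r 1; linarith
  have hx₀1 : x₀ < 1 := by have := min_le_right r 1; linarith
  have hsmall : ∀ᶠ y : ℝ in 𝓝[>] 0, y < κ * x₀ :=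
    mem_nhdsWithin_of_mem_nhds (Iio_mem_nhds (by positivity))
  obtain ⟨y, ⟨hy1, hy2⟩, hy3⟩ := ((hn x₀ hx₀pos hx₀1).and hsmall |>.and self_mem_nhdsWithin).exists
  have hy3 : 0 < y := hy3
  have hmem : f v + (x₀ + ε * y * Complex.I) * e ∈ sector (f v) e ε κ r :=
    ⟨(x₀, y), ⟨hx₀pos, hx₀r, hy3, hy2⟩, rfl⟩
  filter_upwards [self_mem_nhdsWithin, mem_nhdsWithin_of_mem_nhds (Iio_mem_nhds hr)] with s hs hsr
  have hs : 0 < s := hs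
  have hsr : s < r := hsr
  rw [← hy1]
  refine wind_eq_of_isPreconnected f σ hS (isPreconnected_sector _ _ _ _ _) hdis ?_ hmem
  refine ⟨(s, s * (κ / 2)), ⟨hs, hsr, by positivity, ?_⟩, ?_⟩
  · simp only
    nlinarith [mul_pos hs hκ]
  · simp only
    push_cast
    ring

/-- A nonpositive real quotient would make both edges at `f v` start in the same direction, so that
they overlap. -/
theorem direction_slitPlane (h : IsPlanarCurve f σ) (v : ι) :
    -(f (σ v) - f v) / (f (σ.symm v) - f v) ∈ Complex.slitPlane := by
  set u := f v with hu
  set a := f (σ.symm v) with ha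
  set b := f (σ v) with hb
  have hau : a - u ≠ 0 := sub_ne_zero.2 (h.inj.ne (h.symm_ne v))
  have hbu : b - u ≠ 0 := sub_ne_zero.2 (h.inj.ne (h.ne v))
  rw [Complex.mem_slitPlane_iff]
  by_contra! hcon
  set q := -(b - u) / (a - u) with hq
  have hqr : q = (q.re : ℂ) := Complex.ext (by simp) (by simp [hcon.2])
  have hb' : b - u = ((-q.re : ℝ) : ℂ) * (a - u) := by
    have : -(b - u) = (q.re : ℂ) * (a - u) := by rw [← hqr, hq, div_mul_cancel₀ _ hau]
    push_cast
    linear_combination -this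
  have ht : 0 < -q.re := by
    refine lt_of_le_of_ne (by linarith [hcon.1]) fun e => hbu ?_
    rw [hb', ← e]; simp
  set t := -q.re with htdef
  -- a common point of the two edges at `u`
  have hz1 : pointAt u b (1 / (2 * (1 + t))) ∈ openSegment ℝ u b :=
    mem_openSegment_iff_pointAt.2 ⟨_, by positivity, by rw [div_lt_one (by positivity)]; linarith, rfl⟩
  refine h.disj (h.symm_ne v).symm hz1 ?_
  rw [Equiv.apply_symm_apply, segment_symm, mem_segment_iff_pointAt]
  refine ⟨t / (2 * (1 + t)), by positivity, by rw [div_le_one (by positivity)]; linarith, ?_⟩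
  have h2 : (1 + (t : ℂ)) ≠ 0 := by exact_mod_cast (by positivity : (0 : ℝ) < 1 + t).ne'
  rw [pointAt, pointAt, hb']
  push_cast
  field_simp
  rw [← hu, ← ha]
  ring

/-- The winding number to the left of an edge agrees for consecutive edges. -/
theorem left_wind_eq (h : IsPlanarCurve f σ) (hS : ∀ v, v ∈ S ↔ σ v ∈ S) {v : ι} (hv : v ∈ S) {n₁ n₂ : ℤ}
    (h₁ : ∀ z ∈ openSegment ℝ (f (σ.symm v)) (f v), ∀ᶠ x in 𝓝 z,
      (0 < signedArea (f (σ.symm v)) (f v) x → wind f σ S x = n₁))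
    (h₂ : ∀ z ∈ openSegment ℝ (f v) (f (σ v)), ∀ᶠ x in 𝓝 z,
      (0 < signedArea (f v) (f (σ v)) x → wind f σ S x = n₂)) : n₁ = n₂ := by
  obtain ⟨R, hR⟩ := h.exists_wind_ray hS hv
  set u := f v with hu
  set a := f (σ.symm v) with ha
  set b := f (σ v) with hb
  have hau : a - u ≠ 0 := sub_ne_zero.2 (h.inj.ne (h.symm_ne v))
  have hbu : b - u ≠ 0 := sub_ne_zero.2 (h.inj.ne (h.ne v))
  have sq : ∀ {e : ℂ}, e ≠ 0 → 0 < e.re ^ 2 + e.im ^ 2 := by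
    intro e he
    have := Complex.normSq_pos.2 he
    rw [Complex.normSq_apply] at this
    nlinarith
  have tend : ∀ (x ε : ℝ) (e : ℂ), Tendsto (fun y : ℝ => u + (x + ε * y * Complex.I) * e) (𝓝[>] 0)
      (𝓝 (u + x * e)) := by
    intro x ε e
    have : Tendsto (fun y : ℝ => u + (x + ε * y * Complex.I) * e) (𝓝 0)
        (𝓝 (u + (x + ε * (0 : ℝ) * Complex.I) * e)) := Continuous.tendsto (by fun_prop) _
    simp only [Complex.ofReal_zero, mul_zero, zero_mul, add_zero] at this
    exact this.mono_left nhdsWithin_le_nhds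
  -- The left side of the incoming edge is clockwise from the direction `a - u`, hence `ε = -1`; for
  -- the outgoing edge, left is counterclockwise from `b - u`.
  obtain ⟨κ₁, hκ₁, H1⟩ := h.wind_in_sector hS v hau (ε := -1) (Or.inr rfl) (n := n₁) (by
    intro x hx0 hx1
    have hz : u + x * (a - u) ∈ openSegment ℝ a u := by
      rw [openSegment_symm, mem_openSegment_iff_pointAt]
      exact ⟨x, hx0, hx1, rfl⟩
    filter_upwards [(tend x (-1) (a - u)).eventually (h₁ _ hz), self_mem_nhdsWithin] with y hy hy0
    have hy0 : 0 < y := hy0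
    refine hy ?_
    have e : signedArea a u (u + (x + (-1 : ℝ) * y * Complex.I) * (a - u)) =
        y * ((a - u).re ^ 2 + (a - u).im ^ 2) := by
      simp [signedArea]; ring
    rw [e]
    exact mul_pos hy0 (sq hau))
  obtain ⟨κ₂, hκ₂, H2⟩ := h.wind_in_sector hS v hbu (ε := 1) (Or.inl rfl) (n := n₂) (by
    intro x hx0 hx1
    have hz : u + x * (b - u) ∈ openSegment ℝ u b := by
      rw [mem_openSegment_iff_pointAt]
      exact ⟨x, hx0, hx1, rfl⟩
    filter_upwards [(tend x 1 (b - u)).eventually (h₂ _ hz), self_mem_nhdsWithin] with y hy hy0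
    have hy0 : 0 < y := hy0
    refine hy ?_
    have e : signedArea u b (u + (x + (1 : ℝ) * y * Complex.I) * (b - u)) =
        y * ((b - u).re ^ 2 + (b - u).im ^ 2) := by
      simp [signedArea]; ring
    rw [e]
    exact mul_pos hy0 (sq hbu))
  -- choose a common opening that also avoids the edge directions
  set β := -(b - u) / (a - u) with hβ
  have hβs : β ∈ Complex.slitPlane := h.direction_slitPlane v
  obtain ⟨κ, hκ, hκ1, hκ2, hβκ⟩ : ∃ κ > 0, κ ≤ κ₁ ∧ κ ≤ κ₂ ∧
      β * (1 + (κ / 2 : ℝ) * Complex.I) ∈ Complex.slitPlane := by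
    have t : Tendsto (fun κ : ℝ => β * (1 + (κ / 2 : ℝ) * Complex.I)) (𝓝[>] 0) (𝓝 β) := by
      have : Tendsto (fun κ : ℝ => β * (1 + (κ / 2 : ℝ) * Complex.I)) (𝓝 0)
          (𝓝 (β * (1 + ((0 : ℝ) / 2 : ℝ) * Complex.I))) := Continuous.tendsto (by fun_prop) _
      simp only [zero_div, Complex.ofReal_zero, zero_mul, add_zero, mul_one] at this
      exact this.mono_left nhdsWithin_le_nhds
    have e1 := t.eventually (Complex.isOpen_slitPlane.mem_nhds hβs)
    have e2 : ∀ᶠ κ : ℝ in 𝓝[>] 0, κ < κ₁ := mem_nhdsWithin_of_mem_nhds (Iio_mem_nhds hκ₁)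
    have e3 : ∀ᶠ κ : ℝ in 𝓝[>] 0, κ < κ₂ := mem_nhdsWithin_of_mem_nhds (Iio_mem_nhds hκ₂)
    obtain ⟨κ, ⟨⟨k1, k2⟩, k3⟩, k4⟩ := (e1.and e2 |>.and e3 |>.and self_mem_nhdsWithin).exists
    exact ⟨κ, k4, k2.le, k3.le, k1⟩
  set ζ : ℂ := 1 + (κ / 2 : ℝ) * Complex.I with hζ
  set ζ' : ℂ := 1 - (κ / 2 : ℝ) * Complex.I with hζ'
  have hζim : ζ.im = κ / 2 := by simp [hζ]
  have hζim' : ζ'.im = -(κ / 2) := by simp [hζ']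
  have hζ0 : ζ ≠ 0 := fun e => by rw [e] at hζim; simp at hζim; linarith
  have hζ0' : ζ' ≠ 0 := fun e => by rw [e] at hζim'; simp at hζim'; linarith
  set N : ℝ := 1 + (κ / 2) ^ 2 with hN
  have hNpos : 0 < N := by positivity
  have hNmul : ζ * ζ' = (N : ℂ) := by
    simp only [hζ, hζ', hN]
    push_cast
    linear_combination -((κ : ℂ) / 2) ^ 2 * Complex.I_sq
  have hslit : -ζ' ∈ Complex.slitPlane := by
    rw [Complex.mem_slitPlane_iff]; right; rw [Complex.neg_im, hζim']; linarith
  -- For the ray beside the incoming edge the two arguments in `exists_wind_ray` are those of `-ζ'`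
  -- and `β * ζ`, up to positive factors. For the ray beside the outgoing edge they are the same in
  -- the other order, so the winding numbers agree.
  have e11 : -(ζ' * (a - u)) / (a - u) = -ζ' := by field_simp
  have e12 : (b - u) / -(ζ' * (a - u)) = ((N⁻¹ : ℝ) : ℂ) * (β * ζ) := by
    have hN0 : (N : ℂ) ≠ 0 := by exact_mod_cast hNpos.ne'
    rw [hβ]
    push_cast
    field_simp
    linear_combination hNmul
  have e21 : -(ζ * (b - u)) / (a - u) = β * ζ := by rw [hβ]; ring
  have e22 : (b - u) / -(ζ * (b - u)) = ((N⁻¹ : ℝ) : ℂ) * -ζ' := by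
    have hN0 : (N : ℂ) ≠ 0 := by exact_mod_cast hNpos.ne'
    push_cast
    field_simp
    linear_combination hNmul
  have scale : ∀ {x : ℂ}, x ∈ Complex.slitPlane → ((N⁻¹ : ℝ) : ℂ) * x ∈ Complex.slitPlane := by
    intro x hx
    rw [Complex.mem_slitPlane_iff] at hx ⊢
    rw [Complex.re_ofReal_mul, Complex.im_ofReal_mul]
    rcases hx with hx | hx
    · exact Or.inl (mul_pos (inv_pos.2 hNpos) hx)
    · exact Or.inr (mul_ne_zero (inv_pos.2 hNpos).ne' hx)
  have r1 := hR (ζ' * (a - u)) (mul_ne_zero hζ0' hau) (by rw [e11]; exact hslit)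
    (by rw [e12]; exact scale hβκ)
  have r2 := hR (ζ * (b - u)) (mul_ne_zero hζ0 hbu) (by rw [e21]; exact hβκ)
    (by rw [e22]; exact scale hslit)
  rw [e11, e12, Complex.arg_real_mul _ (inv_pos.2 hNpos)] at r1
  rw [e21, e22, Complex.arg_real_mul _ (inv_pos.2 hNpos)] at r2
  obtain ⟨s, ⟨⟨s1, s2⟩, s3⟩, s4⟩ := (r1.and r2 |>.and (H1 κ hκ hκ1) |>.and (H2 κ hκ hκ2)).exists
  have g1 : (1 + ((-1 : ℝ) : ℂ) * (κ / 2 : ℝ) * Complex.I) * (a - u) = ζ' * (a - u) := by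
    rw [hζ']; push_cast; ring
  have g2 : (1 + ((1 : ℝ) : ℂ) * (κ / 2 : ℝ) * Complex.I) * (b - u) = ζ * (b - u) := by
    rw [hζ]; push_cast; ring
  rw [g1] at s3
  rw [g2] at s4
  have e : R + (-ζ').arg + (β * ζ).arg = R + (β * ζ).arg + (-ζ').arg := by ring
  rw [e] at s1
  have : (n₁ : ℝ) = n₂ := s3.symm.trans (s1.trans (s2.symm.trans s4))
  exact_mod_cast this

end IsPlanarCurve

/-! ### Levels of the components -/

theorem mem_curve {ι : Type*} {f : ι → ℂ} {σ : Equiv.Perm ι} {S : Finset ι} {v : ι} {z : ℂ} (hv : v ∈ S)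
    (hz : z ∈ segment ℝ (f v) (f (σ v))) : z ∈ curve f σ S :=
  Set.mem_biUnion (Finset.mem_coe.2 hv) hz

theorem dense_compl_curve {ι : Type*} {f : ι → ℂ} {σ : Equiv.Perm ι} {S : Finset ι}
    (h : ∀ v ∈ S, f v ≠ f (σ v)) : Dense (curve f σ S)ᶜ := by
  have hd : Dense (⋂ v ∈ (S : Set ι), {x | signedArea (f v) (f (σ v)) x ≠ 0}) := by
    refine dense_biInter_of_isOpen (fun v _ => ?_) (Set.Finite.countable S.finite_toSet) fun v hv z => ?_
    · refine isOpen_ne_fun ?_ continuous_const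
      unfold signedArea
      fun_prop
    · by_cases hz : signedArea (f v) (f (σ v)) z = 0
      · rw [mem_closure_iff_frequently]
        exact (frequently_left (h v hv) z hz).mono fun x hx => hx.ne'
      · exact subset_closure hz
  refine hd.mono fun x hx hm => ?_
  obtain ⟨w, hw, hzw⟩ := Set.mem_iUnion₂.1 hm
  obtain ⟨t, -, -, rfl⟩ := mem_segment_iff_pointAt.1 hzw
  exact (Set.mem_iInter₂.1 hx) w hw (by simp [signedArea_pointAt, signedArea_left, signedArea_right])

theorem eventually_mem_openSegment_or {a b z : ℂ} (hz : z ∈ openSegment ℝ a b) (hab : a ≠ b) :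
    ∀ᶠ x in 𝓝 z, signedArea a b x = 0 → x ∈ openSegment ℝ a b := by
  obtain ⟨t, ht0, ht1, rfl⟩ := mem_openSegment_iff_pointAt.1 hz
  have hba : b - a ≠ 0 := sub_ne_zero.2 hab.symm
  have hc : Continuous fun x : ℂ => ((x - a) / (b - a)).re := by fun_prop
  have he : ((pointAt a b t - a) / (b - a)).re = t := by
    have : (pointAt a b t - a) / (b - a) = t := by rw [pointAt]; field_simp; ring
    rw [this, Complex.ofReal_re]
  have h1 : ∀ᶠ x in 𝓝 (pointAt a b t), ((x - a) / (b - a)).re ∈ Set.Ioo (0 : ℝ) 1 :=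
    hc.continuousAt.eventually (by simp only [he]; exact Ioo_mem_nhds ht0 ht1)
  filter_upwards [h1] with x hx hs
  rw [mem_openSegment_iff_pointAt]
  refine ⟨_, hx.1, hx.2, ?_⟩
  have him : ((x - a) / (b - a)).im = 0 := by
    have : ((x - a) / (b - a)).im = signedArea a b x / Complex.normSq (b - a) := by
      simp only [Complex.div_im, signedArea, Complex.sub_re, Complex.sub_im]
      ring
    rw [this, hs, zero_div]
  have : (((x - a) / (b - a)).re : ℂ) = (x - a) / (b - a) := Complex.ext (by simp) (by simp [him])
  rw [pointAt, this]
  field_simp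
  ring

/-- The part of a winding number on the levels of absolute value at least `k`. -/
def levelValue (k w : ℤ) : ℤ := (if k ≤ w then 1 else 0) - (if w ≤ -k then 1 else 0)

namespace IsPlanarCurve

variable {ι : Type*} [Fintype ι] {f : ι → ℂ} {σ : Equiv.Perm ι}

theorem exists_leftWind (h : IsPlanarCurve f σ) : ∃ lam : ι → ℤ, (∀ v, lam (σ v) = lam v) ∧
    ∀ v, ∀ z ∈ openSegment ℝ (f v) (f (σ v)), ∀ᶠ x in 𝓝 z,
      (0 < signedArea (f v) (f (σ v)) x → wind f σ Finset.univ x = lam v) ∧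
      (signedArea (f v) (f (σ v)) x < 0 → wind f σ Finset.univ x = lam v - 1) := by
  have hS : ∀ v, v ∈ (Finset.univ : Finset ι) ↔ σ v ∈ (Finset.univ : Finset ι) := by simp
  choose lam hlam using fun v => h.exists_edge_wind hS (Finset.mem_univ v)
  refine ⟨lam, fun v => ?_, hlam⟩
  refine (h.left_wind_eq hS (v := σ v) (Finset.mem_univ _) (n₁ := lam v) (n₂ := lam (σ v)) ?_ ?_).symm
  · rw [Equiv.symm_apply_apply]
    exact fun z hz => (hlam v z hz).mono fun x hx => hx.1
  · exact fun z hz => (hlam (σ v) z hz).mono fun x hx => hx.1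

/-- Across an edge, from right to left, the total winding number passes from `lam v - 1` to `lam v`.
This raises `levelValue k` by one if `max (lam v) (1 - lam v) = k` and leaves it unchanged
otherwise, just like the winding number of the selected components. So the difference of both sides
extends to a locally constant function off the finitely many vertices. Their complement is
connected, and the difference vanishes far away. -/
theorem wind_level (h : IsPlanarCurve f σ) {lam : ι → ℤ} (hlam : ∀ v, lam (σ v) = lam v)
    (hw : ∀ v, ∀ z ∈ openSegment ℝ (f v) (f (σ v)), ∀ᶠ x in 𝓝 z,
      (0 < signedArea (f v) (f (σ v)) x → wind f σ Finset.univ x = lam v) ∧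
      (signedArea (f v) (f (σ v)) x < 0 → wind f σ Finset.univ x = lam v - 1)) {k : ℤ} (hk : 1 ≤ k)
    {x : ℂ} (hx : x ∉ curve f σ Finset.univ) :
    wind f σ (Finset.univ.filter fun v => max (lam v) (1 - lam v) = k) x =
      levelValue k (round (wind f σ Finset.univ x)) := by
  classical
  have hU : ∀ v, v ∈ (Finset.univ : Finset ι) ↔ σ v ∈ (Finset.univ : Finset ι) := by simp
  set S := Finset.univ.filter fun v => max (lam v) (1 - lam v) = k with hSdef
  have hS : ∀ v, v ∈ S ↔ σ v ∈ S := by intro v; simp [hSdef, hlam]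
  have hdense := dense_compl_curve (S := Finset.univ) fun v _ => h.f_ne v
  set D : ℂ → ℝ := fun x => wind f σ S x - levelValue k (round (wind f σ Finset.univ x)) with hD
  have hsub : curve f σ S ⊆ curve f σ Finset.univ := by
    intro z hz
    obtain ⟨w, hw, hzw⟩ := Set.mem_iUnion₂.1 hz
    exact mem_curve (Finset.mem_univ w) hzw
  have hoff : ∀ z ∉ curve f σ Finset.univ, ∀ᶠ x in 𝓝 z, D x = D z := by
    intro z hz
    filter_upwards [eventually_wind_eq f σ hU hz, eventually_wind_eq f σ hS fun hm => hz (hsub hm)]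
      with x h1 h2
    simp only [hD, h1, h2]
  have hloc : ∀ p ∈ (Set.range f)ᶜ, ∃ c, ∀ᶠ x in 𝓝 p, x ∉ curve f σ Finset.univ → D x = c := by
    intro p hp
    by_cases hpc : p ∈ curve f σ Finset.univ
    · obtain ⟨v, -, hzv⟩ := Set.mem_iUnion₂.1 hpc
      have hz : p ∈ openSegment ℝ (f v) (f (σ v)) :=
        mem_openSegment_of_ne_left_right (fun e => hp ⟨v, e⟩) (fun e => hp ⟨_, e⟩) hzv
      have hseg := eventually_mem_openSegment_or hz (h.f_ne v)
      by_cases hv : v ∈ S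
      · have hvk : max (lam v) (1 - lam v) = k := by simpa [hSdef] using hv
        obtain ⟨n, hn⟩ := h.exists_edge_wind hS hv
        refine ⟨n - levelValue k (lam v), ?_⟩
        filter_upwards [hn p hz, hw v p hz, hseg] with x h1 h2 h3 hxc
        rcases lt_trichotomy (signedArea (f v) (f (σ v)) x) 0 with h0 | h0 | h0
        · have e : wind f σ Finset.univ x = ((lam v - 1 : ℤ) : ℝ) := by rw [h2.2 h0]; push_cast; ring
          simp only [hD, h1.2 h0, e, round_intCast]
          have : levelValue k (lam v - 1) = levelValue k (lam v) - 1 := by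
            unfold levelValue
            split_ifs <;> omega
          rw [this]; push_cast; ring
        · exact absurd (mem_curve (Finset.mem_univ v) (openSegment_subset_segment _ _ _ (h3 h0))) hxc
        · simp only [hD, h1.1 h0, h2.1 h0, round_intCast]
      · have hvk : max (lam v) (1 - lam v) ≠ k := by simpa [hSdef] using hv
        refine ⟨wind f σ S p - levelValue k (lam v), ?_⟩
        filter_upwards [eventually_wind_eq f σ hS (h.notMem_curve_of_notMem hv hz), hw v p hz, hseg]
          with x h1 h2 h3 hxc
        rcases lt_trichotomy (signedArea (f v) (f (σ v)) x) 0 with h0 | h0 | h0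
        · have e : wind f σ Finset.univ x = ((lam v - 1 : ℤ) : ℝ) := by rw [h2.2 h0]; push_cast; ring
          simp only [hD, h1, e, round_intCast]
          have : levelValue k (lam v - 1) = levelValue k (lam v) := by
            unfold levelValue
            split_ifs <;> omega
          rw [this]
        · exact absurd (mem_curve (Finset.mem_univ v) (openSegment_subset_segment _ _ _ (h3 h0))) hxc
        · simp only [hD, h1, h2.1 h0, round_intCast]
    · exact ⟨D p, (hoff p hpc).mono fun x hx _ => hx⟩
  have huniq : ∀ {p c c'}, (∀ᶠ x in 𝓝 p, x ∉ curve f σ Finset.univ → D x = c) →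
      (∀ᶠ x in 𝓝 p, x ∉ curve f σ Finset.univ → D x = c') → c = c' := by
    intro p c c' h1 h2
    obtain ⟨x, hx, h3⟩ := ((mem_closure_iff_frequently.1 (hdense p)).and_eventually (h1.and h2)).exists
    exact (h3.1 hx).symm.trans (h3.2 hx)
  -- `H` extends the difference `D` over the interiors of the edges. Its values are unique because
  -- the complement of the curve is dense.
  choose! H hH using hloc
  have hconn : IsPreconnected (Set.range f)ᶜ := by
    refine (Set.Countable.isPathConnected_compl_of_one_lt_rank ?_
      (Set.finite_range f).countable).isConnected.isPreconnected
    rw [Complex.rank_real_complex]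
    norm_num
  have hHloc : ∀ p ∈ (Set.range f)ᶜ, ∀ᶠ x in 𝓝[(Set.range f)ᶜ] p, H x = H p := by
    intro p hp
    have := (eventually_eventually_nhds.2 (hH p hp))
    filter_upwards [this.filter_mono nhdsWithin_le_nhds, self_mem_nhdsWithin] with x hx hx'
    exact huniq (hH x hx') hx
  have hHD : ∀ p ∉ curve f σ Finset.univ, p ∈ (Set.range f)ᶜ ∧ H p = D p := by
    intro p hp
    have hp' : p ∈ (Set.range f)ᶜ := by
      rintro ⟨v, rfl⟩
      exact hp (mem_curve (Finset.mem_univ v) (left_mem_segment _ _ _))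
    exact ⟨hp', huniq (hH p hp') ((hoff p hp).mono fun x hx _ => hx)⟩
  -- The point `M * I` lies above all vertices, so both winding numbers vanish there.
  obtain ⟨M, hM⟩ : ∃ M : ℝ, ∀ v, (f v).im < M := by
    obtain ⟨M, hM⟩ := (Set.finite_range fun v => (f v).im).bddAbove
    exact ⟨M + 1, fun v => (hM ⟨v, rfl⟩).trans_lt (lt_add_one M)⟩
  have hfar : ∀ v, signedArea 0 1 (f v) < signedArea 0 1 (M * Complex.I) := by
    intro v
    simpa [signedArea] using hM v
  have hMc : (M * Complex.I : ℂ) ∉ curve f σ Finset.univ := by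
    intro hm
    obtain ⟨w, hw, hzw⟩ := Set.mem_iUnion₂.1 hm
    obtain ⟨t, ht0, ht1, e⟩ := mem_segment_iff_pointAt.1 hzw
    have h1 := hfar w
    have h2 := hfar (σ w)
    have h3 : signedArea 0 1 (M * Complex.I) = (1 - t) * signedArea 0 1 (f w) + t * signedArea 0 1 (f (σ w)) := by
      rw [← e]
      simp only [signedArea, pointAt_re, pointAt_im]
      simp
      ring
    rcases ht0.eq_or_lt with rfl | ht0
    · linarith
    · nlinarith [mul_pos ht0 (sub_pos.2 h2), mul_nonneg (sub_nonneg.2 ht1) (sub_pos.2 h1).le]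
  have hzero : D (M * Complex.I) = 0 := by
    simp only [hD]
    rw [wind_eq_zero f σ hS fun v _ => hfar v, wind_eq_zero f σ hU fun v _ => hfar v]
    have : levelValue k (round (0 : ℝ)) = 0 := by
      rw [round_zero]
      unfold levelValue
      split_ifs <;> omega
    rw [this]; simp
  have e := hconn.eq_of_eventually_eq hHloc (hHD x hx).1 (hHD _ hMc).1
  rw [(hHD x hx).2, (hHD _ hMc).2, hzero] at e
  exact sub_eq_zero.1 e

/-- The components of a planar curve are distributed to levels; in each level the winding
number is at most one in absolute value, and it vanishes on the components of smaller level. -/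
theorem exists_level (h : IsPlanarCurve f σ) : ∃ lev : ι → ℤ, (∀ v, lev (σ v) = lev v) ∧ ∀ k,
    (∀ x ∉ curve f σ (Finset.univ.filter (lev · = k)),
      wind f σ (Finset.univ.filter (lev · = k)) x = 0 ∨ wind f σ (Finset.univ.filter (lev · = k)) x = 1 ∨
        wind f σ (Finset.univ.filter (lev · = k)) x = -1) ∧
    ∀ v, lev v < k → ∀ z ∈ segment ℝ (f v) (f (σ v)),
      z ∉ curve f σ (Finset.univ.filter (lev · = k)) ∧ wind f σ (Finset.univ.filter (lev · = k)) z = 0 := by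
  classical
  obtain ⟨lam, hlam, hw⟩ := h.exists_leftWind
  -- This is the larger absolute value of the winding numbers `lam v` and `lam v - 1` on the two
  -- sides of the edge. It is at least 1, so smaller `k` belong to no component.
  refine ⟨fun v => max (lam v) (1 - lam v), fun v => by simp only [hlam], fun k => ?_⟩
  set S := Finset.univ.filter fun v => max (lam v) (1 - lam v) = k with hSdef
  have hS : ∀ v, v ∈ S ↔ σ v ∈ S := by intro v; simp [hSdef, hlam]
  have hdense := dense_compl_curve (S := Finset.univ) fun v _ => h.f_ne v
  rcases lt_or_ge k 1 with hk | hk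
  · have hempty : S = ∅ := by
      ext v
      simp only [hSdef, Finset.mem_filter, Finset.mem_univ, true_and, Finset.notMem_empty, iff_false]
      omega
    rw [hempty]
    simp [wind, curve]
  have key := fun x hx => h.wind_level hlam hw hk (x := x) hx
  refine ⟨fun x hx => ?_, fun v hv => ?_⟩
  · obtain ⟨y, hy, e⟩ := ((mem_closure_iff_frequently.1 (hdense x)).and_eventually
      (eventually_wind_eq f σ hS hx)).exists
    rw [← e, key y hy]
    generalize round (wind f σ Finset.univ y) = n
    have : levelValue k n = 0 ∨ levelValue k n = 1 ∨ levelValue k n = -1 := by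
      unfold levelValue
      split_ifs <;> simp
    rcases this with e | e | e <;> simp [e]
  · simp only at hv
    have hvS : v ∉ S := by simp only [hSdef, Finset.mem_filter, Finset.mem_univ, true_and]; omega
    have hvS' : σ v ∉ S := fun hm => hvS ((hS v).2 hm)
    have hvS'' : σ.symm v ∉ S := fun hm => hvS (by simpa using (hS _).1 hm)
    have hvertex : ∀ v, v ∉ S → f v ∉ curve f σ S := by
      intro v hv hm
      obtain ⟨w, hw, hzw⟩ := Set.mem_iUnion₂.1 hm
      refine h.vertex_notMem_segment ?_ ?_ hzw
      · rintro rfl; exact hv hw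
      · rintro rfl; exact hv (by simpa using (hS _).1 hw)
    have hoff : ∀ z ∈ segment ℝ (f v) (f (σ v)), z ∉ curve f σ S := by
      intro z hz
      rw [← insert_endpoints_openSegment] at hz
      rcases hz with rfl | rfl | hz
      · exact hvertex _ hvS
      · exact hvertex _ hvS'
      · exact h.notMem_curve_of_notMem hvS hz
    refine fun z hz => ⟨hoff z hz, ?_⟩
    have hm : pointAt (f v) (f (σ v)) (1 / 2) ∈ openSegment ℝ (f v) (f (σ v)) :=
      mem_openSegment_iff_pointAt.2 ⟨_, by norm_num, by norm_num, rfl⟩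
    rw [wind_eq_of_isPreconnected f σ hS (convex_segment _ _).isPreconnected hoff hz
      (openSegment_subset_segment _ _ _ hm)]
    obtain ⟨y, hy, ⟨e1, e2⟩, e3⟩ := ((mem_closure_iff_frequently.1 (hdense _)).and_eventually
      ((hw v _ hm).and ((eventually_mem_openSegment_or hm (h.f_ne v)).and
        (eventually_wind_eq f σ hS (hoff _ (openSegment_subset_segment _ _ _ hm))))) |>.mono
          fun y hy => (⟨hy.1, hy.2.1, hy.2.2⟩ : _ ∧ _ ∧ _)).exists
    obtain ⟨e3, e4⟩ := e3
    rw [← e4, key y hy]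
    -- Next to an edge of smaller level both winding numbers have absolute value below `k`.
    have hval : ∀ n : ℤ, n = lam v ∨ n = lam v - 1 → levelValue k n = 0 := by
      intro n hn
      unfold levelValue
      split_ifs <;> omega
    rcases lt_trichotomy (signedArea (f v) (f (σ v)) y) 0 with h0 | h0 | h0
    · have e : wind f σ Finset.univ y = ((lam v - 1 : ℤ) : ℝ) := by rw [e2 h0]; push_cast; ring
      rw [e, round_intCast, hval _ (Or.inr rfl)]
      simp
    · exact absurd (mem_curve (Finset.mem_univ v) (openSegment_subset_segment _ _ _ (e3 h0))) hy
    · rw [e1 h0, round_intCast, hval _ (Or.inl rfl)]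
      simp

end IsPlanarCurve

/-! ### Inner triangles of one level -/

theorem continuous_signedArea (a b : ℂ) : Continuous (signedArea a b) := by
  unfold signedArea
  fun_prop

theorem signedArea_of_mem_openSegment {a b z : ℂ} (hz : z ∈ openSegment ℝ a b) :
    signedArea a b z = 0 := by
  obtain ⟨t, -, -, rfl⟩ := mem_openSegment_iff_pointAt.1 hz
  rw [signedArea_pointAt]; simp

theorem convex_signedArea_pos (a b : ℂ) : Convex ℝ {z | 0 < signedArea a b z} := by
  intro x hx y hy s t hs ht hst
  simp only [Set.mem_ofPred_eq] at *
  have : signedArea a b (s • x + t • y) = s * signedArea a b x + t * signedArea a b y := by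
    simp only [signedArea, Complex.add_re, Complex.add_im, Complex.real_smul, Complex.mul_re,
      Complex.mul_im, Complex.ofReal_re, Complex.ofReal_im]
    obtain rfl : s = 1 - t := by linarith
    ring
  rw [this]
  rcases hs.eq_or_lt with rfl | hs
  · obtain rfl : t = 1 := by linarith
    simpa using hy
  · nlinarith [mul_pos hs hx, mul_nonneg ht hy.le]

theorem isPreconnected_insideTriangle (a b c : ℂ) : IsPreconnected {z | InsideTriangle a b c z} :=
  (((convex_signedArea_pos a b).inter (convex_signedArea_pos b c)).inter
    (convex_signedArea_pos c a)).isPreconnected |> fun h => by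
      convert h using 1
      ext z
      simp [InsideTriangle, and_assoc]

theorem IsEmptyTriangle.eventually_inside {V : Finset ℂ} {F : ℂ → ℂ → Prop} {a b c z : ℂ}
    (h : IsEmptyTriangle V F a b c) (hz : z ∈ openSegment ℝ a b) :
    ∀ᶠ x in 𝓝 z, 0 < signedArea a b x → InsideTriangle a b c x := by
  obtain ⟨t, ht0, ht1, rfl⟩ := mem_openSegment_iff_pointAt.1 hz
  have h1 : 0 < signedArea b c (pointAt a b t) := by
    rw [signedArea_pointAt, signedArea_left, signedArea_cyc]
    nlinarith [h.pos]
  have h2 : 0 < signedArea c a (pointAt a b t) := by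
    rw [signedArea_pointAt, signedArea_right, ← signedArea_cyc, signedArea_cyc, signedArea_cyc]
    nlinarith [h.pos, signedArea_cyc a b c, signedArea_cyc b c a, signedArea_cyc c a b]
  filter_upwards [(continuous_signedArea b c).continuousAt.eventually (lt_mem_nhds h1),
    (continuous_signedArea c a).continuousAt.eventually (lt_mem_nhds h2)] with x e1 e2 e3
  exact ⟨e3, e1, e2⟩

theorem midpoint_mem_openSegment' (a b : ℂ) : pointAt a b (1 / 2) ∈ openSegment ℝ a b :=
  mem_openSegment_iff_pointAt.2 ⟨_, by norm_num, by norm_num, rfl⟩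

section Symm

variable {ι : Type*} {f : ι → ℂ} {σ : Equiv.Perm ι} {S : Finset ι}

theorem curve_symm (hS : ∀ v, v ∈ S ↔ σ v ∈ S) : curve f σ.symm S = curve f σ S := by
  apply Set.Subset.antisymm
  · intro z hz
    obtain ⟨w, hw, hzw⟩ := Set.mem_iUnion₂.1 hz
    rw [segment_symm] at hzw
    exact mem_curve (v := σ.symm w) ((hS _).2 (by simpa using hw)) (by simpa using hzw)
  · intro z hz
    obtain ⟨w, hw, hzw⟩ := Set.mem_iUnion₂.1 hz
    rw [segment_symm] at hzw
    exact mem_curve (v := σ w) ((hS _).1 hw) (by simpa using hzw)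

/-- Off the curve no argument equals `π`, so inverting a quotient changes the sign of its argument.
-/
theorem wind_symm (hS : ∀ v, v ∈ S ↔ σ v ∈ S) {x : ℂ} (hx : x ∉ curve f σ S) :
    wind f σ.symm S x = -wind f σ S x := by
  have h1 : ∑ v ∈ S, ((f (σ.symm v) - x) / (f v - x)).arg =
      ∑ v ∈ S, ((f v - x) / (f (σ v) - x)).arg :=
    (Finset.sum_equiv (s := S) (t := S) (f := fun v => ((f v - x) / (f (σ v) - x)).arg)
      (g := fun v => ((f (σ.symm v) - x) / (f v - x)).arg) σ hS (fun v _ => by simp)).symm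
  have h2 : ∀ v ∈ S, ((f v - x) / (f (σ v) - x)).arg = -((f (σ v) - x) / (f v - x)).arg := by
    intro v hv
    rw [← inv_div, Complex.arg_inv, if_neg]
    refine (Complex.mem_slitPlane_iff_arg.1 (mem_slitPlane_of_notMem_segment
      (ne_of_notMem_curve f σ hx v hv) fun hm => hx (mem_curve hv hm))).1
  rw [wind, wind, h1, Finset.sum_congr rfl h2, Finset.sum_neg_distrib, neg_div]

theorem IsPlanarCurve.symm (h : IsPlanarCurve f σ) : IsPlanarCurve f σ.symm where
  inj := h.inj
  ne := h.symm_ne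
  disj {v w z} hvw hz hz' := by
    rw [openSegment_symm] at hz
    rw [segment_symm] at hz'
    exact h.disj (v := σ.symm v) (w := σ.symm w) (σ.symm.injective.ne hvw) (by simpa using hz)
      (by simpa using hz')

end Symm

/-- A planar curve with winding numbers of absolute value at most one, and a maximal noncrossing
system of segments containing its edges. -/
structure IsLevelCurve {ι : Type*} [DecidableEq ι] (f : ι → ℂ) (σ : Equiv.Perm ι) (S : Finset ι) (F : ℂ → ℂ → Prop) :
    Prop where
  curve : IsPlanarCurve f σ
  inv : ∀ v, v ∈ S ↔ σ v ∈ S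
  max : IsMaximalNoncrossing (S.image f) F
  edge : ∀ {v}, v ∈ S → F (f v) (f (σ v))
  val : ∀ x ∉ _root_.curve f σ S, wind f σ S x = 0 ∨ wind f σ S x = 1 ∨ wind f σ S x = -1

/-- An empty triangle in which the winding number is one. -/
structure IsInnerTriangle {ι : Type*} [DecidableEq ι] (f : ι → ℂ) (σ : Equiv.Perm ι) (S : Finset ι)
    (F : ℂ → ℂ → Prop) (a b c : ι) : Prop where
  mem₁ : a ∈ S
  mem₂ : b ∈ S
  mem₃ : c ∈ S
  empty : IsEmptyTriangle (S.image f) F (f a) (f b) (f c)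
  wind : ∀ z, InsideTriangle (f a) (f b) (f c) z → wind f σ S z = 1

section Level

variable {ι : Type*} [DecidableEq ι] {f : ι → ℂ} {σ : Equiv.Perm ι} {S : Finset ι} {F : ℂ → ℂ → Prop}

theorem IsInnerTriangle.rotate {a b c : ι} (h : IsInnerTriangle f σ S F a b c) :
    IsInnerTriangle f σ S F b c a :=
  ⟨h.mem₂, h.mem₃, h.mem₁, h.empty.rotate, fun z hz => h.wind z hz.rotate.rotate⟩

theorem IsInnerTriangle.eventually_wind {a b c : ι} (h : IsInnerTriangle f σ S F a b c) {z : ℂ}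
    (hz : z ∈ openSegment ℝ (f a) (f b)) :
    ∀ᶠ x in 𝓝 z, 0 < signedArea (f a) (f b) x → _root_.wind f σ S x = 1 :=
  (h.empty.eventually_inside hz).mono fun x hx hx' => h.wind x (hx hx')

namespace IsLevelCurve

/-- Reversal exchanges the winding numbers 1 and -1. What is proved for inner triangles thereby
applies to the regions of winding number -1. -/
theorem symm (h : IsLevelCurve f σ S F) : IsLevelCurve f σ.symm S F where
  curve := h.curve.symm
  inv v := by rw [h.inv (σ.symm v)]; simp
  max := h.max
  edge {v} hv := by
    have := h.max.symm (h.edge ((h.inv (σ.symm v)).2 (by simpa using hv)))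
    simpa using this
  val x hx := by
    rw [curve_symm h.inv] at hx
    rw [wind_symm h.inv hx]
    rcases h.val x hx with e | e | e <;> simp [e]

theorem notMem_curve_of_inside (h : IsLevelCurve f σ S F) {a b c z : ℂ}
    (ht : IsEmptyTriangle (S.image f) F a b c) (hz : InsideTriangle a b c z) :
    z ∉ _root_.curve f σ S := by
  intro hm
  obtain ⟨w, hw, hzw⟩ := Set.mem_iUnion₂.1 hm
  rw [← insert_endpoints_openSegment] at hzw
  rcases hzw with rfl | rfl | hzw
  · exact IsMaximalNoncrossing.not_inside_of_mem ht (Finset.mem_image_of_mem f hw) hz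
  · exact IsMaximalNoncrossing.not_inside_of_mem ht (Finset.mem_image_of_mem f ((h.inv w).1 hw)) hz
  · exact h.max.not_inside ht (h.edge hw) hzw hz

theorem wind_eq_of_inside (h : IsLevelCurve f σ S F) {a b c z z' : ℂ}
    (ht : IsEmptyTriangle (S.image f) F a b c) (hz : InsideTriangle a b c z) (hz' : InsideTriangle a b c z') :
    wind f σ S z = wind f σ S z' :=
  wind_eq_of_isPreconnected f σ h.inv (isPreconnected_insideTriangle a b c)
    (fun _ hx => h.notMem_curve_of_inside ht hx) hz hz'

/-- Where the winding number is one to the left of a segment of the system there is an inner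
triangle. -/
theorem exists_innerTriangle (h : IsLevelCurve f σ S F) {a b : ι} (ha : a ∈ S) (hb : b ∈ S)
    (hab : F (f a) (f b)) {z : ℂ} (hz : z ∈ openSegment ℝ (f a) (f b))
    (hw : ∃ᶠ x in 𝓝 z, 0 < signedArea (f a) (f b) x ∧ wind f σ S x = 1) :
    ∃ c, IsInnerTriangle f σ S F a b c := by
  have hex : ∃ y ∈ S.image f, 0 < signedArea (f a) (f b) y := by
    by_contra! hcon
    obtain ⟨x, h1, h2⟩ := hw.exists
    rw [wind_eq_zero f σ h.inv fun v hv => (hcon _ (Finset.mem_image_of_mem f hv)).trans_lt h1] at h2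
    exact zero_ne_one h2
  obtain ⟨r, hr⟩ := h.max.exists_emptyTriangle hab hex
  obtain ⟨c, hc, rfl⟩ := Finset.mem_image.1 (h.max.mem hr.ca)
  obtain ⟨x, ⟨h1, h2⟩, h3⟩ := (hw.and_eventually (hr.eventually_inside hz)).exists
  exact ⟨c, ha, hb, hc, hr, fun y hy => by rw [h.wind_eq_of_inside hr hy (h3 h1), h2]⟩

theorem eventually_notMem_curve (h : IsLevelCurve f σ S F) {v : ι} {z : ℂ}
    (hz : z ∈ openSegment ℝ (f v) (f (σ v))) :
    ∀ᶠ x in 𝓝 z, signedArea (f v) (f (σ v)) x ≠ 0 → x ∉ _root_.curve f σ S := by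
  have hcl : z ∉ _root_.curve f σ (S.erase v) := h.curve.notMem_curve_of_notMem (by simp) hz
  filter_upwards [(isClosed_curve f σ _).isOpen_compl.mem_nhds hcl] with x hx hx' hm
  obtain ⟨w, hw, hzw⟩ := Set.mem_iUnion₂.1 hm
  by_cases hwv : w = v
  · subst hwv
    obtain ⟨t, -, -, rfl⟩ := mem_segment_iff_pointAt.1 hzw
    exact hx' (by rw [signedArea_pointAt]; simp)
  · exact hx (mem_curve (Finset.mem_erase.2 ⟨hwv, hw⟩) hzw)

/-- The values on the two sides differ by one and are both among 0, 1 and -1, which leaves two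
possibilities for the left one. -/
theorem exists_edge_wind (h : IsLevelCurve f σ S F) {v : ι} (hv : v ∈ S) :
    ∃ n : ℤ, (n = 0 ∨ n = 1) ∧ ∀ z ∈ openSegment ℝ (f v) (f (σ v)), ∀ᶠ x in 𝓝 z,
      (0 < signedArea (f v) (f (σ v)) x → wind f σ S x = n) ∧
      (signedArea (f v) (f (σ v)) x < 0 → wind f σ S x = n - 1) := by
  obtain ⟨n, hn⟩ := h.curve.exists_edge_wind h.inv hv
  refine ⟨n, ?_, hn⟩
  have hz := midpoint_mem_openSegment' (f v) (f (σ v))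
  have hne := h.curve.f_ne v
  have hs := signedArea_of_mem_openSegment hz
  obtain ⟨x, h1, h2, h3⟩ := ((frequently_left hne _ hs).and_eventually
    ((hn _ hz).and (h.eventually_notMem_curve hz))).exists
  have hs' : signedArea (f (σ v)) (f v) (pointAt (f v) (f (σ v)) (1 / 2)) = 0 := by
    rw [signedArea_swap, hs, neg_zero]
  obtain ⟨y, k1, k2, k3⟩ := ((frequently_left hne.symm _ hs').and_eventually
    ((hn _ hz).and (h.eventually_notMem_curve hz))).exists
  rw [signedArea_swap, neg_pos] at k1
  have e1 := h.val x (h3 h1.ne')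
  have e2 := h.val y (k3 k1.ne)
  rw [h2.1 h1] at e1
  rw [k2.2 k1] at e2
  have e1 : n = 0 ∨ n = 1 ∨ n = -1 := by exact_mod_cast e1
  have e2 : n - 1 = 0 ∨ n - 1 = 1 ∨ n - 1 = -1 := by exact_mod_cast e2
  omega

theorem edge_left (h : IsLevelCurve f σ S F) {v : ι} (hv : v ∈ S) {n : ℤ}
    (hn : ∀ z ∈ openSegment ℝ (f v) (f (σ v)), ∀ᶠ x in 𝓝 z,
      (0 < signedArea (f v) (f (σ v)) x → wind f σ S x = n) ∧
      (signedArea (f v) (f (σ v)) x < 0 → wind f σ S x = n - 1)) :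
    (∃ c, IsInnerTriangle f σ S F v (σ v) c) ↔ n = 1 := by
  have hz := midpoint_mem_openSegment' (f v) (f (σ v))
  have hs := signedArea_of_mem_openSegment hz
  have hne := h.curve.f_ne v
  constructor
  · rintro ⟨c, hc⟩
    obtain ⟨x, h1, h2, h3⟩ := ((frequently_left hne _ hs).and_eventually
      ((hn _ hz).and (hc.eventually_wind hz))).exists
    have := h3 h1
    rw [h2.1 h1] at this
    exact_mod_cast this
  · rintro rfl
    refine h.exists_innerTriangle hv ((h.inv v).1 hv) (h.edge hv) hz ?_
    exact ((frequently_left hne _ hs).and_eventually (hn _ hz)).mono fun x hx =>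
      ⟨hx.1, by simpa using hx.2.1 hx.1⟩

/-- On the right of an edge the winding number is 0 or -1. -/
theorem not_inner_backward (h : IsLevelCurve f σ S F) {v c : ι} :
    ¬ IsInnerTriangle f σ S F (σ v) v c := by
  intro hc
  obtain ⟨n, hn01, hn⟩ := h.exists_edge_wind hc.mem₂
  have hz := midpoint_mem_openSegment' (f v) (f (σ v))
  have hs' : signedArea (f (σ v)) (f v) (pointAt (f v) (f (σ v)) (1 / 2)) = 0 := by
    rw [signedArea_swap, signedArea_of_mem_openSegment hz, neg_zero]
  obtain ⟨x, h1, h2, h3⟩ := ((frequently_left (h.curve.f_ne v).symm _ hs').and_eventually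
    ((hn _ hz).and (hc.eventually_wind (by rw [openSegment_symm]; exact hz)))).exists
  have e := h3 h1
  rw [signedArea_swap, neg_pos] at h1
  rw [h2.2 h1] at e
  have : n - 1 = 1 := by exact_mod_cast e
  omega

/-- Either the left side has winding number 1, or the right side has winding number -1 and is an
inner side of the reversed curve. -/
theorem exists_inner_edge (h : IsLevelCurve f σ S F) {v : ι} (hv : v ∈ S) :
    (∃ c, IsInnerTriangle f σ S F v (σ v) c) ∨ ∃ c, IsInnerTriangle f σ.symm S F (σ v) v c := by
  obtain ⟨n, hn01, hn⟩ := h.exists_edge_wind hv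
  rcases hn01 with rfl | rfl
  · right
    have hz := midpoint_mem_openSegment' (f v) (f (σ v))
    have hs' : signedArea (f (σ v)) (f v) (pointAt (f v) (f (σ v)) (1 / 2)) = 0 := by
      rw [signedArea_swap, signedArea_of_mem_openSegment hz, neg_zero]
    refine h.symm.exists_innerTriangle ((h.inv v).1 hv) hv (h.max.symm (h.edge hv))
      (by rw [openSegment_symm]; exact hz) ?_
    refine ((frequently_left (h.curve.f_ne v).symm _ hs').and_eventually
      ((hn _ hz).and (h.eventually_notMem_curve hz))).mono ?_
    rintro x ⟨h1, h2, h3⟩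
    have h4 := h1
    rw [signedArea_swap, neg_pos] at h4
    refine ⟨h1, ?_⟩
    rw [wind_symm h.inv (h3 h4.ne), h2.2 h4]
    norm_num
  · exact Or.inl ((h.edge_left hv hn).2 rfl)

/-- The curve is positively oriented along consecutive edges simultaneously. -/
theorem exists_inner_prev (h : IsLevelCurve f σ S F) {v c : ι} (hc : IsInnerTriangle f σ S F v (σ v) c) :
    ∃ d, IsInnerTriangle f σ S F (σ.symm v) v d := by
  have hw : σ.symm v ∈ S := (h.inv _).2 (by simpa using hc.mem₁)
  obtain ⟨n, -, hn⟩ := h.exists_edge_wind hc.mem₁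
  obtain ⟨m, -, hm⟩ := h.exists_edge_wind hw
  have e1 := h.edge_left hw hm
  have e2 := h.edge_left hc.mem₁ hn
  simp only [Equiv.apply_symm_apply] at hm e1
  have := h.curve.left_wind_eq h.inv hc.mem₁ (fun z hz => (hm z hz).mono fun x hx => hx.1)
    (fun z hz => (hn z hz).mono fun x hx => hx.1)
  exact e1.2 (this.trans (e2.1 ⟨c, hc⟩))

theorem notMem_curve_of_mem_segment (h : IsLevelCurve f σ S F) {a b : ι} (hab : F (f a) (f b))
    (h1 : b ≠ σ a) (h2 : a ≠ σ b) {z : ℂ} (hz : z ∈ openSegment ℝ (f a) (f b)) :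
    z ∉ _root_.curve f σ S := by
  intro hm
  obtain ⟨w, hw, hzw⟩ := Set.mem_iUnion₂.1 hm
  rw [← insert_endpoints_openSegment] at hzw
  rcases hzw with rfl | rfl | hzw
  · exact h.max.free hab hz (Finset.mem_image_of_mem f hw)
  · exact h.max.free hab hz (Finset.mem_image_of_mem f ((h.inv w).1 hw))
  · rcases h.max.disj hab (h.edge hw) hz hzw with ⟨e1, e2⟩ | ⟨e1, e2⟩
    · have e1 := h.curve.inj e1
      have e2 := h.curve.inj e2
      subst e1
      exact h1 e2.symm
    · have e1 := h.curve.inj e1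
      have e2 := h.curve.inj e2
      subst e1
      exact h2 e2.symm

theorem wind_eq_one (h : IsLevelCurve f σ S F) {a b c : ι} (ht : IsInnerTriangle f σ S F a b c) {z : ℂ}
    (hz : z ∈ openSegment ℝ (f a) (f b)) (hzc : z ∉ _root_.curve f σ S) : wind f σ S z = 1 := by
  obtain ⟨x, h1, h2, h3⟩ := ((frequently_left (h.max.ne ht.empty.ab) _
    (signedArea_of_mem_openSegment hz)).and_eventually
      ((ht.eventually_wind hz).and (eventually_wind_eq f σ h.inv hzc))).exists
  rw [← h3, h2 h1]

/-- A segment of the system that is not an edge has its interior off the curve. The winding number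
is then 1 on its other side too, so a triangle lies there. -/
theorem exists_opposite (h : IsLevelCurve f σ S F) {a b c : ι} (ht : IsInnerTriangle f σ S F a b c)
    (hab : b ≠ σ a) : ∃ d, IsInnerTriangle f σ S F b a d := by
  have hba : a ≠ σ b := by rintro rfl; exact h.not_inner_backward ht
  have hz := midpoint_mem_openSegment' (f a) (f b)
  have hzc := h.notMem_curve_of_mem_segment ht.empty.ab hab hba hz
  have hs' : signedArea (f b) (f a) (pointAt (f a) (f b) (1 / 2)) = 0 := by
    rw [signedArea_swap, signedArea_of_mem_openSegment hz, neg_zero]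
  refine h.exists_innerTriangle ht.mem₂ ht.mem₁ (h.max.symm ht.empty.ab)
    (by rw [openSegment_symm]; exact hz) ?_
  refine ((frequently_left (h.max.ne ht.empty.ab).symm _ hs').and_eventually
    (eventually_wind_eq f σ h.inv hzc)).mono fun x hx => ⟨hx.1, hx.2.trans (h.wind_eq_one ht hz hzc)⟩

/-- Two inner triangles to the left of one segment share interior points close to its midpoint, so
they have the same corners. -/
theorem inner_unique (h : IsLevelCurve f σ S F) {a b c d : ι} (hc : IsInnerTriangle f σ S F a b c)
    (hd : IsInnerTriangle f σ S F a b d) : c = d := by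
  have hz := midpoint_mem_openSegment' (f a) (f b)
  obtain ⟨x, h1, h2, h3⟩ := ((frequently_left (h.max.ne hc.empty.ab) _
    (signedArea_of_mem_openSegment hz)).and_eventually
      ((hc.empty.eventually_inside hz).and (hd.empty.eventually_inside hz))).exists
  have hin := h3 h1
  have e := h.max.eq_of_inside hc.empty hd.empty (h2 h1) hin.1.le hin.2.1.le hin.2.2.le
  have : f c ∈ ({f a, f b, f d} : Set ℂ) := by rw [← e]; simp
  rcases this with e | e | e
  · exact absurd e (h.max.ne hc.empty.ca)
  · exact absurd e.symm (h.max.ne hc.empty.bc)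
  · exact h.curve.inj e

/-- Triangles of opposite orientations do not meet along a segment. -/
theorem not_inner_symm (h : IsLevelCurve f σ S F) {a b c d : ι} (hc : IsInnerTriangle f σ S F a b c)
    (hd : IsInnerTriangle f σ.symm S F b a d) : False := by
  have hz := midpoint_mem_openSegment' (f a) (f b)
  have hz' := hz
  rw [openSegment_symm] at hz'
  by_cases h2 : a = σ b
  · subst h2
    exact h.not_inner_backward hc
  by_cases h1 : b = σ a
  · subst h1
    obtain ⟨n, hn01, hn⟩ := h.exists_edge_wind hc.mem₁
    have e1 := (h.edge_left hc.mem₁ hn).1 ⟨c, hc⟩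
    have hs' : signedArea (f (σ a)) (f a) (pointAt (f a) (f (σ a)) (1 / 2)) = 0 := by
      rw [signedArea_swap, signedArea_of_mem_openSegment hz, neg_zero]
    obtain ⟨x, k1, k2, k3, k4⟩ := ((frequently_left (h.curve.f_ne a).symm _ hs').and_eventually
      ((hn _ hz).and ((hd.eventually_wind hz').and (h.eventually_notMem_curve hz)))).exists
    have e := k3 k1
    rw [signedArea_swap, neg_pos] at k1
    rw [wind_symm h.inv (k4 k1.ne), k2.2 k1, e1] at e
    norm_num at e
  have hzc := h.notMem_curve_of_mem_segment hc.empty.ab h1 h2 hz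
  have e1 := h.wind_eq_one hc hz hzc
  have e2 := h.symm.wind_eq_one hd hz' (by rwa [curve_symm h.inv])
  rw [wind_symm h.inv hzc, e1] at e2
  norm_num at e2

theorem not_inner_and_symm (h : IsLevelCurve f σ S F) {a b c : ι} (hc : IsInnerTriangle f σ S F a b c)
    (hd : IsInnerTriangle f σ.symm S F a b c) : False := by
  have hz := midpoint_mem_openSegment' (f a) (f b)
  obtain ⟨x, h1, h2⟩ := ((frequently_left (h.max.ne hc.empty.ab) _
    (signedArea_of_mem_openSegment hz)).and_eventually (hc.empty.eventually_inside hz)).exists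
  have e1 := hc.wind x (h2 h1)
  have e2 := hd.wind x (h2 h1)
  rw [wind_symm h.inv (h.notMem_curve_of_inside hc.empty (h2 h1)), e1] at e2
  norm_num at e2

end IsLevelCurve

end Level

/-! ### Links of the floor triangulations -/

/-- A positive rotation that does not pass the negative real axis increases the argument. -/
theorem arg_lt_arg {w₁ w₂ : ℂ} (h1 : w₁ ∈ Complex.slitPlane) (h2 : w₂ ≠ 0)
    (h : 0 < (w₂ / w₁).im) (hn : ¬ (0 < w₁.im ∧ w₂.im < 0)) : w₁.arg < w₂.arg := by
  have h10 : w₁ ≠ 0 := Complex.slitPlane_ne_zero h1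
  have hpi := Real.pi_pos
  obtain ⟨k, hk⟩ := Real.Angle.angle_eq_iff_two_pi_dvd_sub.1
    ((Complex.arg_div_coe_angle h2 h10).trans (Real.Angle.coe_sub _ _).symm)
  have d0 : 0 < (w₂ / w₁).arg := by
    refine lt_of_le_of_ne (Complex.arg_nonneg_iff.2 h.le) fun e => ?_
    rw [(Complex.arg_eq_zero_iff.1 e.symm).2] at h
    exact h.false
  have d1 := Complex.arg_le_pi (w₂ / w₁)
  by_contra hle
  rw [not_lt] at hle
  have a1 := Complex.arg_le_pi w₁
  have a1' : w₁.arg < Real.pi := lt_of_le_of_ne a1 (Complex.mem_slitPlane_iff_arg.1 h1).1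
  have a2 := Complex.neg_pi_lt_arg w₂
  -- The turn from `w₁` to `w₂` is by an angle in `(0, π]`, so the argument fails to increase only
  -- by passing the cut exactly once. Then `w₁` is in the upper and `w₂` in the lower half-plane.
  have hk1 : k = 1 := by
    have k1 : (0 : ℝ) < k := by
      by_contra hk0
      nlinarith
    have k2 : (k : ℝ) < 2 := by
      by_contra hk0
      nlinarith
    have k1 : (0 : ℤ) < k := by exact_mod_cast k1
    have k2 : k < (2 : ℤ) := by exact_mod_cast k2
    omega
  subst hk1
  push_cast at hk
  refine hn ⟨?_, Complex.arg_neg_iff.1 (by linarith)⟩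
  have p : 0 < w₁.arg := by linarith
  refine lt_of_le_of_ne (Complex.arg_nonneg_iff.1 p.le) fun e => ?_
  rcases Complex.mem_slitPlane_iff.1 h1 with hr | hi
  · rw [Complex.arg_eq_zero_iff.2 ⟨hr.le, e.symm⟩] at p
    exact p.false
  · exact hi e.symm

theorem eventually_pointAt_inside {v p q m : ℂ} (h : 0 < signedArea v p q) (h1 : 0 < signedArea v p m)
    (h2 : 0 < signedArea v m q) : ∀ᶠ s : ℝ in 𝓝[>] 0, InsideTriangle v p q (pointAt v m s) := by
  have hc : Tendsto (fun s : ℝ => signedArea p q (pointAt v m s)) (𝓝[>] 0) (𝓝 (signedArea p q v)) := by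
    have : Tendsto (fun s : ℝ => signedArea p q (pointAt v m s)) (𝓝 0) (𝓝 (signedArea p q (pointAt v m 0))) := by
      simp only [signedArea_pointAt]
      exact Continuous.tendsto (by fun_prop) _
    rw [pointAt_zero] at this
    exact this.mono_left nhdsWithin_le_nhds
  have hpos : 0 < signedArea p q v := by rwa [signedArea_cyc]
  filter_upwards [hc.eventually (lt_mem_nhds hpos), self_mem_nhdsWithin] with s e1 e2
  have e2 : 0 < s := e2
  refine ⟨?_, e1, ?_⟩
  · rw [signedArea_pointAt, signedArea_left]
    nlinarith [mul_pos e2 h1]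
  · rw [signedArea_pointAt, signedArea_right, ← signedArea_cyc v m q, ← signedArea_cyc m q v] at *
    nlinarith [mul_pos e2 h2]

section Level

variable {ι : Type*} [DecidableEq ι] {f : ι → ℂ} {σ : Equiv.Perm ι} {S : Finset ι} {F : ℂ → ℂ → Prop}

namespace IsLevelCurve

/-- In the fan at `v`, directions increase when measured from the direction of the edge at `v`. -/
theorem arg_lt_of_inner (h : IsLevelCurve f σ S F) {v d a : ι} (ht : IsInnerTriangle f σ S F v d a)
    (hd : d ≠ σ v) :
    (-((f d - f v) / (f (σ v) - f v))).arg < (-((f a - f v) / (f (σ v) - f v))).arg := by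
  have hs := sub_ne_zero.2 (h.curve.f_ne v).symm
  have hvd := h.max.ne ht.empty.ab
  have hva := (h.max.ne ht.empty.ca).symm
  have him : ∀ x, (-((x - f v) / (f (σ v) - f v))).im =
      signedArea (f v) x (f (σ v)) / Complex.normSq (f (σ v) - f v) := by
    intro x
    simp only [Complex.neg_im, Complex.div_im, signedArea, Complex.sub_re, Complex.sub_im]
    ring
  have hN := Complex.normSq_pos.2 hs
  -- The minus sign puts the branch cut on the edge from `v` to `σ v`. No other segment of `F` at
  -- `v` has this direction, since it would overlap the edge.
  have hslit : ∀ x, F (f v) (f x) → x ≠ σ v → -((f x - f v) / (f (σ v) - f v)) ∈ Complex.slitPlane := by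
    intro x hx hxs
    rw [Complex.mem_slitPlane_iff]
    by_contra! hcon
    obtain ⟨c1, c2⟩ := hcon
    set q := (f x - f v) / (f (σ v) - f v) with hq
    have hqr : (q.re : ℂ) = q := Complex.ext (by simp) (by simpa [eq_comm] using c2)
    have hx0 : f x - f v ≠ 0 := sub_ne_zero.2 (h.max.ne hx).symm
    have e : f x - f v = q.re * (f (σ v) - f v) := by rw [hqr, hq, div_mul_cancel₀ _ hs]
    have hqpos : 0 < q.re := by
      refine lt_of_le_of_ne (by simpa using c1) fun e0 => hx0 ?_
      rw [e, ← e0]; simp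
    have m1 : pointAt (f v) (f x) (1 / (2 * (1 + q.re))) ∈ openSegment ℝ (f v) (f x) :=
      mem_openSegment_iff_pointAt.2 ⟨_, by positivity, by rw [div_lt_one (by positivity)]; linarith, rfl⟩
    have m2 : pointAt (f v) (f x) (1 / (2 * (1 + q.re))) ∈ openSegment ℝ (f v) (f (σ v)) := by
      refine mem_openSegment_iff_pointAt.2 ⟨q.re / (2 * (1 + q.re)), by positivity,
        by rw [div_lt_one (by positivity)]; linarith, ?_⟩
      rw [pointAt, pointAt, e]
      push_cast
      ring
    rcases h.max.disj hx (h.edge ht.mem₁) m1 m2 with ⟨-, e2⟩ | ⟨e1, -⟩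
    · exact hxs (h.curve.inj e2.symm)
    · exact h.max.ne hx e1
  refine arg_lt_arg (hslit d ht.empty.ab hd) ?_ ?_ ?_
  · exact neg_ne_zero.2 (div_ne_zero (sub_ne_zero.2 hva.symm) hs)
  · rw [neg_div_neg_eq, div_div_div_cancel_right₀ hs]
    have : ((f a - f v) / (f d - f v)).im = signedArea (f v) (f d) (f a) / Complex.normSq (f d - f v) := by
      simp only [Complex.div_im, signedArea, Complex.sub_re, Complex.sub_im]
      ring
    rw [this]
    exact div_pos ht.empty.pos (Complex.normSq_pos.2 (sub_ne_zero.2 hvd.symm))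
  -- If the turn passed the cut, the edge from `v` to `σ v` would start inside the empty triangle.
  · rintro ⟨k1, k2⟩
    rw [him] at k1 k2
    have k1 : 0 < signedArea (f v) (f d) (f (σ v)) := (div_pos_iff_of_pos_right hN).1 k1
    have k2 : 0 < signedArea (f v) (f (σ v)) (f a) := by
      have := (div_neg_iff.1 k2).resolve_left (fun hh => by linarith [hh.2])
      have e : signedArea (f v) (f (σ v)) (f a) = -signedArea (f v) (f a) (f (σ v)) := by
        simp only [signedArea]; ring
      rw [e]; linarith [this.1]
    obtain ⟨s, ⟨s1, s2⟩, s3⟩ := ((eventually_pointAt_inside ht.empty.pos k1 k2).and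
      (mem_nhdsWithin_of_mem_nhds (Iio_mem_nhds one_pos)) |>.and self_mem_nhdsWithin).exists
    exact h.max.not_inside ht.empty (h.edge ht.mem₁)
      (mem_openSegment_iff_pointAt.2 ⟨s, s3, s2, rfl⟩) s1

/-- From a triangle at `v` turn clockwise, across the segment from `v` to `a`, to the next triangle.
The angle measured from the edge at `v` decreases strictly, so this stops, and it can only stop at
`σ v`. The induction is on the number of vertices of smaller angle. -/
theorem link_inner (h : IsLevelCurve f σ S F) {v a b : ι} (ht : IsInnerTriangle f σ S F v a b) :
    (∃ c, IsInnerTriangle f σ S F v (σ v) c) ∧ Relation.EqvGen (IsInnerTriangle f σ S F v) a (σ v) := by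
  let θ : ι → ℝ := fun x => (-((f x - f v) / (f (σ v) - f v))).arg
  suffices H : ∀ n : ℕ, ∀ a b, (S.filter fun x => θ x < θ a).card ≤ n → IsInnerTriangle f σ S F v a b →
      (∃ c, IsInnerTriangle f σ S F v (σ v) c) ∧ Relation.EqvGen (IsInnerTriangle f σ S F v) a (σ v) from
    H _ a b le_rfl ht
  intro n
  induction n with
  | zero =>
    intro a b hn ht
    by_cases has : a = σ v
    · subst has; exact ⟨⟨b, ht⟩, .refl _⟩
    · obtain ⟨d, hd⟩ := h.exists_opposite ht has
      have hd' := hd.rotate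
      by_cases hds : d = σ v
      · subst hds; exact ⟨⟨a, hd'⟩, .symm _ _ (.rel _ _ hd')⟩
      · have := h.arg_lt_of_inner hd' hds
        have hm : d ∈ S.filter fun x => θ x < θ a := Finset.mem_filter.2 ⟨hd'.mem₂, this⟩
        rw [Finset.card_eq_zero.1 (Nat.le_zero.1 hn)] at hm
        exact absurd hm (Finset.notMem_empty _)
  | succ n ih =>
    intro a b hn ht
    by_cases has : a = σ v
    · subst has; exact ⟨⟨b, ht⟩, .refl _⟩
    · obtain ⟨d, hd⟩ := h.exists_opposite ht has
      have hd' := hd.rotate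
      by_cases hds : d = σ v
      · subst hds; exact ⟨⟨a, hd'⟩, .symm _ _ (.rel _ _ hd')⟩
      · have hlt := h.arg_lt_of_inner hd' hds
        obtain ⟨h1, h2⟩ := ih d a (by
          have : (S.filter fun x => θ x < θ d).card < (S.filter fun x => θ x < θ a).card := by
            refine Finset.card_lt_card (Finset.ssubset_iff_of_subset ?_ |>.2
              ⟨d, Finset.mem_filter.2 ⟨hd'.mem₂, hlt⟩, by simp⟩)
            intro x hx
            rw [Finset.mem_filter] at hx ⊢
            exact ⟨hx.1, hx.2.trans hlt⟩
          omega) hd'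
        exact ⟨h1, .trans _ _ _ (.symm _ _ (.rel _ _ hd')) h2⟩

end IsLevelCurve

/-- The oriented triangles spanned by a curve: positively oriented ones where the winding number is
`1`, negatively oriented ones where it is `-1`. -/
def FloorTriangle (f : ι → ℂ) (σ : Equiv.Perm ι) (S : Finset ι) (F : ℂ → ℂ → Prop) (a b c : ι) : Prop :=
  IsInnerTriangle f σ S F a b c ∨ IsInnerTriangle f σ.symm S F b a c

namespace IsLevelCurve

theorem floor_rotate {a b c : ι} (ht : FloorTriangle f σ S F a b c) : FloorTriangle f σ S F b c a :=
  ht.imp (fun h => h.rotate) fun h => h.rotate.rotate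

theorem floor_unique (h : IsLevelCurve f σ S F) {a b c d : ι} (hc : FloorTriangle f σ S F a b c)
    (hd : FloorTriangle f σ S F a b d) : c = d := by
  rcases hc with hc | hc <;> rcases hd with hd | hd
  · exact h.inner_unique hc hd
  · exact (h.not_inner_symm hc hd).elim
  · exact (h.not_inner_symm hd hc).elim
  · exact h.symm.inner_unique hc hd

theorem not_floor_swap (h : IsLevelCurve f σ S F) {a b c : ι} (hc : FloorTriangle f σ S F a b c) :
    ¬ FloorTriangle f σ S F b a c := by
  rintro (hd | hd) <;> rcases hc with hc | hc
  · have := hc.empty.pos; have := hd.empty.pos; rw [signedArea_swap] at this; linarith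
  · exact h.not_inner_and_symm hd hc
  · exact h.not_inner_and_symm hc hd
  · have := hc.empty.pos; have := hd.empty.pos; rw [signedArea_swap] at this; linarith

theorem exists_floor_edge (h : IsLevelCurve f σ S F) {v : ι} (hv : v ∈ S) :
    ∃ c, FloorTriangle f σ S F v (σ v) c := by
  rcases h.exists_inner_edge hv with ⟨c, hc⟩ | ⟨c, hc⟩
  exacts [⟨c, .inl hc⟩, ⟨c, .inr hc⟩]

theorem not_floor_backward (h : IsLevelCurve f σ S F) {v c : ι} : ¬ FloorTriangle f σ S F (σ v) v c := by
  rintro (hc | hc)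
  · exact h.not_inner_backward hc
  · exact h.symm.not_inner_backward (v := σ v) (c := c) (by simpa using hc)

theorem exists_floor_opposite (h : IsLevelCurve f σ S F) {a b c : ι} (ht : FloorTriangle f σ S F a b c)
    (hab : b ≠ σ a) : ∃ d, FloorTriangle f σ S F b a d := by
  rcases ht with ht | ht
  · obtain ⟨d, hd⟩ := h.exists_opposite ht hab
    exact ⟨d, .inl hd⟩
  · obtain ⟨d, hd⟩ := h.symm.exists_opposite ht (by rintro rfl; simp at hab)
    exact ⟨d, .inr hd⟩

/-- For positive triangles this is `link_inner`. Negative triangles are inner for the reversed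
curve, where turning leads to `σ.symm v`; since the edge to `σ v` also borders such a triangle, by
`exists_inner_prev`, `σ v` is joined to `σ.symm v` in the same way. -/
theorem floor_link (h : IsLevelCurve f σ S F) {v a b : ι} (ht : FloorTriangle f σ S F v a b) :
    Relation.EqvGen (FloorTriangle f σ S F v) a (σ v) := by
  have key : ∀ {x y}, Relation.EqvGen (IsInnerTriangle f σ S F v) x y →
      Relation.EqvGen (FloorTriangle f σ S F v) x y := fun hxy =>
    hxy.mono fun _ _ h => .inl h
  have key' : ∀ {x y}, Relation.EqvGen (IsInnerTriangle f σ.symm S F v) x y →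
      Relation.EqvGen (FloorTriangle f σ S F v) x y := by
    intro x y hxy
    induction hxy with
    | rel x y hxy => exact .symm _ _ (.rel _ _ (.inr hxy.rotate.rotate))
    | refl x => exact .refl _
    | symm x y _ ih => exact .symm _ _ ih
    | trans x y z _ _ ih1 ih2 => exact .trans _ _ _ ih1 ih2
  rcases ht with ht | ht
  · exact key (h.link_inner ht).2
  · obtain ⟨⟨c, hc⟩, h1⟩ := h.symm.link_inner (v := v) (a := b) ht.rotate
    obtain ⟨d, hd⟩ := h.symm.exists_inner_prev hc
    rw [Equiv.symm_symm] at hd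
    have hd' := hd.rotate
    obtain ⟨-, h2⟩ := h.symm.link_inner hd'
    refine .trans _ _ _ (.rel _ _ (.inr ht)) (.trans _ _ _ (key' h1) ?_)
    refine .trans _ _ _ (.symm _ _ (key' h2)) (key' (.rel _ _ hd'))

end IsLevelCurve

end Level

section Level

variable {ι : Type*} [DecidableEq ι] {f : ι → ℂ} {σ : Equiv.Perm ι} {S : Finset ι} {F : ℂ → ℂ → Prop}

namespace IsLevelCurve

/-- A point of the closed triangle is a limit of interior points, and off the curve the winding
number is locally constant. -/
theorem wind_eq_one_of_mem (h : IsLevelCurve f σ S F) {a b c : ι} (ht : IsInnerTriangle f σ S F a b c)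
    {z : ℂ} (hz : z ∈ convexHull ℝ {f a, f b, f c}) (hzc : z ∉ _root_.curve f σ S) :
    wind f σ S z = 1 := by
  rw [mem_convexHull_triangle_iff ht.empty.pos] at hz
  have hm := midpoint_mem_openSegment' (f a) (f b)
  obtain ⟨y, hy1, hy2⟩ := ((frequently_left (h.max.ne ht.empty.ab) _
    (signedArea_of_mem_openSegment hm)).and_eventually (ht.empty.eventually_inside hm)).exists
  obtain ⟨y1, y2, y3⟩ := hy2 hy1
  have ht0 : Tendsto (fun s : ℝ => pointAt z y s) (𝓝[>] 0) (𝓝 z) := by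
    have : Tendsto (fun s : ℝ => pointAt z y s) (𝓝 0) (𝓝 (pointAt z y 0)) := by
      unfold pointAt
      exact Continuous.tendsto (by fun_prop) _
    rw [pointAt_zero] at this
    exact this.mono_left nhdsWithin_le_nhds
  obtain ⟨s, ⟨s1, s2⟩, s3⟩ := ((ht0.eventually (eventually_wind_eq f σ h.inv hzc)).and
    (mem_nhdsWithin_of_mem_nhds (Iio_mem_nhds one_pos)) |>.and self_mem_nhdsWithin).exists
  have s2 : s < 1 := s2
  have s3 : 0 < s := s3
  rw [← s1]
  refine ht.wind _ ⟨?_, ?_, ?_⟩ <;> rw [signedArea_pointAt]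
  · nlinarith [mul_pos s3 y1, mul_nonneg (sub_pos.2 s2).le hz.1]
  · nlinarith [mul_pos s3 y2, mul_nonneg (sub_pos.2 s2).le hz.2.1]
  · nlinarith [mul_pos s3 y3, mul_nonneg (sub_pos.2 s2).le hz.2.2]

theorem notMem_of_wind_eq_zero (h : IsLevelCurve f σ S F) {a b c : ι} (ht : FloorTriangle f σ S F a b c)
    {z : ℂ} (hzc : z ∉ _root_.curve f σ S) (hz0 : wind f σ S z = 0) :
    z ∉ convexHull ℝ {f a, f b, f c} := by
  intro hz
  rcases ht with ht | ht
  · rw [h.wind_eq_one_of_mem ht hz hzc] at hz0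
    norm_num at hz0
  · rw [Set.insert_comm] at hz
    have := h.symm.wind_eq_one_of_mem ht hz (by rwa [curve_symm h.inv])
    rw [wind_symm h.inv hzc, hz0] at this
    norm_num at this

/-! ### Counting the triangles of a floor -/

/-- An unoriented version of an empty triangle with winding number `1` or `-1`, with a vertex `v`
such that the triangle lies in direction `m` from `v`. -/
def Apex (f : ι → ℂ) (σ : Equiv.Perm ι) (S : Finset ι) (F : ℂ → ℂ → Prop) (m : ℂ) (v : ι)
    (T : Finset ι) : Prop :=
  v ∈ S ∧ ∃ p q, IsEmptyTriangle (S.image f) F (f v) (f p) (f q) ∧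
    (∀ z, InsideTriangle (f v) (f p) (f q) z → wind f σ S z = 1 ∨ wind f σ S z = -1) ∧
    T = {v, p, q} ∧ ∀ᶠ s : ℝ in 𝓝[>] 0, InsideTriangle (f v) (f p) (f q) (f v + s * m)

/-- Two such triangles share the interior points `f v + s * m` for small `s`, so they are equal by
`eq_of_inside`. -/
theorem Apex.unique (h : IsLevelCurve f σ S F) {m : ℂ} {v : ι} {T T' : Finset ι}
    (hT : Apex f σ S F m v T) (hT' : Apex f σ S F m v T') : T = T' := by
  obtain ⟨-, p, q, h1, -, rfl, h3⟩ := hT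
  obtain ⟨-, p', q', h1', -, rfl, h3'⟩ := hT'
  obtain ⟨s, s1, s2⟩ := (h3.and h3').exists
  have e := h.max.eq_of_inside h1 h1' s1 s2.1.le s2.2.1.le s2.2.2.le
  have : f '' (({v, p, q} : Finset ι) : Set ι) = f '' (({v, p', q'} : Finset ι) : Set ι) := by
    simpa [Set.image_insert_eq] using e
  exact Finset.coe_injective (h.curve.inj.image_injective this)

/-- The two edges at `v` lie on different sides of the line through `f v` in direction `m`, so the
two halves of this line are separated by the curve near `f v`. The winding numbers there differ by
exactly one, whereas 1 and -1 have the same parity. -/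
theorem not_apex_both (h : IsLevelCurve f σ S F) {m : ℂ} (hm : m ≠ 0) {v : ι} {T T' : Finset ι}
    (hT : Apex f σ S F m v T) (hT' : Apex f σ S F (-m) v T')
    (hmono : (signedArea 0 m (f (σ.symm v)) - signedArea 0 m (f v)) *
      (signedArea 0 m (f (σ v)) - signedArea 0 m (f v)) < 0) : False := by
  obtain ⟨hv, p, q, -, h2, -, h3⟩ := hT
  obtain ⟨-, p', q', -, h2', -, h3'⟩ := hT'
  obtain ⟨R, hR⟩ := h.curve.exists_wind_ray h.inv hv
  have hpi := Real.pi_pos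
  have hA : f (σ.symm v) - f v ≠ 0 := sub_ne_zero.2 (h.curve.inj.ne (h.curve.symm_ne v))
  set A := f (σ.symm v) - f v with hAdef
  set B := f (σ v) - f v with hBdef
  have eA : signedArea 0 m (f (σ.symm v)) - signedArea 0 m (f v) = signedArea 0 m A := by
    simp [signedArea, hAdef]; ring
  have eB : signedArea 0 m (f (σ v)) - signedArea 0 m (f v) = signedArea 0 m B := by
    simp [signedArea, hBdef]; ring
  rw [eA, eB] at hmono
  have hX : (m / A).im = -signedArea 0 m A / Complex.normSq A := by
    simp only [Complex.div_im, signedArea, Complex.zero_re, Complex.zero_im]; ring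
  have hY : (B / m).im = signedArea 0 m B / Complex.normSq m := by
    simp only [Complex.div_im, signedArea, Complex.zero_re, Complex.zero_im]; ring
  have hNA := Complex.normSq_pos.2 hA
  have hNm := Complex.normSq_pos.2 hm
  have hXY : (0 < (m / A).im ∧ 0 < (B / m).im) ∨ ((m / A).im < 0 ∧ (B / m).im < 0) := by
    rw [hX, hY]
    rcases mul_neg_iff.1 hmono with ⟨k1, k2⟩ | ⟨k1, k2⟩
    · exact Or.inr ⟨div_neg_of_neg_of_pos (by linarith) hNA, div_neg_of_neg_of_pos k2 hNm⟩
    · exact Or.inl ⟨div_pos (by linarith) hNA, div_pos k2 hNm⟩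
  have sl : ∀ z : ℂ, z.im ≠ 0 → z ∈ Complex.slitPlane := fun z hz => Complex.mem_slitPlane_iff.2 (Or.inr hz)
  have nX : (m / A).im ≠ 0 := by rcases hXY with k | k; exacts [k.1.ne', k.1.ne]
  have nY : (B / m).im ≠ 0 := by rcases hXY with k | k; exacts [k.2.ne', k.2.ne]
  have r1 := hR m hm (sl _ (by rw [neg_div, Complex.neg_im]; exact neg_ne_zero.2 nX))
    (sl _ (by rw [div_neg, Complex.neg_im]; exact neg_ne_zero.2 nY))
  have r2 := hR (-m) (neg_ne_zero.2 hm) (sl _ (by rw [neg_neg]; exact nX))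
    (sl _ (by rw [neg_neg]; exact nY))
  obtain ⟨s, ⟨⟨s1, s2⟩, s3⟩, s4⟩ := (r1.and r2 |>.and h3 |>.and h3').exists
  have w1 := h2 _ s3
  have w2 := h2' _ s4
  rw [s1] at w1
  rw [s2] at w2
  rw [neg_div, div_neg] at w1
  rw [neg_neg] at w2
  set X := (m / A).arg
  set Y := (B / m).arg
  -- Replacing `m` by `-m` changes both arguments by `π` in the same sense, and hence the quotient
  -- by one.
  have e : round ((R + X + Y) / (2 * Real.pi)) = round ((R + (-(m / A)).arg + (-(B / m)).arg) / (2 * Real.pi)) + 1 ∨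
      round ((R + X + Y) / (2 * Real.pi)) = round ((R + (-(m / A)).arg + (-(B / m)).arg) / (2 * Real.pi)) - 1 := by
    rcases hXY with ⟨k1, k2⟩ | ⟨k1, k2⟩
    · left
      rw [Complex.arg_neg_eq_arg_sub_pi_of_im_pos k1, Complex.arg_neg_eq_arg_sub_pi_of_im_pos k2,
        ← round_add_one]
      congr 1
      field_simp
      ring
    · right
      rw [Complex.arg_neg_eq_arg_add_pi_of_im_neg k1, Complex.arg_neg_eq_arg_add_pi_of_im_neg k2,
        ← round_sub_one]
      congr 1
      field_simp
      ring
  generalize round ((R + X + Y) / (2 * Real.pi)) = x at *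
  generalize round ((R + (-(m / A)).arg + (-(B / m)).arg) / (2 * Real.pi)) = y at *
  have w1 : y = 1 ∨ y = -1 := by exact_mod_cast w1
  have w2 : x = 1 ∨ x = -1 := by exact_mod_cast w2
  omega

/-- The lines in direction `m` are the level lines of `signedArea 0 m`. The one through the vertex
with the middle value separates the other two vertices, so it enters the triangle. -/
theorem exists_apex_of_middle {a b c : ι} {m : ℂ}
    (ht : IsEmptyTriangle (S.image f) F (f a) (f b) (f c)) (ha : a ∈ S)
    (hw : ∀ z, InsideTriangle (f a) (f b) (f c) z → wind f σ S z = 1 ∨ wind f σ S z = -1)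
    (hmid : (signedArea 0 m (f b) - signedArea 0 m (f a)) *
      (signedArea 0 m (f c) - signedArea 0 m (f a)) < 0) :
    Apex f σ S F m a {a, b, c} ∨ Apex f σ S F (-m) a {a, b, c} := by
  have e1 : ∀ m' : ℂ, signedArea (f a) (f b) (f a + m') =
      -(signedArea 0 m' (f b) - signedArea 0 m' (f a)) := by
    intro m'; simp [signedArea]; ring
  have e2 : ∀ m' : ℂ, signedArea (f a) (f a + m') (f c) =
      signedArea 0 m' (f c) - signedArea 0 m' (f a) := by
    intro m'; simp [signedArea]; ring
  have neg : ∀ z, signedArea 0 (-m) z = -signedArea 0 m z := by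
    intro z; simp [signedArea]; ring
  have key : ∀ m' : ℂ, 0 < -(signedArea 0 m' (f b) - signedArea 0 m' (f a)) →
      0 < signedArea 0 m' (f c) - signedArea 0 m' (f a) → Apex f σ S F m' a {a, b, c} := by
    intro m' h1 h2
    refine ⟨ha, b, c, ht, hw, rfl, ?_⟩
    rw [← e1] at h1
    rw [← e2] at h2
    refine (eventually_pointAt_inside ht.pos h1 h2).mono fun s hs => ?_
    simpa [pointAt] using hs
  rcases mul_neg_iff.1 hmid with ⟨k1, k2⟩ | ⟨k1, k2⟩
  · right; exact key _ (by rw [neg, neg]; linarith) (by rw [neg, neg]; linarith)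
  · left; exact key _ (by linarith) (by linarith)

/-- As `m` is generic, the three values at the corners differ, and the corner with the middle one
serves as `v`. -/
theorem exists_apex (h : IsLevelCurve f σ S F) {m : ℂ}
    (hm : ∀ v ∈ S, ∀ w ∈ S, v ≠ w → signedArea 0 m (f v) ≠ signedArea 0 m (f w)) {a b c : ι}
    (ht : FloorTriangle f σ S F a b c) :
    ∃ v ∈ S, Apex f σ S F m v {a, b, c} ∨ Apex f σ S F (-m) v {a, b, c} := by
  have key : ∀ {a b c : ι}, a ∈ S → b ∈ S → c ∈ S → IsEmptyTriangle (S.image f) F (f a) (f b) (f c) →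
      (∀ z, InsideTriangle (f a) (f b) (f c) z → wind f σ S z = 1 ∨ wind f σ S z = -1) →
      ∃ v ∈ S, Apex f σ S F m v {a, b, c} ∨ Apex f σ S F (-m) v {a, b, c} := by
    intro a b c ha hb hc ht hw
    have hab : a ≠ b := by rintro rfl; exact h.max.ne ht.ab rfl
    have hbc : b ≠ c := by rintro rfl; exact h.max.ne ht.bc rfl
    have hca : c ≠ a := by rintro rfl; exact h.max.ne ht.ca rfl
    have n1 := sub_ne_zero.2 (hm a ha b hb hab)
    have n2 := sub_ne_zero.2 (hm b hb c hc hbc)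
    have n3 := sub_ne_zero.2 (hm c hc a ha hca)
    by_cases k1 : (signedArea 0 m (f b) - signedArea 0 m (f a)) *
      (signedArea 0 m (f c) - signedArea 0 m (f a)) < 0
    · exact ⟨a, ha, exists_apex_of_middle ht ha hw k1⟩
    by_cases k2 : (signedArea 0 m (f c) - signedArea 0 m (f b)) *
      (signedArea 0 m (f a) - signedArea 0 m (f b)) < 0
    · refine ⟨b, hb, ?_⟩
      have : ({a, b, c} : Finset ι) = {b, c, a} := by ext; simp; tauto
      rw [this]
      exact exists_apex_of_middle ht.rotate hb (fun z hz => hw z hz.rotate.rotate) k2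
    · refine ⟨c, hc, ?_⟩
      have : ({a, b, c} : Finset ι) = {c, a, b} := by ext; simp; tauto
      rw [this]
      refine exists_apex_of_middle ht.rotate.rotate hc (fun z hz => hw z hz.rotate) ?_
      set x := signedArea 0 m (f a)
      set y := signedArea 0 m (f b)
      set z := signedArea 0 m (f c)
      have p1 : 0 < (y - x) * (z - x) := by
        refine lt_of_le_of_ne (not_lt.1 k1) (mul_ne_zero ?_ n3).symm
        rw [← neg_sub]; exact neg_ne_zero.2 n1
      have p2 : 0 < (z - y) * (x - y) := by
        refine lt_of_le_of_ne (not_lt.1 k2) (mul_ne_zero ?_ n1).symm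
        rw [← neg_sub]; exact neg_ne_zero.2 n2
      have p3 : 0 < (x - y) ^ 2 := by positivity
      -- If neither `x` nor `y` is the middle value, this identity shows that `z` is.
      have : ((x - z) * (y - z)) * (x - y) ^ 2 = -(((y - x) * (z - x)) * ((z - y) * (x - y))) := by ring
      nlinarith [mul_pos p1 p2]
  rcases ht with ht | ht
  · exact key ht.mem₁ ht.mem₂ ht.mem₃ ht.empty fun z hz => Or.inl (ht.wind z hz)
  · have : ({a, b, c} : Finset ι) = {b, a, c} := by ext; simp; tauto
    rw [this]
    refine key ht.mem₁ ht.mem₂ ht.mem₃ ht.empty fun z hz => Or.inr ?_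
    have := ht.wind z hz
    rw [wind_symm h.inv (h.notMem_curve_of_inside ht.empty hz)] at this
    linarith

end IsLevelCurve

end Level

/-! ### All floors of a planar curve -/

/-- Oriented triangles `T` with vertices on a planar curve which are arranged in levels and have the
curve as their boundary. -/
structure IsFloor {ι : Type*} (f : ι → ℂ) (σ : Equiv.Perm ι) (lev : ι → ℤ) (T : ι → ι → ι → Prop) :
    Prop where
  lev_next : ∀ v, lev (σ v) = lev v
  lev_eq : ∀ {a b c}, T a b c → lev b = lev a
  rotate : ∀ {a b c}, T a b c → T b c a
  area : ∀ {a b c}, T a b c → signedArea (f a) (f b) (f c) ≠ 0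
  unique : ∀ {a b c d}, T a b c → T a b d → c = d
  not_swap : ∀ {a b c}, T a b c → ¬ T b a c
  inter : ∀ {a b c a' b' c'}, T a b c → T a' b' c' → lev a = lev a' →
    convexHull ℝ {f a, f b, f c} ∩ convexHull ℝ {f a', f b', f c'} ⊆
      convexHull ℝ (({f a, f b, f c} : Set ℂ) ∩ {f a', f b', f c'})
  edge_inter : ∀ {v a b c}, T a b c → lev v = lev a →
    convexHull ℝ {f v, f (σ v)} ∩ convexHull ℝ {f a, f b, f c} ⊆
      convexHull ℝ (({f v, f (σ v)} : Set ℂ) ∩ {f a, f b, f c})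
  edge_disjoint : ∀ {v a b c}, T a b c → lev v < lev a →
    Disjoint (segment ℝ (f v) (f (σ v))) (convexHull ℝ {f a, f b, f c})
  exists_edge : ∀ v, ∃ c, T v (σ v) c
  not_backward : ∀ {v c}, ¬ T (σ v) v c
  opposite : ∀ {a b c}, T a b c → b ≠ σ a → ∃ d, T b a d
  link : ∀ {v a b}, T v a b → Relation.EqvGen (T v) a (σ v)

/-- Each level has its own maximal system and its own triangles, and the level of a triangle is read
off from its corners. In the bound a vertex counts 1 if the linear function is monotone along the
curve there, and 2 otherwise. -/
theorem IsPlanarCurve.exists_floor {ι : Type*} [Fintype ι] [DecidableEq ι] {f : ι → ℂ}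
    {σ : Equiv.Perm ι} (h : IsPlanarCurve f σ) : ∃ lev T, IsFloor f σ lev T ∧ ∀ m : ℂ, m ≠ 0 →
      (∀ v w, v ≠ w → signedArea 0 m (f v) ≠ signedArea 0 m (f w)) →
      {s : Finset ι | ∃ a b c, T a b c ∧ s = {a, b, c}}.ncard ≤
        ∑ v, if (signedArea 0 m (f (σ.symm v)) - signedArea 0 m (f v)) *
          (signedArea 0 m (f (σ v)) - signedArea 0 m (f v)) < 0 then 1 else 2 := by
  classical
  obtain ⟨lev, hlev, hk⟩ := h.exists_level
  set S : ℤ → Finset ι := fun k => Finset.univ.filter (lev · = k) with hSdef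
  have mem_S : ∀ {v k}, v ∈ S k ↔ lev v = k := by simp [hSdef]
  have hinv : ∀ k v, v ∈ S k ↔ σ v ∈ S k := by intro k v; rw [mem_S, mem_S, hlev]
  have hex : ∀ k, ∃ F, IsLevelCurve f σ (S k) F := by
    intro k
    obtain ⟨F, hF, hE⟩ := IsMaximalNoncrossing.exists_extension ((S k).image f)
      (fun a b => ∃ v ∈ S k, (a = f v ∧ b = f (σ v)) ∨ (a = f (σ v) ∧ b = f v))
      (by
        rintro a b ⟨v, hv, ⟨rfl, rfl⟩ | ⟨rfl, rfl⟩⟩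
        exacts [Finset.mem_image_of_mem f hv, Finset.mem_image_of_mem f ((hinv k v).1 hv)])
      (by rintro a b ⟨v, hv, hab⟩; exact ⟨v, hv, by tauto⟩)
      (by
        rintro a b ⟨v, hv, ⟨rfl, rfl⟩ | ⟨rfl, rfl⟩⟩
        exacts [h.f_ne v, (h.f_ne v).symm])
      (by
        rintro a b z ⟨v, hv, hab⟩ hz hzS
        have hz' : z ∈ openSegment ℝ (f v) (f (σ v)) := by
          rcases hab with ⟨rfl, rfl⟩ | ⟨rfl, rfl⟩
          exacts [hz, by rwa [openSegment_symm]]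
        obtain ⟨w, hw, rfl⟩ := Finset.mem_image.1 hzS
        exact h.ne_of_mem_openSegment hz' w rfl)
      (by
        rintro a b c d z ⟨v, hv, hab⟩ ⟨w, hw, hcd⟩ hz hzw
        have hz' : z ∈ openSegment ℝ (f v) (f (σ v)) := by
          rcases hab with ⟨rfl, rfl⟩ | ⟨rfl, rfl⟩
          exacts [hz, by rwa [openSegment_symm]]
        have hzw' : z ∈ openSegment ℝ (f w) (f (σ w)) := by
          rcases hcd with ⟨rfl, rfl⟩ | ⟨rfl, rfl⟩
          exacts [hzw, by rwa [openSegment_symm]]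
        have hvw : v = w := by
          by_contra hvw
          exact h.disj hvw hz' (openSegment_subset_segment _ _ _ hzw')
        subst hvw
        rcases hab with ⟨rfl, rfl⟩ | ⟨rfl, rfl⟩ <;> rcases hcd with ⟨rfl, rfl⟩ | ⟨rfl, rfl⟩ <;> simp)
    exact ⟨F, h, hinv k, hF, fun {v} hv => hE ⟨v, hv, Or.inl ⟨rfl, rfl⟩⟩, (hk k).1⟩
  choose F hF using hex
  have mem : ∀ {k a b c}, FloorTriangle f σ (S k) (F k) a b c → lev a = k ∧ lev b = k ∧ lev c = k := by
    rintro k a b c (ht | ht)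
    exacts [⟨mem_S.1 ht.mem₁, mem_S.1 ht.mem₂, mem_S.1 ht.mem₃⟩,
      ⟨mem_S.1 ht.mem₂, mem_S.1 ht.mem₁, mem_S.1 ht.mem₃⟩]
  have single : ∀ {k k' a b c a' b' c'}, FloorTriangle f σ (S k) (F k) a b c →
      FloorTriangle f σ (S k') (F k') a' b' c' → lev a = lev a' → k = k' := by
    intro k k' a b c a' b' c' h1 h2 e
    rw [← (mem h1).1, ← (mem h2).1, e]
  have perm : ∀ {k a b c}, FloorTriangle f σ (S k) (F k) a b c → ∃ a' b' c',
      IsEmptyTriangle ((S k).image f) (F k) (f a') (f b') (f c') ∧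
        ({f a', f b', f c'} : Set ℂ) = {f a, f b, f c} := by
    rintro k a b c (ht | ht)
    · exact ⟨_, _, _, ht.empty, rfl⟩
    · exact ⟨_, _, _, ht.empty, Set.insert_comm _ _ _⟩
  refine ⟨lev, fun a b c => ∃ k, FloorTriangle f σ (S k) (F k) a b c, ?_, ?_⟩
  · refine ⟨hlev, ?_, ?_, ?_, ?_, ?_, ?_, ?_, ?_, ?_, ?_, ?_, ?_⟩
    · rintro a b c ⟨k, ht⟩
      rw [(mem ht).1, (mem ht).2.1]
    · rintro a b c ⟨k, ht⟩
      exact ⟨k, IsLevelCurve.floor_rotate ht⟩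
    · rintro a b c ⟨k, ht | ht⟩
      · exact ht.empty.pos.ne'
      · rw [signedArea_swap]; exact neg_ne_zero.2 ht.empty.pos.ne'
    · rintro a b c d ⟨k, h1⟩ ⟨k', h2⟩
      obtain rfl := single h1 h2 rfl
      exact (hF k).floor_unique h1 h2
    · rintro a b c ⟨k, h1⟩ ⟨k', h2⟩
      obtain rfl := single h1 h2 ((mem h1).1.trans (mem h1).2.1.symm)
      exact (hF k).not_floor_swap h1 h2
    · rintro a b c a' b' c' ⟨k, h1⟩ ⟨k', h2⟩ e
      obtain rfl := single h1 h2 e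
      obtain ⟨x, y, z, ht, e1⟩ := perm h1
      obtain ⟨x', y', z', ht', e1'⟩ := perm h2
      have := (hF k).max.triangle_inter_triangle ht ht'
      rwa [e1, e1'] at this
    · rintro v a b c ⟨k, h1⟩ e
      obtain ⟨x, y, z, ht, e1⟩ := perm h1
      have := (hF k).max.segment_inter_triangle
        ((hF k).edge (mem_S.2 (e.trans (mem h1).1))) ht
      rwa [e1] at this
    · rintro v a b c ⟨k, h1⟩ e
      rw [Set.disjoint_left]
      intro z hz
      obtain ⟨z1, z2⟩ := (hk k).2 v (by rw [← (mem h1).1]; exact e) z hz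
      exact (hF k).notMem_of_wind_eq_zero h1 z1 z2
    · intro v
      obtain ⟨c, hc⟩ := (hF (lev v)).exists_floor_edge (v := v) (mem_S.2 rfl)
      exact ⟨c, _, hc⟩
    · rintro v c ⟨k, h1⟩
      exact (hF k).not_floor_backward h1
    · rintro a b c ⟨k, h1⟩ hab
      obtain ⟨d, hd⟩ := (hF k).exists_floor_opposite h1 hab
      exact ⟨d, k, hd⟩
    · rintro v a b ⟨k, h1⟩
      exact ((hF k).floor_link h1).mono fun _ _ h => ⟨k, h⟩
  · intro m hm hinj
    set sg : Bool → ℂ := fun b => if b then m else -m with hsg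
    let P : ι × Bool → Finset ι → Prop := fun x s =>
      IsLevelCurve.Apex f σ (S (lev x.1)) (F (lev x.1)) (sg x.2) x.1 s
    have hap : ∀ s ∈ {s : Finset ι | ∃ a b c, (∃ k, FloorTriangle f σ (S k) (F k) a b c) ∧ s = {a, b, c}},
        ∃ x, P x s := by
      rintro s ⟨a, b, c, ⟨k, ht⟩, rfl⟩
      obtain ⟨v, hv, hh⟩ := (hF k).exists_apex (fun v _ w _ => hinj v w) ht
      obtain rfl := mem_S.1 hv
      rcases hh with hh | hh
      · exact ⟨(v, true), by simpa [P, hsg] using hh⟩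
      · exact ⟨(v, false), by simpa [P, hsg] using hh⟩
    rcases isEmpty_or_nonempty ι with hι | hι
    · refine (le_of_eq (congrArg Set.ncard (Set.eq_empty_of_forall_notMem ?_))).trans (by simp)
      rintro s ⟨a, -⟩
      exact hι.elim a
    choose! φ hφ using hap
    -- A triangle is recovered from its middle vertex and the sign of the direction.
    have hinjφ : Set.InjOn φ {s : Finset ι | ∃ a b c, (∃ k, FloorTriangle f σ (S k) (F k) a b c) ∧ s = {a, b, c}} := by
      intro s hs t ht e
      have h1 := hφ s hs
      have h2 := hφ t ht
      rw [← e] at h2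
      exact IsLevelCurve.Apex.unique (hF _) h1 h2
    calc _ ≤ ((Finset.univ.filter fun x => ∃ s, P x s : Finset (ι × Bool)) : Set (ι × Bool)).ncard :=
          Set.ncard_le_ncard_of_injOn φ (fun s hs => by simpa using ⟨s, hφ s hs⟩) hinjφ
      _ = ∑ v, ∑ b, if ∃ s, P (v, b) s then 1 else 0 := by
          rw [Set.ncard_coe_finset, Finset.card_filter, Fintype.sum_prod_type]
      _ ≤ _ := by
          refine Finset.sum_le_sum fun v _ => ?_
          rw [Fintype.sum_bool]
          split_ifs with h1 h2 h3 <;> try norm_num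
          obtain ⟨s, hs⟩ := h1
          obtain ⟨t, ht⟩ := h2
          exact ((hF _).not_apex_both hm (by simpa [P, hsg] using hs) (by simpa [P, hsg] using ht) h3).elim

/-! ### Simplices that meet in common faces -/

section Meet

variable {W E : Type*} [AddCommGroup E] [Module ℝ E] {pos : W → E} {s t : Set W}

theorem MeetProperly.symm (h : MeetProperly pos s t) : MeetProperly pos t s := by
  unfold MeetProperly at *
  rwa [Set.inter_comm, Set.inter_comm t s]

theorem MeetProperly.of_subset (h : s ⊆ t) : MeetProperly pos s t := by
  unfold MeetProperly
  rw [Set.inter_eq_left.2 h]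
  exact Set.inter_subset_left

theorem MeetProperly.of_disjoint (h : ∀ x, x ∈ convexHull ℝ (pos '' s) → x ∉ convexHull ℝ (pos '' t)) :
    MeetProperly pos s t := fun x hx => (h x hx.1 hx.2).elim

/-- A function that respects convex combinations. -/
def IsAffineFun (L : E → ℝ) : Prop :=
  ∀ x y : E, ∀ u v : ℝ, u + v = 1 → L (u • x + v • y) = u * L x + v * L y

theorem IsAffineFun.neg {L : E → ℝ} (hL : IsAffineFun L) : IsAffineFun fun x => -L x := by
  intro x y u v huv
  simp only [hL x y u v huv]
  ring

theorem IsAffineFun.convex_nonneg {L : E → ℝ} (hL : IsAffineFun L) : Convex ℝ {x | 0 ≤ L x} := by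
  intro x hx y hy u v hu hv huv
  simp only [Set.mem_ofPred_eq] at *
  rw [hL x y u v huv]
  positivity

theorem IsAffineFun.convex_pos {L : E → ℝ} (hL : IsAffineFun L) : Convex ℝ {x | 0 < L x} := by
  intro x hx y hy u v hu hv huv
  simp only [Set.mem_ofPred_eq] at *
  rw [hL x y u v huv]
  rcases hu.eq_or_lt with rfl | hu
  · obtain rfl : v = 1 := by linarith
    simpa using hy
  · nlinarith [mul_pos hu hx, mul_nonneg hv hy.le]

/-- A convex combination of nonnegative values vanishes only if all the weight is on points with
value zero. -/
theorem mem_convexHull_zeros {L : E → ℝ} (hL : IsAffineFun L) {A : Set E} (hA : ∀ x ∈ A, 0 ≤ L x) {x : E}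
    (hx : x ∈ convexHull ℝ A) (hx0 : L x ≤ 0) : x ∈ convexHull ℝ {y ∈ A | L y = 0} := by
  have hu : A = {y ∈ A | L y = 0} ∪ {y ∈ A | 0 < L y} := by
    ext y
    constructor
    · intro hy
      rcases (hA y hy).eq_or_lt with h | h
      exacts [Or.inl ⟨hy, h.symm⟩, Or.inr ⟨hy, h⟩]
    · rintro (h | h) <;> exact h.1
  have hpos : convexHull ℝ {y ∈ A | 0 < L y} ⊆ {y | 0 < L y} :=
    convexHull_min (fun y hy => hy.2) hL.convex_pos
  have hneg : convexHull ℝ {y ∈ A | L y = 0} ⊆ {y | 0 ≤ L y} :=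
    convexHull_min (fun y hy => hy.2.ge) hL.convex_nonneg
  rcases Set.eq_empty_or_nonempty {y ∈ A | 0 < L y} with h0 | h0
  · rw [h0, Set.union_empty] at hu
    rwa [← hu]
  rcases Set.eq_empty_or_nonempty {y ∈ A | L y = 0} with h1 | h1
  · rw [h1, Set.empty_union] at hu
    rw [hu] at hx
    exact absurd (hpos hx) (not_lt.2 hx0)
  rw [hu, convexHull_union h1 h0, mem_convexJoin] at hx
  obtain ⟨a, ha, b, hb, u, v, hu, hv, huv, rfl⟩ := hx
  rw [hL a b u v huv] at hx0
  have k1 : 0 < L b := hpos hb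
  have k2 : 0 ≤ L a := hneg ha
  have : v = 0 := by
    by_contra hv0
    have := mul_pos (lt_of_le_of_ne hv (Ne.symm hv0)) k1
    nlinarith [mul_nonneg hu k2]
  subst this
  obtain rfl : u = 1 := by linarith
  simpa using ha

/-- Simplices on different sides of a hyperplane meet properly if their faces in it do. -/
theorem MeetProperly.of_separated {L : E → ℝ} (hL : IsAffineFun L) (hs : ∀ w ∈ s, 0 ≤ L (pos w))
    (ht : ∀ w ∈ t, L (pos w) ≤ 0)
    (h : MeetProperly pos {w ∈ s | L (pos w) = 0} {w ∈ t | L (pos w) = 0}) : MeetProperly pos s t := by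
  rintro x ⟨hx, hx'⟩
  have h1 : 0 ≤ L x := convexHull_min (s := pos '' s) (by rintro _ ⟨w, hw, rfl⟩; exact hs w hw)
    hL.convex_nonneg hx
  have h2 : 0 ≤ -L x := convexHull_min (s := pos '' t) (t := {x | 0 ≤ -L x})
    (by rintro _ ⟨w, hw, rfl⟩; exact neg_nonneg.2 (ht w hw)) hL.neg.convex_nonneg hx'
  have e : ∀ s : Set W, {y ∈ pos '' s | L y = 0} = pos '' {w ∈ s | L (pos w) = 0} := by
    intro s
    ext y
    constructor
    · rintro ⟨⟨w, hw, rfl⟩, h⟩; exact ⟨w, ⟨hw, h⟩, rfl⟩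
    · rintro ⟨w, ⟨hw, h⟩, rfl⟩; exact ⟨⟨w, hw, rfl⟩, h⟩
  have m1 := mem_convexHull_zeros hL (by rintro _ ⟨w, hw, rfl⟩; exact hs w hw) hx (by linarith)
  have m2 := mem_convexHull_zeros hL.neg (by rintro _ ⟨w, hw, rfl⟩; exact neg_nonneg.2 (ht w hw)) hx'
    (by linarith)
  simp only [neg_eq_zero] at m2
  rw [e] at m1 m2
  refine convexHull_mono (Set.image_mono ?_) (h ⟨m1, m2⟩)
  rintro w ⟨h1, h2⟩
  exact ⟨h1.1, h2.1⟩

theorem MeetProperly.of_separated_subset {L : E → ℝ} (hL : IsAffineFun L) (hs : ∀ w ∈ s, 0 ≤ L (pos w))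
    (ht : ∀ w ∈ t, L (pos w) ≤ 0) (h : ∀ w ∈ s, L (pos w) = 0 → w ∈ t) : MeetProperly pos s t :=
  .of_separated hL hs ht (.of_subset fun w hw => show w ∈ t ∧ L (pos w) = 0 from ⟨h w hw.1 hw.2, hw.2⟩)

end Meet

section Column

variable {W : Type*} {base : W → ℂ} {ht : W → ℝ} {s t : Set W}

theorem mem_convexHull_base {x : ℂ × ℝ} (hx : x ∈ convexHull ℝ ((fun w => (base w, ht w)) '' s)) :
    x.1 ∈ convexHull ℝ (base '' s) := by
  have := Set.mem_image_of_mem (LinearMap.fst ℝ ℂ ℝ) hx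
  rw [LinearMap.image_convexHull, Set.image_image] at this
  exact this

theorem mem_convexHull_height {x : ℂ × ℝ} (hx : x ∈ convexHull ℝ ((fun w => (base w, ht w)) '' s)) :
    x.2 ∈ convexHull ℝ (ht '' s) := by
  have := Set.mem_image_of_mem (LinearMap.snd ℝ ℂ ℝ) hx
  rw [LinearMap.image_convexHull, Set.image_image] at this
  exact this

/-- If `x.1` is not in the hull of the other base points, a combination with positive weight on them
cannot project to `x.1`. So `x` is a combination of the points above `x.1` alone. -/
theorem mem_convexHull_fiber {x : ℂ × ℝ} (hx : x ∈ convexHull ℝ ((fun w => (base w, ht w)) '' s))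
    (hz : x.1 ∉ convexHull ℝ (base '' s \ {x.1})) :
    x ∈ convexHull ℝ ((fun w => (base w, ht w)) '' {w ∈ s | base w = x.1}) := by
  obtain ⟨z, y⟩ := x
  simp only at hz ⊢
  have hu : s = {w ∈ s | base w = z} ∪ {w ∈ s | base w ≠ z} := by
    ext w
    by_cases h : base w = z <;> simp [h]
  have e : base '' {w ∈ s | base w ≠ z} = base '' s \ {z} := by
    ext y
    constructor
    · rintro ⟨w, ⟨hw, h⟩, rfl⟩; exact ⟨⟨w, hw, rfl⟩, h⟩
    · rintro ⟨⟨w, hw, rfl⟩, h⟩; exact ⟨w, ⟨hw, h⟩, rfl⟩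
  rcases Set.eq_empty_or_nonempty {w ∈ s | base w ≠ z} with h0 | h0
  · rw [h0, Set.union_empty] at hu
    rwa [← hu]
  rcases Set.eq_empty_or_nonempty {w ∈ s | base w = z} with h1 | h1
  · rw [h1, Set.empty_union] at hu
    have := mem_convexHull_base hx
    rw [← e, ← hu] at hz
    exact absurd this hz
  rw [hu, Set.image_union, convexHull_union (h1.image _) (h0.image _), mem_convexJoin] at hx
  obtain ⟨a, ha, b, hb, u, v, hu, hv, huv, hab⟩ := hx
  have ha1 : a.1 = z := by
    have := mem_convexHull_base ha
    have h2 : base '' {w ∈ s | base w = z} ⊆ {z} := by rintro _ ⟨w, hw, rfl⟩; exact hw.2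
    have h3 := convexHull_mono h2 this
    rwa [convexHull_singleton] at h3
  have hb1 := mem_convexHull_base hb
  rw [e] at hb1
  have hv0 : v = 0 := by
    by_contra hv0
    have e1 := congrArg Prod.fst hab
    simp only [Prod.fst_add, Prod.smul_fst, ha1] at e1
    obtain rfl : u = 1 - v := by linarith
    have : v • (b.1 - z) = 0 := by
      rw [smul_sub, ← sub_eq_zero.2 e1]
      module
    rcases smul_eq_zero.1 this with h | h
    · exact hv0 h
    · rw [sub_eq_zero.1 h] at hb1
      exact hz hb1
  subst hv0
  obtain rfl : u = 1 := by linarith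
  simp only [one_smul, zero_smul, add_zero] at hab
  rwa [← hab]

/-- Convexity of `s` in the vertical direction. -/
def Tame (base : W → ℂ) (ht : W → ℝ) (s : Set W) : Prop :=
  ∀ u ∈ s, ∀ u' ∈ s, ∀ v, base u = base u' → base v = base u → ht u ≤ ht v → ht v ≤ ht u' → v ∈ s

theorem Tame.fiber (h : Tame base ht s) (z : ℂ) : Tame base ht {w ∈ s | base w = z} :=
  fun u hu u' hu' v h1 h2 h3 h4 => ⟨h u hu.1 u' hu'.1 v h1 h2 h3 h4, h2.trans hu.2⟩

theorem exists_le_of_mem_convexHull {y : ℝ} (hy : y ∈ convexHull ℝ (ht '' s)) :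
    (∃ u ∈ s, ht u ≤ y) ∧ ∃ u ∈ s, y ≤ ht u := by
  constructor
  · by_contra! hcon
    exact lt_irrefl y (convexHull_min (s := ht '' s) (t := Set.Ioi y)
      (by rintro _ ⟨w, hw, rfl⟩; exact hcon w hw) (convex_Ioi y) hy)
  · by_contra! hcon
    exact lt_irrefl y (convexHull_min (s := ht '' s) (t := Set.Iio y)
      (by rintro _ ⟨w, hw, rfl⟩; exact hcon w hw) (convex_Iio y) hy)

/-- Over one point of the plane both hulls are vertical intervals. By tameness the higher of the two
lower ends and the lower of the two upper ends are vertices of both. -/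
theorem mem_convexHull_inter_of_column (hs' : Tame base ht s)
    (ht' : Tame base ht t) {x : ℂ × ℝ} (hsz : ∀ w ∈ s, base w = x.1) (htz : ∀ w ∈ t, base w = x.1)
    (hx : x ∈ convexHull ℝ ((fun w => (base w, ht w)) '' s))
    (hx' : x ∈ convexHull ℝ ((fun w => (base w, ht w)) '' t)) :
    x ∈ convexHull ℝ ((fun w => (base w, ht w)) '' (s ∩ t)) := by
  obtain ⟨⟨l, hl, hlx⟩, u, hu, hux⟩ := exists_le_of_mem_convexHull (mem_convexHull_height hx)
  obtain ⟨⟨l', hl', hlx'⟩, u', hu', hux'⟩ := exists_le_of_mem_convexHull (mem_convexHull_height hx')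
  obtain ⟨p, hp, hp', hpx⟩ : ∃ p ∈ s, p ∈ t ∧ ht p ≤ x.2 := by
    rcases le_total (ht l) (ht l') with h | h
    · exact ⟨l', hs' l hl u hu l' ((hsz l hl).trans (hsz u hu).symm) ((htz l' hl').trans (hsz l hl).symm) h
        (hlx'.trans hux), hl', hlx'⟩
    · exact ⟨l, hl, ht' l' hl' u' hu' l ((htz l' hl').trans (htz u' hu').symm)
        ((hsz l hl).trans (htz l' hl').symm) h (hlx.trans hux'), hlx⟩
  obtain ⟨q, hq, hq', hqx⟩ : ∃ q ∈ s, q ∈ t ∧ x.2 ≤ ht q := by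
    rcases le_total (ht u) (ht u') with h | h
    · exact ⟨u, hu, ht' l' hl' u' hu' u ((htz l' hl').trans (htz u' hu').symm)
        ((hsz u hu).trans (htz l' hl').symm) (hlx'.trans hux) h, hux⟩
    · exact ⟨u', hs' l hl u hu u' ((hsz l hl).trans (hsz u hu).symm) ((htz u' hu').trans (hsz l hl).symm)
        (hlx.trans hux') h, hu', hux'⟩
  have hseg : x ∈ segment ℝ (base p, ht p) (base q, ht q) := by
    have hm : x.2 ∈ segment ℝ (ht p) (ht q) := by
      rw [segment_eq_Icc (hpx.trans hqx)]
      exact ⟨hpx, hqx⟩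
    obtain ⟨α, β, h1, h2, h3, h4⟩ := hm
    refine ⟨α, β, h1, h2, h3, Prod.ext ?_ h4⟩
    simp only [Prod.fst_add, Prod.smul_fst, hsz p hp, hsz q hq]
    rw [← add_smul, h3, one_smul]
  rw [← convexHull_pair] at hseg
  refine convexHull_mono ?_ hseg
  rintro _ (rfl | rfl)
  exacts [⟨p, ⟨hp, hp'⟩, rfl⟩, ⟨q, ⟨hq, hq'⟩, rfl⟩]

/-- Vertically convex simplices whose projections meet only in common extreme points. -/
theorem MeetProperly.of_extreme (hs' : Tame base ht s) (ht' : Tame base ht t)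
    (h : ∀ z ∈ convexHull ℝ (base '' s), z ∈ convexHull ℝ (base '' t) →
      z ∉ convexHull ℝ (base '' s \ {z}) ∧ z ∉ convexHull ℝ (base '' t \ {z})) :
    MeetProperly (fun w => (base w, ht w)) s t := by
  rintro x ⟨hx, hx'⟩
  obtain ⟨h1, h2⟩ := h x.1 (mem_convexHull_base hx) (mem_convexHull_base hx')
  refine convexHull_mono (Set.image_mono ?_) (mem_convexHull_inter_of_column (hs'.fiber x.1) (ht'.fiber x.1) (fun w hw => hw.2) (fun w hw => hw.2)
    (mem_convexHull_fiber hx h1) (mem_convexHull_fiber hx' h2))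
  rintro w ⟨h1, h2⟩
  exact ⟨h1.1, h2.1⟩

end Column

/-! ### Diagrams and the gluing pattern of the surface -/

/-- The nodes of a closed polygon in space together with its projection to the plane. At each
crossing, `t` is the node on the upper strand, followed by `p`, and `b` is the node below it on the
lower strand, preceded by `q`. -/
structure Diagram (N Cr : Type*) where
  next : Equiv.Perm N
  t : Cr → N
  b : Cr → N
  p : Cr → N
  q : Cr → N
  f : N → ℂ
  a : N → ℝ
  next_q : ∀ c, next (q c) = b c
  next_t : ∀ c, next (t c) = p c
  t_inj : Function.Injective t
  q_inj : Function.Injective q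
  t_ne_b : ∀ c d, t c ≠ b d
  t_ne_p : ∀ c d, t c ≠ p d
  t_ne_q : ∀ c d, t c ≠ q d
  b_ne_p : ∀ c d, b c ≠ p d
  b_ne_q : ∀ c d, b c ≠ q d
  p_ne_q : ∀ c d, p c ≠ q d
  next_next_ne : ∀ x, next (next x) ≠ x
  next_p_ne : ∀ c, next (p c) ≠ q c
  next_b_ne : ∀ c, next (b c) ≠ t c
  f_t : ∀ c, f (t c) = f (b c)
  f_inj : ∀ x y, x ∉ Set.range t → y ∉ Set.range t → f x = f y → x = y
  height : ∀ c, a (b c) < a (t c)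

namespace Diagram

variable {N Cr : Type*} (D : Diagram N Cr)

theorem b_inj : Function.Injective D.b := fun c d h =>
  D.q_inj (D.next.injective (by rw [D.next_q, D.next_q, h]))

theorem p_inj : Function.Injective D.p := fun c d h =>
  D.t_inj (D.next.injective (by rw [D.next_t, D.next_t, h]))

/-- The nodes that are not on the upper strand of a crossing. -/
abbrev Lower : Type _ := {x : N // x ∉ Set.range D.t}

def B (c : Cr) : D.Lower := ⟨D.b c, by rintro ⟨d, h⟩; exact D.t_ne_b _ _ h⟩

def P (c : Cr) : D.Lower := ⟨D.p c, by rintro ⟨d, h⟩; exact D.t_ne_p _ _ h⟩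

def Q (c : Cr) : D.Lower := ⟨D.q c, by rintro ⟨d, h⟩; exact D.t_ne_q _ _ h⟩

theorem ne_t (x : D.Lower) (c : Cr) : x.1 ≠ D.t c := fun h => x.2 ⟨c, h.symm⟩

open Classical in
/-- The successor of a node after smoothing the crossings. -/
noncomputable def smoothFun (x : D.Lower) : D.Lower :=
  if h : ∃ c, D.next x = D.t c then D.B h.choose
  else if h' : ∃ c, x.1 = D.q c then D.P h'.choose
  else ⟨D.next x, fun ⟨c, hc⟩ => h ⟨c, hc.symm⟩⟩

theorem smoothFun_t {x : D.Lower} {c : Cr} (h : D.next x = D.t c) : D.smoothFun x = D.B c := by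
  have hex : ∃ c, D.next x = D.t c := ⟨c, h⟩
  rw [smoothFun, dif_pos hex, ← D.t_inj (h.symm.trans hex.choose_spec)]

theorem smoothFun_q (c : Cr) : D.smoothFun (D.Q c) = D.P c := by
  have h1 : ¬ ∃ d, D.next (D.Q c) = D.t d := by
    rintro ⟨d, h⟩
    exact D.t_ne_b d c (by rw [← h, ← D.next_q]; rfl)
  have hex : ∃ d, (D.Q c).1 = D.q d := ⟨c, rfl⟩
  rw [smoothFun, dif_neg h1, dif_pos hex]
  have : D.q c = D.q hex.choose := hex.choose_spec
  rw [← D.q_inj this]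

theorem smoothFun_next {x : D.Lower} (h : ∀ c, D.next x ≠ D.t c) (h' : ∀ c, x.1 ≠ D.q c) :
    (D.smoothFun x).1 = D.next x := by
  rw [smoothFun, dif_neg (by simpa using h), dif_neg (by simpa using h')]

theorem smoothFun_cases (x : D.Lower) : (∃ c, D.next x = D.t c ∧ D.smoothFun x = D.B c) ∨
    (∃ c, x = D.Q c ∧ D.smoothFun x = D.P c) ∨ ((∀ c, D.next x ≠ D.t c) ∧ (∀ c, x.1 ≠ D.q c) ∧
      (D.smoothFun x).1 = D.next x) := by
  by_cases h : ∃ c, D.next x = D.t c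
  · obtain ⟨c, h⟩ := h
    exact Or.inl ⟨c, h, D.smoothFun_t h⟩
  by_cases h' : ∃ c, x.1 = D.q c
  · obtain ⟨c, h'⟩ := h'
    obtain rfl : x = D.Q c := Subtype.ext h'
    exact Or.inr (Or.inl ⟨c, rfl, D.smoothFun_q c⟩)
  · push Not at h h'
    exact Or.inr (Or.inr ⟨h, h', D.smoothFun_next h h'⟩)

/-- After the smoothing, b is reached only from the node before t, because q has been diverted to p,
and p is reached only from q, because t has been removed. -/
theorem smoothFun_injective : Function.Injective D.smoothFun := by
  have kb : ∀ x : D.Lower, (∀ c, x.1 ≠ D.q c) → ∀ c, D.next x ≠ D.b c := by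
    intro x h c hc
    rw [← D.next_q] at hc
    exact h c (D.next.injective hc)
  have kp : ∀ x : D.Lower, ∀ c, D.next x ≠ D.p c := by
    intro x c hc
    rw [← D.next_t] at hc
    exact D.ne_t x c (D.next.injective hc)
  intro x y hxy
  rcases D.smoothFun_cases x with ⟨c, h1, h2⟩ | ⟨c, h1, h2⟩ | ⟨h1, h1', h2⟩ <;>
  rcases D.smoothFun_cases y with ⟨d, k1, k2⟩ | ⟨d, k1, k2⟩ | ⟨k1, k1', k2⟩
  · have : c = d := D.b_inj (congrArg Subtype.val (h2.symm.trans (hxy.trans k2)))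
    subst this
    exact Subtype.ext (D.next.injective (h1.trans k1.symm))
  · exact (D.b_ne_p c d (congrArg Subtype.val (h2.symm.trans (hxy.trans k2)))).elim
  · exact (kb y k1' c (by rw [← k2, ← hxy, h2]; rfl)).elim
  · exact (D.b_ne_p d c (congrArg Subtype.val (k2.symm.trans (hxy.symm.trans h2)))).elim
  · have : c = d := D.p_inj (congrArg Subtype.val (h2.symm.trans (hxy.trans k2)))
    rw [h1, k1, this]
  · exact (kp y c (by rw [← k2, ← hxy, h2]; rfl)).elim
  · exact (kb x h1' d (by rw [← h2, hxy, k2]; rfl)).elim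
  · exact (kp x d (by rw [← h2, hxy, k2]; rfl)).elim
  · exact Subtype.ext (D.next.injective (by rw [← h2, ← k2, hxy]))

/-- The smoothing of the crossings, as a permutation. -/
noncomputable def smooth [Finite N] : Equiv.Perm D.Lower :=
  Equiv.ofBijective D.smoothFun (Finite.injective_iff_bijective.1 D.smoothFun_injective)

open Classical in
/-- The upper end of the wall that starts at `x`. -/
noncomputable def top (x : N) : N := if h : ∃ c, x = D.q c then D.p h.choose else D.next x

theorem top_q (c : Cr) : D.top (D.q c) = D.p c := by
  have hex : ∃ d, D.q c = D.q d := ⟨c, rfl⟩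
  rw [top, dif_pos hex, ← D.q_inj hex.choose_spec]

theorem top_of_ne {x : N} (h : ∀ c, x ≠ D.q c) : D.top x = D.next x := by
  rw [top, dif_neg (by simpa using h)]

theorem next_ne (x : N) : D.next x ≠ x := fun h => D.next_next_ne x (by rw [h, h])

/-- The triangles at the crossings. -/
inductive Roof : N → N → N → Prop
  | tpq (c : Cr) : Roof (D.t c) (D.p c) (D.q c)
  | pqt (c : Cr) : Roof (D.p c) (D.q c) (D.t c)
  | qtp (c : Cr) : Roof (D.q c) (D.t c) (D.p c)
  | tqb (c : Cr) : Roof (D.t c) (D.q c) (D.b c)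
  | qbt (c : Cr) : Roof (D.q c) (D.b c) (D.t c)
  | btq (c : Cr) : Roof (D.b c) (D.t c) (D.q c)

theorem Roof.unique {D : Diagram N Cr} {x y z z' : N} (h : D.Roof x y z) (h' : D.Roof x y z') : z = z' := by
  have H : ∀ {x y z x' y' z'}, D.Roof x y z → D.Roof x' y' z' → x' = x → y' = y → z = z' := by
    intro x y z x' y' z' h h' e1 e2
    cases h <;> cases h' <;>
      first
      | exact (D.t_ne_b _ _ e1).elim | exact (D.t_ne_b _ _ e1.symm).elim
      | exact (D.t_ne_p _ _ e1).elim | exact (D.t_ne_p _ _ e1.symm).elim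
      | exact (D.t_ne_q _ _ e1).elim | exact (D.t_ne_q _ _ e1.symm).elim
      | exact (D.b_ne_p _ _ e1).elim | exact (D.b_ne_p _ _ e1.symm).elim
      | exact (D.b_ne_q _ _ e1).elim | exact (D.b_ne_q _ _ e1.symm).elim
      | exact (D.p_ne_q _ _ e1).elim | exact (D.p_ne_q _ _ e1.symm).elim
      | exact (D.t_ne_b _ _ e2).elim | exact (D.t_ne_b _ _ e2.symm).elim
      | exact (D.t_ne_p _ _ e2).elim | exact (D.t_ne_p _ _ e2.symm).elim
      | exact (D.t_ne_q _ _ e2).elim | exact (D.t_ne_q _ _ e2.symm).elim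
      | exact (D.b_ne_p _ _ e2).elim | exact (D.b_ne_p _ _ e2.symm).elim
      | exact (D.b_ne_q _ _ e2).elim | exact (D.b_ne_q _ _ e2.symm).elim
      | exact (D.p_ne_q _ _ e2).elim | exact (D.p_ne_q _ _ e2.symm).elim
      | rw [D.t_inj e1] | rw [D.q_inj e1] | rw [D.b_inj e1] | rw [D.p_inj e1]
  exact H h h' rfl rfl

theorem Roof.not_swap {D : Diagram N Cr} {x y z : N} (h : D.Roof x y z) : ¬ D.Roof y x z := by
  have H : ∀ {x y z x' y' z'}, D.Roof x y z → D.Roof x' y' z' → x' = y → y' = x → z' = z → False := by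
    intro x y z x' y' z' h h' e1 e2 e3
    cases h <;> cases h' <;>
      first
      | exact D.t_ne_b _ _ e1 | exact D.t_ne_b _ _ e1.symm
      | exact D.t_ne_p _ _ e1 | exact D.t_ne_p _ _ e1.symm
      | exact D.t_ne_q _ _ e1 | exact D.t_ne_q _ _ e1.symm
      | exact D.b_ne_p _ _ e1 | exact D.b_ne_p _ _ e1.symm
      | exact D.b_ne_q _ _ e1 | exact D.b_ne_q _ _ e1.symm
      | exact D.p_ne_q _ _ e1 | exact D.p_ne_q _ _ e1.symm
      | exact D.t_ne_b _ _ e2 | exact D.t_ne_b _ _ e2.symm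
      | exact D.t_ne_p _ _ e2 | exact D.t_ne_p _ _ e2.symm
      | exact D.t_ne_q _ _ e2 | exact D.t_ne_q _ _ e2.symm
      | exact D.b_ne_p _ _ e2 | exact D.b_ne_p _ _ e2.symm
      | exact D.b_ne_q _ _ e2 | exact D.b_ne_q _ _ e2.symm
      | exact D.p_ne_q _ _ e2 | exact D.p_ne_q _ _ e2.symm
      | exact D.b_ne_p _ _ e3 | exact D.b_ne_p _ _ e3.symm
  exact fun h' => H h h' rfl rfl rfl

variable [Finite N]

theorem smooth_q (c : Cr) : D.smooth (D.Q c) = D.P c := D.smoothFun_q c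

/-- The upper end of a wall lies over the smoothed successor and coincides with it, except for edges
into b, whose walls rise to t. -/
theorem top_cases (x : D.Lower) : (∃ c, D.top x = D.t c ∧ D.smooth x = D.B c) ∨
    ((∀ c, D.top x ≠ D.t c) ∧ (D.smooth x).1 = D.top x) := by
  rcases D.smoothFun_cases x with ⟨c, h1, h2⟩ | ⟨c, h1, h2⟩ | ⟨h1, h1', h2⟩
  · left
    refine ⟨c, ?_, h2⟩
    rw [top_of_ne, h1]
    rintro d hd
    rw [hd, D.next_q] at h1
    exact D.t_ne_b _ _ h1.symm
  · right
    subst h1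
    have : D.top (D.Q c) = D.p c := D.top_q c
    exact ⟨fun d hd => D.t_ne_p d c (by rw [← hd, this]), by rw [this, smooth_q]; rfl⟩
  · right
    rw [top_of_ne D h1']
    exact ⟨h1, h2⟩

theorem top_eq_t_iff {x : D.Lower} {c : Cr} : D.top x = D.t c ↔ D.smooth x = D.B c := by
  rcases D.top_cases x with ⟨d, h1, h2⟩ | ⟨h1, h2⟩
  · rw [h1, h2]
    constructor
    · intro h; rw [D.t_inj h]
    · intro h; rw [D.b_inj (congrArg Subtype.val h)]
  · constructor
    · intro h; exact (h1 c h).elim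
    · intro h
      rw [h] at h2
      have h2 : D.b c = D.top x := h2
      by_cases hq : ∃ d, x.1 = D.q d
      · obtain ⟨d, hd⟩ := hq
        rw [hd, D.top_q] at h2
        exact (D.b_ne_p _ _ h2).elim
      · push Not at hq
        rw [D.top_of_ne hq, ← D.next_q] at h2
        exact (hq c (D.next.injective h2.symm)).elim

theorem top_ne_b (x : D.Lower) (c : Cr) : D.top x ≠ D.b c := by
  intro h
  rcases D.top_cases x with ⟨d, h1, h2⟩ | ⟨h1, h2⟩
  · exact D.t_ne_b _ _ (h1.symm.trans h)
  · exact h1 c (D.top_eq_t_iff.2 (Subtype.ext (h2.trans h)))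

theorem smooth_ne (x : D.Lower) : D.smooth x ≠ x := by
  rcases D.smoothFun_cases x with ⟨c, h1, h2⟩ | ⟨c, h1, h2⟩ | ⟨h1, h1', h2⟩
  · intro h
    have : D.B c = x := h2.symm.trans h
    subst this
    exact D.next_b_ne c h1
  · intro h
    have : D.P c = D.Q c := h2.symm.trans (h.trans h1)
    exact D.p_ne_q c c (congrArg Subtype.val this)
  · intro h
    have : (D.smoothFun x).1 = x.1 := congrArg Subtype.val h
    exact D.next_ne x (h2.symm.trans this)

theorem top_ne (x : D.Lower) : D.top x ≠ x := by
  intro h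
  rcases D.top_cases x with ⟨c, h1, h2⟩ | ⟨h1, h2⟩
  · exact D.ne_t x c (h.symm.trans h1)
  · exact D.smooth_ne x (Subtype.ext (h2.trans h))

/-- The triangles with two vertices on the polygon. -/
inductive Upper : N → N → D.Lower → Prop
  | edge (x : D.Lower) : Upper x (D.top x) x
  | cross (c : Cr) (y : D.Lower) (h : D.smooth y = D.B c) : Upper (D.t c) (D.b c) y

/-- The triangles with one vertex on the polygon. -/
inductive Under : N → D.Lower → D.Lower → Prop
  | edge (x : D.Lower) : Under (D.smooth x) (D.smooth x) x

/-- The oriented triangles of the surface: walls, triangles at the crossings, and floors. -/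
inductive Tri (T : D.Lower → D.Lower → D.Lower → Prop) : N ⊕ D.Lower → N ⊕ D.Lower → N ⊕ D.Lower → Prop
  | roof {x y z} (h : D.Roof x y z) : Tri T (.inl x) (.inl y) (.inl z)
  | upper {x y v} (h : D.Upper x y v) : Tri T (.inl x) (.inl y) (.inr v)
  | upper' {x y v} (h : D.Upper x y v) : Tri T (.inl y) (.inr v) (.inl x)
  | upper'' {x y v} (h : D.Upper x y v) : Tri T (.inr v) (.inl x) (.inl y)
  | under {x u v} (h : D.Under x u v) : Tri T (.inl x) (.inr u) (.inr v)
  | under' {x u v} (h : D.Under x u v) : Tri T (.inr u) (.inr v) (.inl x)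
  | under'' {x u v} (h : D.Under x u v) : Tri T (.inr v) (.inl x) (.inr u)
  | floor {u v w} (h : T u v w) : Tri T (.inr u) (.inr v) (.inr w)

variable {D}

theorem Roof.upper_false {x y z : N} {v : D.Lower} (h : D.Roof x y z) (h' : D.Upper x y v) : False := by
  have H : ∀ {x y z x' y'} {v : D.Lower}, D.Roof x y z → D.Upper x' y' v → x' = x → y' = y → False := by
    intro x y z x' y' v h h' e1 e2
    cases h' with
    | edge =>
      cases h with
      | tpq c => exact D.ne_t v c e1
      | pqt c =>
        rw [e1, D.top_of_ne (fun d => D.p_ne_q c d)] at e2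
        exact D.next_p_ne c e2
      | qtp c =>
        rw [e1, D.top_q] at e2
        exact D.t_ne_p _ _ e2.symm
      | tqb c => exact D.ne_t v c e1
      | qbt c =>
        rw [e1, D.top_q] at e2
        exact D.b_ne_p _ _ e2.symm
      | btq c =>
        rw [e1, D.top_of_ne (fun d => D.b_ne_q c d)] at e2
        exact D.next_b_ne c e2
    | cross d _ hd =>
      cases h with
      | tpq c => exact D.b_ne_p _ _ e2
      | pqt c => exact D.b_ne_q _ _ e2
      | qtp c => exact D.t_ne_b _ _ e2.symm
      | tqb c => exact D.b_ne_q _ _ e2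
      | qbt c => exact D.t_ne_q _ _ e1
      | btq c => exact D.t_ne_b _ _ e1
  exact H h h' rfl rfl

theorem Upper.unique {x y : N} {v v' : D.Lower} (h : D.Upper x y v) (h' : D.Upper x y v') : v = v' := by
  have H : ∀ {x y x' y'} {v v' : D.Lower}, D.Upper x y v → D.Upper x' y' v' → x' = x → y' = y → v = v' := by
    intro x y x' y' v v' h h' e1 e2
    cases h with
    | edge =>
      cases h' with
      | edge => exact Subtype.ext e1.symm
      | cross c _ h => exact (D.ne_t v c e1.symm).elim
    | cross c _ h =>
      cases h' with
      | edge => exact (D.ne_t v' c e1).elim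
      | cross c' _ h' =>
        rw [D.t_inj e1, ← h] at h'
        exact D.smooth.injective h'.symm
  exact H h h' rfl rfl

theorem Upper.not_swap {x y : N} {v : D.Lower} (h : D.Upper x y v) : ¬ D.Upper y x v := by
  have H : ∀ {x y x' y'} {v v' : D.Lower}, D.Upper x y v → D.Upper x' y' v' → v = v' → x' = y → y' = x → False := by
    intro x y x' y' v v' h h' ev e1 e2
    subst ev
    cases h with
    | edge =>
      cases h' with
      | edge => exact D.top_ne v e1.symm
      | cross c _ h => exact D.smooth_ne v (h.trans (Subtype.ext e2))
    | cross c _ h =>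
      cases h' with
      | edge => exact D.smooth_ne v (h.trans (Subtype.ext e1.symm))
      | cross c' _ h' => exact D.t_ne_b _ _ e1
  exact fun h' => H h h' rfl rfl rfl

theorem Upper.left_unique {x y y' : N} {v : D.Lower} (h : D.Upper y x v) (h' : D.Upper y' x v) : y = y' := by
  have H : ∀ {x y x' y'} {v v' : D.Lower}, D.Upper y x v → D.Upper y' x' v' → v = v' → x' = x → y = y' := by
    intro x y x' y' v v' h h' ev e1
    subst ev
    cases h with
    | edge =>
      cases h' with
      | edge => rfl
      | cross c _ h => exact (D.top_ne_b v c e1.symm).elim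
    | cross c _ h =>
      cases h' with
      | edge => exact (D.top_ne_b v c e1).elim
      | cross c' _ h' => rw [D.b_inj e1]
  exact H h h' rfl rfl

theorem Upper.right_unique {x y y' : N} {v : D.Lower} (h : D.Upper x y v) (h' : D.Upper x y' v) : y = y' := by
  have H : ∀ {x y x' y'} {v v' : D.Lower}, D.Upper x y v → D.Upper x' y' v' → v = v' → x' = x → y = y' := by
    intro x y x' y' v v' h h' ev e1
    subst ev
    cases h with
    | edge =>
      cases h' with
      | edge => rfl
      | cross c _ h => exact (D.ne_t v c e1.symm).elim
    | cross c _ h =>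
      cases h' with
      | edge => exact (D.ne_t v c e1).elim
      | cross c' _ h' => rw [D.t_inj e1]
  exact H h h' rfl rfl

theorem under_iff {x : N} {u v : D.Lower} : D.Under x u v ↔ x = u ∧ D.smooth v = u := by
  constructor
  · rintro ⟨⟩; exact ⟨rfl, rfl⟩
  · rintro ⟨rfl, rfl⟩; exact .edge v

theorem Upper.right_ne {x : N} {v : D.Lower} (h : D.Upper x v v) : False := by
  have H : ∀ {y}, D.Upper x y v → y = v → False := by
    rintro y ⟨⟩ e
    · exact D.top_ne v e
    · rename_i c h
      exact D.smooth_ne v (h.trans (Subtype.ext e))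
  exact H h rfl

theorem Upper.left_ne {y : N} {v : D.Lower} (h : D.Upper (D.smooth v) y v) : False := by
  have H : ∀ {x}, D.Upper x y v → x = D.smooth v → False := by
    rintro x ⟨⟩ e
    · exact D.smooth_ne v (Subtype.ext e.symm)
    · exact D.ne_t _ _ e.symm
  exact H h rfl

section Floor

variable {T : D.Lower → D.Lower → D.Lower → Prop} {g : D.Lower → ℂ} {lev : D.Lower → ℤ}

theorem Tri.rotate (hT : IsFloor g D.smooth lev T) {a b c : N ⊕ D.Lower} (h : D.Tri T a b c) :
    D.Tri T b c a := by
  cases h with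
  | roof h => cases h <;> exact .roof (by constructor)
  | upper h => exact .upper' h
  | upper' h => exact .upper'' h
  | upper'' h => exact .upper h
  | under h => exact .under' h
  | under' h => exact .under'' h
  | under'' h => exact .under h
  | floor h => exact .floor (hT.rotate h)

theorem Tri.unique (hT : IsFloor g D.smooth lev T) {a b c d : N ⊕ D.Lower} (h : D.Tri T a b c)
    (h' : D.Tri T a b d) : c = d := by
  cases h with
  | roof h =>
    cases h' with
    | roof h' => rw [h.unique h']
    | upper h' => exact (h.upper_false h').elim
  | upper h =>
    cases h' with
    | roof h' => exact (h'.upper_false h).elim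
    | upper h' => rw [h.unique h']
  | upper' h =>
    cases h' with
    | upper' h' => rw [h.left_unique h']
    | under h' =>
      obtain ⟨rfl, -⟩ := under_iff.1 h'
      exact h.right_ne.elim
  | upper'' h =>
    cases h' with
    | upper'' h' => rw [h.right_unique h']
    | under'' h' =>
      obtain ⟨rfl, rfl⟩ := under_iff.1 h'
      exact h.left_ne.elim
  | under h =>
    cases h' with
    | upper' h' =>
      obtain ⟨rfl, -⟩ := under_iff.1 h
      exact h'.right_ne.elim
    | under h' =>
      rw [D.smooth.injective ((under_iff.1 h).2.trans (under_iff.1 h').2.symm)]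
  | under' h =>
    cases h' with
    | under' h' => rw [(under_iff.1 h).1, (under_iff.1 h').1]
    | floor h' =>
      obtain ⟨-, rfl⟩ := under_iff.1 h
      exact (hT.not_backward h').elim
  | under'' h =>
    cases h' with
    | upper'' h' =>
      obtain ⟨rfl, rfl⟩ := under_iff.1 h
      exact h'.left_ne.elim
    | under'' h' => rw [Subtype.ext ((under_iff.1 h).1.symm.trans (under_iff.1 h').1)]
  | floor h =>
    cases h' with
    | under' h' =>
      obtain ⟨-, rfl⟩ := under_iff.1 h'
      exact (hT.not_backward h).elim
    | floor h' => rw [hT.unique h h']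

theorem Tri.not_swap (hT : IsFloor g D.smooth lev T) {a b c : N ⊕ D.Lower} (h : D.Tri T a b c) :
    ¬ D.Tri T b a c := by
  have hU : ∀ {x u v}, D.Under x u v → ¬ D.Under x v u := by
    intro x u v h h'
    rw [under_iff] at h h'
    obtain ⟨rfl, h⟩ := h
    have : u = v := Subtype.ext h'.1
    subst this
    exact D.smooth_ne _ h
  intro h'
  cases h with
  | roof h => cases h' with | roof h' => exact h.not_swap h'
  | upper h => cases h' with | upper h' => exact h.not_swap h'
  | upper' h => cases h' with | upper'' h' => exact h.not_swap h'
  | upper'' h => cases h' with | upper' h' => exact h.not_swap h'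
  | under h => cases h' with | under'' h' => exact hU h h'
  | under' h => cases h' with | under' h' => exact hU h h'
  | under'' h => cases h' with | under h' => exact hU h h'
  | floor h => cases h' with | floor h' => exact hT.not_swap h h'

/-- Apart from the edges of the polygon, every oriented edge meets its reverse. The roof triangles
share t q, their edge p q lies on the wall of the chord and b t on the wall ending at b. Vertical
and diagonal wall edges belong to neighbouring wall triangles, bottom edges to a floor, and inner
floor edges to two floor triangles. -/
theorem Tri.boundary_iff (hT : IsFloor g D.smooth lev T) {a b : N ⊕ D.Lower} :
    ((∃ c, D.Tri T a b c) ∧ ∀ d, ¬ D.Tri T b a d) ↔ ∃ x, a = .inl x ∧ b = .inl (D.next x) := by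
  constructor
  · rintro ⟨⟨c, h⟩, hd⟩
    have under_edge : ∀ v : D.Lower, ∃ y, D.Upper y (D.smooth v) v := by
      intro v
      rcases D.top_cases v with ⟨c, h1, h2⟩ | ⟨h1, h2⟩
      · refine ⟨D.t c, ?_⟩
        rw [h2]
        exact .cross c v h2
      · refine ⟨v, ?_⟩
        rw [h2]
        exact .edge v
    have cross_edge : ∀ {v : D.Lower} {c}, D.smooth v = D.B c → D.Upper v (D.t c) v := by
      intro v c h
      have := Upper.edge (D := D) v
      rwa [D.top_eq_t_iff.2 h] at this
    cases h with
    | roof h =>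
      cases h with
      | tpq c => exact ⟨_, rfl, by rw [D.next_t]⟩
      | pqt c =>
        refine (hd _ (.upper (v := D.Q c) ?_)).elim
        have := Upper.edge (D := D) (D.Q c)
        rwa [show D.top (D.Q c) = D.p c from D.top_q c] at this
      | qtp c => exact (hd _ (.roof (.tqb c))).elim
      | tqb c => exact (hd _ (.roof (.qtp c))).elim
      | qbt c => exact ⟨_, rfl, by rw [D.next_q]⟩
      | btq c => exact (hd _ (.upper (.cross c (D.smooth.symm (D.B c)) (by simp)))).elim
    | upper h =>
      rename_i v
      cases h with
      | edge =>
        by_cases hq : ∃ c, v.1 = D.q c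
        · obtain ⟨c, hq⟩ := hq
          refine (hd (.inl (D.t c)) ?_).elim
          rw [hq, D.top_q]
          exact .roof (.pqt c)
        · push Not at hq
          exact ⟨v, rfl, by rw [D.top_of_ne hq]⟩
      | cross c _ h => exact (hd _ (.roof (.btq c))).elim
    | upper' h =>
      rename_i v
      cases h with
      | edge =>
        rcases D.top_cases v with ⟨c, h1, h2⟩ | ⟨h1, h2⟩
        · rw [h1] at hd
          exact (hd _ (.upper'' (.cross c v h2))).elim
        · rw [← h2] at hd
          exact (hd _ (.under'' (.edge v))).elim
      | cross c _ h =>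
        refine (hd (.inr (D.B c)) (.under'' ?_)).elim
        exact under_iff.2 ⟨rfl, h⟩
    | upper'' h =>
      rename_i v
      cases h with
      | edge => exact (hd (.inr (D.smooth.symm v)) (.under (under_iff.2 ⟨rfl, by simp⟩))).elim
      | cross c _ h => exact (hd _ (.upper' (cross_edge h))).elim
    | under h =>
      rename_i x u v
      obtain ⟨rfl, -⟩ := under_iff.1 h
      exact (hd _ (.upper'' (.edge u))).elim
    | under' h =>
      obtain ⟨-, rfl⟩ := under_iff.1 h
      obtain ⟨c, hc⟩ := hT.exists_edge ‹_›
      exact (hd _ (.floor hc)).elim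
    | under'' h =>
      obtain ⟨rfl, rfl⟩ := under_iff.1 h
      obtain ⟨y, hy⟩ := under_edge ‹_›
      exact (hd _ (.upper' hy)).elim
    | floor h =>
      rename_i u v w
      by_cases huv : v = D.smooth u
      · subst huv
        exact (hd _ (.under' (.edge u))).elim
      · obtain ⟨d, h⟩ := hT.opposite h huv
        exact (hd _ (.floor h)).elim
  · rintro ⟨x, rfl, rfl⟩
    by_cases hx : ∃ c, D.t c = x
    · obtain ⟨c, rfl⟩ := hx
      rw [D.next_t]
      refine ⟨⟨_, .roof (.tpq c)⟩, fun d hd => ?_⟩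
      have H : ∀ {x y z}, D.Roof x y z → x = D.p c → y = D.t c → False := by
        rintro _ _ _ ⟨⟩ e1 e2
        exacts [D.t_ne_p _ _ e2.symm, D.t_ne_q _ _ e2.symm, D.p_ne_q _ _ e1.symm, D.t_ne_q _ _ e2.symm,
          D.t_ne_b _ _ e2.symm, D.b_ne_p _ _ e1]
      have H' : ∀ {x y v}, D.Upper x y v → x = D.p c → y = D.t c → False := by
        rintro _ _ v ⟨⟩ e1 e2
        · rw [e1, D.top_of_ne (fun d => D.p_ne_q c d), ← D.next_t] at e2
          exact D.next_next_ne _ e2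
        · exact D.t_ne_b _ _ e2.symm
      cases hd with
      | roof h => exact H h rfl rfl
      | upper h => exact H' h rfl rfl
    by_cases hx' : ∃ c, x = D.q c
    · obtain ⟨c, rfl⟩ := hx'
      rw [D.next_q]
      refine ⟨⟨_, .roof (.qbt c)⟩, fun d hd => ?_⟩
      have H : ∀ {x y z}, D.Roof x y z → x = D.b c → y = D.q c → False := by
        rintro _ _ _ ⟨⟩ e1 e2
        exacts [D.p_ne_q _ _ e2, D.b_ne_p _ _ e1.symm, D.t_ne_q _ _ e2, D.t_ne_b _ _ e1,
          D.b_ne_q _ _ e2, D.t_ne_q _ _ e2]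
      have H' : ∀ {x y v}, D.Upper x y v → x = D.b c → y = D.q c → False := by
        rintro _ _ v ⟨⟩ e1 e2
        · rw [e1, D.top_of_ne (fun d => D.b_ne_q c d), ← D.next_q] at e2
          exact D.next_next_ne _ e2
        · exact D.b_ne_q _ _ e2
      cases hd with
      | roof h => exact H h rfl rfl
      | upper h => exact H' h rfl rfl
    push Not at hx hx'
    refine ⟨⟨.inr ⟨x, by simpa using hx⟩, .upper ?_⟩, fun d hd => ?_⟩
    · have := Upper.edge (D := D) ⟨x, by simpa using hx⟩
      rwa [D.top_of_ne hx'] at this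
    · have H : ∀ {x' y z}, D.Roof x' y z → x' = D.next x → y = x → False := by
        rintro _ _ _ ⟨⟩ e1 e2 <;> rename_i c
        · rw [← e2, ← D.next_t] at e1
          exact D.next_next_ne _ e1.symm
        · exact hx' c e2.symm
        · exact hx c e2
        · exact hx' c e2.symm
        · rw [← e2, ← D.next_q] at e1
          exact D.next_next_ne _ e1.symm
        · exact hx c e2
      have H' : ∀ {x' y v}, D.Upper x' y v → x' = D.next x → y = x → False := by
        rintro _ _ v ⟨⟩ e1 e2
        · by_cases hq : ∃ c, v.1 = D.q c
          · obtain ⟨c, hq⟩ := hq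
            rw [hq, D.top_q] at e2
            rw [hq, ← e2] at e1
            exact D.next_p_ne c e1.symm
          · push Not at hq
            rw [D.top_of_ne hq, e1] at e2
            exact D.next_next_ne _ e2
        · rename_i c h
          rw [← e2] at e1
          exact D.next_b_ne c e1.symm
      cases hd with
      | roof h => exact H h rfl rfl
      | upper h => exact H' h rfl rfl

/-- For each kind of vertex all neighbours are joined to one reference neighbour in the link. -/
theorem Tri.link (hT : IsFloor g D.smooth lev T) {v a b a' b' : N ⊕ D.Lower} (h : D.Tri T v a b)
    (h' : D.Tri T v a' b') : Relation.EqvGen (D.Tri T v) a a' := by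
  suffices H : ∃ r, ∀ a b, D.Tri T v a b → Relation.EqvGen (D.Tri T v) a r by
    obtain ⟨r, hr⟩ := H
    exact .trans _ _ _ (hr a b h) (.symm _ _ (hr a' b' h'))
  have cross_edge : ∀ {v : D.Lower} {c}, D.smooth v = D.B c → D.Upper v (D.t c) v := by
    intro v c h
    have := Upper.edge (D := D) v
    rwa [D.top_eq_t_iff.2 h] at this
  rcases v with x | v
  · by_cases hx : ∃ c, D.t c = x
    · obtain ⟨c, rfl⟩ := hx
      -- The link of t is the path p, q, b, the floor copy of the node before t, and that node
      -- itself.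
      refine ⟨.inl (D.b c), fun a b hab => ?_⟩
      have e1 : D.Tri T (.inl (D.t c)) (.inl (D.q c)) (.inl (D.b c)) := .roof (.tqb c)
      have e2 : D.Tri T (.inl (D.t c)) (.inl (D.p c)) (.inl (D.q c)) := .roof (.tpq c)
      have H : ∀ {x y z}, D.Roof x y z → x = D.t c → y = D.p c ∨ y = D.q c := by
        rintro _ _ _ ⟨⟩ e
        exacts [Or.inl (by rw [D.t_inj e]), (D.t_ne_p _ _ e.symm).elim, (D.t_ne_q _ _ e.symm).elim,
          Or.inr (by rw [D.t_inj e]), (D.t_ne_q _ _ e.symm).elim, (D.t_ne_b _ _ e.symm).elim]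
      have H1 : ∀ {x y v}, D.Upper x y v → x = D.t c → y = D.b c := by
        rintro _ _ v ⟨⟩ e
        exacts [(D.ne_t _ _ e).elim, by rw [D.t_inj e]]
      have H2 : ∀ {x y v}, D.Upper x y v → y = D.t c → D.smooth v = D.B c := by
        rintro _ _ v ⟨⟩ e
        exacts [D.top_eq_t_iff.1 e, (D.t_ne_b _ _ e.symm).elim]
      cases hab with
      | roof h =>
        rcases H h rfl with rfl | rfl
        · exact .trans _ _ _ (.rel _ _ e2) (.rel _ _ e1)
        · exact .rel _ _ e1
      | upper h =>
        obtain rfl := H1 h rfl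
        exact .refl _
      | upper' h =>
        have := H2 h rfl
        exact .symm _ _ (.rel _ _ (.upper (.cross c _ this)))
      | under h => exact (D.ne_t _ _ (under_iff.1 h).1.symm).elim
    · push Not at hx
      set X : D.Lower := ⟨x, by simpa using hx⟩ with hX
      have key : ∀ {v}, D.smooth v = X → Relation.EqvGen (D.Tri T (.inl x)) (.inr v) (.inr X) :=
        fun h => .symm _ _ (.rel _ _ (.under (under_iff.2 ⟨rfl, h⟩)))
      have keytop : Relation.EqvGen (D.Tri T (.inl x)) (.inl (D.top X)) (.inr X) :=
        .rel _ _ (.upper (.edge X))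
      -- For the remaining nodes of the polygon the reference is the floor copy of the node.
      refine ⟨.inr X, fun a b hab => ?_⟩
      have H2 : ∀ {x' y v}, D.Upper x' y v → y = x → D.smooth v = X := by
        rintro _ _ v ⟨⟩ e
        · rcases D.top_cases v with ⟨c, h1, h2⟩ | ⟨h1, h2⟩
          · exact (hx c (h1.symm.trans e)).elim
          · exact Subtype.ext (h2.trans e)
        · rename_i c h
          exact h.trans (Subtype.ext e)
      have H1 : ∀ {x' y v}, D.Upper x' y v → x' = x → y = D.top X := by
        rintro _ _ v ⟨⟩ e
        · rw [e]
        · exact (hx _ e).elim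
      have H : ∀ {x' y z}, D.Roof x' y z → x' = x → Relation.EqvGen (D.Tri T (.inl x)) (.inl y) (.inr X) := by
        have hq : ∀ c, D.q c = x → Relation.EqvGen (D.Tri T (.inl x)) (.inl (D.p c)) (.inr X) := by
          intro c e
          have : D.top X = D.p c := by rw [← D.top_q, e]
          rwa [this] at keytop
        rintro _ _ _ ⟨⟩ e
        · exact (hx _ e).elim
        · rename_i c
          have h1 : D.Upper (D.q c) x (D.Q c) := by
            have := Upper.edge (D := D) (D.Q c)
            rwa [show D.top (D.Q c) = x from (D.top_q c).trans e] at this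
          exact .trans _ _ _ (.symm _ _ (.rel _ _ (.upper' h1)))
            (key ((D.smooth_q c).trans (Subtype.ext e)))
        · rename_i c
          refine .trans _ _ _ (.rel _ _ ?_) (hq c e)
          rw [← e]
          exact .roof (.qtp c)
        · exact (hx _ e).elim
        · rename_i c
          refine .trans _ (Sum.inl (D.t c)) _ (.rel _ (Sum.inl (D.t c)) ?_)
            (.trans _ (Sum.inl (D.p c)) _ (.rel (Sum.inl (D.t c)) (Sum.inl (D.p c)) ?_) (hq c e))
          · rw [← e]; exact .roof (.qbt c)
          · rw [← e]; exact .roof (.qtp c)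
        · rename_i c
          have hs : D.smooth (D.smooth.symm X) = D.B c := by
            rw [Equiv.apply_symm_apply]; exact Subtype.ext e.symm
          refine .trans _ (.inr (D.smooth.symm X)) _ (.symm _ _ (.rel _ _ ?_)) (key (by simp))
          rw [← e]
          exact .upper' (.cross c _ hs)
      cases hab with
      | roof h => exact H h rfl
      | upper h => rw [H1 h rfl]; exact keytop
      | upper' h => exact key (H2 h rfl)
      | under h =>
        rename_i u v
        have : u = X := Subtype.ext (under_iff.1 h).1.symm
        rw [this]
        exact .refl _
  -- For a floor copy the reference is the floor copy of the successor, to which the link of the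
  -- floor leads.
  · refine ⟨.inr (D.smooth v), fun a b hab => ?_⟩
    have hfl : ∀ {u w}, T v u w → Relation.EqvGen (D.Tri T (.inr v)) (.inr u) (.inr (D.smooth v)) := by
      intro u w h
      have := hT.link h
      clear h
      generalize D.smooth v = s at this
      induction this with
      | rel x y h => exact .rel _ _ (.floor h)
      | refl x => exact .refl _
      | symm x y _ ih => exact .symm _ _ ih
      | trans x y z _ _ ih1 ih2 => exact .trans _ _ _ ih1 ih2
    have hprev : Relation.EqvGen (D.Tri T (.inr v)) (.inr (D.smooth.symm v)) (.inr (D.smooth v)) := by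
      obtain ⟨c, hc⟩ := hT.exists_edge (D.smooth.symm v)
      rw [Equiv.apply_symm_apply] at hc
      have := hT.rotate hc
      exact .trans _ _ _ (.symm _ _ (.rel _ _ (.floor this))) (hfl this)
    have hv : Relation.EqvGen (D.Tri T (.inr v)) (.inl v.1) (.inr (D.smooth v)) :=
      .trans _ _ _ (.symm _ _ (.rel _ _ (.under' (under_iff.2 ⟨rfl, by simp⟩)))) hprev
    have hs : Relation.EqvGen (D.Tri T (.inr v)) (.inl (D.smooth v).1) (.inr (D.smooth v)) :=
      .rel _ _ (.under'' (.edge v))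
    cases hab with
    | upper'' h =>
      cases h with
      | edge => exact hv
      | cross c _ h =>
        refine .trans _ _ _ (.rel _ _ (.upper'' (.cross c v h))) ?_
        rw [h] at hs ⊢
        exact hs
    | under' h =>
      rename_i w
      obtain rfl : w = D.smooth.symm v := by rw [← (under_iff.1 h).2]; simp
      exact hprev
    | under'' h =>
      obtain ⟨rfl, rfl⟩ := under_iff.1 h
      exact hs
    | floor h => exact hfl h

end Floor

end Diagram

/-! ### Separating functions and nondegenerate triangles -/

theorem IsAffineFun.signedArea (p q : ℂ) (k : ℝ) :
    IsAffineFun fun x : ℂ × ℝ => k * signedArea p q x.1 := by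
  intro x y u v huv
  obtain rfl : u = 1 - v := by linarith
  simp only [_root_.signedArea, Prod.fst_add, Prod.smul_fst, Complex.add_re, Complex.add_im,
    Complex.real_smul, Complex.mul_re, Complex.mul_im, Complex.ofReal_re, Complex.ofReal_im]
  ring

theorem IsAffineFun.height (k : ℝ) : IsAffineFun fun x : ℂ × ℝ => x.2 - k := by
  intro x y u v huv
  obtain rfl : u = 1 - v := by linarith
  simp only [Prod.snd_add, Prod.smul_snd, smul_eq_mul]
  ring

/-- The height above the line through `(p, y)` and `(q, z)`, in the vertical plane. -/
noncomputable def heightAbove (p q : ℂ) (y z : ℝ) (x : ℂ × ℝ) : ℝ :=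
  x.2 - y - ((x.1 - p) / (q - p)).re * (z - y)

theorem isAffineFun_heightAbove (p q : ℂ) (y z : ℝ) : IsAffineFun (heightAbove p q y z) := by
  intro x x' u v huv
  obtain rfl : u = 1 - v := by linarith
  have : (((1 - v) • x + v • x').1 - p) / (q - p) =
      ((1 - v : ℝ) : ℂ) * ((x.1 - p) / (q - p)) + (v : ℂ) * ((x'.1 - p) / (q - p)) := by
    simp only [Prod.fst_add, Prod.smul_fst, Complex.real_smul]
    push_cast
    ring
  simp only [heightAbove, this, Complex.add_re, Complex.re_ofReal_mul, Prod.snd_add, Prod.smul_snd,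
    smul_eq_mul]
  ring

theorem heightAbove_left (p q : ℂ) (y z h : ℝ) : heightAbove p q y z (p, h) = h - y := by
  simp [heightAbove]

theorem heightAbove_right {p q : ℂ} (hpq : p ≠ q) (y z h : ℝ) : heightAbove p q y z (q, h) = h - z := by
  have : (q - p) / (q - p) = 1 := div_self (sub_ne_zero.2 hpq.symm)
  simp [heightAbove, this]

theorem not_collinear_of_area {x y z : ℂ × ℝ} (h : signedArea x.1 y.1 z.1 ≠ 0) :
    ¬ Collinear ℝ ({x, y, z} : Set (ℂ × ℝ)) := by
  intro hc
  obtain ⟨v, hv⟩ := (collinear_iff_of_mem (Set.mem_insert x _)).1 hc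
  obtain ⟨r, hr⟩ := hv y (by simp)
  obtain ⟨s, hs⟩ := hv z (by simp)
  apply h
  rw [hr, hs]
  simp [signedArea]
  ring

theorem not_collinear_of_vertical {x y z : ℂ × ℝ} (h1 : y.1 = x.1) (h2 : x.2 ≠ y.2) (h3 : z.1 ≠ x.1) :
    ¬ Collinear ℝ ({x, y, z} : Set (ℂ × ℝ)) := by
  intro hc
  obtain ⟨v, hv⟩ := (collinear_iff_of_mem (Set.mem_insert x _)).1 hc
  obtain ⟨r, hr⟩ := hv y (by simp)
  obtain ⟨s, hs⟩ := hv z (by simp)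
  have hr0 : r ≠ 0 := by
    rintro rfl
    rw [hr] at h2
    simp at h2
  have : v.1 = 0 := by
    rw [hr] at h1
    simpa [hr0] using h1
  rw [hs] at h3
  simp [this] at h3

theorem notMem_convexHull_pair_diff {a b z : ℂ} (hab : a ≠ b) (hz : z = a ∨ z = b) :
    z ∉ convexHull ℝ (({a, b} : Set ℂ) \ {z}) := by
  have key : ∀ {a b : ℂ}, a ≠ b → a ∉ convexHull ℝ (({a, b} : Set ℂ) \ {a}) := by
    intro a b hab hm
    have : ({a, b} : Set ℂ) \ {a} ⊆ {b} := by
      rintro x ⟨rfl | rfl, h⟩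
      exacts [(h rfl).elim, rfl]
    have := convexHull_mono this hm
    rw [convexHull_singleton] at this
    exact hab this
  rcases hz with rfl | rfl
  · exact key hab
  · rw [Set.pair_comm]; exact key hab.symm

theorem notMem_convexHull_triple_diff {a b c z : ℂ} (h : signedArea a b c ≠ 0)
    (hz : z = a ∨ z = b ∨ z = c) : z ∉ convexHull ℝ (({a, b, c} : Set ℂ) \ {z}) := by
  have key : ∀ {a b c : ℂ}, signedArea a b c ≠ 0 → a ∉ convexHull ℝ (({a, b, c} : Set ℂ) \ {a}) := by
    intro a b c h hm
    have : ({a, b, c} : Set ℂ) \ {a} ⊆ {b, c} := by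
      rintro x ⟨rfl | h', h⟩
      exacts [(h rfl).elim, h']
    have := convexHull_mono this hm
    rw [convexHull_pair, mem_segment_iff_pointAt] at this
    obtain ⟨t, -, -, e⟩ := this
    rw [← signedArea_cyc, ← e, signedArea_pointAt] at h
    simp at h
  rcases hz with rfl | rfl | rfl
  · exact key h
  · have : ({a, z, c} : Set ℂ) = {z, c, a} := by ext; simp; tauto
    rw [this]
    exact key (by rwa [signedArea_cyc])
  · have : ({a, b, z} : Set ℂ) = {z, a, b} := by ext; simp; tauto
    rw [this]
    exact key (by rwa [← signedArea_cyc])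

/-- A point of the segment that is not an end requires both ends in `A`; an end that lies in a hull
of some of the ends is itself one of them. -/
theorem mem_convexHull_inter_of_pair {u v z : ℂ} {A T : Set ℂ} (hA : A ⊆ {u, v}) (huv : u ≠ v)
    (hz : z ∈ convexHull ℝ A) (hz' : z ∈ convexHull ℝ ({u, v} ∩ T)) : z ∈ convexHull ℝ (A ∩ T) := by
  have key : ∀ {A : Set ℂ} {u v z : ℂ}, A ⊆ {u, v} → z ∈ convexHull ℝ A → z ≠ v → u ∈ A := by
    intro A u v z hA hz hzv
    by_contra hu
    have : A ⊆ {v} := by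
      intro x hx
      rcases hA hx with rfl | h
      exacts [(hu hx).elim, h]
    have := convexHull_mono this hz
    rw [convexHull_singleton] at this
    exact hzv this
  by_cases hzu : z = u
  · subst hzu
    exact subset_convexHull _ _ ⟨key hA hz huv, (key (Set.inter_subset_left.trans subset_rfl) hz' huv).2⟩
  by_cases hzv : z = v
  · subst hzv
    rw [Set.pair_comm] at hA hz'
    exact subset_convexHull _ _ ⟨key hA hz huv.symm, (key Set.inter_subset_left hz' huv.symm).2⟩
  have hu := key hA hz hzv
  have hv := key (by rwa [Set.pair_comm] at hA) hz hzu
  have : A = {u, v} := Set.Subset.antisymm hA (by rintro x (rfl | rfl) <;> assumption)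
  rwa [this]

/-! ### Walls and crossing triangles in space -/

namespace Diagram

variable {N Cr : Type*} {D : Diagram N Cr}

variable (D) in
/-- The projection of the vertices of the surface to the plane. -/
def base : N ⊕ D.Lower → ℂ := Sum.elim D.f fun v => D.f v

variable (D) in
/-- The heights of the vertices of the surface. -/
def ht (lev : D.Lower → ℤ) (C : ℝ) : N ⊕ D.Lower → ℝ := Sum.elim D.a fun v => lev v + C

@[simp] theorem base_inl (x : N) : D.base (.inl x) = D.f x := rfl
@[simp] theorem base_inr (v : D.Lower) : D.base (.inr v) = D.f v := rfl
@[simp] theorem ht_inl (lev : D.Lower → ℤ) (C : ℝ) (x : N) : D.ht lev C (.inl x) = D.a x := rfl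
@[simp] theorem ht_inr (lev : D.Lower → ℤ) (C : ℝ) (v : D.Lower) : D.ht lev C (.inr v) = lev v + C := rfl

theorem lower_inj {v w : D.Lower} (h : D.f v = D.f w) : v = w := Subtype.ext (D.f_inj _ _ v.2 w.2 h)

theorem exists_lower (w : N ⊕ D.Lower) : ∃ v : D.Lower, D.base w = D.f v := by
  rcases w with x | w
  · by_cases hx : ∃ c, D.t c = x
    · obtain ⟨c, rfl⟩ := hx
      exact ⟨D.B c, D.f_t c⟩
    · exact ⟨⟨x, by simpa using hx⟩, rfl⟩
  · exact ⟨w, rfl⟩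

/-- Over a vertex of the smoothed curve lie its floor copy and the node itself, and over b also the
node t. -/
theorem column {v : D.Lower} {w : N ⊕ D.Lower} (h : D.base w = D.f v) :
    w = .inr v ∨ w = .inl v.1 ∨ ∃ c, v = D.B c ∧ w = .inl (D.t c) := by
  rcases w with x | w
  · by_cases hx : ∃ c, D.t c = x
    · obtain ⟨c, rfl⟩ := hx
      refine Or.inr (Or.inr ⟨c, ?_, rfl⟩)
      rw [base_inl, D.f_t] at h
      exact (lower_inj (v := D.B c) h).symm
    · right; left
      rw [D.f_inj x v.1 (by simpa using hx) v.2 h]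
  · left
    rw [lower_inj h]

variable [Finite N]

/-- The projection of the smoothed diagram is embedded, apart from the triangles at the crossings,
which are disjoint from each other and from the rest of the diagram. -/
structure IsPlanar (D : Diagram N Cr) : Prop where
  curve : IsPlanarCurve (fun x : D.Lower => D.f x) D.smooth
  area : ∀ c, signedArea (D.f (D.b c)) (D.f (D.p c)) (D.f (D.q c)) ≠ 0
  roof_disj : ∀ {c d z}, c ≠ d → z ∈ convexHull ℝ {D.f (D.b c), D.f (D.p c), D.f (D.q c)} →
    z ∉ convexHull ℝ {D.f (D.b d), D.f (D.p d), D.f (D.q d)}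
  roof_edge : ∀ {c x z}, x ≠ D.Q c → z ∈ convexHull ℝ {D.f (D.b c), D.f (D.p c), D.f (D.q c)} →
    z ∈ segment ℝ (D.f x) (D.f (D.smooth x)) →
    ∃ v : D.Lower, (v = x ∨ v = D.smooth x) ∧ (v = D.B c ∨ v = D.P c ∨ v = D.Q c) ∧ z = D.f v
  dir : ∀ c, ∃ r s : ℝ, 0 < r ∧ 0 < s ∧ D.f (D.p c) - D.f (D.q c) =
    r * (D.f (D.q c) - D.f (D.smooth.symm (D.Q c))) + s * (D.f (D.smooth (D.P c)) - D.f (D.p c))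

theorem f_top (x : D.Lower) : D.f (D.top x) = D.f (D.smooth x) := by
  rcases D.top_cases x with ⟨c, h1, h2⟩ | ⟨h1, h2⟩
  · rw [h1, h2, D.f_t]; rfl
  · rw [h2]

section

variable {lev : D.Lower → ℤ} {C : ℝ} (hC : ∀ v x, lev v + C < D.a x)

/-- A column has a vertex strictly between two others only in the case of the floor copy of b, b and
t, in this vertical order. -/
theorem tame_of (hC : ∀ v x, lev v + C < D.a x) {s : Set (N ⊕ D.Lower)}
    (h : ∀ c, .inr (D.B c) ∈ s → .inl (D.t c) ∈ s → .inl (D.b c) ∈ s) : Tame D.base (D.ht lev C) s := by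
  intro u hu u' hu' v h1 h2 h3 h4
  obtain ⟨L, hL⟩ := exists_lower u
  rcases column (h2.trans hL) with rfl | rfl | ⟨c, rfl, rfl⟩
  · rcases column hL with rfl | rfl | ⟨c, rfl, rfl⟩
    · exact hu
    · exact absurd h3 (not_le.2 (hC _ _))
    · exact absurd h3 (not_le.2 (hC _ _))
  · rcases column hL with rfl | rfl | ⟨c, rfl, rfl⟩
    · rcases column (h1.symm.trans hL) with rfl | rfl | ⟨c, rfl, rfl⟩
      · exact absurd h4 (not_le.2 (hC _ _))
      · exact hu'
      · exact h c hu hu'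
    · exact hu
    · exact absurd h3 (not_le.2 (D.height c))
  · rcases column (h1.symm.trans hL) with rfl | rfl | ⟨d, e, rfl⟩
    · exact absurd h4 (not_le.2 (hC _ _))
    · exact absurd h4 (not_le.2 (D.height c))
    · rw [D.b_inj (congrArg Subtype.val e)]
      exact hu'

theorem pos_injective (hC : ∀ v x, lev v + C < D.a x) :
    Function.Injective fun w => (D.base w, D.ht lev C w) := by
  intro v w h
  have h1 : D.base v = D.base w := congrArg Prod.fst h
  have h2 : D.ht lev C v = D.ht lev C w := congrArg Prod.snd h
  -- A vertex at the place of `w` lies weakly between `w` and `w`, hence in the tame set `{w}`.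
  have ht : Tame D.base (D.ht lev C) {w} := by
    refine tame_of hC ?_
    rintro c e1 e2
    exact absurd (e1.trans e2.symm) (by simp)
  exact ht w rfl w rfl v rfl h1 h2.ge h2.le

-- The triangles of a wall form a fan at the floor copy of `x`: `wallA` below the upper edge of the
-- wall, `wallC` above its bottom edge, and between them, if the edge ends at b, `wallB` with the
-- vertical side from b to t.
variable (D) in
def wallA (x : D.Lower) : Set (N ⊕ D.Lower) := {.inr x, .inl x.1, .inl (D.top x)}
variable (D) in
def wallB (c : Cr) : Set (N ⊕ D.Lower) := {.inr (D.smooth.symm (D.B c)), .inl (D.t c), .inl (D.b c)}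
variable (D) in
def wallC (x : D.Lower) : Set (N ⊕ D.Lower) := {.inl (D.smooth x).1, .inr (D.smooth x), .inr x}
variable (D) in
def roofA (c : Cr) : Set (N ⊕ D.Lower) := {.inl (D.t c), .inl (D.p c), .inl (D.q c)}
variable (D) in
def roofB (c : Cr) : Set (N ⊕ D.Lower) := {.inl (D.t c), .inl (D.b c), .inl (D.q c)}

/-- The vertex sets of the triangles of the wall over an edge. -/
inductive Wall (D : Diagram N Cr) : D.Lower → Set (N ⊕ D.Lower) → Prop
  | a (x) : Wall D x (D.wallA x)
  | b (x c) (h : D.smooth x = D.B c) : Wall D x (D.wallB c)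
  | c (x) : Wall D x (D.wallC x)

/-- The vertex sets of the triangles at a crossing. -/
inductive Cap (D : Diagram N Cr) : Cr → Set (N ⊕ D.Lower) → Prop
  | a (c) : Cap D c (D.roofA c)
  | b (c) : Cap D c (D.roofB c)

theorem Wall.tame (hC : ∀ v x, lev v + C < D.a x) {x : D.Lower} {s : Set (N ⊕ D.Lower)} (h : D.Wall x s) :
    Tame D.base (D.ht lev C) s := by
  refine tame_of hC fun d h1 h2 => ?_
  cases h with
  | a =>
    simp only [wallA, Set.mem_insert_iff, Set.mem_singleton_iff, Sum.inr.injEq, reduceCtorEq, or_false,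
      Sum.inl.injEq, false_or] at h1 h2
    rcases h2 with h2 | h2
    · exact (D.ne_t x d h2.symm).elim
    · exact (D.smooth_ne x (by rw [← h1]; rw [← h1] at h2; exact D.top_eq_t_iff.1 h2.symm)).elim
  | b c hc =>
    simp only [wallB, Set.mem_insert_iff, Set.mem_singleton_iff, Sum.inr.injEq, reduceCtorEq, or_false,
      Sum.inl.injEq, false_or] at h1 h2 ⊢
    rcases h2 with h2 | h2
    · right; rw [D.t_inj h2]
    · exact (D.t_ne_b _ _ h2).elim
  | c =>
    simp only [wallC, Set.mem_insert_iff, Set.mem_singleton_iff, reduceCtorEq, or_false,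
      Sum.inl.injEq] at h2
    exact (D.ne_t _ d h2.symm).elim

theorem Cap.tame (hC : ∀ v x, lev v + C < D.a x) {c : Cr} {s : Set (N ⊕ D.Lower)} (h : D.Cap c s) :
    Tame D.base (D.ht lev C) s := by
  refine tame_of hC fun d h1 h2 => ?_
  cases h <;> simp [roofA, roofB] at h1

theorem Wall.base_image {x : D.Lower} {s : Set (N ⊕ D.Lower)} (h : D.Wall x s) :
    D.base '' s = {D.f x, D.f (D.smooth x)} := by
  cases h with
  | a => simp [wallA, Set.image_insert_eq, f_top]
  | b c hc =>
    have e : D.f (D.B c) = D.f (D.b c) := rfl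
    simp [wallB, Set.image_insert_eq, ← hc, D.f_t]
    rw [hc, e]
  | c => simp [wallC, Set.image_insert_eq, Set.pair_comm]

theorem Cap.base_image {c : Cr} {s : Set (N ⊕ D.Lower)} (h : D.Cap c s) :
    D.base '' s = {D.f (D.b c), D.f (D.p c), D.f (D.q c)} ∨ D.base '' s = {D.f (D.b c), D.f (D.q c)} := by
  cases h with
  | a => left; simp [roofA, Set.image_insert_eq, D.f_t]
  | b => right; simp [roofB, Set.image_insert_eq, D.f_t]

theorem IsPlanar.smooth_ne_f (h : D.IsPlanar) (x : D.Lower) : D.f x ≠ D.f (D.smooth x) := h.curve.f_ne x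

/-- Different edges of the smoothed curve meet only in common endpoints, which are extreme in both
projections. -/
theorem wall_wall_ne (hC : ∀ v x, lev v + C < D.a x) (h : D.IsPlanar) {x y : D.Lower} (hxy : x ≠ y)
    {s s' : Set (N ⊕ D.Lower)} (hs : D.Wall x s) (hs' : D.Wall y s') :
    MeetProperly (fun w => (D.base w, D.ht lev C w)) s s' := by
  refine .of_extreme (hs.tame hC) (hs'.tame hC) ?_
  rw [hs.base_image, hs'.base_image, convexHull_pair, convexHull_pair]
  intro z hz hz'
  have key : ∀ {x y : D.Lower}, x ≠ y → z ∈ segment ℝ (D.f x) (D.f (D.smooth x)) →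
      z ∈ segment ℝ (D.f y) (D.f (D.smooth y)) → z = D.f x ∨ z = D.f (D.smooth x) := by
    intro x y hxy hz hz'
    by_contra! hcon
    exact h.curve.disj hxy (mem_openSegment_of_ne_left_right hcon.1.symm hcon.2.symm hz) hz'
  exact ⟨notMem_convexHull_pair_diff (h.smooth_ne_f x) (key hxy hz hz'),
    notMem_convexHull_pair_diff (h.smooth_ne_f y) (key hxy.symm hz' hz)⟩

/-- Two triangles of the fan at the floor copy of `x` are separated, in their vertical plane, by the
line along a ray of the fan between them. -/
theorem wall_wall_same (hC : ∀ v x, lev v + C < D.a x) (h : D.IsPlanar) {x : D.Lower}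
    {s s' : Set (N ⊕ D.Lower)} (hs : D.Wall x s) (hs' : D.Wall x s') :
    MeetProperly (fun w => (D.base w, D.ht lev C w)) s s' := by
  have hne := h.smooth_ne_f x
  have hAC : MeetProperly (fun w => (D.base w, D.ht lev C w)) (D.wallA x) (D.wallC x) := by
    refine .of_separated_subset (isAffineFun_heightAbove (D.f x) (D.f (D.smooth x)) (lev x + C)
      (D.a (D.smooth x))) ?_ ?_ ?_
    · rintro w (rfl | rfl | rfl)
      · simp [heightAbove_left]
      · simp [heightAbove_left, (hC x x).le]
      · simp only [base_inl, ht_inl, f_top, heightAbove_right hne]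
        rcases D.top_cases x with ⟨c, h1, h2⟩ | ⟨h1, h2⟩
        · rw [h1, h2]; exact sub_nonneg.2 (D.height c).le
        · rw [h2]; simp
    · rintro w (rfl | rfl | rfl)
      · simp [heightAbove_right hne]
      · simp [heightAbove_right hne, (hC _ _).le]
      · simp [heightAbove_left]
    · rintro w (rfl | rfl | rfl)
      · simp [wallC]
      · simp only [base_inl, ht_inl, heightAbove_left]
        intro e
        exact absurd (hC x x) (by linarith)
      · simp only [base_inl, ht_inl, f_top, heightAbove_right hne]
        rcases D.top_cases x with ⟨c, h1, h2⟩ | ⟨h1, h2⟩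
        · rw [h1, h2]
          intro e
          exact absurd (D.height c) (not_lt.2 (sub_eq_zero.1 e).le)
        · intro _; simp [wallC, h2]
  have hAB : ∀ c, D.smooth x = D.B c →
      MeetProperly (fun w => (D.base w, D.ht lev C w)) (D.wallA x) (D.wallB c) := by
    intro c hc
    have hx : D.smooth.symm (D.B c) = x := by rw [← hc]; simp
    have hb : D.f (D.b c) = D.f (D.smooth x) := by rw [hc]; rfl
    have ht := D.top_eq_t_iff.2 hc
    refine .of_separated_subset (isAffineFun_heightAbove (D.f x) (D.f (D.smooth x)) (lev x + C)
      (D.a (D.t c))) ?_ ?_ ?_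
    · rintro w (rfl | rfl | rfl)
      · simp [heightAbove_left]
      · simp [heightAbove_left, (hC x x).le]
      · simp [ht, D.f_t, hb, heightAbove_right hne]
    · rintro w (rfl | rfl | rfl)
      · simp [heightAbove_left, hx]
      · simp [D.f_t, hb, heightAbove_right hne]
      · simp [hb, heightAbove_right hne, (D.height c).le]
    · rintro w (rfl | rfl | rfl)
      · simp [wallB, hx]
      · simp only [base_inl, ht_inl, heightAbove_left]
        intro e
        exact absurd (hC x x) (by linarith)
      · simp [wallB, ht]
  have hBC : ∀ c, D.smooth x = D.B c →
      MeetProperly (fun w => (D.base w, D.ht lev C w)) (D.wallB c) (D.wallC x) := by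
    intro c hc
    have hx : D.smooth.symm (D.B c) = x := by rw [← hc]; simp
    have hb : D.f (D.b c) = D.f (D.smooth x) := by rw [hc]; rfl
    have hb' : (D.smooth x).1 = D.b c := by rw [hc]; rfl
    refine .of_separated_subset (isAffineFun_heightAbove (D.f x) (D.f (D.smooth x)) (lev x + C)
      (D.a (D.b c))) ?_ ?_ ?_
    · rintro w (rfl | rfl | rfl)
      · simp [heightAbove_left, hx]
      · simp [D.f_t, hb, heightAbove_right hne, (D.height c).le]
      · simp [hb, heightAbove_right hne]
    · rintro w (rfl | rfl | rfl)
      · rw [base_inl, ht_inl, heightAbove_right hne, hb']; simp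
      · rw [base_inr, ht_inr, heightAbove_right hne]; linarith [hC (D.smooth x) (D.b c)]
      · simp [heightAbove_left]
    · rintro w (rfl | rfl | rfl)
      · simp [wallC, hx]
      · simp only [base_inl, ht_inl, D.f_t, hb, heightAbove_right hne]
        intro e
        exact absurd (D.height c) (not_lt.2 (sub_eq_zero.1 e).le)
      · simp [wallC, hb']
  cases hs with
  | a =>
    cases hs' with
    | a => exact .of_subset subset_rfl
    | b c hc => exact hAB c hc
    | c => exact hAC
  | b c hc =>
    cases hs' with
    | a => exact (hAB c hc).symm
    | b d hd =>
      rw [D.b_inj (congrArg Subtype.val (hc.symm.trans hd))]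
      exact .of_subset subset_rfl
    | c => exact hBC c hc
  | c =>
    cases hs' with
    | a => exact hAC.symm
    | b c hc => exact (hBC c hc).symm
    | c => exact .of_subset subset_rfl

theorem Cap.base_subset {c : Cr} {s : Set (N ⊕ D.Lower)} (h : D.Cap c s) :
    D.base '' s ⊆ {D.f (D.b c), D.f (D.p c), D.f (D.q c)} := by
  rcases h.base_image with e | e <;> rw [e]
  rintro z (rfl | rfl) <;> simp

theorem IsPlanar.q_ne_b (h : D.IsPlanar) (c : Cr) : D.f (D.b c) ≠ D.f (D.q c) := fun e =>
  h.area c (by rw [e]; simp [signedArea])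

/-- The projected crossing triangle meets other edges of the smoothed curve only in common vertices,
and these are extreme in both projections. -/
theorem cap_wall_ne (hC : ∀ v x, lev v + C < D.a x) (h : D.IsPlanar) {c : Cr} {x : D.Lower} (hx : x ≠ D.Q c)
    {s s' : Set (N ⊕ D.Lower)} (hs : D.Cap c s) (hs' : D.Wall x s') :
    MeetProperly (fun w => (D.base w, D.ht lev C w)) s s' := by
  refine .of_extreme (hs.tame hC) (hs'.tame hC) fun z hz hz' => ?_
  have hz1 := convexHull_mono hs.base_subset hz
  rw [hs'.base_image, convexHull_pair] at hz'
  obtain ⟨v, hv1, hv2, rfl⟩ := h.roof_edge hx hz1 hz'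
  have hB : ∀ c, D.f (D.B c) = D.f (D.b c) := fun _ => rfl
  have hP : ∀ c, D.f (D.P c) = D.f (D.p c) := fun _ => rfl
  have hQ : ∀ c, D.f (D.Q c) = D.f (D.q c) := fun _ => rfl
  refine ⟨?_, ?_⟩
  · intro hm
    refine notMem_convexHull_triple_diff (h.area c) ?_ (convexHull_mono (Set.sdiff_subset_sdiff_left hs.base_subset) hm)
    rcases hv2 with rfl | rfl | rfl
    exacts [Or.inl rfl, Or.inr (Or.inl rfl), Or.inr (Or.inr rfl)]
  · rw [hs'.base_image]
    refine notMem_convexHull_pair_diff (h.smooth_ne_f x) ?_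
    rcases hv1 with rfl | rfl
    exacts [Or.inl rfl, Or.inr rfl]

/-- This is the wall below the chord from q to p, the one wall that shares an edge with a triangle
at the crossing. -/
theorem cap_wall_same (hC : ∀ v x, lev v + C < D.a x) (h : D.IsPlanar) {c : Cr}
    {s s' : Set (N ⊕ D.Lower)} (hs : D.Cap c s) (hs' : D.Wall (D.Q c) s') :
    MeetProperly (fun w => (D.base w, D.ht lev C w)) s s' := by
  have hA := h.area c
  have hbase : D.base '' s' = {D.f (D.q c), D.f (D.p c)} := by
    rw [hs'.base_image, D.smooth_q]; rfl
  have hpq : D.f (D.q c) ≠ D.f (D.p c) := by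
    have := h.smooth_ne_f (D.Q c)
    rwa [D.smooth_q] at this
  cases hs with
  | b =>
    -- The projection of `roofB` is the segment from b to q, which meets the chord only in q.
    refine .of_extreme (Cap.tame hC (.b c)) (hs'.tame hC) fun z hz hz' => ?_
    have e : D.base '' D.roofB c = {D.f (D.b c), D.f (D.q c)} := by
      simp [roofB, Set.image_insert_eq, D.f_t]
    have hzq : z = D.f (D.q c) := by
      rw [e, convexHull_pair, mem_segment_iff_pointAt] at hz
      obtain ⟨t, -, -, rfl⟩ := hz
      rw [hbase, convexHull_pair, mem_segment_iff_pointAt] at hz'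
      obtain ⟨t', -, -, e'⟩ := hz'
      have h1 : signedArea (D.f (D.p c)) (D.f (D.q c)) (pointAt (D.f (D.b c)) (D.f (D.q c)) t) =
          (1 - t) * signedArea (D.f (D.b c)) (D.f (D.p c)) (D.f (D.q c)) := by
        rw [signedArea_pointAt, signedArea_right, signedArea_cyc]; ring
      rw [← e', signedArea_pointAt, signedArea_left, signedArea_right, mul_zero, mul_zero, add_zero] at h1
      have : 1 - t = 0 := by
        rcases mul_eq_zero.1 h1.symm with h | h
        exacts [h, (hA h).elim]
      obtain rfl : t = 1 := by linarith
      exact pointAt_one _ _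
    rw [e, hbase]
    exact ⟨notMem_convexHull_pair_diff (h.q_ne_b c) (Or.inr hzq), notMem_convexHull_pair_diff hpq (Or.inl hzq)⟩
  | a =>
    set A := signedArea (D.f (D.b c)) (D.f (D.p c)) (D.f (D.q c)) with hAdef
    have hA2 : 0 < A * A := mul_self_pos.2 hA
    -- The vertical plane over the chord separates the two triangles and contains only the edge p q
    -- of `roofA`; what remains is a comparison inside this plane.
    refine .of_separated (IsAffineFun.signedArea (D.f (D.p c)) (D.f (D.q c)) A) ?_ ?_ ?_
    · rintro w (rfl | rfl | rfl)
      · simp only [base_inl, D.f_t]; rw [signedArea_cyc]; exact hA2.le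
      · simp
      · simp
    · intro w hw
      have := Set.mem_image_of_mem D.base hw
      rw [hbase] at this
      rcases this with e | e
      · simp [e]
      · rw [Set.mem_singleton_iff] at e; simp [e]
    · have hq : (D.Q c).1 = D.q c := rfl
      have hp : (D.P c).1 = D.p c := rfl
      cases hs' with
      | a =>
        refine .of_subset ?_
        rintro w ⟨rfl | rfl | rfl, hw⟩
        · simp only [base_inl, D.f_t] at hw
          rw [signedArea_cyc] at hw
          exact absurd hw hA2.ne'
        · refine ⟨?_, hw⟩
          simp [wallA, hq, D.top_q]
        · refine ⟨?_, hw⟩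
          simp [wallA, hq]
      | b d hd =>
        rw [D.smooth_q] at hd
        exact (D.b_ne_p _ _ (congrArg Subtype.val hd).symm).elim
      | c =>
        refine .of_separated_subset (isAffineFun_heightAbove (D.f (D.q c)) (D.f (D.p c))
          (lev (D.Q c) + C) (D.a (D.p c))) ?_ ?_ ?_
        · rintro w ⟨rfl | rfl | rfl, hw⟩
          · simp only [base_inl, D.f_t] at hw
            rw [signedArea_cyc] at hw
            exact absurd hw hA2.ne'
          · simp [heightAbove_right hpq]
          · simp [heightAbove_left, (hC _ _).le]
        · rintro w ⟨rfl | rfl | rfl, -⟩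
          · rw [D.smooth_q]; simp [heightAbove_right hpq, hp]
          · rw [D.smooth_q]; simp [heightAbove_right hpq, hp, (hC _ _).le]
          · simp [heightAbove_left, hq]
        · rintro w ⟨rfl | rfl | rfl, hw⟩ hw'
          · simp only [base_inl, D.f_t] at hw
            rw [signedArea_cyc] at hw
            exact absurd hw hA2.ne'
          · refine ⟨?_, hw⟩
            simp [wallC, D.smooth_q, hp]
          · rw [base_inl, ht_inl, heightAbove_left] at hw'
            exact absurd (hC (D.Q c) (D.q c)) (by linarith)

/-- Triangles of different crossings have disjoint projections. Those of one crossing are separated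
by the vertical plane through q and b, which contains `roofB`. -/
theorem cap_cap (h : D.IsPlanar) {c d : Cr}
    {s s' : Set (N ⊕ D.Lower)} (hs : D.Cap c s) (hs' : D.Cap d s') :
    MeetProperly (fun w => (D.base w, D.ht lev C w)) s s' := by
  by_cases hcd : c = d
  · subst hcd
    have hAB : MeetProperly (fun w => (D.base w, D.ht lev C w)) (D.roofA c) (D.roofB c) := by
      set A := signedArea (D.f (D.b c)) (D.f (D.p c)) (D.f (D.q c)) with hAdef
      have hA2 : 0 < A * A := mul_self_pos.2 (h.area c)
      have e : signedArea (D.f (D.q c)) (D.f (D.b c)) (D.f (D.p c)) = A := by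
        rw [hAdef, ← signedArea_cyc, signedArea_cyc, signedArea_cyc, signedArea_cyc]
      refine .of_separated_subset (IsAffineFun.signedArea (D.f (D.q c)) (D.f (D.b c)) A) ?_ ?_ ?_
      · rintro w (rfl | rfl | rfl)
        · simp [D.f_t]
        · rw [base_inl, e]; exact hA2.le
        · simp
      · rintro w (rfl | rfl | rfl)
        · simp [D.f_t]
        · simp
        · simp
      · rintro w (rfl | rfl | rfl) hw
        · simp [roofB]
        · rw [base_inl, e] at hw; exact absurd hw hA2.ne'
        · simp [roofB]
    cases hs <;> cases hs'
    exacts [.of_subset subset_rfl, hAB, hAB.symm, .of_subset subset_rfl]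
  · refine .of_disjoint fun x hx hx' => ?_
    exact h.roof_disj hcd (convexHull_mono hs.base_subset (mem_convexHull_base hx))
      (convexHull_mono hs'.base_subset (mem_convexHull_base hx'))

end

end Diagram

/-! ### The embedded surface of a diagram -/

section Level

variable {W : Type*} {base : W → ℂ} {ht : W → ℝ} {s t : Set W} {h : ℝ}

theorem mem_convexHull_level (hs : ∀ w ∈ s, ht w = h) {x : ℂ × ℝ} :
    x ∈ convexHull ℝ ((fun w => (base w, ht w)) '' s) ↔ x.1 ∈ convexHull ℝ (base '' s) ∧ x.2 = h := by
  have : (fun w => (base w, ht w)) '' s = (base '' s) ×ˢ {h} := by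
    ext ⟨z, y⟩
    constructor
    · rintro ⟨w, hw, e⟩
      simp only [Prod.mk.injEq] at e
      exact ⟨⟨w, hw, e.1⟩, e.2.symm.trans (hs w hw)⟩
    · rintro ⟨⟨w, hw, rfl⟩, rfl : y = h⟩
      exact ⟨w, hw, Prod.ext rfl (hs w hw)⟩
  rw [this, convexHull_prod, convexHull_singleton]
  rfl

theorem MeetProperly.of_level (hs : ∀ w ∈ s, ht w = h) (ht' : ∀ w ∈ t, ht w = h)
    (hinj : Set.InjOn base (s ∪ t))
    (H : convexHull ℝ (base '' s) ∩ convexHull ℝ (base '' t) ⊆ convexHull ℝ (base '' s ∩ base '' t)) :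
    MeetProperly (fun w => (base w, ht w)) s t := by
  rintro x ⟨hx, hx'⟩
  rw [mem_convexHull_level hs] at hx
  rw [mem_convexHull_level ht'] at hx'
  rw [mem_convexHull_level (h := h) fun w hw => hs w hw.1,
    hinj.image_inter Set.subset_union_left Set.subset_union_right]
  exact ⟨H ⟨hx.1, hx'.1⟩, hx.2⟩

end Level

namespace Diagram

variable {N Cr : Type*} {D : Diagram N Cr} [Finite N] {lev : D.Lower → ℤ} {C : ℝ}
  {T : D.Lower → D.Lower → D.Lower → Prop}

theorem Wall.mem_cases {x : D.Lower} {s : Set (N ⊕ D.Lower)} (h : D.Wall x s) {w : N ⊕ D.Lower}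
    (hw : w ∈ s) : w = .inr x ∨ w = .inr (D.smooth x) ∨ ∃ y, w = .inl y := by
  cases h with
  | a => rcases hw with rfl | rfl | rfl <;> simp
  | b c hc =>
    have : D.smooth.symm (D.B c) = x := by rw [← hc]; simp
    rcases hw with rfl | rfl | rfl <;> simp [this]
  | c => rcases hw with rfl | rfl | rfl <;> simp

theorem Wall.le_height (hT : IsFloor (fun x : D.Lower => D.f x) D.smooth lev T)
    (hC : ∀ v x, lev v + C < D.a x) {x : D.Lower} {s : Set (N ⊕ D.Lower)} (h : D.Wall x s)
    {w : N ⊕ D.Lower} (hw : w ∈ s) : lev x + C ≤ D.ht lev C w := by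
  rcases h.mem_cases hw with rfl | rfl | ⟨y, rfl⟩
  · simp
  · simp [hT.lev_next]
  · exact (hC _ _).le

theorem Cap.mem_cases {c : Cr} {s : Set (N ⊕ D.Lower)} (h : D.Cap c s) {w : N ⊕ D.Lower}
    (hw : w ∈ s) : ∃ y, w = .inl y := by
  cases h <;> rcases hw with rfl | rfl | rfl <;> exact ⟨_, rfl⟩

/-- The vertex sets of the triangles of the floors. -/
def Flat (T : D.Lower → D.Lower → D.Lower → Prop) (lev : D.Lower → ℤ) (k : ℤ) (s : Set (N ⊕ D.Lower)) : Prop :=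
  ∃ u v w, T u v w ∧ lev u = k ∧ s = {.inr u, .inr v, .inr w}

theorem Flat.height (hT : IsFloor (fun x : D.Lower => D.f x) D.smooth lev T) {k : ℤ}
    {s : Set (N ⊕ D.Lower)} (h : Flat T lev k s) : ∀ w ∈ s, D.ht lev C w = k + C := by
  obtain ⟨u, v, w, ht, rfl, rfl⟩ := h
  have h1 := hT.lev_eq ht
  have h2 := hT.lev_eq (hT.rotate ht)
  rintro _ (rfl | rfl | rfl)
  · rfl
  · simp [h1]
  · simp [h1, h2]

theorem injOn_base_inr {s : Set (N ⊕ D.Lower)} (hs : ∀ w ∈ s, ∃ v, w = .inr v) : Set.InjOn D.base s := by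
  intro w hw w' hw' e
  obtain ⟨v, rfl⟩ := hs w hw
  obtain ⟨v', rfl⟩ := hs w' hw'
  rw [lower_inj e]

theorem Flat.exists_inr {k : ℤ} {s : Set (N ⊕ D.Lower)} (h : Flat T lev k s) : ∀ w ∈ s, ∃ v, w = .inr v := by
  obtain ⟨u, v, w, ht, rfl, rfl⟩ := h
  rintro _ (rfl | rfl | rfl) <;> exact ⟨_, rfl⟩

theorem Flat.base_image {u v w : D.Lower} :
    D.base '' {.inr u, .inr v, .inr w} = {D.f u, D.f v, D.f w} := by
  simp [Set.image_insert_eq]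

theorem flat_flat (hT : IsFloor (fun x : D.Lower => D.f x) D.smooth lev T) {k l : ℤ}
    {s s' : Set (N ⊕ D.Lower)} (hs : Flat T lev k s) (hs' : Flat T lev l s') :
    MeetProperly (fun w => (D.base w, D.ht lev C w)) s s' := by
  by_cases hkl : k = l
  · subst hkl
    refine .of_level (hs.height hT) (hs'.height hT) (injOn_base_inr ?_) ?_
    · rintro w (hw | hw)
      exacts [hs.exists_inr w hw, hs'.exists_inr w hw]
    · obtain ⟨u, v, w, ht, rfl, rfl⟩ := hs
      obtain ⟨u', v', w', ht', hl, rfl⟩ := hs'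
      rw [Flat.base_image, Flat.base_image]
      exact hT.inter ht ht' hl.symm
  · refine .of_disjoint fun x hx hx' => hkl ?_
    rw [mem_convexHull_level (hs.height hT)] at hx
    rw [mem_convexHull_level (hs'.height hT)] at hx'
    exact_mod_cast add_right_cancel (hx.2.symm.trans hx'.2)

theorem cap_flat (hT : IsFloor (fun x : D.Lower => D.f x) D.smooth lev T)
    (hC : ∀ v x, lev v + C < D.a x) {c : Cr} {k : ℤ}
    {s s' : Set (N ⊕ D.Lower)} (hs : D.Cap c s) (hs' : Flat T lev k s') :
    MeetProperly (fun w => (D.base w, D.ht lev C w)) s s' := by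
  refine .of_disjoint fun x hx hx' => ?_
  obtain ⟨⟨w, hw, hwx⟩, -⟩ := exists_le_of_mem_convexHull (mem_convexHull_height hx)
  rw [mem_convexHull_level (hs'.height hT)] at hx'
  obtain ⟨y, rfl⟩ := hs.mem_cases hw
  obtain ⟨u, v, w, ht, rfl, rfl⟩ := hs'
  exact absurd (hC u y) (not_lt.2 (hwx.trans hx'.2.le))

/-- A wall of smaller level avoids the floor in projection. A wall of the same level can touch the
floor's plane only in its bottom edge or an end of it, which is covered by `edge_inter`. A wall of
larger level stays above the floor. -/
theorem wall_flat (hT : IsFloor (fun x : D.Lower => D.f x) D.smooth lev T)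
    (hC : ∀ v x, lev v + C < D.a x) (h : D.IsPlanar) {x : D.Lower} {k : ℤ}
    {s s' : Set (N ⊕ D.Lower)} (hs : D.Wall x s) (hs' : Flat T lev k s') :
    MeetProperly (fun w => (D.base w, D.ht lev C w)) s s' := by
  rcases lt_trichotomy (lev x) k with hk | hk | hk
  · refine .of_disjoint fun z hz hz' => ?_
    have h1 := mem_convexHull_base hz
    have h2 := mem_convexHull_base hz'
    rw [hs.base_image, convexHull_pair] at h1
    obtain ⟨u, v, w, ht, rfl, rfl⟩ := hs'
    rw [Flat.base_image] at h2
    exact Set.disjoint_left.1 (hT.edge_disjoint ht hk) h1 h2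
  · have hz : ∀ w ∈ {w ∈ s | D.ht lev C w - (k + C) = 0}, w = .inr x ∨ w = .inr (D.smooth x) := by
      rintro w ⟨hw, e⟩
      rcases hs.mem_cases hw with h | h | ⟨y, rfl⟩
      · exact Or.inl h
      · exact Or.inr h
      · exact absurd (hC x y) (by rw [ht_inl] at e; rw [hk]; linarith)
    have h0 : {w ∈ s' | D.ht lev C w - (k + C) = 0} = s' :=
      Set.Subset.antisymm (fun w hw => hw.1) fun w hw => ⟨hw, sub_eq_zero.2 (hs'.height hT w hw)⟩
    refine .of_separated (IsAffineFun.height (k + C)) ?_ ?_ ?_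
    · intro w hw
      have := hs.le_height hT hC hw
      rw [hk] at this
      exact sub_nonneg.2 this
    · intro w hw
      exact (sub_eq_zero.2 (hs'.height hT w hw)).le
    · rw [h0]
      refine .of_level (h := k + C) (fun w hw => sub_eq_zero.1 hw.2) (hs'.height hT) (injOn_base_inr ?_) ?_
      · rintro w (hw | hw)
        · rcases hz w hw with rfl | rfl <;> exact ⟨_, rfl⟩
        · exact hs'.exists_inr w hw
      · rintro z ⟨h1, h2⟩
        have hsub : D.base '' {w ∈ s | D.ht lev C w - (k + C) = 0} ⊆ {D.f x, D.f (D.smooth x)} := by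
          rintro _ ⟨w, hw, rfl⟩
          rcases hz w hw with rfl | rfl <;> simp
        obtain ⟨u, v, w, ht, hu, rfl⟩ := hs'
        rw [Flat.base_image] at h2 ⊢
        exact mem_convexHull_inter_of_pair hsub (h.smooth_ne_f x) h1
          (hT.edge_inter ht (hk.trans hu.symm) ⟨convexHull_mono hsub h1, h2⟩)
  · refine .of_disjoint fun z hz hz' => ?_
    obtain ⟨⟨w, hw, hwx⟩, -⟩ := exists_le_of_mem_convexHull (mem_convexHull_height hz)
    rw [mem_convexHull_level (hs'.height hT)] at hz'
    have := hs.le_height hT hC hw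
    have : (k : ℝ) < lev x := by exact_mod_cast hk
    linarith [hz'.2]

theorem Tri.cases {a b c : N ⊕ D.Lower} (h : D.Tri T a b c) :
    (∃ x, D.Wall x {a, b, c}) ∨ (∃ d, D.Cap d {a, b, c}) ∨ ∃ k, Flat T lev k {a, b, c} := by
  have rot : ∀ a b c : N ⊕ D.Lower, ({a, b, c} : Set (N ⊕ D.Lower)) = {b, c, a} := by
    intro a b c; ext; simp; tauto
  have hU : ∀ {x y v}, D.Upper x y v → ∃ z, D.Wall z {.inr v, .inl x, .inl y} := by
    rintro x y v ⟨⟩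
    · exact ⟨v, .a v⟩
    · rename_i c h
      have := Wall.b v c h
      rw [wallB, ← h, Equiv.symm_apply_apply] at this
      exact ⟨v, this⟩
  have hD : ∀ {x u v}, D.Under x u v → ∃ z, D.Wall z {.inl x, .inr u, .inr v} := by
    rintro x u v ⟨⟩
    exact ⟨v, .c v⟩
  have hR : ∀ {x y z}, D.Roof x y z → ∃ d, D.Cap d {.inl x, .inl y, .inl z} := by
    rintro x y z ⟨⟩ <;> rename_i d
    · exact ⟨d, .a d⟩
    · rw [← rot]; exact ⟨d, .a d⟩
    · rw [rot]; exact ⟨d, .a d⟩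
    · rw [Set.pair_comm]; exact ⟨d, .b d⟩
    · rw [rot, Set.insert_comm]; exact ⟨d, .b d⟩
    · rw [Set.insert_comm]; exact ⟨d, .b d⟩
  cases h with
  | roof h => exact Or.inr (Or.inl (hR h))
  | upper h => rw [← rot]; exact Or.inl (hU h)
  | upper' h => rw [rot]; exact Or.inl (hU h)
  | upper'' h => exact Or.inl (hU h)
  | under h => exact Or.inl (hD h)
  | under' h => rw [← rot]; exact Or.inl (hD h)
  | under'' h => rw [rot]; exact Or.inl (hD h)
  | floor h => exact Or.inr (Or.inr ⟨_, _, _, _, h, rfl, rfl⟩)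

theorem Wall.not_collinear (hC : ∀ v x, lev v + C < D.a x) (h : D.IsPlanar) {x : D.Lower}
    {s : Set (N ⊕ D.Lower)} (hs : D.Wall x s) :
    ¬ Collinear ℝ ((fun w => (D.base w, D.ht lev C w)) '' s) := by
  have hne := h.smooth_ne_f x
  have rot : ∀ a b c : ℂ × ℝ, ({a, b, c} : Set (ℂ × ℝ)) = {b, c, a} := by
    intro a b c; ext; simp; tauto
  cases hs with
  | a =>
    simp only [wallA, Set.image_insert_eq, Set.image_singleton]
    refine not_collinear_of_vertical rfl (hC _ _).ne ?_
    simpa [f_top] using hne.symm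
  | b c hc =>
    simp only [wallB, Set.image_insert_eq, Set.image_singleton]
    rw [rot]
    refine not_collinear_of_vertical (D.f_t c).symm (D.height c).ne' ?_
    rw [← hc]
    simp only [Equiv.symm_apply_apply, base_inr, base_inl, D.f_t]
    rwa [hc] at hne
  | c =>
    simp only [wallC, Set.image_insert_eq, Set.image_singleton]
    exact not_collinear_of_vertical rfl (hC _ _).ne' hne

theorem Cap.not_collinear (h : D.IsPlanar) {c : Cr}
    {s : Set (N ⊕ D.Lower)} (hs : D.Cap c s) :
    ¬ Collinear ℝ ((fun w => (D.base w, D.ht lev C w)) '' s) := by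
  cases hs with
  | a =>
    simp only [roofA, Set.image_insert_eq, Set.image_singleton]
    refine not_collinear_of_area ?_
    simpa [D.f_t] using h.area c
  | b =>
    simp only [roofB, Set.image_insert_eq, Set.image_singleton]
    refine not_collinear_of_vertical (D.f_t c).symm (D.height c).ne' ?_
    simpa [D.f_t] using (h.q_ne_b c).symm

theorem Flat.not_collinear (hT : IsFloor (fun x : D.Lower => D.f x) D.smooth lev T) {k : ℤ}
    {s : Set (N ⊕ D.Lower)} (hs : Flat T lev k s) :
    ¬ Collinear ℝ ((fun w => (D.base w, D.ht lev C w)) '' s) := by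
  obtain ⟨u, v, w, ht, rfl, rfl⟩ := hs
  simp only [Set.image_insert_eq, Set.image_singleton]
  exact not_collinear_of_area (hT.area ht)

theorem isOrientedSurface (hT : IsFloor (fun x : D.Lower => D.f x) D.smooth lev T)
    (hC : ∀ v x, lev v + C < D.a x) (h : D.IsPlanar) :
    IsOrientedSurface (fun w => (D.base w, D.ht lev C w)) (D.Tri T) where
  inj := pos_injective hC
  cyc := Tri.rotate hT
  indep {a b c} ht := by
    rw [affineIndependent_iff_not_collinear]
    have e : Set.range ![(D.base a, D.ht lev C a), (D.base b, D.ht lev C b), (D.base c, D.ht lev C c)] =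
        (fun w => (D.base w, D.ht lev C w)) '' {a, b, c} := by
      simp only [Set.image_insert_eq, Set.image_singleton]
      ext x
      simp
      tauto
    rw [e]
    rcases ht.cases (lev := lev) with ⟨x, hx⟩ | ⟨d, hd⟩ | ⟨k, hk⟩
    exacts [hx.not_collinear hC h, hd.not_collinear h, hk.not_collinear hT]
  coherent := Tri.unique hT
  noflip := Tri.not_swap hT
  link := Tri.link hT
  proper ht ht' := by
    rcases ht.cases (lev := lev) with ⟨x, hx⟩ | ⟨d, hd⟩ | ⟨k, hk⟩ <;>
      rcases ht'.cases (lev := lev) with ⟨x', hx'⟩ | ⟨d', hd'⟩ | ⟨k', hk'⟩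
    · by_cases e : x = x'
      · subst e; exact wall_wall_same hC h hx hx'
      · exact wall_wall_ne hC h e hx hx'
    · refine .symm ?_
      by_cases e : x = D.Q d'
      · subst e; exact cap_wall_same hC h hd' hx
      · exact cap_wall_ne hC h e hd' hx
    · exact wall_flat hT hC h hx hk'
    · by_cases e : x' = D.Q d
      · subst e; exact cap_wall_same hC h hd hx'
      · exact cap_wall_ne hC h e hd hx'
    · exact cap_cap h hd hd'
    · exact cap_flat hT hC hd hk'
    · exact (wall_flat hT hC h hx' hk).symm
    · exact (cap_flat hT hC hd' hk).symm
    · exact flat_flat hT hk hk'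

end Diagram

/-! ### Counting all triangles -/

/-- For `m = 1 + t * I` two points get the same value only if `t` is the slope of the line through
them, which excludes finitely many `t`. -/
theorem exists_generic_linear {ι : Type*} [Finite ι] {f : ι → ℂ} (hf : Function.Injective f) :
    ∃ m : ℂ, m ≠ 0 ∧ ∀ v w, v ≠ w → signedArea 0 m (f v) ≠ signedArea 0 m (f w) := by
  obtain ⟨t, ht⟩ := (Set.finite_range fun p : ι × ι =>
    ((f p.1).im - (f p.2).im) / ((f p.1).re - (f p.2).re)).infinite_compl.nonempty
  refine ⟨⟨1, t⟩, fun h => by simpa using congrArg Complex.re h, fun v w hvw e => ?_⟩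
  simp only [signedArea, Complex.zero_re, Complex.zero_im, sub_zero, one_mul] at e
  by_cases hre : (f v).re = (f w).re
  · exact hvw (hf (Complex.ext hre (by rw [hre] at e; linarith)))
  · refine ht ⟨(v, w), ?_⟩
    rw [div_eq_iff (sub_ne_zero.2 hre)]
    linarith

theorem ncard_range_le {α β : Type*} [Finite α] (g : α → β) : (Set.range g).ncard ≤ Nat.card α := by
  rw [← Set.image_univ]
  exact (Set.ncard_image_le Set.finite_univ).trans (by rw [Set.ncard_univ])

namespace Diagram

variable {N Cr : Type*} {D : Diagram N Cr} [Finite N] {lev : D.Lower → ℤ} {C : ℝ}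
  {T : D.Lower → D.Lower → D.Lower → Prop}

/-- The chord from q to p is a positive combination of the edge before q and the edge after p. If a
linear function turned back at both q and p, it would have the opposite sign on the chord and on
both edges. So each crossing contributes a vertex where it is monotone. -/
theorem card_le_monotone [Fintype D.Lower] [Fintype Cr] (h : D.IsPlanar) {m : ℂ}
    (hm : ∀ v w : D.Lower, v ≠ w → signedArea 0 m (D.f v) ≠ signedArea 0 m (D.f w)) :
    (∑ v : D.Lower, if (signedArea 0 m (D.f (D.smooth.symm v)) - signedArea 0 m (D.f v)) *
      (signedArea 0 m (D.f (D.smooth v)) - signedArea 0 m (D.f v)) < 0 then 1 else 2) + Fintype.card Cr ≤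
      2 * Fintype.card D.Lower := by
  classical
  set p : D.Lower → Prop := fun v => (signedArea 0 m (D.f (D.smooth.symm v)) - signedArea 0 m (D.f v)) *
      (signedArea 0 m (D.f (D.smooth v)) - signedArea 0 m (D.f v)) < 0 with hp
  have hsum : ∀ p : D.Lower → Prop, ∀ [DecidablePred p],
      (∑ v : D.Lower, if p v then 1 else 2) + (Finset.univ.filter p).card = 2 * Fintype.card D.Lower := by
    intro p _
    rw [Finset.card_filter, ← Finset.sum_add_distrib]
    rw [Finset.sum_congr rfl (g := fun _ => 2) fun v _ => by by_cases hv : p v <;> simp [hv]]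
    simp [mul_comm]
  have key : ∀ c, p (D.Q c) ∨ p (D.P c) := by
    intro c
    obtain ⟨r, s, hr, hs, e⟩ := h.dir c
    have hsm : D.smooth.symm (D.P c) = D.Q c := by rw [← D.smooth_q]; simp
    simp only [hp, D.smooth_q, hsm]
    have hne := hm (D.P c) (D.Q c) fun h => D.p_ne_q c c (congrArg Subtype.val h)
    have lin : signedArea 0 m (D.f (D.P c)) - signedArea 0 m (D.f (D.Q c)) =
        r * (signedArea 0 m (D.f (D.Q c)) - signedArea 0 m (D.f (D.smooth.symm (D.Q c)))) +
        s * (signedArea 0 m (D.f (D.smooth (D.P c))) - signedArea 0 m (D.f (D.P c))) := by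
      have e1 := congrArg Complex.re e
      have e2 := congrArg Complex.im e
      simp only [Complex.sub_re, Complex.sub_im, Complex.add_re, Complex.add_im, Complex.re_ofReal_mul,
        Complex.im_ofReal_mul] at e1 e2
      simp only [signedArea, Complex.zero_re, Complex.zero_im, sub_zero]
      change m.re * (D.f (D.p c)).im - m.im * (D.f (D.p c)).re - (m.re * (D.f (D.q c)).im - m.im * (D.f (D.q c)).re) =
        r * ((m.re * (D.f (D.q c)).im - m.im * (D.f (D.q c)).re) - _) +
        s * (_ - (m.re * (D.f (D.p c)).im - m.im * (D.f (D.p c)).re))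
      linear_combination m.re * e2 - m.im * e1
    by_contra! hcon
    have hpos : 0 < (signedArea 0 m (D.f (D.P c)) - signedArea 0 m (D.f (D.Q c))) *
        (signedArea 0 m (D.f (D.P c)) - signedArea 0 m (D.f (D.Q c))) := mul_self_pos.2 (sub_ne_zero.2 hne)
    have h1 := mul_nonneg hr.le hcon.1
    have h2 := mul_nonneg hs.le hcon.2
    have h3 := congrArg (fun x => x * (signedArea 0 m (D.f (D.P c)) - signedArea 0 m (D.f (D.Q c)))) lin
    nlinarith
  have hinj : Fintype.card Cr ≤ (Finset.univ.filter p).card := by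
    rw [← Finset.card_univ]
    refine Finset.card_le_card_of_injOn (fun c => if p (D.Q c) then D.Q c else D.P c) ?_ ?_
    · intro c _
      rw [Finset.mem_coe, Finset.mem_filter]
      refine ⟨Finset.mem_univ _, ?_⟩
      beta_reduce
      by_cases hc : p (D.Q c)
      · rwa [if_pos hc]
      · rw [if_neg hc]; exact (key c).resolve_left hc
    · intro c _ d _ e
      have hPQ : ∀ c d, D.P c ≠ D.Q d := fun c d h => D.p_ne_q c d (congrArg Subtype.val h)
      by_cases hc : p (D.Q c) <;> by_cases hd : p (D.Q d) <;> simp only [hc, hd, if_true, if_false] at e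
      · exact D.q_inj (congrArg Subtype.val e)
      · exact (hPQ _ _ e.symm).elim
      · exact (hPQ _ _ e).elim
      · exact D.p_inj (congrArg Subtype.val e)
  rw [← hsum p]
  refine add_le_add (le_of_eq (Finset.sum_congr rfl fun v _ => ?_)) hinj
  congr

/-- Two triangles for each edge of the smoothed curve, and for each crossing the extra wall triangle
and two roof triangles; the floors are kept as a separate term. -/
theorem ncard_tri_le [Finite Cr] :
    {s : Set (N ⊕ D.Lower) | ∃ a b c, D.Tri T a b c ∧ s = {a, b, c}}.ncard ≤
      2 * Nat.card D.Lower + 3 * Nat.card Cr +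
        {s : Set D.Lower | ∃ a b c, T a b c ∧ s = {a, b, c}}.ncard := by
  have hsub : {s : Set (N ⊕ D.Lower) | ∃ a b c, D.Tri T a b c ∧ s = {a, b, c}} ⊆
      ((Set.range D.wallA ∪ Set.range D.wallC) ∪ (Set.range D.wallB ∪ (Set.range D.roofA ∪ Set.range D.roofB))) ∪
        (fun s => Sum.inr '' s) '' {s : Set D.Lower | ∃ a b c, T a b c ∧ s = {a, b, c}} := by
    rintro s ⟨a, b, c, ht, rfl⟩
    rcases ht.cases (lev := fun _ => 0) with ⟨x, hx⟩ | ⟨d, hd⟩ | ⟨k, u, v, w, ht, -, e⟩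
    · left
      generalize ({a, b, c} : Set (N ⊕ D.Lower)) = s at hx
      cases hx with
      | a => exact Or.inl (Or.inl ⟨x, rfl⟩)
      | b d h => exact Or.inr (Or.inl ⟨d, rfl⟩)
      | c => exact Or.inl (Or.inr ⟨x, rfl⟩)
    · left; right; right
      generalize ({a, b, c} : Set (N ⊕ D.Lower)) = s at hd
      cases hd with
      | a => exact Or.inl ⟨d, rfl⟩
      | b => exact Or.inr ⟨d, rfl⟩
    · right
      rw [e]
      exact ⟨_, ⟨u, v, w, ht, rfl⟩, by simp [Set.image_insert_eq]⟩
  refine (Set.ncard_le_ncard hsub).trans ?_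
  refine (Set.ncard_union_le _ _).trans ?_
  have h1 := Set.ncard_union_le (Set.range D.wallA ∪ Set.range D.wallC)
    (Set.range D.wallB ∪ (Set.range D.roofA ∪ Set.range D.roofB))
  have h2 := Set.ncard_union_le (Set.range D.wallA) (Set.range D.wallC)
  have h3 := Set.ncard_union_le (Set.range D.wallB) (Set.range D.roofA ∪ Set.range D.roofB)
  have h4 := Set.ncard_union_le (Set.range D.roofA) (Set.range D.roofB)
  have k1 := ncard_range_le D.wallA
  have k2 := ncard_range_le D.wallC
  have k3 := ncard_range_le D.wallB
  have k4 := ncard_range_le D.roofA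
  have k5 := ncard_range_le D.roofB
  have k6 := Set.ncard_image_le (f := fun s : Set D.Lower => (Sum.inr '' s : Set (N ⊕ D.Lower)))
    (Set.toFinite {s : Set D.Lower | ∃ a b c, T a b c ∧ s = {a, b, c}})
  omega

/-- A diagram bounds an embedded oriented surface. -/
theorem IsPlanar.exists_surface [Finite Cr] (h : D.IsPlanar) :
    ∃ (pos : N ⊕ D.Lower → ℂ × ℝ) (Tri : N ⊕ D.Lower → N ⊕ D.Lower → N ⊕ D.Lower → Prop),
      IsOrientedSurface pos Tri ∧ (∀ x, pos (.inl x) = (D.f x, D.a x)) ∧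
      (∀ a b, ((∃ c, Tri a b c) ∧ ∀ d, ¬ Tri b a d) ↔ ∃ x, a = .inl x ∧ b = .inl (D.next x)) ∧
      {s : Set (N ⊕ D.Lower) | ∃ a b c, Tri a b c ∧ s = {a, b, c}}.ncard ≤
        4 * Nat.card D.Lower + 2 * Nat.card Cr := by
  classical
  have := Fintype.ofFinite D.Lower
  have := Fintype.ofFinite Cr
  obtain ⟨lev, T, hT, hcount⟩ := h.curve.exists_floor
  obtain ⟨m, hm0, hm⟩ := exists_generic_linear h.curve.inj
  obtain ⟨C, hC⟩ := (Set.finite_range fun p : D.Lower × N => D.a p.2 - lev p.1).bddBelow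
  -- Lowering the bound `C` by 1 puts all floors strictly below the polygon.
  have hC' : ∀ v x, lev v + (C - 1) < D.a x := by
    intro v x
    have : C ≤ D.a x - lev v := hC ⟨(v, x), rfl⟩
    linarith
  refine ⟨_, D.Tri T, isOrientedSurface hT hC' h, fun x => rfl, fun a b => Tri.boundary_iff hT, ?_⟩
  have h1 := ncard_tri_le (D := D) (T := T)
  have h2 := hcount m hm0 hm
  have h3 := card_le_monotone h hm
  have h4 : {s : Set D.Lower | ∃ a b c, T a b c ∧ s = {a, b, c}}.ncard ≤
      {s : Finset D.Lower | ∃ a b c, T a b c ∧ s = {a, b, c}}.ncard := by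
    rw [show {s : Set D.Lower | ∃ a b c, T a b c ∧ s = {a, b, c}} =
      (fun s : Finset D.Lower => (s : Set D.Lower)) '' {s : Finset D.Lower | ∃ a b c, T a b c ∧ s = {a, b, c}} by
        ext s
        constructor
        · rintro ⟨a, b, c, ht, rfl⟩; exact ⟨{a, b, c}, ⟨a, b, c, ht, rfl⟩, by simp⟩
        · rintro ⟨_, ⟨a, b, c, ht, rfl⟩, rfl⟩; exact ⟨a, b, c, ht, by simp⟩]
    exact Set.ncard_image_le (Set.toFinite _)
  rw [Nat.card_eq_fintype_card, Nat.card_eq_fintype_card] at *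
  -- For `L` vertices of the smoothed curve and `c` crossings: `2L + 3c` walls and roofs, and at
  -- most `2L - c` floor triangles.
  omega

end Diagram

/-! ### Generic projections -/

/-- The triple product of `u`, `v` and `d`. -/
def bracket (d u v : Fin 3 → ℝ) : ℝ :=
  (u 1 * v 2 - u 2 * v 1) * d 0 + (u 2 * v 0 - u 0 * v 2) * d 1 + (u 0 * v 1 - u 1 * v 0) * d 2

/-- It vanishes if the three lines through `a i` with direction `e i` have concurrent images under
the projection along `d`. -/
def concurrency (a b c u v w d : Fin 3 → ℝ) : ℝ :=
  bracket d a u * bracket d v w + bracket d b v * bracket d w u + bracket d c w * bracket d u v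

def IsPolynomialFun (F : (Fin 3 → ℝ) → ℝ) : Prop :=
  ∃ p : MvPolynomial (Fin 3) ℝ, ∀ d, F d = MvPolynomial.eval d p

theorem IsPolynomialFun.add {F G : (Fin 3 → ℝ) → ℝ} (hF : IsPolynomialFun F) (hG : IsPolynomialFun G) :
    IsPolynomialFun fun d => F d + G d := by
  obtain ⟨p, hp⟩ := hF
  obtain ⟨q, hq⟩ := hG
  exact ⟨p + q, fun d => by simp only [map_add, hp, hq]⟩

theorem IsPolynomialFun.mul {F G : (Fin 3 → ℝ) → ℝ} (hF : IsPolynomialFun F) (hG : IsPolynomialFun G) :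
    IsPolynomialFun fun d => F d * G d := by
  obtain ⟨p, hp⟩ := hF
  obtain ⟨q, hq⟩ := hG
  exact ⟨p * q, fun d => by simp only [map_mul, hp, hq]⟩

theorem isPolynomialFun_bracket (u v : Fin 3 → ℝ) : IsPolynomialFun fun d => bracket d u v :=
  ⟨.C (u 1 * v 2 - u 2 * v 1) * .X 0 + .C (u 2 * v 0 - u 0 * v 2) * .X 1 +
    .C (u 0 * v 1 - u 1 * v 0) * .X 2, fun d => by
      simp only [map_add, map_mul, MvPolynomial.eval_C, MvPolynomial.eval_X, bracket]⟩

theorem isPolynomialFun_concurrency (a b c u v w : Fin 3 → ℝ) :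
    IsPolynomialFun (concurrency a b c u v w) :=
  (((isPolynomialFun_bracket _ _).mul (isPolynomialFun_bracket _ _)).add
    ((isPolynomialFun_bracket _ _).mul (isPolynomialFun_bracket _ _))).add
    ((isPolynomialFun_bracket _ _).mul (isPolynomialFun_bracket _ _))

/-- The product of those polynomials that are not zero is not zero, so over the reals it does not
vanish at some point. -/
theorem exists_forall_ne_zero {ι : Type*} [Finite ι] (F : ι → (Fin 3 → ℝ) → ℝ)
    (hF : ∀ i, IsPolynomialFun (F i)) : ∃ d, ∀ i, (∃ d', F i d' ≠ 0) → F i d ≠ 0 := by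
  classical
  have := Fintype.ofFinite ι
  choose p hp using hF
  have hne : ∏ i ∈ Finset.univ.filter (fun i => p i ≠ 0), p i ≠ 0 :=
    Finset.prod_ne_zero_iff.2 fun i hi => (Finset.mem_filter.1 hi).2
  obtain ⟨d, hd⟩ : ∃ d, MvPolynomial.eval d (∏ i ∈ Finset.univ.filter (fun i => p i ≠ 0), p i) ≠ 0 := by
    by_contra! hcon
    exact hne (MvPolynomial.funext fun d => by rw [hcon, map_zero])
  refine ⟨d, fun i ⟨d', hd'⟩ => ?_⟩
  rw [map_prod, Finset.prod_ne_zero_iff] at hd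
  rw [hp]
  refine hd i (Finset.mem_filter.2 ⟨Finset.mem_univ _, fun h0 => ?_⟩)
  rw [hp, h0, map_zero] at hd'
  exact hd' rfl

theorem exists_eq_smul_add_smul {u v w d : Fin 3 → ℝ} (hd : bracket d u v ≠ 0) (h : bracket w u v = 0) :
    ∃ α β : ℝ, w = α • u + β • v := by
  refine ⟨bracket d w v / bracket d u v, bracket d u w / bracket d u v, ?_⟩
  have key : ∀ k : Fin 3, bracket d u v * w k = bracket d w v * u k + bracket d u w * v k + bracket w u v * d k := by
    intro k
    fin_cases k <;> simp only [bracket, Fin.zero_eta, Fin.mk_one, Fin.reduceFinMk] <;> ring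
  ext k
  have := key k
  rw [h, zero_mul, add_zero] at this
  simp only [Pi.add_apply, Pi.smul_apply, smul_eq_mul]
  field_simp
  linarith

/-- Three pairwise skew lines are not concurrent in a generic projection. -/
theorem exists_concurrency_ne_zero {a b c u v w : Fin 3 → ℝ} (h1 : bracket (b - a) u v ≠ 0)
    (h2 : bracket (c - b) v w ≠ 0) (h3 : bracket (c - a) u w ≠ 0) : ∃ d, concurrency a b c u v w d ≠ 0 := by
  -- If `w` lies in the plane spanned by `u` and `v`, the expression splits off the factor `bracket
  -- d u v`. The other factor is linear in `d` and is nonzero at `d = u`; a small family `u + τ • (b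
  -- - a)` then avoids both zero sets. If the directions are independent, `u + v` is a witness.
  by_cases hD : bracket w u v = 0
  · obtain ⟨α, β, rfl⟩ := exists_eq_smul_add_smul h1 hD
    have e : ∀ d, concurrency a b c u v (α • u + β • v) d =
        bracket d u v * (α * bracket d (c - a) u + β * bracket d (c - b) v) := by
      intro d
      simp only [concurrency, bracket, Pi.add_apply, Pi.sub_apply, Pi.smul_apply, smul_eq_mul]
      ring
    have hw : ∀ x, bracket x v (α • u + β • v) = α * bracket u x v := by
      intro x
      simp only [bracket, Pi.add_apply, Pi.smul_apply, smul_eq_mul]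
      ring
    have hw' : ∀ x, bracket x u (α • u + β • v) = β * bracket x u v := by
      intro x
      simp only [bracket, Pi.add_apply, Pi.smul_apply, smul_eq_mul]
      ring
    rw [hw] at h2
    rw [hw'] at h3
    have hl : β * bracket u (c - b) v ≠ 0 := mul_ne_zero (left_ne_zero_of_mul h3) (right_ne_zero_of_mul h2)
    have hδ : ∀ τ : ℝ, bracket (u + τ • (b - a)) u v = τ * bracket (b - a) u v := by
      intro τ
      simp only [bracket, Pi.add_apply, Pi.sub_apply, Pi.smul_apply, smul_eq_mul]
      ring
    set m := α * bracket (b - a) (c - a) u + β * bracket (b - a) (c - b) v with hm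
    have hℓ : ∀ τ : ℝ, α * bracket (u + τ • (b - a)) (c - a) u + β * bracket (u + τ • (b - a)) (c - b) v =
        β * bracket u (c - b) v + τ * m := by
      intro τ
      simp only [hm, bracket, Pi.add_apply, Pi.sub_apply, Pi.smul_apply, smul_eq_mul]
      ring
    obtain ⟨τ, hτ, hτ'⟩ : ∃ τ : ℝ, τ ≠ 0 ∧ β * bracket u (c - b) v + τ * m ≠ 0 := by
      by_cases h : β * bracket u (c - b) v + 1 * m = 0
      · exact ⟨-1, by norm_num, fun h' => hl (by linarith)⟩
      · exact ⟨1, one_ne_zero, h⟩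
    refine ⟨u + τ • (b - a), ?_⟩
    rw [e, hδ, hℓ]
    exact mul_ne_zero (mul_ne_zero hτ h1) hτ'
  · refine ⟨u + v, ?_⟩
    have e : concurrency a b c u v w (u + v) = - bracket w u v * bracket (b - a) u v := by
      simp only [concurrency, bracket, Pi.add_apply, Pi.sub_apply]
      ring
    rw [e]
    exact mul_ne_zero (neg_ne_zero.2 hD) h1

/-- The shear that makes the direction `d` vertical. -/
noncomputable def shear (d : Fin 3 → ℝ) : (Fin 3 → ℝ) ≃ₗ[ℝ] ℂ × ℝ where
  toFun x := (⟨x 0 - d 0 / d 2 * x 2, x 1 - d 1 / d 2 * x 2⟩, x 2)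
  invFun y := ![y.1.re + d 0 / d 2 * y.2, y.1.im + d 1 / d 2 * y.2, y.2]
  map_add' x y := by
    refine Prod.ext (Complex.ext ?_ ?_) rfl <;> simp <;> ring
  map_smul' r x := by
    refine Prod.ext (Complex.ext ?_ ?_) rfl <;> simp <;> ring
  left_inv x := by
    ext k
    fin_cases k <;> simp
  right_inv y := by
    refine Prod.ext (Complex.ext ?_ ?_) rfl <;> simp

theorem signedArea_shear {d : Fin 3 → ℝ} (hd : d 2 ≠ 0) (u v : Fin 3 → ℝ) :
    signedArea 0 (shear d u).1 (shear d v).1 = bracket d u v / d 2 := by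
  simp only [signedArea, shear, bracket, LinearEquiv.coe_mk, LinearMap.coe_mk, AddHom.coe_mk,
    Complex.zero_re, Complex.zero_im]
  field_simp
  ring

theorem eq_smul_of_shear_fst {d x : Fin 3 → ℝ} (hd : d 2 ≠ 0) (h : (shear d x).1 = 0) :
    x = (x 2 / d 2) • d := by
  have h0 := congrArg Complex.re h
  have h1 := congrArg Complex.im h
  simp only [shear, LinearEquiv.coe_mk, LinearMap.coe_mk, AddHom.coe_mk, Complex.zero_re,
    Complex.zero_im] at h0 h1
  ext k
  fin_cases k
  · simp only [Fin.zero_eta, Pi.smul_apply, smul_eq_mul]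
    rw [sub_eq_zero.1 h0]; ring
  · simp only [Fin.mk_one, Pi.smul_apply, smul_eq_mul]
    rw [sub_eq_zero.1 h1]; ring
  · simp only [Fin.reduceFinMk, Pi.smul_apply, smul_eq_mul]
    field_simp

section Generic

variable {I : Type*}

/-- An embedded closed polygon in space whose projection to the plane is generic. -/
structure IsGenericPolygon (ρ : Equiv.Perm I) (v : I → ℂ × ℝ) : Prop where
  embedded : ∀ {i j : I} {s t : ℝ}, s ∈ Set.Ico (0 : ℝ) 1 → t ∈ Set.Ico (0 : ℝ) 1 →
    v i + s • (v (ρ i) - v i) = v j + t • (v (ρ j) - v j) → i = j ∧ s = t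
  vertex : ∀ {i j : I} {t : ℝ}, t ∈ Set.Ico (0 : ℝ) 1 →
    (v i).1 = pointAt (v j).1 (v (ρ j)).1 t → i = j ∧ t = 0
  transverse : ∀ {i j : I} {s t : ℝ}, i ≠ j → s ∈ Set.Ico (0 : ℝ) 1 → t ∈ Set.Ico (0 : ℝ) 1 →
    pointAt (v i).1 (v (ρ i)).1 s = pointAt (v j).1 (v (ρ j)).1 t →
    signedArea 0 ((v (ρ i)).1 - (v i).1) ((v (ρ j)).1 - (v j).1) ≠ 0
  triple : ∀ {i j k : I} {s t u : ℝ}, i ≠ j → i ≠ k → j ≠ k → s ∈ Set.Ico (0 : ℝ) 1 →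
    t ∈ Set.Ico (0 : ℝ) 1 → u ∈ Set.Ico (0 : ℝ) 1 →
    pointAt (v i).1 (v (ρ i)).1 s = pointAt (v j).1 (v (ρ j)).1 t →
    pointAt (v i).1 (v (ρ i)).1 s ≠ pointAt (v k).1 (v (ρ k)).1 u

/-- Every embedded closed polygon has a generic projection. -/
theorem exists_isGenericPolygon [Finite I] {ρ : Equiv.Perm I} (hρ : ∀ i, ρ i ≠ i) {v : I → Fin 3 → ℝ}
    (hv : ∀ {i j : I} {s t : ℝ}, s ∈ Set.Ico (0 : ℝ) 1 → t ∈ Set.Ico (0 : ℝ) 1 →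
      v i + s • (v (ρ i) - v i) = v j + t • (v (ρ j) - v j) → i = j ∧ s = t) :
    ∃ L : (Fin 3 → ℝ) ≃ₗ[ℝ] ℂ × ℝ, IsGenericPolygon ρ fun i => L (v i) := by
  -- The brackets of all vertex differences and coordinate vectors, together with the concurrency
  -- expressions of all triples of edges, contain every condition needed. The direction `d` is a
  -- zero of one of them only if that expression vanishes identically.
  let X : (I × I) ⊕ Fin 3 → Fin 3 → ℝ := Sum.elim (fun p => v p.1 - v p.2) fun k => Pi.single k 1
  let e : I → Fin 3 → ℝ := fun i => v (ρ i) - v i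
  obtain ⟨d, hd⟩ := exists_forall_ne_zero (ι := (((I × I) ⊕ Fin 3) × ((I × I) ⊕ Fin 3)) ⊕ (I × I × I))
    (Sum.elim (fun p d => bracket d (X p.1) (X p.2)) fun p =>
      concurrency (v p.1) (v p.2.1) (v p.2.2) (e p.1) (e p.2.1) (e p.2.2)) (by
      rintro (p | p)
      exacts [isPolynomialFun_bracket _ _, isPolynomialFun_concurrency _ _ _ _ _ _])
  have hX : ∀ p q, bracket d (X p) (X q) = 0 → ∀ d', bracket d' (X p) (X q) = 0 := by
    intro p q h d'
    by_contra h'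
    exact hd (.inl (p, q)) ⟨d', h'⟩ h
  have hee : ∀ i j, bracket d (e i) (e j) = 0 → ∀ d', bracket d' (e i) (e j) = 0 := fun i j =>
    hX (.inl (ρ i, i)) (.inl (ρ j, j))
  have hev : ∀ i j k, bracket d (e i) (v j - v k) = 0 → ∀ d', bracket d' (e i) (v j - v k) = 0 := fun i j k =>
    hX (.inl (ρ i, i)) (.inl (j, k))
  -- The bracket of the first two coordinate vectors is the last coordinate of `d`.
  have hd2 : d 2 ≠ 0 := by
    intro h
    have := hX (.inr 0) (.inr 1) (by simp [X, bracket, h]) (Pi.single 2 1)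
    simp [X, bracket] at this
  -- No edge is parallel to `d`. Otherwise its brackets with the coordinate vectors would vanish at
  -- `d`, hence identically, and the edge would be zero.
  have hed : ∀ i, ∃ s, bracket s (e i) d ≠ 0 := by
    intro i
    have h0 : e i ≠ 0 := by
      intro h
      have := hv (i := ρ i) (j := i) (s := 0) (t := 0) (by simp) (by simp) (by simpa using sub_eq_zero.1 h)
      exact hρ i this.1
    by_contra! hcon
    apply h0
    have hk : ∀ k d', bracket d' (e i) (Pi.single k 1) = 0 := fun k =>
      hX (.inl (ρ i, i)) (.inr k) (by
        have := hcon (Pi.single k 1)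
        simp only [bracket] at this ⊢
        change _ = (0 : ℝ)
        simp only [X, Sum.elim_inl, Sum.elim_inr]
        linear_combination -this)
    have a1 := hk 0 (Pi.single 1 1)
    have a2 := hk 0 (Pi.single 2 1)
    have a3 := hk 1 (Pi.single 2 1)
    simp [bracket] at a1 a2 a3
    ext k
    fin_cases k
    exacts [a3, a2, a1]
  have proj : ∀ i s, pointAt (shear d (v i)).1 (shear d (v (ρ i))).1 s = (shear d (v i + s • e i)).1 := by
    intro i s
    simp only [pointAt, map_add, map_smul, e, map_sub, Prod.fst_add, Prod.smul_fst, Prod.fst_sub,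
      Complex.real_smul]
  have lift : ∀ {i j s t}, pointAt (shear d (v i)).1 (shear d (v (ρ i))).1 s =
      pointAt (shear d (v j)).1 (shear d (v (ρ j))).1 t →
      ∃ τ : ℝ, v i + s • e i - (v j + t • e j) = τ • d := by
    intro i j s t h
    rw [proj, proj] at h
    exact ⟨_, eq_smul_of_shear_fst hd2 (by rw [map_sub, Prod.fst_sub, h, sub_self])⟩
  -- If two edges meet in projection with parallel images, the genericity of `d` makes the edges
  -- parallel to each other and to the difference of their starting points. Then the points above
  -- the meeting point differ by no multiple of `d` except zero, contrary to embeddedness.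
  have trans : ∀ {i j s t}, i ≠ j → s ∈ Set.Ico (0 : ℝ) 1 → t ∈ Set.Ico (0 : ℝ) 1 →
      pointAt (shear d (v i)).1 (shear d (v (ρ i))).1 s = pointAt (shear d (v j)).1 (shear d (v (ρ j))).1 t →
      bracket d (e i) (e j) ≠ 0 := by
    intro i j s t hij hs ht h h0
    obtain ⟨τ, hτ⟩ := lift h
    have e1 : v i - v j = t • e j - s • e i + τ • d := by rw [← hτ]; module
    have h1 := hee i j h0
    have h2 := hev i i j (by
      rw [e1]
      simp only [bracket, Pi.add_apply, Pi.sub_apply, Pi.smul_apply, smul_eq_mul] at h0 ⊢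
      linear_combination t * h0)
    obtain ⟨s', hs'⟩ := hed i
    have h3 : τ * bracket s' (e i) d = 0 := by
      have h1 := h1 s'
      have h2 := h2 s'
      rw [e1] at h2
      simp only [bracket, Pi.add_apply, Pi.sub_apply, Pi.smul_apply, smul_eq_mul] at h1 h2 ⊢
      linear_combination h2 - t * h1
    rw [(mul_eq_zero.1 h3).resolve_right hs', zero_smul, sub_eq_zero] at hτ
    exact hij (hv hs ht hτ).1
  have skew : ∀ {i j s t}, i ≠ j → s ∈ Set.Ico (0 : ℝ) 1 → t ∈ Set.Ico (0 : ℝ) 1 →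
      pointAt (shear d (v i)).1 (shear d (v (ρ i))).1 s = pointAt (shear d (v j)).1 (shear d (v (ρ j))).1 t →
      bracket (v j - v i) (e i) (e j) ≠ 0 := by
    intro i j s t hij hs ht h h0
    obtain ⟨τ, hτ⟩ := lift h
    have e1 : v j - v i = s • e i - t • e j - τ • d := by rw [← hτ]; module
    have h3 : τ * bracket d (e i) (e j) = 0 := by
      rw [e1] at h0
      simp only [bracket, Pi.sub_apply, Pi.smul_apply, smul_eq_mul] at h0 ⊢
      linear_combination -h0
    rw [(mul_eq_zero.1 h3).resolve_right (trans hij hs ht h), zero_smul, sub_eq_zero] at hτ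
    exact hij (hv hs ht hτ).1
  refine ⟨shear d, ?_, ?_, ?_, ?_⟩
  · intro i j s t hs ht h
    refine hv hs ht ((shear d).injective ?_)
    simpa only [map_add, map_smul, map_sub] using h
  · intro i j t ht h
    obtain ⟨τ, hτ⟩ := lift (i := i) (j := j) (s := 0) (t := t) ((pointAt_zero _ _).trans h)
    have e1 : v i - v j = t • e j + τ • d := by rw [← hτ]; module
    have h2 := hev j i j (by
      rw [e1]
      simp only [bracket, Pi.add_apply, Pi.smul_apply, smul_eq_mul]
      ring)
    obtain ⟨s', hs'⟩ := hed j
    have h3 : τ * bracket s' (e j) d = 0 := by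
      have h2 := h2 s'
      rw [e1] at h2
      simp only [bracket, Pi.add_apply, Pi.smul_apply, smul_eq_mul] at h2 ⊢
      linear_combination h2
    rw [(mul_eq_zero.1 h3).resolve_right hs'] at hτ
    have := hv (by simp) ht (sub_eq_zero.1 (hτ.trans (zero_smul ℝ d)))
    exact ⟨this.1, this.2.symm⟩
  · intro i j s t hij hs ht h
    rw [← Prod.fst_sub, ← Prod.fst_sub, ← map_sub, ← map_sub, signedArea_shear hd2]
    exact div_ne_zero (trans hij hs ht h) hd2
  · intro i j k s t u hij hik hjk hs ht hu h1 h2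
    have h3 := h1.symm.trans h2
    -- At a triple point the concurrency expression vanishes at `d`. But three edges meeting
    -- pairwise in projection span pairwise skew lines, so the expression is not identically zero.
    refine hd (.inr (i, j, k)) (exists_concurrency_ne_zero (skew hij hs ht h1) (skew hjk ht hu h3)
      (skew hik hs hu h2)) ?_
    obtain ⟨τ, hτ⟩ := lift h1
    obtain ⟨τ', hτ'⟩ := lift h2
    have e1 : v j = v i + s • e i - t • e j - τ • d := by rw [← hτ]; module
    have e2 : v k = v i + s • e i - u • e k - τ' • d := by rw [← hτ']; module
    change concurrency (v i) (v j) (v k) (e i) (e j) (e k) d = 0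
    rw [e1, e2]
    simp only [concurrency, bracket, Pi.add_apply, Pi.sub_apply, Pi.smul_apply, smul_eq_mul]
    ring

end Generic

/-! ### Subdivisions of a polygon -/

/-- A subdivision of the edges of a closed polygon. Each node is the point with parameter `par`
on its edge, and is followed by the point with parameter `fin` on the same edge. -/
structure Subdivision {I : Type*} (ρ : Equiv.Perm I) (N : Type*) where
  edge : N → I
  par : N → ℝ
  vertex : I → N
  next : Equiv.Perm N
  fin : N → ℝ
  edge_vertex : ∀ i, edge (vertex i) = i
  par_vertex : ∀ i, par (vertex i) = 0
  par_mem : ∀ x, par x ∈ Set.Ico (0 : ℝ) 1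
  inj : ∀ {x y}, edge x = edge y → par x = par y → x = y
  par_lt : ∀ x, par x < fin x
  fin_le : ∀ x, fin x ≤ 1
  gap : ∀ {x y}, edge y = edge x → par y ≤ par x ∨ fin x ≤ par y
  next_cases : ∀ x, (edge (next x) = edge x ∧ par (next x) = fin x) ∨ (next x = vertex (ρ (edge x)) ∧ fin x = 1)

/-- A node is followed by the node with the next larger parameter on its edge or, if there is none,
by the initial vertex of the next edge. Since that vertex has parameter zero, the two cases cannot
have a common successor. -/
theorem exists_successor {I N : Type*} [Finite N] {ρ : Equiv.Perm I} (edge : N → I) (par : N → ℝ)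
    (vertex : I → N) (edge_vertex : ∀ i, edge (vertex i) = i) (par_vertex : ∀ i, par (vertex i) = 0)
    (par_mem : ∀ x, par x ∈ Set.Ico (0 : ℝ) 1) (inj : ∀ {x y}, edge x = edge y → par x = par y → x = y) :
    ∃ (next : Equiv.Perm N) (fin : N → ℝ), (∀ x, par x < fin x) ∧ (∀ x, fin x ≤ 1) ∧
      (∀ {x y}, edge y = edge x → par y ≤ par x ∨ fin x ≤ par y) ∧
      ∀ x, (edge (next x) = edge x ∧ par (next x) = fin x) ∨ (next x = vertex (ρ (edge x)) ∧ fin x = 1) := by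
  have hex : ∀ x, ∃ y : N, ∃ u : ℝ, par x < u ∧ u ≤ 1 ∧ (∀ y, edge y = edge x → par y ≤ par x ∨ u ≤ par y) ∧
      ((edge y = edge x ∧ par y = u) ∨ (y = vertex (ρ (edge x)) ∧ u = 1)) := by
    intro x
    by_cases h : ∃ y, edge y = edge x ∧ par x < par y
    · obtain ⟨y, hy, hmin⟩ := Set.exists_min_image {y | edge y = edge x ∧ par x < par y} par
        (Set.toFinite _) h
      refine ⟨y, par y, hy.2, (par_mem y).2.le, fun w hw => ?_, Or.inl ⟨hy.1, rfl⟩⟩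
      rcases le_or_gt (par w) (par x) with h | h
      exacts [Or.inl h, Or.inr (hmin w ⟨hw, h⟩)]
    · push Not at h
      exact ⟨_, 1, (par_mem x).2, le_rfl, fun w hw => Or.inl (h w hw), Or.inr ⟨rfl, rfl⟩⟩
  choose g u h1 h2 h3 h4 using hex
  have hg : Function.Injective g := by
    have key : ∀ {x y}, edge x = edge y → u x = u y → par y ≤ par x := by
      intro x y e e'
      rcases h3 x y e.symm with h | h
      · exact h
      · exact absurd (h1 y) (not_lt.2 (e' ▸ h))
    intro x y hxy
    rcases h4 x with ⟨a1, a2⟩ | ⟨a1, a2⟩ <;> rcases h4 y with ⟨b1, b2⟩ | ⟨b1, b2⟩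
    · have e : edge x = edge y := by rw [← a1, ← b1, hxy]
      have e' : u x = u y := by rw [← a2, ← b2, hxy]
      exact inj e (le_antisymm (key e.symm e'.symm) (key e e'))
    · rw [hxy, b1, par_vertex] at a2
      exact absurd (h1 x) (not_lt.2 (a2 ▸ (par_mem x).1))
    · rw [← hxy, a1, par_vertex] at b2
      exact absurd (h1 y) (not_lt.2 (b2 ▸ (par_mem y).1))
    · have e : edge x = edge y := ρ.injective (by
        rw [← edge_vertex (ρ (edge x)), ← edge_vertex (ρ (edge y)), ← a1, ← b1, hxy])
      have e' : u x = u y := by rw [a2, b2]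
      exact inj e (le_antisymm (key e.symm e'.symm) (key e e'))
  exact ⟨Equiv.ofBijective g (Finite.injective_iff_bijective.1 hg), u, h1, h2, fun {x y} => h3 x y, h4⟩

/-- The subdivision of a closed polygon with given nodes. -/
noncomputable def Subdivision.ofNodes {I N : Type*} [Finite N] (ρ : Equiv.Perm I) (edge : N → I) (par : N → ℝ)
    (vertex : I → N) (edge_vertex : ∀ i, edge (vertex i) = i) (par_vertex : ∀ i, par (vertex i) = 0)
    (par_mem : ∀ x, par x ∈ Set.Ico (0 : ℝ) 1) (inj : ∀ {x y}, edge x = edge y → par x = par y → x = y) :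
    Subdivision ρ N :=
  let H := exists_successor (ρ := ρ) edge par vertex edge_vertex par_vertex par_mem inj
  ⟨edge, par, vertex, H.choose, H.choose_spec.choose, edge_vertex, par_vertex, par_mem, inj,
    H.choose_spec.choose_spec.1, H.choose_spec.choose_spec.2.1, H.choose_spec.choose_spec.2.2.1,
    H.choose_spec.choose_spec.2.2.2⟩

namespace Subdivision

variable {I N : Type*} {ρ : Equiv.Perm I} (S : Subdivision ρ N)

theorem separated {x y : N} (hxy : x ≠ y) (h : S.edge x = S.edge y) : S.fin x ≤ S.par y ∨ S.fin y ≤ S.par x := by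
  rcases S.gap h with h1 | h1
  · rcases S.gap h.symm with h2 | h2
    · exact (hxy (S.inj h (le_antisymm h1 h2))).elim
    · exact Or.inl h2
  · exact Or.inr h1

theorem next_eq {x y : N} (h : S.edge y = S.edge x) (hlt : S.par x < S.par y)
    (hgap : ∀ w, S.edge w = S.edge x → S.par w ≤ S.par x ∨ S.par y ≤ S.par w) :
    S.next x = y ∧ S.fin x = S.par y := by
  have h1 : S.fin x ≤ S.par y := (S.gap h).resolve_left (not_le.2 hlt)
  rcases S.next_cases x with ⟨e, e'⟩ | ⟨e, e'⟩
  · have h2 := (hgap _ e).resolve_left (not_le.2 (e' ▸ S.par_lt x))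
    have h3 : S.par (S.next x) = S.par y := le_antisymm (e' ▸ h1) h2
    exact ⟨S.inj (e.trans h.symm) h3, e'.symm.trans h3⟩
  · exact absurd (S.par_mem y).2 (not_lt.2 (e' ▸ h1))

theorem next_next_ne (h1 : ∀ i, ρ i ≠ i) (h2 : ∀ i, ρ (ρ i) ≠ i) (x : N) : S.next (S.next x) ≠ x := by
  intro h
  rcases S.next_cases x with ⟨a, a'⟩ | ⟨a, a'⟩ <;> rcases S.next_cases (S.next x) with ⟨b, b'⟩ | ⟨b, b'⟩ <;>
    rw [h] at b
  · rw [h] at b'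
    have := S.par_lt (S.next x)
    rw [← b', a'] at this
    exact lt_asymm this (S.par_lt x)
  · have := congrArg S.edge b
    rw [edge_vertex, a] at this
    exact h1 _ this.symm
  · have := congrArg S.edge a
    rw [edge_vertex, ← b] at this
    exact h1 _ this.symm
  · have := congrArg S.edge b
    rw [edge_vertex, a, edge_vertex] at this
    exact h2 _ this.symm

theorem exists_cover [Finite N] (i : I) {u : ℝ} (hu : u ∈ Set.Ico (0 : ℝ) 1) :
    ∃ x, S.edge x = i ∧ S.par x ≤ u ∧ u < S.fin x := by
  obtain ⟨x, hx, hmax⟩ := Set.exists_max_image {x | S.edge x = i ∧ S.par x ≤ u} S.par (Set.toFinite _)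
    ⟨S.vertex i, S.edge_vertex i, by rw [S.par_vertex]; exact hu.1⟩
  refine ⟨x, hx.1, hx.2, ?_⟩
  by_contra! hcon
  rcases S.next_cases x with ⟨a, a'⟩ | ⟨a, a'⟩
  · have := hmax (S.next x) ⟨a.trans hx.1, a' ▸ hcon⟩
    exact absurd (S.par_lt x) (not_lt.2 (a' ▸ this))
  · exact absurd hu.2 (not_lt.2 (a' ▸ hcon))

end Subdivision

/-! ### Crossings of a generic projection -/

section Crossing

variable {I : Type*} {ρ : Equiv.Perm I} {v : I → ℂ × ℝ}

/-- The points of the projected edges. -/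
def sidePoint (ρ : Equiv.Perm I) (v : I → ℂ × ℝ) (i : I) (s : ℝ) : ℂ := pointAt (v i).1 (v (ρ i)).1 s

/-- The heights of the points of the edges. -/
def sideHeight (ρ : Equiv.Perm I) (v : I → ℂ × ℝ) (i : I) (s : ℝ) : ℝ := (v i).2 + s * ((v (ρ i)).2 - (v i).2)

/-- The direction of a projected edge. -/
def sideVector (ρ : Equiv.Perm I) (v : I → ℂ × ℝ) (i : I) : ℂ := (v (ρ i)).1 - (v i).1

theorem sidePoint_add (i : I) (s t : ℝ) :
    sidePoint ρ v i (s + t) = sidePoint ρ v i s + t * sideVector ρ v i := by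
  simp only [sidePoint, pointAt, sideVector]
  push_cast
  ring

theorem sidePoint_sub (i : I) (s t : ℝ) :
    sidePoint ρ v i s - sidePoint ρ v i t = ((s - t : ℝ) : ℂ) * sideVector ρ v i := by
  simp only [sidePoint, pointAt, sideVector]
  push_cast
  ring

theorem sidePoint_zero (i : I) : sidePoint ρ v i 0 = (v i).1 := pointAt_zero _ _

theorem sidePoint_one (i : I) : sidePoint ρ v i 1 = (v (ρ i)).1 := pointAt_one _ _

theorem prod_sidePoint (i : I) (s : ℝ) :
    (sidePoint ρ v i s, sideHeight ρ v i s) = v i + s • (v (ρ i) - v i) := by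
  refine Prod.ext ?_ rfl
  simp [sidePoint, pointAt]

/-- The pairs of an upper and a lower edge that cross in the projection. -/
def Crossing (ρ : Equiv.Perm I) (v : I → ℂ × ℝ) : Type _ :=
  {p : I × I // p.1 ≠ p.2 ∧ ∃ s t, s ∈ Set.Ioo (0 : ℝ) 1 ∧ t ∈ Set.Ioo (0 : ℝ) 1 ∧
    sidePoint ρ v p.1 s = sidePoint ρ v p.2 t ∧ sideHeight ρ v p.2 t < sideHeight ρ v p.1 s}

namespace Crossing

instance [Finite I] : Finite (Crossing ρ v) := Subtype.finite

/-- The upper edge (`true`) and the lower edge (`false`) of a crossing. -/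
def side (c : Crossing ρ v) : Bool → I := fun o => if o then c.1.1 else c.1.2

/-- The parameters of a crossing on its two edges. -/
noncomputable def param (c : Crossing ρ v) : Bool → ℝ :=
  fun o => if o then c.2.2.choose else c.2.2.choose_spec.choose

variable (c : Crossing ρ v)

theorem side_ne (o : Bool) : c.side o ≠ c.side (!o) := by
  cases o
  exacts [c.2.1.symm, c.2.1]

theorem param_mem (o : Bool) : c.param o ∈ Set.Ioo (0 : ℝ) 1 := by
  cases o
  exacts [c.2.2.choose_spec.choose_spec.2.1, c.2.2.choose_spec.choose_spec.1]

theorem param_mem' (o : Bool) : c.param o ∈ Set.Ico (0 : ℝ) 1 := Set.Ioo_subset_Ico_self (c.param_mem o)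

/-- The double point of the projection. -/
noncomputable def point : ℂ := sidePoint ρ v (c.side true) (c.param true)

theorem sidePoint_param (o : Bool) : sidePoint ρ v (c.side o) (c.param o) = c.point := by
  cases o
  exacts [c.2.2.choose_spec.choose_spec.2.2.1.symm, rfl]

theorem height_lt : sideHeight ρ v (c.side false) (c.param false) < sideHeight ρ v (c.side true) (c.param true) :=
  c.2.2.choose_spec.choose_spec.2.2.2

theorem ext_side {c d : Crossing ρ v} (h : ∀ o, c.side o = d.side o) : c = d :=
  Subtype.ext (Prod.ext (h true) (h false))

end Crossing

namespace IsGenericPolygon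

variable (h : IsGenericPolygon ρ v)

/-- A projected vertex lies on no other edge, so different edges can meet only at interior
parameters. -/
theorem sidePoint_cases (h : IsGenericPolygon ρ v) (hρ : ∀ i, ρ i ≠ i) {i j : I} {s t : ℝ}
    (hs : s ∈ Set.Ico (0 : ℝ) 1) (ht : t ∈ Set.Ico (0 : ℝ) 1) (e : sidePoint ρ v i s = sidePoint ρ v j t) :
    (i = j ∧ s = t) ∨ (i ≠ j ∧ s ∈ Set.Ioo (0 : ℝ) 1 ∧ t ∈ Set.Ioo (0 : ℝ) 1) := by
  by_cases hij : i = j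
  · subst hij
    refine Or.inl ⟨rfl, pointAt_injective ?_ e⟩
    intro e
    exact hρ i (h.vertex (i := ρ i) (j := i) (t := 0) (by simp) (by rw [pointAt_zero, e])).1
  · refine Or.inr ⟨hij, ⟨lt_of_le_of_ne hs.1 ?_, hs.2⟩, ⟨lt_of_le_of_ne ht.1 ?_, ht.2⟩⟩
    · rintro rfl
      exact hij (h.vertex ht (by rw [← sidePoint_zero (ρ := ρ)]; exact e)).1
    · rintro rfl
      exact hij (h.vertex hs (by rw [← sidePoint_zero (ρ := ρ)]; exact e.symm)).1.symm

/-- Edges that meet are not parallel, so the equation for the parameters has a nonzero determinant.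
-/
theorem param_unique (h : IsGenericPolygon ρ v) {i j : I} (hij : i ≠ j) {s t s' t' : ℝ}
    (hs : s ∈ Set.Ico (0 : ℝ) 1) (ht : t ∈ Set.Ico (0 : ℝ) 1)
    (e : sidePoint ρ v i s = sidePoint ρ v j t) (e' : sidePoint ρ v i s' = sidePoint ρ v j t') :
    s' = s ∧ t' = t := by
  have hA := h.transverse hij hs ht e
  have e2 : ((s' - s : ℝ) : ℂ) * sideVector ρ v i = ((t' - t : ℝ) : ℂ) * sideVector ρ v j := by
    rw [← sidePoint_sub, ← sidePoint_sub, e, e']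
  have h1 := congrArg Complex.re e2
  have h2 := congrArg Complex.im e2
  simp only [Complex.re_ofReal_mul, Complex.im_ofReal_mul, sideVector] at h1 h2
  simp only [signedArea, Complex.zero_re, Complex.zero_im, sub_zero] at hA
  constructor
  · refine sub_eq_zero.1 ((mul_eq_zero.1 ?_).resolve_right hA)
    linear_combination ((v (ρ j)).1 - (v j).1).im * h1 - ((v (ρ j)).1 - (v j).1).re * h2
  · refine sub_eq_zero.1 ((mul_eq_zero.1 ?_).resolve_right hA)
    linear_combination ((v (ρ i)).1 - (v i).1).im * h1 - ((v (ρ i)).1 - (v i).1).re * h2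

theorem exists_crossing (h : IsGenericPolygon ρ v) (hρ : ∀ i, ρ i ≠ i) {i j : I} {s t : ℝ}
    (hs : s ∈ Set.Ico (0 : ℝ) 1) (ht : t ∈ Set.Ico (0 : ℝ) 1) (e : sidePoint ρ v i s = sidePoint ρ v j t) :
    (i = j ∧ s = t) ∨ ∃ (c : Crossing ρ v) (o : Bool), c.side o = i ∧ c.param o = s ∧
      c.side (!o) = j ∧ c.param (!o) = t := by
  rcases h.sidePoint_cases hρ hs ht e with h1 | ⟨hij, hs', ht'⟩
  · exact Or.inl h1
  right
  have hne : sideHeight ρ v i s ≠ sideHeight ρ v j t := by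
    intro e'
    exact hij (h.embedded hs ht (by rw [← prod_sidePoint, ← prod_sidePoint, e, e'])).1
  rcases lt_or_gt_of_ne hne with hlt | hlt
  · let c : Crossing ρ v := ⟨(j, i), Ne.symm hij, t, s, ht', hs', e.symm, hlt⟩
    have e1 := h.param_unique (Ne.symm hij) ht hs e.symm
      ((c.sidePoint_param true).trans (c.sidePoint_param false).symm)
    exact ⟨c, false, rfl, e1.2, rfl, e1.1⟩
  · let c : Crossing ρ v := ⟨(i, j), hij, s, t, hs', ht', e, hlt⟩
    have e1 := h.param_unique hij hs ht e ((c.sidePoint_param true).trans (c.sidePoint_param false).symm)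
    exact ⟨c, true, rfl, e1.1, rfl, e1.2⟩

/-- A third edge through a double point is excluded by `triple`. -/
theorem side_cases (h : IsGenericPolygon ρ v) (hρ : ∀ i, ρ i ≠ i) (c : Crossing ρ v) {k : I} {u : ℝ}
    (hu : u ∈ Set.Ico (0 : ℝ) 1) (e : sidePoint ρ v k u = c.point) :
    ∃ o, c.side o = k ∧ c.param o = u := by
  by_cases hk : ∃ o, c.side o = k
  · obtain ⟨o, rfl⟩ := hk
    rw [← c.sidePoint_param o] at e
    rcases h.sidePoint_cases hρ hu (c.param_mem' o) e with h1 | h1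
    exacts [⟨o, rfl, h1.2.symm⟩, (h1.1 rfl).elim]
  · push Not at hk
    exact (h.triple (c.side_ne true) (hk true) (hk false) (c.param_mem' true) (c.param_mem' false) hu
      ((c.sidePoint_param true).trans (c.sidePoint_param false).symm) ((c.sidePoint_param true).trans e.symm)).elim

/-- Without triple points a point of an edge belongs to one crossing only, and it cannot be on the
upper and on the lower strand because the heights differ. -/
theorem event_unique (h : IsGenericPolygon ρ v) (hρ : ∀ i, ρ i ≠ i) {c d : Crossing ρ v} {o o' : Bool}
    (e : c.side o = d.side o') (e' : c.param o = d.param o') : c = d ∧ o = o' := by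
  have e1 : sidePoint ρ v (d.side (!o')) (d.param (!o')) = c.point := by
    rw [d.sidePoint_param, ← d.sidePoint_param o', ← e, ← e', c.sidePoint_param]
  obtain ⟨o'', h1, h2⟩ := h.side_cases hρ c (d.param_mem' _) e1
  by_cases ho : o'' = o
  · subst ho
    exact (d.side_ne o' (e.symm.trans h1)).elim
  obtain rfl : o'' = !o := by cases o <;> cases o'' <;> simp_all
  by_cases ho : o = o'
  · subst ho
    refine ⟨Crossing.ext_side fun p => ?_, rfl⟩
    by_cases hp : p = o
    · rw [hp, e]
    · obtain rfl : p = !o := by cases p <;> cases o <;> simp_all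
      exact h1
  · exfalso
    obtain rfl : o' = !o := by cases o <;> cases o' <;> simp_all
    have k1 := c.height_lt
    have k2 := d.height_lt
    cases o <;> simp only [Bool.not_true, Bool.not_false] at e e' h1 h2
    · rw [e, e', h1, h2] at k1
      exact lt_asymm k1 k2
    · rw [e, e', h1, h2] at k1
      exact lt_asymm k1 k2

theorem point_injective (h : IsGenericPolygon ρ v) (hρ : ∀ i, ρ i ≠ i) :
    Function.Injective (Crossing.point : Crossing ρ v → ℂ) := by
  intro c d e
  obtain ⟨o, h1, h2⟩ := h.side_cases hρ c (d.param_mem' true) ((d.sidePoint_param true).trans e.symm)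
  exact (h.event_unique hρ h1 h2).1

end IsGenericPolygon

end Crossing

/-! ### Small triangles at the crossings -/

section Crossing

variable {I : Type*} {ρ : Equiv.Perm I} {v : I → ℂ × ℝ}

/-- A small triangle at a crossing. -/
noncomputable def Crossing.corner (c : Crossing ρ v) (ε : ℝ) : Set ℂ :=
  convexHull ℝ {c.point, c.point + ε * sideVector ρ v (c.side true), c.point - ε * sideVector ρ v (c.side false)}

/-- The triangle is placed in the parallelogram spanned by its two sides at the crossing, which is
all that the estimates need. -/
theorem Crossing.mem_corner (c : Crossing ρ v) {ε : ℝ} {z : ℂ} (hz : z ∈ c.corner ε) :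
    ∃ α β : ℝ, 0 ≤ α ∧ α ≤ 1 ∧ 0 ≤ β ∧ β ≤ 1 ∧ z = c.point + ((α * ε : ℝ) : ℂ) * sideVector ρ v (c.side true) -
      ((β * ε : ℝ) : ℂ) * sideVector ρ v (c.side false) := by
  refine convexHull_min (t := {z | ∃ α β : ℝ, 0 ≤ α ∧ α ≤ 1 ∧ 0 ≤ β ∧ β ≤ 1 ∧ z = c.point +
    ((α * ε : ℝ) : ℂ) * sideVector ρ v (c.side true) -
      ((β * ε : ℝ) : ℂ) * sideVector ρ v (c.side false)}) ?_ ?_ hz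
  · rintro _ (rfl | rfl | rfl)
    · exact ⟨0, 0, by simp⟩
    · exact ⟨1, 0, by simp⟩
    · exact ⟨0, 1, by simp⟩
  · rintro _ ⟨α, β, h1, h2, h3, h4, rfl⟩ _ ⟨α', β', h1', h2', h3', h4', rfl⟩ r s hr hs hrs
    obtain rfl : s = 1 - r := by linarith
    refine ⟨r * α + (1 - r) * α', r * β + (1 - r) * β', by positivity, by nlinarith, by positivity,
      by nlinarith, ?_⟩
    simp only [Complex.real_smul]
    push_cast
    ring

theorem Crossing.norm_sub_point_le (c : Crossing ρ v) {ε : ℝ} (hε : 0 < ε) {z : ℂ} (hz : z ∈ c.corner ε) :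
    ‖z - c.point‖ ≤ ε * (‖sideVector ρ v (c.side true)‖ + ‖sideVector ρ v (c.side false)‖) := by
  obtain ⟨α, β, h1, h2, h3, h4, rfl⟩ := c.mem_corner hz
  rw [add_sub_assoc, add_sub_cancel_left]
  refine (norm_sub_le _ _).trans ?_
  rw [norm_mul, norm_mul, Complex.norm_real, Complex.norm_real, Real.norm_of_nonneg (by positivity),
    Real.norm_of_nonneg (by positivity), mul_add]
  refine add_le_add (mul_le_mul_of_nonneg_right ?_ (norm_nonneg _)) (mul_le_mul_of_nonneg_right ?_ (norm_nonneg _))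
  · nlinarith
  · nlinarith

/-- The triangles of size `ε` at the crossings are disjoint from each other, and from the vertices and
the other edges. -/
structure IsSmall (ρ : Equiv.Perm I) (v : I → ℂ × ℝ) (ε : ℝ) : Prop where
  pos : 0 < ε
  lower : ∀ (c : Crossing ρ v) o, 2 * ε < c.param o
  upper : ∀ (c : Crossing ρ v) o, 2 * ε < 1 - c.param o
  gap : ∀ (c d : Crossing ρ v) o o', c.side o = d.side o' → (c, o) ≠ (d, o') → 2 * ε < |c.param o - d.param o'|
  side : ∀ (c : Crossing ρ v) k, (∀ o, c.side o ≠ k) → ∀ u ∈ Set.Icc (0 : ℝ) 1,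
    sidePoint ρ v k u ∉ c.corner ε
  disj : ∀ (c d : Crossing ρ v), c ≠ d → ∀ z ∈ c.corner ε, z ∉ d.corner ε

theorem eventually_mul_lt (A : ℝ) {B : ℝ} (hB : 0 < B) : ∀ᶠ ε : ℝ in 𝓝[>] 0, ε * A < B := by
  have : Tendsto (fun ε : ℝ => ε * A) (𝓝 0) (𝓝 (0 * A)) := tendsto_id.mul_const A
  rw [zero_mul] at this
  exact (this.mono_left nhdsWithin_le_nhds).eventually_lt_const hB

theorem continuous_sidePoint (i : I) : Continuous (sidePoint ρ v i) := by
  unfold sidePoint pointAt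
  fun_prop

/-- There are finitely many conditions, and each holds for all small `ε`: distinct parameters and
distinct double points have positive distances, and so has a double point from any edge not through
it. -/
theorem IsGenericPolygon.exists_isSmall [Finite I] (h : IsGenericPolygon ρ v) (hρ : ∀ i, ρ i ≠ i) :
    ∃ ε, IsSmall ρ v ε := by
  have h1 : ∀ (c : Crossing ρ v) o, ∀ᶠ ε : ℝ in 𝓝[>] 0, ε * 2 < c.param o := fun c o =>
    eventually_mul_lt 2 (c.param_mem o).1
  have h2 : ∀ (c : Crossing ρ v) o, ∀ᶠ ε : ℝ in 𝓝[>] 0, ε * 2 < 1 - c.param o := fun c o =>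
    eventually_mul_lt 2 (sub_pos.2 (c.param_mem o).2)
  have h3 : ∀ (c d : Crossing ρ v) o o', ∀ᶠ ε : ℝ in 𝓝[>] 0, c.side o = d.side o' → (c, o) ≠ (d, o') →
      ε * 2 < |c.param o - d.param o'| := by
    intro c d o o'
    by_cases e : c.side o = d.side o' ∧ (c, o) ≠ (d, o')
    · have : 0 < |c.param o - d.param o'| := abs_pos.2 (sub_ne_zero.2 fun e' => e.2 (by
        obtain ⟨rfl, rfl⟩ := h.event_unique hρ e.1 e'; rfl))
      exact (eventually_mul_lt 2 this).mono fun ε hε _ _ => hε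
    · exact .of_forall fun ε e1 e2 => (e ⟨e1, e2⟩).elim
  have h4 : ∀ (c : Crossing ρ v) k, ∀ᶠ ε : ℝ in 𝓝[>] 0, (∀ o, c.side o ≠ k) →
      ∀ u ∈ Set.Icc (0 : ℝ) 1, sidePoint ρ v k u ∉ c.corner ε := by
    intro c k
    by_cases e : ∀ o, c.side o ≠ k
    · obtain ⟨u₀, hu₀, hmin⟩ := isCompact_Icc.exists_isMinOn (s := Set.Icc (0 : ℝ) 1) ⟨0, by simp⟩
        (f := fun u => ‖sidePoint ρ v k u - c.point‖)
        (((continuous_sidePoint k).sub continuous_const).norm.continuousOn)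
      have hpos : 0 < ‖sidePoint ρ v k u₀ - c.point‖ := by
        refine norm_pos_iff.2 (sub_ne_zero.2 fun e' => ?_)
        -- The closed edge includes the parameter 1, where its point is the next vertex.
        rcases hu₀.2.eq_or_lt with rfl | hlt
        · rw [sidePoint_one, ← c.sidePoint_param true] at e'
          exact (c.param_mem true).1.ne' (h.vertex (c.param_mem' true) e').2
        · obtain ⟨o, ho, -⟩ := h.side_cases hρ c ⟨hu₀.1, hlt⟩ e'
          exact e o ho
      filter_upwards [eventually_mul_lt _ hpos, self_mem_nhdsWithin] with ε hε hε0 _ u hu hm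
      exact absurd (hmin hu) (not_le.2 ((c.norm_sub_point_le hε0 hm).trans_lt hε))
    · exact .of_forall fun ε e' => (e e').elim
  have h5 : ∀ (c d : Crossing ρ v), ∀ᶠ ε : ℝ in 𝓝[>] 0, c ≠ d → ∀ z ∈ c.corner ε, z ∉ d.corner ε := by
    intro c d
    by_cases e : c = d
    · exact .of_forall fun ε e' => (e' e).elim
    · have hpos : 0 < ‖c.point - d.point‖ :=
        norm_pos_iff.2 (sub_ne_zero.2 fun e' => e (h.point_injective hρ e'))
      filter_upwards [eventually_mul_lt _ hpos, self_mem_nhdsWithin] with ε hε hε0 _ z hz hz'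
      refine absurd hε (not_lt.2 ?_)
      rw [show c.point - d.point = (z - d.point) - (z - c.point) by ring]
      refine (norm_sub_le _ _).trans ((add_le_add (d.norm_sub_point_le hε0 hz')
        (c.norm_sub_point_le hε0 hz)).trans_eq (mul_add ε _ _).symm)
  have h0 : ∀ᶠ ε : ℝ in 𝓝[>] 0, 0 < ε := self_mem_nhdsWithin
  simp only [← eventually_all] at h1 h2 h3 h4 h5
  obtain ⟨ε, hε, e1, e2, e3, e4, e5⟩ := (h0.and (h1.and (h2.and (h3.and (h4.and h5))))).exists
  refine ⟨ε, hε, ?_, ?_, ?_, e4, e5⟩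
  all_goals simpa only [mul_comm 2 ε]

/-- In the coordinates given by the independent directions of the two strands, the triangle extends
forward along the upper strand and backward along the lower one. -/
theorem IsSmall.mem_corner (h : IsGenericPolygon ρ v) {ε : ℝ} (hε : IsSmall ρ v ε)
    {c : Crossing ρ v} {k : I} {u : ℝ} (hu : u ∈ Set.Icc (0 : ℝ) 1) (hm : sidePoint ρ v k u ∈ c.corner ε) :
    (k = c.side true ∧ c.param true ≤ u ∧ u ≤ c.param true + ε) ∨
      (k = c.side false ∧ c.param false - ε ≤ u ∧ u ≤ c.param false) := by
  have hk : ∃ o, c.side o = k := by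
    by_contra! hcon
    exact hε.side c k hcon u hu hm
  obtain ⟨α, β, h1, h2, h3, h4, e⟩ := c.mem_corner hm
  have hA := h.transverse (c.side_ne true) (c.param_mem' true) (c.param_mem' false)
    ((c.sidePoint_param true).trans (c.sidePoint_param false).symm)
  have key : ∀ x y : ℝ, (x : ℂ) * sideVector ρ v (c.side true) = y * sideVector ρ v (c.side false) →
      x = 0 ∧ y = 0 := by
    intro x y hxy
    have e1 := congrArg Complex.re hxy
    have e2 := congrArg Complex.im hxy
    simp only [Complex.re_ofReal_mul, Complex.im_ofReal_mul] at e1 e2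
    simp only [signedArea, Complex.zero_re, Complex.zero_im, sub_zero] at hA
    change (sideVector ρ v (c.side true)).re * (sideVector ρ v (c.side false)).im -
      (sideVector ρ v (c.side true)).im * (sideVector ρ v (c.side false)).re ≠ 0 at hA
    constructor
    · refine (mul_eq_zero.1 ?_).resolve_right hA
      linear_combination (sideVector ρ v (c.side false)).im * e1 - (sideVector ρ v (c.side false)).re * e2
    · refine (mul_eq_zero.1 ?_).resolve_right hA
      linear_combination (sideVector ρ v (c.side true)).im * e1 - (sideVector ρ v (c.side true)).re * e2
  have hε0 := hε.pos
  obtain ⟨o, rfl⟩ := hk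
  have e' := sidePoint_sub (ρ := ρ) (v := v) (c.side o) u (c.param o)
  rw [c.sidePoint_param, e] at e'
  cases o
  · right
    have := key (α * ε) (u - c.param false + β * ε) (by push_cast at e' ⊢; linear_combination e')
    exact ⟨rfl, by nlinarith [this.2], by nlinarith [this.2]⟩
  · left
    have := key (α * ε - (u - c.param true)) (β * ε) (by push_cast at e' ⊢; linear_combination e')
    exact ⟨rfl, by nlinarith [this.1], by nlinarith [this.1]⟩

end Crossing

/-! ### The diagram of a generic polygon -/

section Nodes

variable {I : Type*} {ρ : Equiv.Perm I} {v : I → ℂ × ℝ}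

/-- The nodes: the vertices of the polygon, the points over and under the crossings, and the points
next to them. -/
abbrev Node (ρ : Equiv.Perm I) (v : I → ℂ × ℝ) : Type _ := I ⊕ (Crossing ρ v × Bool) × Bool

namespace Node

def edge : Node ρ v → I := Sum.elim id fun e => e.1.1.side e.1.2

/-- The second flag marks the neighbouring node, which comes after the crossing on the upper strand
and before it on the lower one. -/
def shift (ε : ℝ) (o m : Bool) : ℝ := if m then (if o then ε else -ε) else 0

noncomputable def par (ε : ℝ) : Node ρ v → ℝ := Sum.elim 0 fun e => e.1.1.param e.1.2 + shift ε e.1.2 e.2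

variable {ε : ℝ}

theorem abs_shift_le (hε : IsSmall ρ v ε) (o m : Bool) : |shift ε o m| ≤ ε := by
  have := hε.pos
  cases m <;> cases o <;> simp [shift, abs_of_pos, this, this.le]

theorem par_inr_mem (hε : IsSmall ρ v ε) (e : (Crossing ρ v × Bool) × Bool) :
    par ε (.inr e : Node ρ v) ∈ Set.Ioo ε 1 := by
  have h1 := abs_le.1 (abs_shift_le hε e.1.2 e.2)
  have h2 := hε.lower e.1.1 e.1.2
  have h3 := hε.upper e.1.1 e.1.2
  have := hε.pos
  change e.1.1.param e.1.2 + shift ε e.1.2 e.2 ∈ _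
  constructor <;> linarith

theorem par_mem (hε : IsSmall ρ v ε) (x : Node ρ v) : par ε x ∈ Set.Ico (0 : ℝ) 1 := by
  rcases x with i | e
  · simp [par]
  · have := par_inr_mem hε e
    exact ⟨hε.pos.le.trans this.1.le, this.2⟩

theorem event_eq (hε : IsSmall ρ v ε) {e e' : (Crossing ρ v × Bool) × Bool}
    (h : edge (.inr e : Node ρ v) = edge (.inr e' : Node ρ v))
    (h' : |e.1.1.param e.1.2 - e'.1.1.param e'.1.2| ≤ 2 * ε) : e.1 = e'.1 := by
  by_contra hne
  exact absurd h' (not_le.2 (hε.gap e.1.1 e'.1.1 e.1.2 e'.1.2 h hne))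

theorem par_inj (hε : IsSmall ρ v ε) {x y : Node ρ v} (h : edge x = edge y) (h' : par ε x = par ε y) : x = y := by
  rcases x with i | e <;> rcases y with j | e'
  · exact congrArg Sum.inl h
  · have := (par_inr_mem hε e').1
    rw [← h'] at this
    exact absurd hε.pos (not_lt.2 this.le)
  · have := (par_inr_mem hε e).1
    rw [h'] at this
    exact absurd hε.pos (not_lt.2 this.le)
  · change e.1.1.param e.1.2 + shift ε e.1.2 e.2 = e'.1.1.param e'.1.2 + shift ε e'.1.2 e'.2 at h'
    have h1 := event_eq hε h (by
      rw [show e.1.1.param e.1.2 - e'.1.1.param e'.1.2 = shift ε e'.1.2 e'.2 - shift ε e.1.2 e.2 by linarith]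
      refine (abs_sub _ _).trans ?_
      linarith [abs_shift_le hε e'.1.2 e'.2, abs_shift_le hε e.1.2 e.2])
    rw [h1, add_right_inj] at h'
    obtain ⟨⟨c, o⟩, m⟩ := e
    obtain ⟨⟨d, o'⟩, m'⟩ := e'
    obtain ⟨rfl, rfl⟩ := Prod.mk.injEq .. ▸ h1
    have := hε.pos
    cases m <;> cases m' <;> cases o <;> simp [shift, this.ne', this.ne] at h' ⊢

/-- The projection of a node. -/
noncomputable def proj (ε : ℝ) (x : Node ρ v) : ℂ := sidePoint ρ v (edge x) (par ε x)

/-- The height of a node. -/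
noncomputable def height (ε : ℝ) (x : Node ρ v) : ℝ := sideHeight ρ v (edge x) (par ε x)

theorem proj_event (ε : ℝ) (c : Crossing ρ v) (o : Bool) : proj ε (.inr ((c, o), false) : Node ρ v) = c.point := by
  rw [← c.sidePoint_param o]
  exact congrArg _ (add_zero _)

theorem proj_after (ε : ℝ) (c : Crossing ρ v) : proj ε (.inr ((c, true), true) : Node ρ v) =
    c.point + ε * sideVector ρ v (c.side true) := by
  rw [← c.sidePoint_param true]
  exact sidePoint_add _ _ _

theorem proj_before (ε : ℝ) (c : Crossing ρ v) : proj ε (.inr ((c, false), true) : Node ρ v) =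
    c.point - ε * sideVector ρ v (c.side false) := by
  rw [← c.sidePoint_param false]
  refine (sidePoint_add _ _ _).trans ?_
  change _ + ((-ε : ℝ) : ℂ) * _ = _
  push_cast
  rw [neg_mul, ← sub_eq_add_neg]
  rfl

/-- Nodes with the same projection are equal or form the two points over a crossing, because the
neighbouring nodes are not double points. -/
theorem proj_inj (hε : IsSmall ρ v ε) (h : IsGenericPolygon ρ v) (hρ : ∀ i, ρ i ≠ i) {x y : Node ρ v} (hxy : proj ε x = proj ε y) :
    x = y ∨ ∃ c o, x = .inr ((c, o), false) ∧ y = .inr ((c, !o), false) := by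
  rcases h.exists_crossing hρ (par_mem hε x) (par_mem hε y) hxy with ⟨h1, h2⟩ | ⟨c, o, h1, h2, h3, h4⟩
  · exact Or.inl (par_inj hε h1 h2)
  · exact Or.inr ⟨c, o, par_inj hε h1.symm (h2.symm.trans (add_zero _).symm),
      par_inj hε h3.symm (h4.symm.trans (add_zero _).symm)⟩

variable [Finite I]

/-- The subdivision of the polygon by the nodes. -/
noncomputable def subdivision (hε : IsSmall ρ v ε) : Subdivision ρ (Node ρ v) :=
  .ofNodes ρ edge (par ε) .inl (fun _ => rfl) (fun _ => rfl) (par_mem hε) (par_inj hε)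

variable (hε : IsSmall ρ v ε)

theorem subdivision_par : (subdivision hε).par = par ε := rfl

/-- Events of other crossings on the same edge are more than `2 * ε` away and are shifted by at most
`ε`, so no node lies between the two. The argument for `next_over` is the same. -/
theorem next_before (c : Crossing ρ v) :
    (subdivision hε).next (.inr ((c, false), true)) = .inr ((c, false), false) ∧
      (subdivision hε).fin (.inr ((c, false), true)) = c.param false := by
  have hε0 := hε.pos
  have e0 : par ε (.inr ((c, false), false) : Node ρ v) = c.param false := add_zero _
  have e1 : par ε (.inr ((c, false), true) : Node ρ v) = c.param false - ε := rfl
  rw [← show (subdivision hε).par (.inr ((c, false), false)) = c.param false from e0]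
  refine (subdivision hε).next_eq rfl ?_ ?_
  · rw [subdivision_par, e0, e1]; linarith
  · intro w hw
    rw [subdivision_par, e0, e1]
    rcases w with i | e
    · left
      have := hε.lower c false
      change (0 : ℝ) ≤ _
      linarith
    · by_cases he : e.1 = (c, false)
      · obtain ⟨e, m⟩ := e
        obtain rfl : e = (c, false) := he
        cases m
        · exact Or.inr e0.ge
        · exact Or.inl e1.le
      · have hgap := hε.gap e.1.1 c e.1.2 false hw he
        have hs := abs_le.1 (abs_shift_le hε e.1.2 e.2)
        change e.1.1.param e.1.2 + shift ε e.1.2 e.2 ≤ _ ∨ _ ≤ e.1.1.param e.1.2 + shift ε e.1.2 e.2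
        rcases lt_abs.1 hgap with h | h
        · right; linarith
        · left; linarith

theorem next_over (c : Crossing ρ v) :
    (subdivision hε).next (.inr ((c, true), false)) = .inr ((c, true), true) ∧
      (subdivision hε).fin (.inr ((c, true), false)) = c.param true + ε := by
  have hε0 := hε.pos
  have e0 : par ε (.inr ((c, true), false) : Node ρ v) = c.param true := add_zero _
  have e1 : par ε (.inr ((c, true), true) : Node ρ v) = c.param true + ε := rfl
  rw [← show (subdivision hε).par (.inr ((c, true), true)) = c.param true + ε from e1]
  refine (subdivision hε).next_eq rfl ?_ ?_
  · rw [subdivision_par, e0, e1]; linarith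
  · intro w hw
    rw [subdivision_par, e0, e1]
    rcases w with i | e
    · left
      exact (c.param_mem true).1.le
    · by_cases he : e.1 = (c, true)
      · obtain ⟨e, m⟩ := e
        obtain rfl : e = (c, true) := he
        cases m
        · exact Or.inl e0.le
        · exact Or.inr e1.ge
      · have hgap := hε.gap e.1.1 c e.1.2 true hw he
        have hs := abs_le.1 (abs_shift_le hε e.1.2 e.2)
        change e.1.1.param e.1.2 + shift ε e.1.2 e.2 ≤ _ ∨ _ ≤ e.1.1.param e.1.2 + shift ε e.1.2 e.2
        rcases lt_abs.1 hgap with h | h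
        · right; linarith
        · left; linarith

theorem edge_next_ne {x : Node ρ v} {e : (Crossing ρ v × Bool) × Bool}
    (h : edge x ≠ e.1.1.side e.1.2) : (subdivision hε).next x ≠ .inr e := by
  intro h'
  rcases (subdivision hε).next_cases x with ⟨h1, -⟩ | ⟨h1, -⟩
  · rw [h'] at h1
    exact h h1.symm
  · rw [h'] at h1
    exact Sum.inr_ne_inl h1

theorem proj_next (x : Node ρ v) :
    proj ε ((subdivision hε).next x) = sidePoint ρ v (edge x) ((subdivision hε).fin x) := by
  rcases (subdivision hε).next_cases x with ⟨h1, h2⟩ | ⟨h1, h2⟩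
  · change edge _ = _ at h1
    change par ε _ = _ at h2
    rw [proj, h1, h2]; rfl
  · rw [h1, h2, sidePoint_one]
    exact sidePoint_zero _

theorem height_next (x : Node ρ v) :
    height ε ((subdivision hε).next x) = sideHeight ρ v (edge x) ((subdivision hε).fin x) := by
  rcases (subdivision hε).next_cases x with ⟨h1, h2⟩ | ⟨h1, h2⟩
  · change edge _ = _ at h1
    change par ε _ = _ at h2
    rw [height, h1, h2]; rfl
  · rw [h1, h2]
    change (v (ρ (edge x))).2 + 0 * _ = (v (edge x)).2 + 1 * _
    ring

/-- The diagram of a generic polygon. -/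
noncomputable def diagram (h : IsGenericPolygon ρ v) (h1 : ∀ i, ρ i ≠ i) (h2 : ∀ i, ρ (ρ i) ≠ i)
    (hε : IsSmall ρ v ε) : Diagram (Node ρ v) (Crossing ρ v) where
  next := (subdivision hε).next
  t c := .inr ((c, true), false)
  b c := .inr ((c, false), false)
  p c := .inr ((c, true), true)
  q c := .inr ((c, false), true)
  f := proj ε
  a := height ε
  next_q c := (next_before hε c).1
  next_t c := (next_over hε c).1
  t_inj c d e := by simpa using e
  q_inj c d e := by simpa using e
  t_ne_b c d := by simp
  t_ne_p c d := by simp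
  t_ne_q c d := by simp
  b_ne_p c d := by simp
  b_ne_q c d := by simp
  p_ne_q c d := by simp
  next_next_ne := (subdivision hε).next_next_ne h1 h2
  next_p_ne c := edge_next_ne hε (c.side_ne true)
  next_b_ne c := edge_next_ne hε (c.side_ne false)
  f_t c := by rw [proj_event, proj_event]
  f_inj x y hx hy e := by
    rcases proj_inj hε h h1 e with h | ⟨c, o, rfl, rfl⟩
    · exact h
    · cases o
      exacts [(hy ⟨c, rfl⟩).elim, (hx ⟨c, rfl⟩).elim]
  height c := by
    have e : ∀ o, height ε (.inr ((c, o), false) : Node ρ v) = sideHeight ρ v (c.side o) (c.param o) := fun o =>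
      congrArg _ (add_zero _)
    rw [e, e]
    exact c.height_lt

end Node

end Nodes

section Segment

variable {I : Type*} {ρ : Equiv.Perm I} {v : I → ℂ × ℝ}

theorem pointAt_sidePoint (i : I) (s t r : ℝ) :
    pointAt (sidePoint ρ v i s) (sidePoint ρ v i t) r = sidePoint ρ v i (s + r * (t - s)) := by
  simp only [sidePoint, pointAt]
  push_cast
  ring

theorem exists_of_mem_segment_sidePoint {i : I} {s t : ℝ} (hst : s ≤ t) {z : ℂ}
    (hz : z ∈ segment ℝ (sidePoint ρ v i s) (sidePoint ρ v i t)) : ∃ u ∈ Set.Icc s t, z = sidePoint ρ v i u := by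
  obtain ⟨r, h0, h1, rfl⟩ := mem_segment_iff_pointAt.1 hz
  exact ⟨_, ⟨by nlinarith, by nlinarith⟩, pointAt_sidePoint i s t r⟩

theorem exists_of_mem_openSegment_sidePoint {i : I} {s t : ℝ} (hst : s < t) {z : ℂ}
    (hz : z ∈ openSegment ℝ (sidePoint ρ v i s) (sidePoint ρ v i t)) : ∃ u ∈ Set.Ioo s t, z = sidePoint ρ v i u := by
  obtain ⟨r, h0, h1, rfl⟩ := mem_openSegment_iff_pointAt.1 hz
  exact ⟨_, ⟨by nlinarith, by nlinarith⟩, pointAt_sidePoint i s t r⟩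

end Segment

/-! ### Planarity of the smoothed diagram -/

namespace Node

variable {I : Type*} {ρ : Equiv.Perm I} {v : I → ℂ × ℝ} {ε : ℝ} [Finite I] (h : IsGenericPolygon ρ v)
  (h1 : ∀ i, ρ i ≠ i) (h2 : ∀ i, ρ (ρ i) ≠ i) (hε : IsSmall ρ v ε)

/-- The interior of a piece of an edge contains neither a vertex nor a double point, since all
double points are nodes. -/
theorem interior (h : IsGenericPolygon ρ v) (h1 : ∀ i, ρ i ≠ i) (hε : IsSmall ρ v ε)
    {x : Node ρ v} {u w : ℝ} (hu : u ∈ Set.Ioo (par ε x) ((subdivision hε).fin x)) {j : I}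
    (hw : w ∈ Set.Icc (0 : ℝ) 1) (e : sidePoint ρ v (edge x) u = sidePoint ρ v j w) : edge x = j ∧ u = w := by
  have hu0 : 0 < u := (par_mem hε x).1.trans_lt hu.1
  have hu' : u ∈ Set.Ico (0 : ℝ) 1 := ⟨hu0.le, hu.2.trans_le ((subdivision hε).fin_le x)⟩
  rcases hw.2.eq_or_lt with rfl | hlt
  · rw [sidePoint_one] at e
    exact absurd (h.vertex hu' e.symm).2 hu0.ne'
  rcases h.exists_crossing h1 hu' ⟨hw.1, hlt⟩ e with h | ⟨c, o, e1, e2, -⟩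
  · exact h
  · have e3 : par ε (.inr ((c, o), false) : Node ρ v) = u := (add_zero _).trans e2
    have := (subdivision hε).gap (x := x) (y := .inr ((c, o), false)) e1
    rw [subdivision_par, e3] at this
    rcases this with h | h
    · exact absurd hu.1 (not_lt.2 h)
    · exact absurd hu.2 (not_lt.2 h)

theorem corner_eq (c : Crossing ρ v) : convexHull ℝ {(diagram h h1 h2 hε).f ((diagram h h1 h2 hε).b c),
    (diagram h h1 h2 hε).f ((diagram h h1 h2 hε).p c),
    (diagram h h1 h2 hε).f ((diagram h h1 h2 hε).q c)} = c.corner ε := by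
  change convexHull ℝ {proj ε (.inr ((c, false), false)), proj ε (.inr ((c, true), true)),
    proj ε (.inr ((c, false), true))} = _
  rw [proj_event, proj_after, proj_before, Crossing.corner]

theorem f_smooth {x : (diagram h h1 h2 hε).Lower} (hx : ∀ c, x ≠ (diagram h h1 h2 hε).Q c) :
    (diagram h h1 h2 hε).f ((diagram h h1 h2 hε).smooth x) =
      sidePoint ρ v (edge x.1) ((subdivision hε).fin x.1) := by
  rw [← Diagram.f_top, Diagram.top_of_ne _ fun c e => hx c (Subtype.ext e)]
  exact proj_next hε x.1

theorem exists_of_mem_segment {x : (diagram h h1 h2 hε).Lower} (hx : ∀ c, x ≠ (diagram h h1 h2 hε).Q c) {z : ℂ}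
    (hz : z ∈ segment ℝ ((diagram h h1 h2 hε).f x) ((diagram h h1 h2 hε).f ((diagram h h1 h2 hε).smooth x))) :
    ∃ u ∈ Set.Icc (par ε x.1) ((subdivision hε).fin x.1), z = sidePoint ρ v (edge x.1) u := by
  rw [f_smooth h h1 h2 hε hx] at hz
  exact exists_of_mem_segment_sidePoint ((subdivision hε).par_lt x.1).le hz

theorem exists_of_mem_openSegment {x : (diagram h h1 h2 hε).Lower} (hx : ∀ c, x ≠ (diagram h h1 h2 hε).Q c) {z : ℂ}
    (hz : z ∈ openSegment ℝ ((diagram h h1 h2 hε).f x) ((diagram h h1 h2 hε).f ((diagram h h1 h2 hε).smooth x))) :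
    ∃ u ∈ Set.Ioo (par ε x.1) ((subdivision hε).fin x.1), z = sidePoint ρ v (edge x.1) u := by
  rw [f_smooth h h1 h2 hε hx] at hz
  exact exists_of_mem_openSegment_sidePoint ((subdivision hε).par_lt x.1) hz

theorem next_of_fin_eq {x y : Node ρ v} (e : edge x = edge y) (e' : (subdivision hε).fin x = par ε y) :
    (subdivision hε).next x = y := by
  rcases (subdivision hε).next_cases x with ⟨a, a'⟩ | ⟨-, a'⟩
  · exact par_inj hε (a.trans e) (a'.trans e')
  · exact absurd (par_mem hε y).2 (not_lt.2 (e' ▸ a').ge)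

theorem roof_disj {c d : Crossing ρ v} {z : ℂ} (hcd : c ≠ d)
    (hz : z ∈ convexHull ℝ {(diagram h h1 h2 hε).f ((diagram h h1 h2 hε).b c),
      (diagram h h1 h2 hε).f ((diagram h h1 h2 hε).p c), (diagram h h1 h2 hε).f ((diagram h h1 h2 hε).q c)}) :
    z ∉ convexHull ℝ {(diagram h h1 h2 hε).f ((diagram h h1 h2 hε).b d),
      (diagram h h1 h2 hε).f ((diagram h h1 h2 hε).p d), (diagram h h1 h2 hε).f ((diagram h h1 h2 hε).q d)} := by
  rw [corner_eq] at hz ⊢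
  exact hε.disj c d hcd z hz

/-- By `IsSmall.mem_corner` the crossing triangle meets the polygon only in the pieces from t to p
and from q to b. Neither is an edge of the smoothed diagram, so other pieces touch it at most in an
end. The chords of other crossings lie in disjoint triangles. -/
theorem roof_edge {c : Crossing ρ v} {x : (diagram h h1 h2 hε).Lower} {z : ℂ} (hx : x ≠ (diagram h h1 h2 hε).Q c)
    (hz : z ∈ convexHull ℝ {(diagram h h1 h2 hε).f ((diagram h h1 h2 hε).b c),
      (diagram h h1 h2 hε).f ((diagram h h1 h2 hε).p c), (diagram h h1 h2 hε).f ((diagram h h1 h2 hε).q c)})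
    (hz' : z ∈ segment ℝ ((diagram h h1 h2 hε).f x) ((diagram h h1 h2 hε).f ((diagram h h1 h2 hε).smooth x))) :
    ∃ w : (diagram h h1 h2 hε).Lower, (w = x ∨ w = (diagram h h1 h2 hε).smooth x) ∧
      (w = (diagram h h1 h2 hε).B c ∨ w = (diagram h h1 h2 hε).P c ∨ w = (diagram h h1 h2 hε).Q c) ∧
      z = (diagram h h1 h2 hε).f w := by
  by_cases hQ : ∃ d, x = (diagram h h1 h2 hε).Q d
  · obtain ⟨d, rfl⟩ := hQ
    have hcd : c ≠ d := by rintro rfl; exact hx rfl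
    refine (roof_disj h h1 h2 hε hcd hz ?_).elim
    rw [Diagram.smooth_q, ← convexHull_pair] at hz'
    refine convexHull_mono ?_ hz'
    rintro _ (rfl | rfl)
    exacts [Or.inr (Or.inr rfl), Or.inr (Or.inl rfl)]
  push Not at hQ
  have hsm := f_smooth h h1 h2 hε hQ
  have hnext : ∀ {y : Node ρ v}, edge x.1 = edge y → (subdivision hε).fin x.1 = par ε y →
      (diagram h h1 h2 hε).next x.1 = y := fun e e' => next_of_fin_eq hε e e'
  obtain ⟨u, hu, rfl⟩ := exists_of_mem_segment h h1 h2 hε hQ hz'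
  rw [corner_eq] at hz
  have hε0 := hε.pos
  have p1 : ∀ o, par ε (.inr ((c, o), false) : Node ρ v) = c.param o := fun o => add_zero _
  have p2 : par ε (.inr ((c, true), true) : Node ρ v) = c.param true + ε := rfl
  have p3 : par ε (.inr ((c, false), true) : Node ρ v) = c.param false - ε := rfl
  have hu01 : u ∈ Set.Icc (0 : ℝ) 1 := ⟨(par_mem hε x.1).1.trans hu.1, hu.2.trans ((subdivision hε).fin_le x.1)⟩
  rcases hε.mem_corner h hu01 hz with ⟨e, hl, hr⟩ | ⟨e, hl, hr⟩
  · have hne : x.1 ≠ .inr ((c, true), false) := fun e => x.2 ⟨c, e.symm⟩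
    rcases (subdivision hε).separated hne e with hs | hs
    · rw [subdivision_par, p1] at hs
      have e1 : u = (subdivision hε).fin x.1 := le_antisymm hu.2 (hs.trans hl)
      have e2 : (diagram h h1 h2 hε).smooth x = (diagram h h1 h2 hε).B c := by
        have : (diagram h h1 h2 hε).next x.1 = (diagram h h1 h2 hε).t c :=
          hnext e ((le_antisymm hs (hl.trans e1.le)).trans (p1 true).symm)
        exact (diagram h h1 h2 hε).smoothFun_t this
      exact ⟨_, Or.inr rfl, Or.inl e2, by rw [hsm, e1]⟩
    · rw [subdivision_par, (next_over hε c).2] at hs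
      have e1 : u = par ε x.1 := le_antisymm (hr.trans hs) hu.1
      refine ⟨x, Or.inl rfl, Or.inr (Or.inl (Subtype.ext (par_inj hε e ?_))), by rw [e1]; rfl⟩
      exact (le_antisymm (e1 ▸ hr) hs).trans p2.symm
  · have hne : x.1 ≠ .inr ((c, false), true) := fun e => hx (Subtype.ext e)
    rcases (subdivision hε).separated hne e with hs | hs
    · rw [subdivision_par, p3] at hs
      have e1 : u = (subdivision hε).fin x.1 := le_antisymm hu.2 (hs.trans hl)
      have e2 : (diagram h h1 h2 hε).smooth x = (diagram h h1 h2 hε).Q c := by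
        have hn : (diagram h h1 h2 hε).next x.1 = (diagram h h1 h2 hε).q c :=
          hnext e ((le_antisymm hs (hl.trans e1.le)).trans p3.symm)
        refine Subtype.ext (((diagram h h1 h2 hε).smoothFun_next (fun d => ?_) fun d e => hQ d (Subtype.ext e)).trans hn)
        rw [hn]
        exact ((diagram h h1 h2 hε).t_ne_q _ _).symm
      exact ⟨_, Or.inr rfl, Or.inr (Or.inr e2), by rw [hsm, e1]⟩
    · rw [subdivision_par, (next_before hε c).2] at hs
      have e1 : u = par ε x.1 := le_antisymm (hr.trans hs) hu.1
      refine ⟨x, Or.inl rfl, Or.inl (Subtype.ext (par_inj hε e ?_)), by rw [e1]; rfl⟩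
      exact (le_antisymm (e1 ▸ hr) hs).trans (p1 false).symm

theorem area_ne (c : Crossing ρ v) : signedArea ((diagram h h1 h2 hε).f ((diagram h h1 h2 hε).b c))
    ((diagram h h1 h2 hε).f ((diagram h h1 h2 hε).p c)) ((diagram h h1 h2 hε).f ((diagram h h1 h2 hε).q c)) ≠ 0 := by
  change signedArea (proj ε (.inr ((c, false), false))) (proj ε (.inr ((c, true), true)))
    (proj ε (.inr ((c, false), true))) ≠ 0
  rw [proj_event, proj_after, proj_before]
  have hA := h.transverse (c.side_ne true) (c.param_mem' true) (c.param_mem' false)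
    ((c.sidePoint_param true).trans (c.sidePoint_param false).symm)
  change signedArea 0 (sideVector ρ v (c.side true)) (sideVector ρ v (c.side false)) ≠ 0 at hA
  have : signedArea c.point (c.point + ε * sideVector ρ v (c.side true)) (c.point - ε * sideVector ρ v (c.side false)) =
      -(ε * ε) * signedArea 0 (sideVector ρ v (c.side true)) (sideVector ρ v (c.side false)) := by
    simp only [signedArea, Complex.add_re, Complex.add_im, Complex.sub_re, Complex.sub_im,
      Complex.re_ofReal_mul, Complex.im_ofReal_mul, Complex.zero_re, Complex.zero_im]
    ring
  rw [this]
  exact mul_ne_zero (neg_ne_zero.2 (mul_pos hε.pos hε.pos).ne') hA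

/-- Chords lie in the crossing triangles and are handled by `roof_edge`; all other edges are pieces
of the projected polygon, whose interiors contain no double points. -/
theorem isPlanarCurve_smooth : IsPlanarCurve (fun x : (diagram h h1 h2 hε).Lower => (diagram h h1 h2 hε).f x)
    (diagram h h1 h2 hε).smooth where
  inj x y e := Diagram.lower_inj e
  ne := Diagram.smooth_ne _
  disj {x y z} hxy hz hz' := by
    have hsm : ∀ x : (diagram h h1 h2 hε).Lower, (diagram h h1 h2 hε).f x ≠ (diagram h h1 h2 hε).f ((diagram h h1 h2 hε).smooth x) := fun x e =>
      (diagram h h1 h2 hε).smooth_ne x (Diagram.lower_inj e).symm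
    have hchord : ∀ {c z}, z ∈ segment ℝ ((diagram h h1 h2 hε).f ((diagram h h1 h2 hε).Q c))
        ((diagram h h1 h2 hε).f ((diagram h h1 h2 hε).smooth ((diagram h h1 h2 hε).Q c))) →
        z ∈ convexHull ℝ {(diagram h h1 h2 hε).f ((diagram h h1 h2 hε).b c),
          (diagram h h1 h2 hε).f ((diagram h h1 h2 hε).p c), (diagram h h1 h2 hε).f ((diagram h h1 h2 hε).q c)} := by
      intro c z hz
      rw [Diagram.smooth_q, ← convexHull_pair] at hz
      refine convexHull_mono ?_ hz
      rintro _ (rfl | rfl)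
      exacts [Or.inr (Or.inr rfl), Or.inr (Or.inl rfl)]
    by_cases hx : ∃ c, x = (diagram h h1 h2 hε).Q c
    · obtain ⟨c, rfl⟩ := hx
      obtain ⟨w, -, hw, rfl⟩ := roof_edge h h1 h2 hε (Ne.symm hxy) (hchord (openSegment_subset_segment _ _ _ hz)) hz'
      have hA := area_ne h h1 h2 hε c
      rw [Diagram.smooth_q] at hz
      have hn : (diagram h h1 h2 hε).f ((diagram h h1 h2 hε).Q c) ≠ (diagram h h1 h2 hε).f ((diagram h h1 h2 hε).P c) := by
        have := hsm ((diagram h h1 h2 hε).Q c)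
        rwa [Diagram.smooth_q] at this
      rcases hw with rfl | rfl | rfl
      · have := signedArea_of_mem_openSegment hz
        rw [signedArea_swap, neg_eq_zero, signedArea_cyc] at this
        exact hA this
      · exact hn (right_mem_openSegment_iff.1 hz)
      · exact hn (left_mem_openSegment_iff.1 hz)
    by_cases hy : ∃ c, y = (diagram h h1 h2 hε).Q c
    · obtain ⟨c, rfl⟩ := hy
      obtain ⟨w, hw, -, rfl⟩ := roof_edge h h1 h2 hε hxy (hchord hz') (openSegment_subset_segment _ _ _ hz)
      rcases hw with rfl | rfl
      · exact hsm _ (left_mem_openSegment_iff.1 hz)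
      · exact hsm _ (right_mem_openSegment_iff.1 hz)
    push Not at hx hy
    obtain ⟨u, hu, rfl⟩ := exists_of_mem_openSegment h h1 h2 hε hx hz
    obtain ⟨w, hw, e⟩ := exists_of_mem_segment h h1 h2 hε hy hz'
    obtain ⟨e1, e2⟩ := interior h h1 hε hu
      ⟨(par_mem hε y.1).1.trans hw.1, hw.2.trans ((subdivision hε).fin_le y.1)⟩ e
    subst e2
    rcases (subdivision hε).separated (fun e => hxy (Subtype.ext e)) e1 with hs | hs
    · exact absurd (hu.2.trans_le hs) (not_lt.2 hw.1)
    · exact absurd (hs.trans_lt hu.1) (not_lt.2 hw.2)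

theorem isPlanar_diagram : (diagram h h1 h2 hε).IsPlanar where
  curve := isPlanarCurve_smooth h h1 h2 hε
  area := area_ne h h1 h2 hε
  roof_disj := roof_disj h h1 h2 hε
  roof_edge := roof_edge h h1 h2 hε
  dir c := by
    set y := (diagram h h1 h2 hε).smooth.symm ((diagram h h1 h2 hε).Q c) with hy
    have hsy : (diagram h h1 h2 hε).smooth y = (diagram h h1 h2 hε).Q c := by simp [hy]
    have hyQ : ∀ d, y ≠ (diagram h h1 h2 hε).Q d := by
      intro d e
      rw [e, Diagram.smooth_q] at hsy
      exact (diagram h h1 h2 hε).p_ne_q d c (congrArg Subtype.val hsy)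
    have hPQ : ∀ d, (diagram h h1 h2 hε).P c ≠ (diagram h h1 h2 hε).Q d := fun d e =>
      (diagram h h1 h2 hε).p_ne_q c d (congrArg Subtype.val e)
    have hedge : edge y.1 = c.side false := by
      have hn : (subdivision hε).next y.1 = .inr ((c, false), true) := by
        rcases (diagram h h1 h2 hε).smoothFun_cases y with ⟨d, -, e⟩ | ⟨d, e, -⟩ | ⟨-, -, e⟩
        · exact ((diagram h h1 h2 hε).b_ne_q d c (congrArg Subtype.val (e.symm.trans hsy))).elim
        · exact (hyQ d e).elim
        · exact e.symm.trans (congrArg Subtype.val hsy)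
      rcases (subdivision hε).next_cases y.1 with ⟨e, -⟩ | ⟨e, -⟩
      · rw [hn] at e; exact e.symm
      · rw [hn] at e; exact (Sum.inr_ne_inl e).elim
    have e1 : (diagram h h1 h2 hε).f ((diagram h h1 h2 hε).q c) - (diagram h h1 h2 hε).f y =
        (((subdivision hε).fin y.1 - par ε y.1 : ℝ) : ℂ) * sideVector ρ v (c.side false) := by
      have := f_smooth h h1 h2 hε hyQ
      rw [hsy] at this
      change (diagram h h1 h2 hε).f ((diagram h h1 h2 hε).q c) = _ at this
      rw [this, ← hedge, ← sidePoint_sub]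
      rfl
    set P := (diagram h h1 h2 hε).P c with hP
    have e2 : (diagram h h1 h2 hε).f ((diagram h h1 h2 hε).smooth P) - (diagram h h1 h2 hε).f ((diagram h h1 h2 hε).p c) =
        (((subdivision hε).fin P.1 - par ε P.1 : ℝ) : ℂ) * sideVector ρ v (c.side true) := by
      rw [f_smooth h h1 h2 hε hPQ]
      exact sidePoint_sub _ _ _
    have p1 := sub_pos.2 ((subdivision hε).par_lt y.1)
    have p2 := sub_pos.2 ((subdivision hε).par_lt P.1)
    rw [subdivision_par] at p1 p2
    -- The chord is `ε` times the sum of the vectors of the two edges of the polygon, while the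
    -- pieces before q and after p are shorter multiples of these vectors; `r` and `s` correct the
    -- lengths.
    refine ⟨ε / ((subdivision hε).fin y.1 - par ε y.1), ε / ((subdivision hε).fin P.1 - par ε P.1),
      div_pos hε.pos p1, div_pos hε.pos p2, ?_⟩
    rw [e1, e2, ← mul_assoc, ← mul_assoc, ← Complex.ofReal_mul, ← Complex.ofReal_mul, div_mul_cancel₀ _ p1.ne',
      div_mul_cancel₀ _ p2.ne']
    change proj ε (.inr ((c, true), true)) - proj ε (.inr ((c, false), true)) = _
    rw [proj_after, proj_before]
    ring

end Node

/-! ### Final counts and the surface in space -/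

theorem IsOrientedSurface.map {W E F : Type*} [AddCommGroup E] [Module ℝ E] [AddCommGroup F] [Module ℝ F]
    {pos : W → E} {Tri : W → W → W → Prop} (h : IsOrientedSurface pos Tri) (L : E ≃ₗ[ℝ] F) :
    IsOrientedSurface (fun w => L (pos w)) Tri where
  inj := L.injective.comp h.inj
  cyc := h.cyc
  indep {a b c} ht := by
    have := (h.indep ht).map' L.toLinearMap.toAffineMap L.injective
    convert this using 1
    ext k
    fin_cases k <;> rfl
  coherent := h.coherent
  noflip := h.noflip
  link := h.link
  proper ht ht' := by
    have himg : ∀ s, convexHull ℝ ((fun w => L (pos w)) '' s) = L '' convexHull ℝ (pos '' s) := by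
      intro s
      rw [show (fun w => L (pos w)) '' s = L.toLinearMap '' (pos '' s) by rw [Set.image_image]; rfl,
        ← LinearMap.image_convexHull]
      rfl
    rintro _ ⟨hx, hx'⟩
    rw [himg] at hx hx' ⊢
    obtain ⟨x, hx, rfl⟩ := hx
    obtain ⟨y, hy, e⟩ := hx'
    obtain rfl := L.injective e
    exact ⟨y, h.proper ht ht' ⟨hx, hy⟩, rfl⟩

theorem IsOrientedSurface.ncard_triangles_le {W E : Type*} [Finite W] [AddCommGroup E] [Module ℝ E] [DecidableEq E]
    {pos : W → E} {Tri : W → W → W → Prop} (h : IsOrientedSurface pos Tri) :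
    h.complex.triangles.ncard ≤ {s : Set W | ∃ a b c, Tri a b c ∧ s = {a, b, c}}.ncard := by
  rw [h.triangles_complex, ← Set.ncard_image_of_injective _ Finset.coe_injective]
  refine (Set.ncard_le_ncard ?_ (Set.toFinite _)).trans (Set.ncard_image_le (f := fun s => pos '' s) (Set.toFinite _))
  rintro _ ⟨_, ⟨a, b, c, ht, rfl⟩, rfl⟩
  exact ⟨_, ⟨a, b, c, ht, rfl⟩, by simp [Set.image_insert_eq]⟩

/-- A crossing yields two ordered pairs of different, nonadjacent edges: consecutive edges already
share a vertex, and transverse lines meet only once. The pairs of equal or adjacent edges are `3n`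
further ordered pairs, distinct because there are at least three edges. -/
theorem IsGenericPolygon.card_crossing_le {I : Type*} {ρ : Equiv.Perm I} {v : I → ℂ × ℝ} [Finite I]
    (h : IsGenericPolygon ρ v) (h1 : ∀ i, ρ i ≠ i) (h2 : ∀ i, ρ (ρ i) ≠ i) :
    2 * Nat.card (Crossing ρ v) + 3 * Nat.card I ≤ Nat.card I ^ 2 := by
  let φ : (Crossing ρ v × Bool) ⊕ (I ⊕ I ⊕ I) → I × I := Sum.elim (fun e => (e.1.side e.2, e.1.side (!e.2)))
    (Sum.elim (fun i => (i, i)) (Sum.elim (fun i => (i, ρ i)) fun i => (ρ i, i)))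
  have hadj : ∀ (c : Crossing ρ v) o, c.side (!o) ≠ ρ (c.side o) := by
    intro c o e
    have := (h.param_unique (c.side_ne o) (c.param_mem' o) (c.param_mem' (!o))
      ((c.sidePoint_param o).trans (c.sidePoint_param (!o)).symm) (s' := 1) (t' := 0)
      (by rw [sidePoint_one, e, sidePoint_zero])).1
    exact (c.param_mem o).2.ne this.symm
  have hcross : ∀ (e : Crossing ρ v × Bool) y, φ (.inl e) ≠ φ (.inr y) := by
    rintro ⟨c, o⟩ (i | i | i) e
    · exact c.side_ne o ((congrArg Prod.fst e).trans (congrArg Prod.snd e).symm)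
    · exact hadj c o ((congrArg Prod.snd e).trans (congrArg ρ (congrArg Prod.fst e)).symm)
    · refine hadj c (!o) ?_
      rw [Bool.not_not]
      exact (congrArg Prod.fst e).trans (congrArg ρ (congrArg Prod.snd e)).symm
  have hφ : Function.Injective φ := by
    rintro (⟨c, o⟩ | x) (⟨d, o'⟩ | y) e
    · have e1 : c.side o = d.side o' := congrArg Prod.fst e
      have e2 : c.side (!o) = d.side (!o') := congrArg Prod.snd e
      have := (h.param_unique (c.side_ne o) (c.param_mem' o) (c.param_mem' (!o))
        ((c.sidePoint_param o).trans (c.sidePoint_param (!o)).symm) (s' := d.param o') (t' := d.param (!o'))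
        (by rw [e1, e2, d.sidePoint_param, d.sidePoint_param])).1
      obtain ⟨rfl, rfl⟩ := h.event_unique h1 e1 this.symm
      rfl
    · exact (hcross _ _ e).elim
    · exact (hcross _ _ e.symm).elim
    · rcases x with i | i | i <;> rcases y with j | j | j <;>
        simp only [φ, Sum.elim_inl, Sum.elim_inr, Prod.mk.injEq] at e
      · rw [e.1]
      · exact (h1 j (e.2.symm.trans e.1)).elim
      · exact (h1 j (e.1.symm.trans e.2)).elim
      · exact (h1 i (e.2.trans e.1.symm)).elim
      · rw [e.1]
      · rw [e.1] at e; exact (h2 j e.2).elim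
      · exact (h1 i (e.1.trans e.2.symm)).elim
      · rw [e.2] at e; exact (h2 j e.1).elim
      · rw [e.2]
  have := Nat.card_le_card_of_injective φ hφ
  simp only [Nat.card_sum, Nat.card_prod, Nat.card_eq_fintype_card (α := Bool), Fintype.card_bool] at this
  rw [sq]
  omega

/-- There are four nodes per crossing besides the vertices, and the node t of each crossing is
removed. -/
theorem Node.card_lower {I : Type*} {ρ : Equiv.Perm I} {v : I → ℂ × ℝ} {ε : ℝ} [Finite I]
    (h : IsGenericPolygon ρ v) (h1 : ∀ i, ρ i ≠ i) (h2 : ∀ i, ρ (ρ i) ≠ i) (hε : IsSmall ρ v ε) :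
    Nat.card (Node.diagram h h1 h2 hε).Lower = Nat.card I + 3 * Nat.card (Crossing ρ v) := by
  have e1 := Set.ncard_add_ncard_compl (Set.range (Node.diagram h h1 h2 hε).t)
  have e2 : (Set.range (Node.diagram h h1 h2 hε).t).ncard = Nat.card (Crossing ρ v) := by
    rw [← Set.image_univ, Set.ncard_image_of_injective _ (Node.diagram h h1 h2 hε).t_inj, Set.ncard_univ]
  have e3 : Nat.card (Node ρ v) = Nat.card I + 4 * Nat.card (Crossing ρ v) := by
    simp only [Nat.card_sum, Nat.card_prod, Nat.card_eq_fintype_card (α := Bool), Fintype.card_bool]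
    omega
  have e4 : Nat.card (Node.diagram h h1 h2 hε).Lower = (Set.range (Node.diagram h h1 h2 hε).t)ᶜ.ncard :=
    Nat.card_coe_set_eq _
  omega

theorem finRotate_ne {n : ℕ} (hn : 3 ≤ n) (i : Fin n) : finRotate n i ≠ i ∧ finRotate n (finRotate n i) ≠ i := by
  obtain ⟨m, rfl⟩ : ∃ m, n = m + 3 := ⟨n - 3, by omega⟩
  constructor
  · intro e
    rw [finRotate_apply] at e
    have := add_eq_left.1 e
    simp at this
  · intro e
    rw [finRotate_apply, finRotate_apply, add_assoc] at e
    have := add_eq_left.1 e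
    simp [Fin.ext_iff, Fin.val_add, Nat.mod_eq_of_lt] at this

theorem theorem1p1 (n : ℕ) (hn : 3 ≤ n) (P : Polygon (EuclideanSpace ℝ (Fin 3)) n)
    (hP : P.IsEmbedded) :
    ∃ (K : Geometry.SimplicialComplex ℝ (EuclideanSpace ℝ (Fin 3))) (_ : K.SurfaceOrientation),
      K.IsSurface ∧
      K.boundaryComplex.IsSubdivisionOfPolygon P ∧
      K.triangles.ncard ≤ 7 * n ^ 2 := by
  classical
  have h1 : ∀ i, finRotate n i ≠ i := fun i => (finRotate_ne hn i).1
  have h2 : ∀ i, finRotate n (finRotate n i) ≠ i := fun i => (finRotate_ne hn i).2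
  have hpath : ∀ i s, P.edgePath ℝ i s = P i + s • (P (finRotate n i) - P i) := by
    intro i s
    rw [Polygon.edgePath, AffineMap.lineMap_apply_module', add_comm]
  let L₀ : EuclideanSpace ℝ (Fin 3) ≃ₗ[ℝ] (Fin 3 → ℝ) := WithLp.linearEquiv 2 ℝ (Fin 3 → ℝ)
  obtain ⟨L₁, h⟩ := exists_isGenericPolygon h1 (v := fun i => L₀ (P i)) (fun {i j s t} hs ht e => by
    refine hP i j s t hs ht (L₀.injective ?_)
    simpa only [hpath, map_add, map_smul, map_sub] using e)
  set L := L₀.trans L₁ with hL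
  change IsGenericPolygon (finRotate n) fun i => L (P i) at h
  obtain ⟨ε, hε⟩ := h.exists_isSmall h1
  obtain ⟨pos, Tri, hT, hpos, hbd, hcard⟩ := (Node.isPlanar_diagram h h1 h2 hε).exists_surface
  -- The surface is built in coordinates in which the projection is vertical, and it is carried back
  -- by the linear isomorphism.
  have hS := hT.map L.symm
  have hedge : ∀ i s, L (P.edgePath ℝ i s) = (sidePoint (finRotate n) (fun i => L (P i)) i s,
      sideHeight (finRotate n) (fun i => L (P i)) i s) := by
    intro i s
    rw [prod_sidePoint, hpath, map_add, map_smul, map_sub]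
  have hpos1 : ∀ x, L.symm (pos (.inl x)) = P.edgePath ℝ (Node.edge x) (Node.par ε x) := by
    intro x
    rw [LinearEquiv.symm_apply_eq, hedge, hpos]
    rfl
  have hpos2 : ∀ x, L.symm (pos (.inl ((Node.diagram h h1 h2 hε).next x))) =
      P.edgePath ℝ (Node.edge x) ((Node.subdivision hε).fin x) := by
    intro x
    rw [LinearEquiv.symm_apply_eq, hedge, hpos]
    exact Prod.ext (Node.proj_next hε x) (Node.height_next hε x)
  have hbe : ∀ e, e ∈ hS.complex.boundaryEdges ↔ ∃ x, e = {P.edgePath ℝ (Node.edge x) (Node.par ε x),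
      P.edgePath ℝ (Node.edge x) ((Node.subdivision hε).fin x)} := by
    intro e
    rw [hS.mem_boundaryEdges_complex]
    constructor
    · rintro ⟨a, b, c, ht, hn, rfl⟩
      obtain ⟨x, rfl, rfl⟩ := (hbd a b).1 ⟨⟨c, ht⟩, hn⟩
      exact ⟨x, by rw [hpos1, hpos2]⟩
    · rintro ⟨x, rfl⟩
      obtain ⟨⟨c, ht⟩, hn⟩ := (hbd _ _).2 ⟨x, rfl, rfl⟩
      exact ⟨_, _, c, ht, hn, by rw [hpos1, hpos2]⟩
  have hsub : ∀ s ∈ hS.complex.boundaryComplex.faces, ∃ i : Fin n, convexHull ℝ (s : Set _) ⊆ P.edgeSet ℝ i := by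
    rintro s ⟨-, e, he, hse⟩
    obtain ⟨x, rfl⟩ := (hbe e).1 he
    refine ⟨Node.edge x, ?_⟩
    have hmem : ∀ u ∈ Set.Icc (0 : ℝ) 1, P.edgePath ℝ (Node.edge x) u ∈ P.edgeSet ℝ (Node.edge x) :=
      fun u hu => ⟨u, hu, rfl⟩
    have hpar := Node.par_mem hε x
    refine convexHull_min ?_ ?_
    · intro y hy
      have := hse hy
      rw [Finset.mem_insert, Finset.mem_singleton] at this
      rcases this with rfl | rfl
      · exact hmem _ ⟨hpar.1, hpar.2.le⟩
      · exact hmem _ ⟨hpar.1.trans ((Node.subdivision hε).par_lt x).le, (Node.subdivision hε).fin_le x⟩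
    · rw [Polygon.edgeSet, affineSegment_eq_segment]
      exact convex_segment _ _
  refine ⟨hS.complex, hS.orientation, hS.isSurface_complex, ⟨?_, hsub⟩, ?_⟩
  · ext y
    rw [Geometry.SimplicialComplex.mem_space_iff, Polygon.boundary, Set.mem_iUnion]
    constructor
    · rintro ⟨s, hs, hy⟩
      obtain ⟨i, hi⟩ := hsub s hs
      exact ⟨i, hi hy⟩
    · rintro ⟨i, u, hu, rfl⟩
      -- The end of a closed edge is the start of the next one, so half-open parameters suffice.
      obtain ⟨j, w, hw, e⟩ : ∃ j, ∃ w ∈ Set.Ico (0 : ℝ) 1, P.edgePath ℝ i u = P.edgePath ℝ j w := by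
        rcases hu.2.eq_or_lt with rfl | hlt
        · exact ⟨finRotate n i, 0, by simp, by simp [Polygon.edgePath]⟩
        · exact ⟨i, u, ⟨hu.1, hlt⟩, rfl⟩
      change ∃ s ∈ hS.complex.boundaryComplex.faces, P.edgePath ℝ i u ∈ convexHull ℝ (s : Set _)
      rw [e]
      obtain ⟨x, rfl, hx1, hx2⟩ := (Node.subdivision hε).exists_cover j hw
      have hb := (hbe _).2 ⟨x, rfl⟩
      refine ⟨_, ⟨hb.1, _, hb, subset_rfl⟩, ?_⟩
      rw [Finset.coe_pair, convexHull_pair, ← image_segment]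
      refine Set.mem_image_of_mem _ ?_
      have hle : Node.par ε x ≤ w := hx1
      rw [segment_eq_Icc (hle.trans hx2.le)]
      exact ⟨hle, hx2.le⟩
  · refine hS.ncard_triangles_le.trans (hcard.trans ?_)
    have k1 := Node.card_lower h h1 h2 hε
    have k2 := h.card_crossing_le h1 h2
    rw [Nat.card_eq_fintype_card (α := Fin n), Fintype.card_fin] at k1 k2
    -- With `c` crossings the bound is `4 * (n + 3 * c) + 2 * c = 4 * n + 14 * c`, and `2 * c + 3 *
    -- n ≤ n ^ 2`.
    omega
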